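/- **Notation.** $\langle y\rangle=\sqrt{1+|y|^2}$, $\hat v=v/\langle v\rangle$ for $v\in\mathbb R^3$; $\lambda_\pm(k)=\pm i\langle k\rangle$, $a_\pm(k)=\mp\frac i2\langle k\rangle^{-1}$ for $k\in\mathbb R^3$; $\delta_n=\frac{n}{\alpha_0-1}$ (so $\delta_1=\frac1{\alpha_0-1}$), where $\alpha_0\ge 8$ is a fixed integer. The $H^m_x$ norm is $\|\langle k\rangle^m\hat f\|_{L^2}$; derivatives in the assumptions are weak derivatives. **Setting.** Let $T>0$, $\epsilon>0$. Let $S_{0,\pm}\in L^2(\mathbb R^3;\mathbb C)$ and $S_\pm\in C([0,T)\times\mathbb R^3;\mathbb C)$ with $S_{0,-}=\overline{S_{0,+}}$, $S_-=\overline{S_+}$ (in particular, $S_+=S_-$ real is allowed), let $E^r\in C([0,T)\times\mathbb R^3;\mathbb R^3)$, and let $$E=\sum_\pm E^{osc}_\pm+E^r,\qquad \widehat{E^{osc}_\pm}(t,k)=a_\pm(k)\,ik\Big(e^{\lambda_\pm(k)t}\widehat{S_{0,\pm}}(k)+\int_0^te^{\lambda_\pm(k)(t-s)}\widehat{S_\pm}(s,k)\,ds\Big).$$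 Assume the following bootstrap bounds for all $t\in[0,T)$ and both signs: * $\|S_\pm(t)\|_{L^p_x},\ \|\partial_xS_\pm(t)\|_{L^p_x},\ \|E^r(t)\|_{L^p_x}\le\epsilon\langle t\rangle^{-3(1-1/p)}$ for $1\le p\le\infty$, and $\|E^{osc}_\pm(t)\|_{L^p_x}\le\epsilon\langle t\rangle^{-3(1/2-1/p)}$ for $2\le p\le\infty$; * for $1\le|\alpha|\le\alpha_0-1$: $\|\partial^\alpha_xS_\pm(t)\|_{L^p_x},\ \|\partial^\alpha_xE^r(t)\|_{L^p_x}\le\epsilon\langle t\rangle^{-3(1-1/p)+\delta_{|\alpha|}}$ for $1\le p\le\infty$, and $\|\partial_x\partial^{\alpha}_xE^r(t)\|_{L^2_x}\le\epsilon\langle t\rangle^{-3/2+\delta_{|\alpha|}}$; * $\|E^{osc}_\pm(t)\|_{H^{\alpha_0}_x}\le\epsilon$, and $\|E^{osc}_\pm(t)\|_{H^{\alpha_0+1}_x},\ \|E^r(t)\|_{H^{\alpha_0+1}_x},\ \|S_\pm(t)\|_{H^{\alpha_0}_x}\le\epsilon\langle t\rangle^{\delta_1}$. Let $X_{s,t}(x,v),V_{s,t}(x,v)$,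 $0\le s\le t<T$, be the characteristics $$\partial_sX_{s,t}=\widehat{V}_{s,t},\quad \partial_sV_{s,t}=E(s,X_{s,t}),\quad X_{t,t}=x,\quad V_{t,t}=v ,$$ where $\widehat V_{s,t}=V_{s,t}/\langle V_{s,t}\rangle$, and put $\widehat\Psi_{s,t}=\frac1{t-s}\int_s^t\widehat V_{\tau,t}\,d\tau$. Let $V^{osc}_{t,t}(x,v)=\sum_\pm E^{osc,1}_\pm(t,x,v)$, where $E^{osc,1}_\pm(t,\cdot,v)$ is obtained from $E^{osc}_\pm(t,\cdot)$ by the Fourier multiplier $(\lambda_\pm(k)+ik\cdot\hat v)^{-1}$, and $\widehat V^{osc}_{t,t}=(\nabla_v\hat v)\,V^{osc}_{t,t}$. **Proposition.** Fix $\alpha_0\ge8$ and a compact set $K\subset\mathbb R^3$. There are $\epsilon_*>0$ and constants implicit in $\lesssim,\gtrsim$, depending only on $\alpha_0$ and $K$ (in the first bound also on $|\beta|$), such that in the above setting with $0<\epsilon\le\epsilon_*$ the following derivatives exist and, with $\|\cdot\|$ denoting the supremum over $x\in\mathbb R^3$ and $v\in K$, for all $0\le s\le t<T$: $$\|\partial_x\partial_v^\beta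 V^{osc}_{t,t}\|\lesssim\epsilon\langle t\rangle^{-3/2+\delta_1}\quad\text{for every multi-index }\beta,$$ $$\|\partial_x(V_{s,t}-v+V^{osc}_{t,t})\|\lesssim\epsilon\langle s\rangle^{-3/2+\delta_1},\qquad \|\partial_v(V_{s,t}-v+V^{osc}_{t,t})\|\lesssim\epsilon\langle s\rangle^{-3/2+\delta_1}\,(1+t-s),$$ $$\|(t-s)\partial_x(\widehat\Psi_{s,t}-\hat v+\widehat V^{osc}_{t,t})\|\lesssim\epsilon\langle s\rangle^{-1+\delta_1},\qquad \|(t-s)\partial_v(\widehat\Psi_{s,t}-\hat v+\widehat V^{osc}_{t,t})\|\lesssim\epsilon\langle s\rangle^{-1+\delta_1}(t-s).$$ In particular, for all $x\in\mathbb R^3$, $v\in K$ and $0\le s\le t<T$, $$|\det(\nabla_xX_{s,t}(x,v))-1|\lesssim\epsilon,\qquad|\det(\nabla_vX_{s,t}(x,v))|\gtrsim\langle v\rangle^{-5}|t-s|^3 .$$ -/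

import Mathlib

open MeasureTheory Set FourierTransform
open scoped ENNReal ContDiff ComplexConjugate

noncomputable section

namespace VKG

/-- Physical space and velocity space `ℝ³`. -/
abbrev R3 := EuclideanSpace ℝ (Fin 3)

/-- `ℂ³`. -/
abbrev C3 := EuclideanSpace ℂ (Fin 3)

/-- The bracket `⟨x⟩ = √(1 + |x|²)`, for times, velocities and wave vectors. -/
def bracket {F : Type*} [NormedAddCommGroup F] (x : F) : ℝ := Real.sqrt (1 + ‖x‖ ^ 2)

/-- The relativistic velocity `v̂ = v / ⟨v⟩`. -/
def hat (v : R3) : R3 := (bracket v)⁻¹ • v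

/-- A real vector seen in `ℂ³`. -/
def cvec (w : R3) : C3 := WithLp.toLp 2 fun i => (w i : ℂ)

/-- The real part, taken componentwise, of a vector of `ℂ³`. -/
def revec (w : C3) : R3 := WithLp.toLp 2 fun i => (w i).re

/-- The wave vector `k = 2πξ` of the frequency `ξ`: Mathlib's Fourier transform is
`∫ e^{-2πi x·ξ} f(x) dx`, so that `e^{ik·x}` is the character of frequency `ξ`. -/
def waveVec (ξ : R3) : R3 := (2 * Real.pi) • ξ

/-- `λ_±(k) = ± i ⟨k⟩`; the signs `±` are the units `1, -1` of `ℤ`. -/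
def lam (σ : ℤˣ) (k : R3) : ℂ := ((σ : ℤ) : ℂ) * Complex.I * (bracket k : ℂ)

/-- `a_±(k) = ∓ (i/2) ⟨k⟩⁻¹`. -/
def amp (σ : ℤˣ) (k : R3) : ℂ := -((σ : ℤ) : ℂ) * (Complex.I / 2) * ((bracket k)⁻¹ : ℝ)

/-- `ω_±^v(k) = λ_±(k) + i k·v̂`. -/
def omega (σ : ℤˣ) (v k : R3) : ℂ := lam σ k + Complex.I * (inner ℝ k (hat v) : ℝ)

/-- Spatial Fourier transform of
`E^osc_±(t) = G^osc_±(t) ⋆_x ∇S₀ + ∫_0^t G^osc_±(t - s) ⋆_x ∇S(s) ds`,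
where `G^osc_±(t)` is the Fourier multiplier `e^{λ_±(k) t} a_±(k)` and `∇` is `ik`.
The potential `S₀` is in `L²`, with its `L²` Fourier transform. -/
def oscHat (S0 : ℤˣ → Lp ℂ 2 (volume : Measure R3)) (S : ℤˣ → ℝ → R3 → ℂ)
    (σ : ℤˣ) (t : ℝ) (ξ : R3) : C3 :=
  (amp σ (waveVec ξ) *
      (Complex.exp (lam σ (waveVec ξ) * t) * (𝓕 (S0 σ) : Lp ℂ 2 (volume : Measure R3)) ξ +
        ∫ s in (0 : ℝ)..t,
          Complex.exp (lam σ (waveVec ξ) * ((t - s : ℝ) : ℂ)) * 𝓕 (S σ s) ξ)) •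
    (Complex.I • cvec (waveVec ξ))

/-- `E^{osc,j}_±(t,x,v)`: the Fourier multiplier `(λ_±(k) + i k·v̂)^{-j}`, i.e. the convolution
in `x` with `φ_{±,j}(·,v)`, applied to `E^osc_±(t)`. For `j = 0` this is `E^osc_±(t,x)`. -/
def oscField (S0 : ℤˣ → Lp ℂ 2 (volume : Measure R3)) (S : ℤˣ → ℝ → R3 → ℂ)
    (σ : ℤˣ) (j : ℕ) (t : ℝ) (x v : R3) : C3 :=
  𝓕⁻ (fun ξ : R3 => (omega σ v (waveVec ξ) ^ j)⁻¹ • oscHat S0 S σ t ξ) x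

/-- `E^osc_±(t,x)`. -/
def Eosc (S0 : ℤˣ → Lp ℂ 2 (volume : Measure R3)) (S : ℤˣ → ℝ → R3 → ℂ)
    (σ : ℤˣ) (t : ℝ) (x : R3) : C3 :=
  𝓕⁻ (oscHat S0 S σ t) x

/-- The electric field `E = ∑_± E^osc_± + E^r`. Under the symmetry `S_- = conj S_+` of the
potentials, the two oscillatory parts are complex conjugates and their sum is real. -/
def field (S0 : ℤˣ → Lp ℂ 2 (volume : Measure R3)) (S : ℤˣ → ℝ → R3 → ℂ)
    (Er : ℝ → R3 → R3) (t : ℝ) (x : R3) : R3 :=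
  revec (∑ σ : ℤˣ, Eosc S0 S σ t x) + Er t x

/-- `V^osc_{t,t}(x,v) = ∑_± E^{osc,1}_±(t,x,v)` (which is real, like the field). -/
def Vosc (S0 : ℤˣ → Lp ℂ 2 (volume : Measure R3)) (S : ℤˣ → ℝ → R3 → ℂ)
    (t : ℝ) (x v : R3) : R3 :=
  revec (∑ σ : ℤˣ, oscField S0 S σ 1 t x v)

/-- `\hat V^osc_{t,t} = ∇_v v̂ V^osc_{t,t}`. -/
def VhatOsc (S0 : ℤˣ → Lp ℂ 2 (volume : Measure R3)) (S : ℤˣ → ℝ → R3 → ℂ)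
    (t : ℝ) (x v : R3) : R3 :=
  fderiv ℝ hat v (Vosc S0 S t x v)

/-- `g` is the weak partial derivative `∂_{I 0} ⋯ ∂_{I (n-1)} f` on `ℝ³`. -/
def IsWeakPartial {F : Type*} [NormedAddCommGroup F] [NormedSpace ℝ F]
    {n : ℕ} (I : Fin n → Fin 3) (f g : R3 → F) : Prop :=
  LocallyIntegrable f ∧ LocallyIntegrable g ∧
    ∀ ψ : R3 → ℝ, ContDiff ℝ ∞ ψ → HasCompactSupport ψ →
      ∫ x, iteratedFDeriv ℝ n ψ x (fun j => EuclideanSpace.single (I j) 1) • f x =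
        (-1 : ℝ) ^ n • ∫ x, ψ x • g x

/-- `‖∂_I f‖_{L^p} ≤ B`, with the weak derivative. -/
def WeakPartialBound {F : Type*} [NormedAddCommGroup F] [NormedSpace ℝ F]
    {n : ℕ} (I : Fin n → Fin 3) (f : R3 → F) (p : ℝ≥0∞) (B : ℝ) : Prop :=
  ∃ g : R3 → F, IsWeakPartial I f g ∧ eLpNorm g p volume ≤ ENNReal.ofReal B

/-- The `H^m` norm of a function on `ℝ³`, in terms of its Fourier transform `h`:
`‖⟨k⟩^m h‖_{L²}`. -/
def sobolevNorm {F : Type*} [NormedAddCommGroup F] [NormedSpace ℝ F]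
    (m : ℕ) (h : R3 → F) : ℝ≥0∞ :=
  eLpNorm (fun ξ : R3 => (bracket (waveVec ξ) ^ m) • h ξ) 2 volume

/-- `δ_α = |α| / (α₀ - 1)` for `|α| = n`. -/
def delta (α₀ n : ℕ) : ℝ := (n : ℝ) / ((α₀ : ℝ) - 1)

/-- `1 / p ∈ [0,1]` for `1 ≤ p ≤ ∞`. -/
def invExp (p : ℝ≥0∞) : ℝ := (p⁻¹).toReal

/-- The bootstrap assumptions of size `ε` on the time interval `[0,T)`, for the field
`E = ∑_± E^osc_± + E^r` generated by `S₀`, `S` and `E^r`. -/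
structure Bootstrap (α₀ : ℕ) (ε T : ℝ) (S0 : ℤˣ → Lp ℂ 2 (volume : Measure R3))
    (S : ℤˣ → ℝ → R3 → ℂ) (Er : ℝ → R3 → R3) : Prop where
  /-- reality of the field -/
  conj_S0 : ∀ᵐ x, S0 (-1) x = conj (S0 1 x)
  conj_S : ∀ t ∈ Ico 0 T, ∀ x, S (-1) t x = conj (S 1 t x)
  /-- regularity in space-time -/
  cont_S : ∀ σ, ContinuousOn (fun z : ℝ × R3 => S σ z.1 z.2) (Ico 0 T ×ˢ univ)
  cont_Er : ContinuousOn (fun z : ℝ × R3 => Er z.1 z.2) (Ico 0 T ×ˢ univ)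
  /-- decay assumptions -/
  decay_S : ∀ σ, ∀ t ∈ Ico 0 T, ∀ p : ℝ≥0∞, 1 ≤ p →
    eLpNorm (S σ t) p volume ≤ ENNReal.ofReal (ε * bracket t ^ (-3 * (1 - invExp p)))
  decay_dS : ∀ σ, ∀ t ∈ Ico 0 T, ∀ p : ℝ≥0∞, 1 ≤ p → ∀ I : Fin 1 → Fin 3,
    WeakPartialBound I (S σ t) p (ε * bracket t ^ (-3 * (1 - invExp p)))
  decay_Er : ∀ t ∈ Ico 0 T, ∀ p : ℝ≥0∞, 1 ≤ p →
    eLpNorm (Er t) p volume ≤ ENNReal.ofReal (ε * bracket t ^ (-3 * (1 - invExp p)))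
  decay_Eosc : ∀ σ, ∀ t ∈ Ico 0 T, ∀ p : ℝ≥0∞, 2 ≤ p →
    eLpNorm (Eosc S0 S σ t) p volume ≤
      ENNReal.ofReal (ε * bracket t ^ (-3 * (1 / 2 - invExp p)))
  /-- decay assumptions for higher derivatives -/
  decay_high_S : ∀ σ, ∀ t ∈ Ico 0 T, ∀ p : ℝ≥0∞, 1 ≤ p →
    ∀ n : ℕ, 1 ≤ n → n ≤ α₀ - 1 → ∀ I : Fin n → Fin 3,
      WeakPartialBound I (S σ t) p (ε * bracket t ^ (-3 * (1 - invExp p) + delta α₀ n))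
  decay_high_Er : ∀ t ∈ Ico 0 T, ∀ p : ℝ≥0∞, 1 ≤ p →
    ∀ n : ℕ, 1 ≤ n → n ≤ α₀ - 1 → ∀ I : Fin n → Fin 3,
      WeakPartialBound I (Er t) p (ε * bracket t ^ (-3 * (1 - invExp p) + delta α₀ n))
  decay_high_Er_two : ∀ t ∈ Ico 0 T, ∀ n : ℕ, 1 ≤ n → n ≤ α₀ - 1 →
    ∀ I : Fin (n + 1) → Fin 3,
      WeakPartialBound I (Er t) 2 (ε * bracket t ^ (-(3 / 2 : ℝ) + delta α₀ n))
  /-- boundedness assumptions -/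
  bdd_Eosc : ∀ σ, ∀ t ∈ Ico 0 T,
    sobolevNorm α₀ (oscHat S0 S σ t) ≤ ENNReal.ofReal ε
  bdd_Eosc_top : ∀ σ, ∀ t ∈ Ico 0 T,
    sobolevNorm (α₀ + 1) (oscHat S0 S σ t) ≤ ENNReal.ofReal (ε * bracket t ^ delta α₀ 1)
  bdd_Er_top : ∀ t ∈ Ico 0 T,
    sobolevNorm (α₀ + 1) (𝓕 (fun x => cvec (Er t x))) ≤
      ENNReal.ofReal (ε * bracket t ^ delta α₀ 1)
  bdd_S_top : ∀ σ, ∀ t ∈ Ico 0 T,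
    sobolevNorm α₀ (𝓕 (S σ t)) ≤ ENNReal.ofReal (ε * bracket t ^ delta α₀ 1)

/-- `X s t x v`, `V s t x v` are the backward characteristics `X_{s,t}(x,v)`, `V_{s,t}(x,v)`,
`0 ≤ s ≤ t < T`, of the field `E`. -/
structure IsCharacteristic (E : ℝ → R3 → R3) (T : ℝ)
    (X V : ℝ → ℝ → R3 → R3 → R3) : Prop where
  X_init : ∀ t ∈ Ico 0 T, ∀ x v, X t t x v = x
  V_init : ∀ t ∈ Ico 0 T, ∀ x v, V t t x v = v
  X_deriv : ∀ t ∈ Ico 0 T, ∀ s ∈ Icc 0 t, ∀ x v,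
    HasDerivWithinAt (fun τ => X τ t x v) (hat (V s t x v)) (Icc 0 t) s
  V_deriv : ∀ t ∈ Ico 0 T, ∀ s ∈ Icc 0 t, ∀ x v,
    HasDerivWithinAt (fun τ => V τ t x v) (E s (X s t x v)) (Icc 0 t) s

/-- The velocity average `\hat Ψ_{s,t}(x,v) = (t-s)⁻¹ ∫_s^t \hat V_{τ,t}(x,v) dτ`. It is used
only multiplied by `t - s`, so that its value at `s = t` is immaterial. -/
def PsiHat (V : ℝ → ℝ → R3 → R3 → R3) (s t : ℝ) (x v : R3) : R3 :=
  (t - s)⁻¹ • ∫ τ in s..t, hat (V τ t x v)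

/-- `f` is differentiable at `a`, with derivative of norm at most `B`. -/
def DerivBound {F : Type*} [NormedAddCommGroup F] [NormedSpace ℝ F]
    (f : R3 → F) (a : R3) (B : ℝ) : Prop :=
  DifferentiableAt ℝ f a ∧ ‖fderiv ℝ f a‖ ≤ B

end VKG

end

/-!
# Derivatives of the characteristics of an oscillating electric field

The field `E` decays only like `⟨τ⟩^{-3/2}` and its gradient is no better, so that the linearized
characteristic system `Z' = ∇v̂ Y`, `Y' = ∇E Z` cannot be estimated directly: with `Z` growing like
`t - τ`, the right-hand side is not integrable. What saves the argument is that `E^osc` oscillates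
in time, with the phase `λ_±(k) + ik·v̂` along a characteristic, and this phase does not vanish since
`|k·v̂| < ⟨k⟩`. Dividing by it gives functions `F = V^osc`, `G = ∂_x F` and `H` (one more division)
of the size `b` of the field, `b² = ⟨τ⟩^{-3+δ}`, with
`E = dF/dτ + O(ε b²)`, `∇E = dG/dτ + O(ε b²)` and `G = dH/dτ + O(ε b²)` along every characteristic
(`NormalForm`, `exists_normalForm`). The regular part `E^r` and its gradient are already `O(ε b²)`.

Consequently `M = Y - G Z` satisfies `M' = R Z - G ∇v̂ Y` with `R = O(ε b²)`, an equation without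
`∇E` (`Linearized.deriv_M`). Together with the equation of `Z` it bounds `Z` and `M` by a
self-consistent choice of weights. For derivatives in the velocity the term `G ∇v̂ M` is not yet
small enough, and is removed by passing to `M + H ∇v̂ M`. For the averages, `(t - s) Ψ̂` is the
displacement `x - X_s`, and its leading term is found by subtracting `∇v̂ H Z` from `Z`
(`Linearized.estimates_x`, `Linearized.estimates_v`). The determinants follow, since `∇_x X` is close
to the identity and `∇_v X` is close to `-(t - s) ∇v̂`, where `∇v̂` is invertible uniformly on
compact sets. That the characteristics are differentiable at all, with derivatives that solve the
linearized system, comes from Grönwall's inequality and a quadratic Taylor remainder of the field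
(`exists_hasFDerivAt_flow`).

The estimates of the normal form are estimates for Fourier multipliers whose symbols are of order
zero, with derivatives in `v` of every order. Such symbols form a normed algebra `Sym`
in which `v ↦ (± + k·v̂/⟨k⟩)⁻¹` is smooth; this yields all `v`-derivatives with
bounds on compact sets, without computing any of them. A multiplier applied at a point is a continuous
functional on this algebra: cutting at frequency `N`, its kernel has `L¹` norm at most `N^{1/4}`
below `N`, and the Sobolev norm controls what lies above. With `N` a small power of `⟨τ⟩` the
loss is absorbed in `δ` (`exists_norm_mulOp_le`). Since the Fourier transform of the source
`S(τ)` need not be continuous in `τ`, differentiation in time goes through Duhamel's formula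
in integrated form (`Evolves`).
-/

noncomputable section

namespace VKG

/-! ### The algebra of symbols of order zero -/

theorem bracket_pos {F : Type*} [NormedAddCommGroup F] (x : F) : 0 < bracket x :=
  Real.sqrt_pos.2 (by positivity)

theorem bracket_sq {F : Type*} [NormedAddCommGroup F] (x : F) : bracket x ^ 2 = 1 + ‖x‖ ^ 2 :=
  Real.sq_sqrt (by positivity)

theorem one_le_bracket {F : Type*} [NormedAddCommGroup F] (x : F) : 1 ≤ bracket x :=
  Real.one_le_sqrt.2 (by nlinarith [norm_nonneg x])

theorem norm_le_bracket {F : Type*} [NormedAddCommGroup F] (x : F) : ‖x‖ ≤ bracket x :=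
  Real.le_sqrt_of_sq_le (by nlinarith [norm_nonneg x])

theorem bracket_le_one_add {F : Type*} [NormedAddCommGroup F] (x : F) : bracket x ≤ 1 + ‖x‖ :=
  Real.sqrt_le_iff.2 ⟨by positivity, by nlinarith [norm_nonneg x]⟩

theorem contDiff_bracket {F : Type*} [NormedAddCommGroup F] [InnerProductSpace ℝ F] :
    ContDiff ℝ ∞ (bracket : F → ℝ) :=
  (contDiff_const.add (contDiff_norm_sq ℝ)).sqrt fun x => by positivity

/-- The weight `⟨k⟩`, as a function of the frequency `ξ`. -/
def wt (ξ : R3) : ℝ := bracket (waveVec ξ)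

theorem wt_pos (ξ : R3) : 0 < wt ξ := bracket_pos _

theorem one_le_wt (ξ : R3) : 1 ≤ wt ξ := one_le_bracket _

theorem contDiff_wt : ContDiff ℝ ∞ wt :=
  contDiff_bracket.comp (contDiff_id.const_smul (2 * Real.pi))

/-- The partial derivative in the `i`-th direction. -/
def pd (i : Fin 3) (a : R3 → ℂ) (ξ : R3) : ℂ := fderiv ℝ a ξ (EuclideanSpace.single i 1)

theorem contDiff_pd (i : Fin 3) {a : R3 → ℂ} (ha : ContDiff ℝ ∞ a) : ContDiff ℝ ∞ (pd i a) :=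
  (contDiff_infty_iff_fderiv.1 ha).2.clm_apply contDiff_const

theorem pd_add (i : Fin 3) {a b : R3 → ℂ} (ha : ContDiff ℝ ∞ a) (hb : ContDiff ℝ ∞ b) :
    pd i (a + b) = pd i a + pd i b := by
  ext ξ
  simp [pd, fderiv_add ((ha.differentiable (by simp)) ξ) ((hb.differentiable (by simp)) ξ)]

theorem pd_mul (i : Fin 3) {a b : R3 → ℂ} (ha : ContDiff ℝ ∞ a) (hb : ContDiff ℝ ∞ b) :
    pd i (a * b) = a * pd i b + pd i a * b := by
  ext ξ
  simp [pd, fderiv_mul ((ha.differentiable (by simp)) ξ) ((hb.differentiable (by simp)) ξ),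
    mul_comm]

theorem pd_const (i : Fin 3) (c : ℂ) : pd i (fun _ => c) = 0 := by
  ext ξ; simp [pd]

theorem pd_pd_mul (i : Fin 3) {a b : R3 → ℂ} (ha : ContDiff ℝ ∞ a) (hb : ContDiff ℝ ∞ b) :
    pd i (pd i (a * b)) = a * pd i (pd i b) + 2 * (pd i a * pd i b) + pd i (pd i a) * b := by
  have h1 := contDiff_pd i ha
  have h2 := contDiff_pd i hb
  have h3 : ContDiff ℝ ∞ (a * pd i b) := ha.mul h2
  have h4 : ContDiff ℝ ∞ (pd i a * b) := h1.mul hb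
  rw [pd_mul i ha hb, pd_add i h3 h4, pd_mul i ha h2, pd_mul i h1 hb]
  ring

/-- The weighted size of the jet of order two of `a` in the direction `p.2` at `p.1`; the weights
are those of a symbol of order zero, and the factor `1/2` makes it submultiplicative. -/
def jet (a : R3 → ℂ) (p : R3 × Fin 3) : ℝ :=
  ‖a p.1‖ + wt p.1 * ‖pd p.2 a p.1‖ + wt p.1 ^ 2 * ‖pd p.2 (pd p.2 a) p.1‖ / 2

theorem norm_le_jet (a : R3 → ℂ) (p : R3 × Fin 3) : ‖a p.1‖ ≤ jet a p := by
  have := wt_pos p.1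
  unfold jet
  have h1 : 0 ≤ wt p.1 * ‖pd p.2 a p.1‖ := by positivity
  have h2 : 0 ≤ wt p.1 ^ 2 * ‖pd p.2 (pd p.2 a) p.1‖ / 2 := by positivity
  linarith

theorem jet_nonneg (a : R3 → ℂ) (p : R3 × Fin 3) : 0 ≤ jet a p :=
  (norm_nonneg _).trans (norm_le_jet a p)

theorem jet_add {a b : R3 → ℂ} (ha : ContDiff ℝ ∞ a) (hb : ContDiff ℝ ∞ b) (p : R3 × Fin 3) :
    jet (a + b) p ≤ jet a p + jet b p := by
  have hw := wt_pos p.1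
  unfold jet
  rw [pd_add _ ha hb, pd_add _ (contDiff_pd _ ha) (contDiff_pd _ hb)]
  have h0 := norm_add_le (a p.1) (b p.1)
  have h1 := mul_le_mul_of_nonneg_left (norm_add_le (pd p.2 a p.1) (pd p.2 b p.1)) hw.le
  have h2 := mul_le_mul_of_nonneg_left
    (norm_add_le (pd p.2 (pd p.2 a) p.1) (pd p.2 (pd p.2 b) p.1)) (sq_nonneg (wt p.1))
  simp only [Pi.add_apply]
  linarith

theorem jet_mul {a b : R3 → ℂ} (ha : ContDiff ℝ ∞ a) (hb : ContDiff ℝ ∞ b) (p : R3 × Fin 3) :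
    jet (a * b) p ≤ jet a p * jet b p := by
  obtain ⟨ξ, i⟩ := p
  have hw := wt_pos ξ
  unfold jet
  rw [pd_pd_mul _ ha hb, pd_mul _ ha hb]
  simp only [Pi.add_apply, Pi.mul_apply, Pi.ofNat_apply]
  have h1 : ‖a ξ * pd i b ξ + pd i a ξ * b ξ‖ ≤ ‖a ξ‖ * ‖pd i b ξ‖ + ‖pd i a ξ‖ * ‖b ξ‖ :=
    (norm_add_le _ _).trans (by simp)
  have h2 : ‖a ξ * pd i (pd i b) ξ + 2 * (pd i a ξ * pd i b ξ) + pd i (pd i a) ξ * b ξ‖ ≤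
      ‖a ξ‖ * ‖pd i (pd i b) ξ‖ + 2 * (‖pd i a ξ‖ * ‖pd i b ξ‖) + ‖pd i (pd i a) ξ‖ * ‖b ξ‖ :=
    (norm_add₃_le).trans (by simp)
  have h1' := mul_le_mul_of_nonneg_left h1 hw.le
  have h2' := mul_le_mul_of_nonneg_left h2 (sq_nonneg (wt ξ))
  rw [norm_mul]
  have h3 : 0 ≤ wt ξ ^ 3 * (‖pd i a ξ‖ * ‖pd i (pd i b) ξ‖ + ‖pd i b ξ‖ * ‖pd i (pd i a) ξ‖) := by
    positivity
  have h4 : 0 ≤ wt ξ ^ 4 * (‖pd i (pd i a) ξ‖ * ‖pd i (pd i b) ξ‖) := by positivity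
  nlinarith

theorem jet_const (c : ℂ) (p : R3 × Fin 3) : jet (fun _ => c) p = ‖c‖ := by
  have h : pd p.2 (0 : R3 → ℂ) = 0 := pd_const p.2 0
  simp [jet, pd_const, h]

/-- Symbols of order zero: smooth functions of the frequency with bounded weighted jets. -/
def symbolSubalgebra : Subalgebra ℝ (R3 → ℂ) where
  carrier := {a | ContDiff ℝ ∞ a ∧ ∃ C, ∀ p, jet a p ≤ C}
  mul_mem' := by
    rintro a b ⟨ha, A, hA⟩ ⟨hb, B, hB⟩
    exact ⟨ha.mul hb, A * B, fun p => (jet_mul ha hb p).trans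
      (mul_le_mul (hA p) (hB p) (jet_nonneg _ _) ((jet_nonneg _ _).trans (hA p)))⟩
  add_mem' := by
    rintro a b ⟨ha, A, hA⟩ ⟨hb, B, hB⟩
    exact ⟨ha.add hb, A + B, fun p => (jet_add ha hb p).trans (add_le_add (hA p) (hB p))⟩
  algebraMap_mem' := fun r => ⟨contDiff_const, ‖(r : ℂ)‖, fun p => (jet_const (r : ℂ) p).le⟩

/-- The algebra of symbols of order zero, normed by the supremum of the weighted jets. It is not
complete, since only two derivatives enter the norm. -/
def Sym : Type := symbolSubalgebra

namespace Sym

instance : CommRing Sym := inferInstanceAs (CommRing symbolSubalgebra)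

instance : Algebra ℝ Sym := inferInstanceAs (Algebra ℝ symbolSubalgebra)

instance : CoeFun Sym fun _ => R3 → ℂ := ⟨fun a => a.1⟩

@[ext] theorem ext {a b : Sym} (h : ∀ ξ, a ξ = b ξ) : a = b := Subtype.ext (funext h)

@[simp] theorem add_apply (a b : Sym) (ξ : R3) : (a + b) ξ = a ξ + b ξ := rfl
@[simp] theorem sub_apply (a b : Sym) (ξ : R3) : (a - b) ξ = a ξ - b ξ := rfl
@[simp] theorem mul_apply (a b : Sym) (ξ : R3) : (a * b) ξ = a ξ * b ξ := rfl
@[simp] theorem one_apply (ξ : R3) : (1 : Sym) ξ = 1 := rfl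
@[simp] theorem zero_apply (ξ : R3) : (0 : Sym) ξ = 0 := rfl
@[simp] theorem smul_apply (r : ℝ) (a : Sym) (ξ : R3) : (r • a) ξ = r * a ξ :=
  Complex.real_smul

theorem contDiff (a : Sym) : ContDiff ℝ ∞ a := a.2.1

theorem bddAbove (a : Sym) : BddAbove (range (jet a)) := by
  obtain ⟨C, hC⟩ := a.2.2
  exact ⟨C, by rintro _ ⟨p, rfl⟩; exact hC p⟩

/-- The norm of the algebra of symbols. -/
def ringNorm : RingNorm Sym where
  toFun a := ⨆ p, jet a p
  map_zero' := by
    have : ∀ p, jet (0 : Sym) p = 0 := fun p => (jet_const 0 p).trans norm_zero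
    simp [this]
  add_le' a b := ciSup_le fun p => (jet_add a.contDiff b.contDiff p).trans
    (add_le_add (le_ciSup a.bddAbove p) (le_ciSup b.bddAbove p))
  neg' a := by
    congr 1
    ext p
    have h : ∀ (i : Fin 3) (c : R3 → ℂ), pd i (-c) = -pd i c := fun i c => by
      ext ξ
      have : (-c) = fun y => -c y := rfl
      simp [pd, this, fderiv_fun_neg]
    change jet (-(a : R3 → ℂ)) p = _
    simp [jet, h]
  mul_le' a b := ciSup_le fun p => (jet_mul a.contDiff b.contDiff p).trans
    (mul_le_mul (le_ciSup a.bddAbove p) (le_ciSup b.bddAbove p) (jet_nonneg _ _)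
      ((jet_nonneg _ p).trans (le_ciSup a.bddAbove p)))
  eq_zero_of_map_eq_zero' a h := by
    ext ξ
    have := (norm_le_jet a (ξ, 0)).trans ((le_ciSup a.bddAbove (ξ, 0)).trans h.le)
    simpa using this

instance : NormedCommRing Sym := { ringNorm.toNormedRing with mul_comm := mul_comm }

theorem jet_le_norm (a : Sym) (p : R3 × Fin 3) : jet a p ≤ ‖a‖ := le_ciSup a.bddAbove p

theorem norm_le_of_jet_le {a : Sym} {C : ℝ} (h : ∀ p, jet a p ≤ C) : ‖a‖ ≤ C := ciSup_le h

theorem norm_apply_le (a : Sym) (ξ : R3) : ‖a ξ‖ ≤ ‖a‖ :=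
  (norm_le_jet a (ξ, 0)).trans (a.jet_le_norm _)

/-- Constant symbols. -/
def const (c : ℂ) : Sym := ⟨fun _ => c, contDiff_const, ‖c‖, fun p => (jet_const c p).le⟩

@[simp] theorem const_apply (c : ℂ) (ξ : R3) : const c ξ = c := rfl

theorem norm_const (c : ℂ) : ‖const c‖ = ‖c‖ := by
  refine le_antisymm (norm_le_of_jet_le fun p => (jet_const c p).le) ?_
  exact (const c).norm_apply_le 0

theorem algebraMap_eq_const (r : ℝ) : algebraMap ℝ Sym r = const r := rfl

instance : NormedAlgebra ℝ Sym where
  norm_smul_le r a := by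
    rw [Algebra.smul_def, algebraMap_eq_const]
    exact (norm_mul_le _ _).trans (by rw [norm_const]; simp)

end Sym

/-! ### The symbols `⟨k⟩⁻¹`, `k/⟨k⟩`, the frequency cutoffs and the inverse of `± + k·v̂/⟨k⟩` -/

theorem hasFDerivAt_bracket {F : Type*} [NormedAddCommGroup F] [InnerProductSpace ℝ F] (x : F) :
    HasFDerivAt (bracket : F → ℝ) ((bracket x)⁻¹ • innerSL ℝ x) x := by
  have h := ((hasStrictFDerivAt_norm_sq x).hasFDerivAt.const_add 1).sqrt (by positivity)
  refine h.congr_fderiv ?_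
  ext y
  simp only [bracket, smul_apply, smul_eq_mul, nsmul_eq_mul, Nat.cast_ofNat]
  field_simp

theorem waveVec_apply (ξ : R3) (i : Fin 3) : waveVec ξ i = 2 * Real.pi * ξ i := by
  simp [waveVec]

theorem hasFDerivAt_wt (ξ : R3) :
    HasFDerivAt wt ((wt ξ)⁻¹ • (2 * Real.pi) • innerSL ℝ (waveVec ξ)) ξ := by
  have h : HasFDerivAt waveVec ((2 * Real.pi) • ContinuousLinearMap.id ℝ R3) ξ :=
    (hasFDerivAt_id ξ).const_smul (2 * Real.pi)
  refine ((hasFDerivAt_bracket (waveVec ξ)).comp ξ h).congr_fderiv ?_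
  ext y
  simp [wt]
  ring

/-- `κ_j = k_j/⟨k⟩` -/
def kapR (j : Fin 3) (ξ : R3) : ℝ := waveVec ξ j * (wt ξ)⁻¹

theorem abs_kapR_le (j : Fin 3) (ξ : R3) : |kapR j ξ| ≤ 1 := by
  unfold kapR
  rw [abs_mul, abs_inv, abs_of_pos (wt_pos ξ), ← div_eq_mul_inv, div_le_one (wt_pos ξ)]
  exact (PiLp.norm_apply_le (waveVec ξ) j).trans (norm_le_bracket _)

theorem inner_single_right (x : R3) (i : Fin 3) :
    inner ℝ x (EuclideanSpace.single i (1 : ℝ)) = x i := by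
  simp [EuclideanSpace.inner_single_right]

theorem pd_ofReal (i : Fin 3) {f : R3 → ℝ} {f' : R3 →L[ℝ] ℝ} {ξ : R3} (h : HasFDerivAt f f' ξ) :
    pd i (fun ξ => ((f ξ : ℝ) : ℂ)) ξ = (f' (EuclideanSpace.single i 1) : ℝ) := by
  have h2 : fderiv ℝ (fun ξ => ((f ξ : ℝ) : ℂ)) ξ = _ :=
    ((Complex.ofRealCLM.hasFDerivAt (x := f ξ)).comp ξ h).fderiv
  rw [pd, h2]
  simp

theorem hasFDerivAt_wt_inv (ξ : R3) :
    HasFDerivAt (fun ξ => (wt ξ)⁻¹)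
      (-(wt ξ ^ 2)⁻¹ • (wt ξ)⁻¹ • (2 * Real.pi) • innerSL ℝ (waveVec ξ)) ξ :=
  (hasDerivAt_inv (wt_pos ξ).ne').comp_hasFDerivAt ξ (hasFDerivAt_wt ξ)

theorem pd_winv (i : Fin 3) :
    pd i (fun ξ => (((wt ξ)⁻¹ : ℝ) : ℂ)) =
      fun ξ => ((-(2 * Real.pi) * kapR i ξ * ((wt ξ)⁻¹ * (wt ξ)⁻¹) : ℝ) : ℂ) := by
  ext ξ
  have hw := (wt_pos ξ).ne'
  rw [pd_ofReal i (hasFDerivAt_wt_inv ξ)]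
  simp only [kapR, smul_apply, innerSL_apply_apply, inner_single_right,
    smul_eq_mul]
  congr 1
  field_simp

theorem hasFDerivAt_kapR (j : Fin 3) (ξ : R3) :
    HasFDerivAt (kapR j) (waveVec ξ j • -(wt ξ ^ 2)⁻¹ • (wt ξ)⁻¹ • (2 * Real.pi) •
      innerSL ℝ (waveVec ξ) + (wt ξ)⁻¹ • (2 * Real.pi) • EuclideanSpace.proj (𝕜 := ℝ) j) ξ := by
  have h0 : HasFDerivAt (fun ξ => waveVec ξ j)
      ((2 * Real.pi) • EuclideanSpace.proj (𝕜 := ℝ) j) ξ := by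
    simp_rw [waveVec_apply]
    exact ((EuclideanSpace.proj (𝕜 := ℝ) j).hasFDerivAt).const_mul _
  exact h0.mul (hasFDerivAt_wt_inv ξ)

theorem pd_kap (i j : Fin 3) :
    pd i (fun ξ => ((kapR j ξ : ℝ) : ℂ)) =
      fun ξ => ((2 * Real.pi * ((if j = i then 1 else 0) - kapR i ξ * kapR j ξ) *
        (wt ξ)⁻¹ : ℝ) : ℂ) := by
  ext ξ
  have hw := (wt_pos ξ).ne'
  rw [pd_ofReal i (hasFDerivAt_kapR j ξ)]
  congr 1
  simp only [kapR, add_apply, smul_apply, innerSL_apply_apply, inner_single_right, smul_eq_mul,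
    PiLp.proj_apply, PiLp.single_apply]
  split_ifs <;> field_simp <;> ring

theorem contDiff_wt_inv : ContDiff ℝ ∞ fun ξ => (wt ξ)⁻¹ :=
  contDiff_wt.inv fun ξ => (wt_pos ξ).ne'

theorem contDiff_kapR (j : Fin 3) : ContDiff ℝ ∞ (kapR j) := by
  refine ContDiff.mul ?_ contDiff_wt_inv
  simp_rw [waveVec_apply]
  exact contDiff_const.mul (contDiff_piLp_apply (p := 2) (i := j))

theorem abs_le_mul_bound {x y A B : ℝ} (hx : |x| ≤ A) (hy : |y| ≤ B) : |x * y| ≤ A * B := by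
  rw [abs_mul]
  exact mul_le_mul hx hy (abs_nonneg y) ((abs_nonneg x).trans hx)

/-- A real symbol whose derivatives are `⟨k⟩⁻¹` and `⟨k⟩⁻²` times bounded functions. -/
theorem jet_le_of_eq {a : R3 → ℂ} {f g : Fin 3 → R3 → ℝ} {A B C : ℝ} (h0 : ∀ ξ, ‖a ξ‖ ≤ A)
    (h1 : ∀ i ξ, pd i a ξ = ((f i ξ * (wt ξ)⁻¹ : ℝ) : ℂ)) (hf : ∀ i ξ, |f i ξ| ≤ B)
    (h2 : ∀ i ξ, pd i (pd i a) ξ = ((g i ξ * ((wt ξ)⁻¹ * (wt ξ)⁻¹) : ℝ) : ℂ))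
    (hg : ∀ i ξ, |g i ξ| ≤ C) (p : R3 × Fin 3) : jet a p ≤ A + B + C / 2 := by
  obtain ⟨ξ, i⟩ := p
  have hw := wt_pos ξ
  unfold jet
  simp only
  rw [h1, h2, Complex.norm_real, Complex.norm_real, Real.norm_eq_abs, Real.norm_eq_abs, abs_mul,
    abs_mul, abs_mul, abs_inv, abs_of_pos hw]
  have e1 : wt ξ * (|f i ξ| * (wt ξ)⁻¹) = |f i ξ| := by field_simp
  have e2 : wt ξ ^ 2 * (|g i ξ| * ((wt ξ)⁻¹ * (wt ξ)⁻¹)) = |g i ξ| := by field_simp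
  rw [e1, e2]
  linarith [h0 ξ, hf i ξ, hg i ξ]

theorem wt_inv_le_one (ξ : R3) : (wt ξ)⁻¹ ≤ 1 := inv_le_one_of_one_le₀ (one_le_wt ξ)

theorem pd_real_mul (i : Fin 3) {f g : R3 → ℝ} (hf : ContDiff ℝ ∞ f) (hg : ContDiff ℝ ∞ g) :
    pd i (fun ξ => ((f ξ * g ξ : ℝ) : ℂ)) =
      (fun ξ => (f ξ : ℂ)) * pd i (fun ξ => (g ξ : ℂ)) + pd i (fun ξ => (f ξ : ℂ)) * fun ξ => (g ξ : ℂ) := by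
  have hf' : ContDiff ℝ ∞ fun ξ => (f ξ : ℂ) := Complex.ofRealCLM.contDiff.comp hf
  have hg' : ContDiff ℝ ∞ fun ξ => (g ξ : ℂ) := Complex.ofRealCLM.contDiff.comp hg
  rw [← pd_mul i hf' hg']
  congr 1
  ext ξ
  simp

theorem pd_pd_kap (i j : Fin 3) (ξ : R3) :
    pd i (pd i (fun ξ => ((kapR j ξ : ℝ) : ℂ))) ξ =
      (((2 * Real.pi) ^ 2 * (3 * kapR i ξ ^ 2 * kapR j ξ - kapR j ξ -
        2 * (if j = i then 1 else 0) * kapR i ξ) *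
        ((wt ξ)⁻¹ * (wt ξ)⁻¹) : ℝ) : ℂ) := by
  have hk := contDiff_kapR
  rw [pd_kap, pd_real_mul i (contDiff_const.mul (contDiff_const.sub ((hk i).mul (hk j))))
    contDiff_wt_inv, pd_winv]
  have e : pd i (fun ξ => ((2 * Real.pi * ((if j = i then 1 else 0) - kapR i ξ * kapR j ξ) : ℝ) : ℂ)) ξ
      = ((2 * Real.pi * (0 - (kapR i ξ * (2 * Real.pi * ((if j = i then 1 else 0) - kapR i ξ * kapR j ξ) * (wt ξ)⁻¹)
        + kapR j ξ * (2 * Real.pi * (1 - kapR i ξ * kapR i ξ) * (wt ξ)⁻¹))) : ℝ) : ℂ) := by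
    have hi := hasFDerivAt_kapR i ξ
    have hj := hasFDerivAt_kapR j ξ
    have ei := pd_ofReal i hi
    have ej := pd_ofReal i hj
    rw [pd_kap] at ei ej
    have ei' := Complex.ofReal_injective ei
    have ej' := Complex.ofReal_injective ej
    have hij : HasFDerivAt (fun ξ => 2 * Real.pi * ((if j = i then 1 else 0) -
        kapR i ξ * kapR j ξ)) _ ξ :=
      (((hi.mul hj).const_sub (if j = i then 1 else 0)).const_mul (2 * Real.pi))
    rw [pd_ofReal i hij]
    congr 1
    rw [smul_apply, neg_apply,
      add_apply, smul_apply,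
      smul_apply, ← ei', ← ej']
    simp
  simp only [Pi.add_apply, Pi.mul_apply, e]
  split_ifs with h
  · subst h; push_cast; ring
  · push_cast; ring

theorem pd_pd_winv (i : Fin 3) (ξ : R3) :
    pd i (pd i (fun ξ => (((wt ξ)⁻¹ : ℝ) : ℂ))) ξ =
      (((2 * Real.pi) ^ 2 * (3 * kapR i ξ ^ 2 - 1) * (wt ξ)⁻¹ *
        ((wt ξ)⁻¹ * (wt ξ)⁻¹) : ℝ) : ℂ) := by
  have hk := contDiff_kapR
  rw [pd_winv, pd_real_mul i (contDiff_const.mul (hk i)) (contDiff_wt_inv.mul contDiff_wt_inv),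
    pd_real_mul i contDiff_const (hk i), pd_real_mul i contDiff_wt_inv contDiff_wt_inv, pd_winv,
    pd_kap]
  simp [pd_const]
  ring

namespace Sym

/-- The symbol `⟨k⟩⁻¹`. -/
def winv : Sym :=
  ⟨fun ξ => (((wt ξ)⁻¹ : ℝ) : ℂ), Complex.ofRealCLM.contDiff.comp contDiff_wt_inv, _,
    jet_le_of_eq (A := 1) (B := 2 * Real.pi * 1 * 1) (C := (2 * Real.pi) ^ 2 * 4 * 1)
      (f := fun i ξ => -(2 * Real.pi) * kapR i ξ * (wt ξ)⁻¹)
      (fun ξ => by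
        rw [Complex.norm_real, Real.norm_eq_abs, abs_of_pos (inv_pos.2 (wt_pos ξ))]
        exact wt_inv_le_one ξ)
      (fun i ξ => by rw [pd_winv]; ring_nf)
      (fun i ξ => abs_le_mul_bound (abs_le_mul_bound (by
        rw [abs_neg, abs_of_pos (by positivity)]) (abs_kapR_le i ξ))
        ((abs_of_pos (inv_pos.2 (wt_pos ξ))).le.trans (wt_inv_le_one ξ)))
      (fun i ξ => pd_pd_winv i ξ)
      (fun i ξ => abs_le_mul_bound (abs_le_mul_bound (abs_of_nonneg (by positivity)).le (by
        have := abs_le.1 (abs_kapR_le i ξ)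
        rw [abs_le]
        constructor <;> nlinarith))
        ((abs_of_pos (inv_pos.2 (wt_pos ξ))).le.trans (wt_inv_le_one ξ)))⟩

/-- The symbol `κ_j = k_j/⟨k⟩`. -/
def kap (j : Fin 3) : Sym :=
  ⟨fun ξ => ((kapR j ξ : ℝ) : ℂ), Complex.ofRealCLM.contDiff.comp (contDiff_kapR j), _,
    jet_le_of_eq (A := 1) (B := 2 * Real.pi * 2) (C := (2 * Real.pi) ^ 2 * 6)
      (fun ξ => by
        rw [Complex.norm_real]
        exact abs_kapR_le j ξ)
      (fun i ξ => by rw [pd_kap])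
      (fun i ξ => abs_le_mul_bound (abs_of_nonneg (by positivity)).le (by
        have h1 := abs_le.1 (abs_le_mul_bound (abs_kapR_le i ξ) (abs_kapR_le j ξ))
        rw [abs_le]
        split_ifs <;> constructor <;> linarith))
      (fun i ξ => pd_pd_kap i j ξ)
      (fun i ξ => abs_le_mul_bound (abs_of_nonneg (by positivity)).le (by
        have hi := abs_le.1 (abs_kapR_le i ξ)
        have hj := abs_le.1 (abs_kapR_le j ξ)
        have hi2 : |kapR i ξ ^ 2| ≤ 1 := by rw [abs_le]; constructor <;> nlinarith
        have h1 := abs_le.1 (abs_le_mul_bound hi2 (abs_kapR_le j ξ))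
        rw [abs_le]
        split_ifs <;> constructor <;> linarith))⟩

@[simp] theorem winv_apply (ξ : R3) : winv ξ = (((wt ξ)⁻¹ : ℝ) : ℂ) := rfl

@[simp] theorem kap_apply (j : Fin 3) (ξ : R3) : kap j ξ = ((kapR j ξ : ℝ) : ℂ) := rfl

end Sym

open Filter Topology in
/-- In a commutative normed algebra, complete or not, a locally bounded inverse of a smooth
function is smooth, since its derivative is `-q² dp`. -/
theorem contDiff_of_mul_eq_one {E R : Type*} [NormedAddCommGroup E] [NormedSpace ℝ E]
    [NormedCommRing R] [NormedAlgebra ℝ R] {p q : E → R} (hp : ContDiff ℝ ∞ p)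
    (h : ∀ v, p v * q v = 1) (hq : ∀ v, ∃ C, ∀ᶠ w in 𝓝 v, ‖q w‖ ≤ C) : ContDiff ℝ ∞ q := by
  have hsub : ∀ v w, q w - q v = q w * q v * (p v - p w) := fun v w => by
    linear_combination (q w) * h v * (-1) + q v * h w
  have hcont : Continuous q := by
    refine continuous_iff_continuousAt.2 fun v => ?_
    obtain ⟨C, hC⟩ := hq v
    rw [ContinuousAt, tendsto_iff_norm_sub_tendsto_zero]
    have hlim : Tendsto (fun w => C * ‖q v‖ * ‖p v - p w‖) (𝓝 v) (𝓝 (C * ‖q v‖ * ‖p v - p v‖)) :=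
      (continuous_const.mul (continuous_const.sub hp.continuous).norm).continuousAt
    rw [sub_self, norm_zero, mul_zero] at hlim
    refine squeeze_zero' (Eventually.of_forall fun w => norm_nonneg _) ?_ hlim
    filter_upwards [hC] with w hw
    rw [hsub v w]
    refine (norm_mul_le _ _).trans (mul_le_mul_of_nonneg_right ?_ (norm_nonneg _))
    exact (norm_mul_le _ _).trans (mul_le_mul_of_nonneg_right hw (norm_nonneg _))
  have hder : ∀ v, HasFDerivAt q ((ContinuousLinearMap.mul ℝ R (-(q v * q v))).comp
      (fderiv ℝ p v)) v := by
    intro v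
    have hpv := ((hp.differentiable (by simp)) v).hasFDerivAt
    have h1 : (fun w => -(q w * q v) * (p w - p v - fderiv ℝ p v (w - v))) =o[𝓝 v]
        fun w => w - v := by
      have hb : (fun w => -(q w * q v)) =O[𝓝 v] fun _ => (1 : ℝ) :=
        ((hcont.mul continuous_const).neg.continuousAt).isBigO_one ℝ
      have := hb.mul_isLittleO hpv.isLittleO.norm_right
      simp only [one_mul] at this
      exact this.of_norm_right
    have h2 : (fun w => -(q w - q v) * (q v * fderiv ℝ p v (w - v))) =o[𝓝 v]
        fun w => w - v := by
      have hb : (fun w => -(q w - q v)) =o[𝓝 v] fun _ => (1 : ℝ) := by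
        rw [Asymptotics.isLittleO_one_iff]
        have : Tendsto (fun w => -(q w - q v)) (𝓝 v) (𝓝 (-(q v - q v))) :=
          (hcont.sub continuous_const).neg.continuousAt
        simpa using this
      have hb2 : (fun w => q v * fderiv ℝ p v (w - v)) =O[𝓝 v] fun w => ‖w - v‖ := by
        refine Asymptotics.IsBigO.of_bound (‖q v‖ * ‖fderiv ℝ p v‖)
          (Eventually.of_forall fun w => ?_)
        rw [norm_norm, mul_assoc]
        exact (norm_mul_le _ _).trans (mul_le_mul_of_nonneg_left
          (ContinuousLinearMap.le_opNorm _ _) (norm_nonneg _))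
      have := hb.mul_isBigO hb2
      simp only [one_mul] at this
      exact this.of_norm_right
    refine HasFDerivAt.of_isLittleO ((h1.add h2).congr_left fun w => ?_)
    simp only [ContinuousLinearMap.comp_apply, ContinuousLinearMap.mul_apply']
    linear_combination (-1 : R) * hsub v w
  have hfd : fderiv ℝ q = fun v => (ContinuousLinearMap.mul ℝ R (-(q v * q v))).comp
      (fderiv ℝ p v) := funext fun v => (hder v).fderiv
  refine contDiff_infty.2 fun n => ?_
  induction n with
  | zero => exact contDiff_zero.2 hcont
  | succ n ih =>
    push_cast
    refine contDiff_succ_iff_fderiv.2 ⟨fun v => (hder v).differentiableAt, by simp, ?_⟩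
    rw [hfd]
    exact ((ContinuousLinearMap.mul ℝ R).contDiff.comp ((ih.mul ih).neg)).clm_comp
      ((contDiff_infty_iff_fderiv.1 hp).2.of_le (by exact_mod_cast le_top))

namespace Sym

theorem pd_of_mul_eq_one {p b : R3 → ℂ} (hp : ContDiff ℝ ∞ p) (hb : ContDiff ℝ ∞ b)
    (h : ∀ ξ, p ξ * b ξ = 1) (i : Fin 3) (ξ : R3) :
    pd i b ξ = -(pd i p ξ * b ξ ^ 2) ∧
      pd i (pd i b) ξ = -(pd i (pd i p) ξ * b ξ ^ 2) + 2 * pd i p ξ ^ 2 * b ξ ^ 3 := by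
  have h1 : p * b = fun _ => 1 := funext h
  have h2 : pd i (p * b) ξ = 0 := by rw [h1, pd_const]; rfl
  have h3 : pd i (pd i (p * b)) ξ = 0 := by
    rw [h1, pd_const]; exact congrFun (pd_const i 0) ξ
  rw [pd_mul i hp hb] at h2
  rw [pd_pd_mul i hp hb] at h3
  simp only [Pi.add_apply, Pi.mul_apply, Pi.ofNat_apply] at h2 h3
  have h4 : pd i b ξ = -(pd i p ξ * b ξ ^ 2) := by
    linear_combination b ξ * h2 - pd i b ξ * h ξ
  refine ⟨h4, ?_⟩
  rw [h4] at h3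
  linear_combination b ξ * h3 - pd i (pd i b) ξ * h ξ

theorem jet_of_mul_eq_one {p : Sym} {b : R3 → ℂ} (hb : ContDiff ℝ ∞ b)
    (h : ∀ ξ, p ξ * b ξ = 1) {c : ℝ} (hc : 0 < c) (hpc : ∀ ξ, c ≤ ‖p ξ‖) (x : R3 × Fin 3) :
    jet b x ≤ c⁻¹ + 2 * ‖p‖ * c⁻¹ ^ 2 + ‖p‖ ^ 2 * c⁻¹ ^ 3 := by
  obtain ⟨ξ, i⟩ := x
  have hw := wt_pos ξ
  have hbn : ‖b ξ‖ ≤ c⁻¹ := by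
    have : ‖p ξ‖ * ‖b ξ‖ = 1 := by rw [← norm_mul, h, norm_one]
    have hp0 : 0 < ‖p ξ‖ := hc.trans_le (hpc ξ)
    rw [← one_div, le_div_iff₀ hc]
    nlinarith [hpc ξ, norm_nonneg (b ξ)]
  have hj := p.jet_le_norm (ξ, i)
  unfold jet at hj ⊢
  simp only at hj ⊢
  have hp0 := norm_nonneg (p ξ)
  have h0 : 0 ≤ wt ξ * ‖pd i p ξ‖ := by positivity
  have h00 : 0 ≤ wt ξ ^ 2 * ‖pd i (pd i p) ξ‖ := by positivity
  have h1 : wt ξ * ‖pd i p ξ‖ ≤ ‖p‖ := by linarith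
  have h2 : wt ξ ^ 2 * ‖pd i (pd i p) ξ‖ ≤ 2 * ‖p‖ := by linarith
  obtain ⟨e1, e2⟩ := pd_of_mul_eq_one p.contDiff hb h i ξ
  have n1 : ‖pd i b ξ‖ = ‖pd i p ξ‖ * ‖b ξ‖ ^ 2 := by rw [e1]; simp
  have n2 : ‖pd i (pd i b) ξ‖ ≤ ‖pd i (pd i p) ξ‖ * ‖b ξ‖ ^ 2 + 2 * ‖pd i p ξ‖ ^ 2 * ‖b ξ‖ ^ 3 := by
    rw [e2]; exact (norm_add_le _ _).trans (by simp)
  have m1 : wt ξ * ‖pd i b ξ‖ ≤ ‖p‖ * c⁻¹ ^ 2 := by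
    rw [n1, ← mul_assoc]; gcongr
  have m2 : wt ξ ^ 2 * ‖pd i (pd i b) ξ‖ ≤ 2 * ‖p‖ * c⁻¹ ^ 2 + 2 * ‖p‖ ^ 2 * c⁻¹ ^ 3 := by
    calc _ ≤ wt ξ ^ 2 * (‖pd i (pd i p) ξ‖ * ‖b ξ‖ ^ 2 + 2 * ‖pd i p ξ‖ ^ 2 * ‖b ξ‖ ^ 3) := by gcongr
      _ = (wt ξ ^ 2 * ‖pd i (pd i p) ξ‖) * ‖b ξ‖ ^ 2 + 2 * (wt ξ * ‖pd i p ξ‖) ^ 2 * ‖b ξ‖ ^ 3 := by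
        ring
      _ ≤ _ := by gcongr
  linarith

/-- The inverse of a symbol that is bounded away from zero. -/
def inv (p : Sym) {c : ℝ} (hc : 0 < c) (h : ∀ ξ, c ≤ ‖p ξ‖) : Sym :=
  have h0 : ∀ ξ, p ξ ≠ 0 := fun ξ => norm_pos_iff.1 (hc.trans_le (h ξ))
  ⟨fun ξ => (p ξ)⁻¹, p.contDiff.inv h0, _,
    jet_of_mul_eq_one (p.contDiff.inv h0) (fun ξ => mul_inv_cancel₀ (h0 ξ)) hc h⟩

theorem norm_inv_le (p : Sym) {c : ℝ} (hc : 0 < c) (h : ∀ ξ, c ≤ ‖p ξ‖) :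
    ‖p.inv hc h‖ ≤ c⁻¹ + 2 * ‖p‖ * c⁻¹ ^ 2 + ‖p‖ ^ 2 * c⁻¹ ^ 3 :=
  have h0 : ∀ ξ, p ξ ≠ 0 := fun ξ => norm_pos_iff.1 (hc.trans_le (h ξ))
  norm_le_of_jet_le
    (jet_of_mul_eq_one (p.contDiff.inv h0) (fun ξ => mul_inv_cancel₀ (h0 ξ)) hc h)

/-- The symbol `κ·e`, linear in the direction `e`. -/
def kdir : R3 →L[ℝ] Sym :=
  ∑ j : Fin 3, (EuclideanSpace.proj (𝕜 := ℝ) j : R3 →L[ℝ] ℝ).smulRight (kap j)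

theorem kdir_apply (e ξ : R3) : kdir e ξ = ((inner ℝ (waveVec ξ) e * (wt ξ)⁻¹ : ℝ) : ℂ) := by
  have h : kdir e = e 0 • kap 0 + e 1 • kap 1 + e 2 • kap 2 := by
    simp [kdir, Fin.sum_univ_three]
  rw [h]
  simp only [add_apply, smul_apply, kap_apply, kapR]
  rw [PiLp.inner_apply, Fin.sum_univ_three]
  push_cast
  simp
  ring

end Sym

theorem contDiff_hat : ContDiff ℝ ∞ hat :=
  (contDiff_bracket.inv fun v => (bracket_pos v).ne').smul contDiff_id

theorem norm_hat_lt_one (v : R3) : ‖hat v‖ < 1 := by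
  have hv := bracket_pos v
  rw [hat, norm_smul, norm_inv, Real.norm_eq_abs, abs_of_pos hv, inv_mul_lt_one₀ hv]
  exact Real.lt_sqrt_of_sq_lt (by linarith)

theorem norm_waveVec_mul_wt_inv_le (ξ : R3) : ‖waveVec ξ‖ * (wt ξ)⁻¹ ≤ 1 := by
  rw [← div_eq_mul_inv, div_le_one (wt_pos ξ)]
  exact norm_le_bracket _

namespace Sym

/-- The symbol `± + k·v̂/⟨k⟩`, so that `ω_±^v = i⟨k⟩ (± + k·v̂/⟨k⟩)`. -/
def phase (σ : ℤˣ) (v : R3) : Sym := const ((σ : ℤ) : ℂ) + kdir (hat v)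

theorem phase_apply (σ : ℤˣ) (v ξ : R3) :
    phase σ v ξ = ((σ : ℤ) : ℂ) + ((inner ℝ (waveVec ξ) (hat v) * (wt ξ)⁻¹ : ℝ) : ℂ) := by
  rw [phase, add_apply, const_apply, kdir_apply]

theorem le_norm_phase (σ : ℤˣ) (v ξ : R3) : 1 - ‖hat v‖ ≤ ‖phase σ v ξ‖ := by
  rw [phase_apply]
  have h1 : ‖((σ : ℤ) : ℂ)‖ = 1 := by
    rcases Int.units_eq_one_or σ with rfl | rfl <;> simp
  have h2 : ‖((inner ℝ (waveVec ξ) (hat v) * (wt ξ)⁻¹ : ℝ) : ℂ)‖ ≤ ‖hat v‖ := by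
    rw [Complex.norm_real, norm_mul, norm_inv, Real.norm_eq_abs (wt ξ), abs_of_pos (wt_pos ξ)]
    calc _ ≤ ‖waveVec ξ‖ * ‖hat v‖ * (wt ξ)⁻¹ := by
          gcongr
          · exact (inv_pos.2 (wt_pos ξ)).le
          · exact norm_inner_le_norm _ _
      _ = ‖waveVec ξ‖ * (wt ξ)⁻¹ * ‖hat v‖ := by ring
      _ ≤ 1 * ‖hat v‖ := by gcongr; exact norm_waveVec_mul_wt_inv_le ξ
      _ = _ := one_mul _
  have h3 := norm_sub_le (((σ : ℤ) : ℂ) + ((inner ℝ (waveVec ξ) (hat v) * (wt ξ)⁻¹ : ℝ) : ℂ))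
    ((inner ℝ (waveVec ξ) (hat v) * (wt ξ)⁻¹ : ℝ) : ℂ)
  rw [add_sub_cancel_right, h1] at h3
  linarith

/-- The symbol `(± + k·v̂/⟨k⟩)⁻¹`. -/
def resolvent (σ : ℤˣ) (v : R3) : Sym :=
  (phase σ v).inv (sub_pos.2 (norm_hat_lt_one v)) (le_norm_phase σ v)

theorem phase_mul_resolvent (σ : ℤˣ) (v : R3) : phase σ v * resolvent σ v = 1 := by
  ext ξ
  exact mul_inv_cancel₀ (norm_pos_iff.1
    ((sub_pos.2 (norm_hat_lt_one v)).trans_le (le_norm_phase σ v ξ)))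

theorem contDiff_phase (σ : ℤˣ) : ContDiff ℝ ∞ (phase σ) :=
  contDiff_const.add (kdir.contDiff.comp contDiff_hat)

theorem contDiff_resolvent (σ : ℤˣ) : ContDiff ℝ ∞ (resolvent σ) := by
  refine contDiff_of_mul_eq_one (contDiff_phase σ) (phase_mul_resolvent σ) fun v => ?_
  have hc : Continuous fun w => (1 - ‖hat w‖)⁻¹ + 2 * ‖phase σ w‖ * (1 - ‖hat w‖)⁻¹ ^ 2 +
      ‖phase σ w‖ ^ 2 * (1 - ‖hat w‖)⁻¹ ^ 3 := by
    have h1 : Continuous fun w => (1 - ‖hat w‖)⁻¹ :=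
      (continuous_const.sub contDiff_hat.continuous.norm).inv₀
        fun w => (sub_pos.2 (norm_hat_lt_one w)).ne'
    have h2 := (contDiff_phase σ).continuous.norm
    fun_prop
  have hev := (hc.continuousAt (x := v)).eventually (Iio_mem_nhds (lt_add_one _))
  exact ⟨_, hev.mono fun w hw => (norm_inv_le (phase σ w) (sub_pos.2 (norm_hat_lt_one w))
    (le_norm_phase σ w)).trans (le_of_lt hw)⟩

theorem omega_inv (σ : ℤˣ) (v ξ : R3) :
    (omega σ v (waveVec ξ))⁻¹ = (const (-Complex.I) * winv * resolvent σ v) ξ := by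
  have h := congrArg (fun a : Sym => a ξ) (phase_mul_resolvent σ v)
  simp only [mul_apply, one_apply] at h
  have hw : (wt ξ : ℂ) ≠ 0 := by exact_mod_cast (wt_pos ξ).ne'
  have e : omega σ v (waveVec ξ) = Complex.I * wt ξ * phase σ v ξ := by
    rw [phase_apply, omega, lam]
    push_cast
    change _ * (wt ξ : ℂ) + _ = _
    field_simp
  rw [e]
  refine inv_eq_of_mul_eq_one_right ?_
  simp only [mul_apply, const_apply, winv_apply, Complex.ofReal_inv]
  field_simp
  linear_combination (-Complex.I ^ 2) * h - Complex.I_sq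

end Sym

/-! ### Radial integrals and frequency cutoffs -/

/-- The area of the unit sphere of `ℝ³`. -/
def sphereArea : ℝ := 3 * (volume : Measure R3).real (Metric.ball 0 1)

theorem sphereArea_nonneg : 0 ≤ sphereArea := by unfold sphereArea; positivity

theorem integral_radial (f : ℝ → ℝ) :
    ∫ x : R3, f ‖x‖ = sphereArea * ∫ y in Ioi (0 : ℝ), y ^ 2 * f y := by
  rw [integral_fun_norm_addHaar]
  simp [sphereArea, mul_assoc]

theorem integrable_radial {f : ℝ → ℝ} (h : IntegrableOn (fun y => y ^ 2 * f y) (Ioi 0)) :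
    Integrable fun x : R3 => f ‖x‖ := by
  rw [integrable_fun_norm_addHaar]
  simpa using h

/-- If `f ‖x‖` is integrable then so is a function dominated by it, with the same bound. -/
theorem radial_bound {f : ℝ → ℝ} {B : ℝ} (h : IntegrableOn (fun y => y ^ 2 * f y) (Ioi 0))
    (hB : ∫ y in Ioi (0 : ℝ), y ^ 2 * f y ≤ B) {g : R3 → ℝ} (hg : AEStronglyMeasurable g)
    (hg0 : ∀ x, 0 ≤ g x) (hgf : ∀ x, g x ≤ f ‖x‖) :
    Integrable g ∧ ∫ x, g x ≤ sphereArea * B := by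
  have hi := integrable_radial h
  have hgi : Integrable g := hi.mono hg (Filter.Eventually.of_forall fun x => by
    rw [Real.norm_of_nonneg (hg0 x), Real.norm_of_nonneg ((hg0 x).trans (hgf x))]
    exact hgf x)
  refine ⟨hgi, (integral_mono hgi hi hgf).trans ?_⟩
  rw [integral_radial]
  exact mul_le_mul_of_nonneg_left hB sphereArea_nonneg

theorem sq_le_wt_sq (ξ : R3) : 1 + ‖ξ‖ ^ 2 ≤ wt ξ ^ 2 := by
  rw [wt, bracket_sq, waveVec, norm_smul, Real.norm_of_nonneg (by positivity)]
  have h1 : 1 ≤ 2 * Real.pi := by linarith [Real.pi_gt_three]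
  have : ‖ξ‖ ≤ 2 * Real.pi * ‖ξ‖ := le_mul_of_one_le_left (norm_nonneg _) h1
  gcongr

theorem wt_le (ξ : R3) : wt ξ ≤ 1 + 7 * ‖ξ‖ := by
  refine (bracket_le_one_add _).trans ?_
  rw [waveVec, norm_smul, Real.norm_of_nonneg (by positivity)]
  have : 2 * Real.pi ≤ 7 := by linarith [Real.pi_lt_d2]
  gcongr

theorem integrable_wt_inv_four :
    Integrable (fun ξ => ((wt ξ)⁻¹) ^ 4) ∧ ∫ ξ, ((wt ξ)⁻¹) ^ 4 ≤ sphereArea * Real.pi := by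
  have h1 : ∀ y : ℝ, y ^ 2 * ((1 + y ^ 2)⁻¹) ^ 2 ≤ (1 + y ^ 2)⁻¹ := fun y => by
    have : 0 < 1 + y ^ 2 := by positivity
    rw [pow_two (1 + y ^ 2)⁻¹, ← mul_assoc]
    refine mul_le_of_le_one_left (by positivity) ?_
    rw [← div_eq_mul_inv, div_le_one this]
    linarith
  have hm : Continuous fun y : ℝ => y ^ 2 * ((1 + y ^ 2)⁻¹) ^ 2 := by
    have : Continuous fun y : ℝ => (1 + y ^ 2)⁻¹ :=
      (by fun_prop : Continuous fun y : ℝ => 1 + y ^ 2).inv₀ fun y => by positivity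
    fun_prop
  have hi : Integrable fun y : ℝ => y ^ 2 * ((1 + y ^ 2)⁻¹) ^ 2 :=
    integrable_inv_one_add_sq.mono hm.aestronglyMeasurable (Filter.Eventually.of_forall fun y => by
      rw [Real.norm_of_nonneg (by positivity), Real.norm_of_nonneg (by positivity)]
      exact h1 y)
  refine radial_bound hi.integrableOn ?_ ((contDiff_wt_inv.continuous.pow 4).aestronglyMeasurable)
    (fun ξ => by positivity) (fun ξ => ?_)
  · calc _ ≤ ∫ y : ℝ, y ^ 2 * ((1 + y ^ 2)⁻¹) ^ 2 :=
          setIntegral_le_integral hi (Filter.Eventually.of_forall fun y => by positivity)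
      _ ≤ ∫ y : ℝ, (1 + y ^ 2)⁻¹ := integral_mono hi integrable_inv_one_add_sq h1
      _ = Real.pi := integral_univ_inv_one_add_sq
  · have := sq_le_wt_sq ξ
    have h2 := wt_pos ξ
    rw [show (4 : ℕ) = 2 * 2 from rfl, pow_mul, inv_pow]
    gcongr

theorem integral_le_of_le_wt_inv_four {g : R3 → ℝ} {L : ℝ} (hg : AEStronglyMeasurable g)
    (hg0 : ∀ ξ, 0 ≤ g ξ) (h : ∀ ξ, g ξ ≤ L * ((wt ξ)⁻¹) ^ 4) :
    Integrable g ∧ ∫ ξ, g ξ ≤ L * (sphereArea * Real.pi) := by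
  have h4 := integrable_wt_inv_four
  have hL : 0 ≤ L := by
    by_contra hL
    have h1 := wt_pos 0
    have h2 : 0 < ((wt 0)⁻¹) ^ 4 := by positivity
    nlinarith [hg0 0, h 0]
  have hi : Integrable g := (h4.1.const_mul L).mono hg (Filter.Eventually.of_forall fun x => by
    rw [Real.norm_of_nonneg (hg0 x), Real.norm_of_nonneg ((hg0 x).trans (h x))]
    exact h x)
  refine ⟨hi, (integral_mono hi (h4.1.const_mul L) h).trans ?_⟩
  rw [integral_const_mul]
  exact mul_le_mul_of_nonneg_left h4.2 hL

theorem integral_le_of_le_wt_inv_two {g : R3 → ℝ} {L R : ℝ} (hR : 0 ≤ R)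
    (hg : AEStronglyMeasurable g) (hg0 : ∀ ξ, 0 ≤ g ξ) (h : ∀ ξ, g ξ ≤ L * ((wt ξ)⁻¹) ^ 2)
    (hgR : ∀ ξ, R < ‖ξ‖ → g ξ = 0) :
    Integrable g ∧ ∫ ξ, g ξ ≤ sphereArea * (L * R) := by
  have hL : 0 ≤ L := by
    by_contra hL
    have h1 := wt_pos 0
    have h2 : 0 < ((wt 0)⁻¹) ^ 2 := by positivity
    nlinarith [hg0 0, h 0]
  let f : ℝ → ℝ := fun y => if y ≤ R then L * (1 + y ^ 2)⁻¹ else 0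
  have hf : ∀ y, y ^ 2 * f y ≤ (Iic R).indicator (fun _ => L) y := fun y => by
    by_cases hy : y ≤ R
    · simp only [f, hy, if_true, indicator, mem_Iic]
      have : 0 < 1 + y ^ 2 := by positivity
      rw [mul_left_comm, ← div_eq_mul_inv]
      refine mul_le_of_le_one_right hL ?_
      rw [div_le_one this]
      linarith
    · simp [f, hy]
  have hf0 : ∀ y, 0 ≤ y ^ 2 * f y := fun y => by
    by_cases hy : y ≤ R <;> simp only [f, hy, if_true, if_false] <;> positivity
  have hm : Measurable fun y => y ^ 2 * f y := by
    refine (measurable_id.pow_const 2).mul (Measurable.ite measurableSet_Iic ?_ measurable_const)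
    fun_prop
  have hI : IntegrableOn ((Iic R).indicator fun _ => L) (Ioi (0 : ℝ)) := by
    rw [IntegrableOn, integrable_indicator_iff measurableSet_Iic, IntegrableOn,
      Measure.restrict_restrict measurableSet_Iic, inter_comm, Ioi_inter_Iic]
    exact integrable_const L
  have hi : IntegrableOn (fun y => y ^ 2 * f y) (Ioi 0) :=
    Integrable.mono (g := (Iic R).indicator fun _ => L) hI hm.aestronglyMeasurable (Filter.Eventually.of_forall fun y => by
      rw [Real.norm_of_nonneg (hf0 y), Real.norm_of_nonneg ((hf0 y).trans (hf y))]
      exact hf y)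
  refine radial_bound hi ?_ hg hg0 fun ξ => ?_
  · refine (setIntegral_mono hi hI hf).trans ?_
    rw [integral_indicator measurableSet_Iic, Measure.restrict_restrict measurableSet_Iic,
      inter_comm, Ioi_inter_Iic, setIntegral_const]
    simp [hR, mul_comm]
  · by_cases hξ : ‖ξ‖ ≤ R
    · simp only [f, hξ, if_true]
      refine (h ξ).trans ?_
      rw [inv_pow]
      gcongr
      exact sq_le_wt_sq ξ
    · simp only [f, hξ, if_false]
      exact (hgR ξ (not_le.1 hξ)).le

/-- The dual of the weight that measures the decay of the kernel of a symbol cut off at frequency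
`N`; it scales like `|x|² + |x|⁴` at the length `N^{-1/2}`, so that its integral does not depend
on `N`. -/
theorem integral_kernel_weight {M : ℝ} (hM : 0 < M) :
    Integrable (fun x : R3 => (M⁻¹ * ‖x‖ ^ 2 + M * ‖x‖ ^ 4)⁻¹) ∧
      ∫ x : R3, (M⁻¹ * ‖x‖ ^ 2 + M * ‖x‖ ^ 4)⁻¹ ≤ sphereArea * Real.pi := by
  have key : EqOn (fun y : ℝ => y ^ 2 * (M⁻¹ * y ^ 2 + M * y ^ 4)⁻¹)
      (fun y => M * (1 + (M * y) ^ 2)⁻¹) (Ioi 0) := fun y hy => by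
    have hy' : 0 < y := hy
    have : 0 < 1 + (M * y) ^ 2 := by positivity
    simp only
    have h2 : M⁻¹ * y ^ 2 + M * y ^ 4 = y ^ 2 * M⁻¹ * (1 + (M * y) ^ 2) := by
      field_simp
    rw [h2]
    field_simp
  have h1 : Integrable fun y : ℝ => M * (1 + (M * y) ^ 2)⁻¹ :=
    (integrable_inv_one_add_sq.comp_mul_left' hM.ne').const_mul M
  have hi : IntegrableOn (fun y : ℝ => y ^ 2 * (M⁻¹ * y ^ 2 + M * y ^ 4)⁻¹) (Ioi 0) :=
    h1.integrableOn.congr_fun key.symm measurableSet_Ioi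
  refine radial_bound (f := fun y => (M⁻¹ * y ^ 2 + M * y ^ 4)⁻¹) hi ?_ ?_ (fun x => by positivity)
    fun x => le_rfl
  · rw [setIntegral_congr_fun measurableSet_Ioi key]
    refine (setIntegral_le_integral h1 (Filter.Eventually.of_forall fun y => by positivity)).trans ?_
    rw [integral_const_mul, Measure.integral_comp_mul_left (fun y => (1 + y ^ 2)⁻¹) M,
      integral_univ_inv_one_add_sq, abs_of_pos (inv_pos.2 hM), smul_eq_mul, ← mul_assoc,
      mul_inv_cancel₀ hM.ne', one_mul]
  · exact (by fun_prop : Measurable fun x : R3 => (M⁻¹ * ‖x‖ ^ 2 + M * ‖x‖ ^ 4)⁻¹).aestronglyMeasurable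

theorem integral_wt_inv_tail {m : ℕ} (hm : 2 ≤ m) {N : ℝ} (hN : 0 < N) :
    IntegrableOn (fun ξ => ((wt ξ)⁻¹) ^ (2 * m)) {ξ | N ≤ ‖ξ‖} ∧
      ∫ ξ in {ξ | N ≤ ‖ξ‖}, ((wt ξ)⁻¹) ^ (2 * m) ≤ sphereArea * N ^ (3 - 2 * (m : ℝ)) := by
  have hmR : (2 : ℝ) ≤ m := by exact_mod_cast hm
  have hS : MeasurableSet {ξ : R3 | N ≤ ‖ξ‖} := measurableSet_le measurable_const measurable_norm
  let f : ℝ → ℝ := (Ici N).indicator fun y => y ^ (-(2 * (m : ℝ)))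
  have hf : (fun y => y ^ 2 * f y) =ᵐ[volume.restrict (Ioi 0)] (Ioi N).indicator
      fun y => y ^ (2 - 2 * (m : ℝ)) := by
    have h0 : ∀ᵐ y : ℝ ∂(volume.restrict (Ioi 0)), y ≠ N :=
      ae_restrict_of_ae (Measure.ae_ne volume N)
    filter_upwards [h0, ae_restrict_mem measurableSet_Ioi] with y hyN hy
    have hy' : (0 : ℝ) < y := hy
    by_cases h : N ≤ y
    · have h' : N < y := lt_of_le_of_ne h (Ne.symm hyN)
      simp only [f, indicator, mem_Ici, h, if_true, mem_Ioi, h']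
      rw [← Real.rpow_natCast y 2, ← Real.rpow_add hy']
      congr 1
    · have h' : ¬ N < y := fun hh => h hh.le
      simp [f, h, h']
  have hI : IntegrableOn (fun y : ℝ => y ^ (2 - 2 * (m : ℝ))) (Ioi N) :=
    integrableOn_Ioi_rpow_of_lt (by linarith) hN
  have hsub : Ioi N ∩ Ioi 0 = Ioi N := inter_eq_left.2 (Ioi_subset_Ioi hN.le)
  have hi : IntegrableOn (fun y => y ^ 2 * f y) (Ioi 0) := by
    refine Integrable.congr ?_ hf.symm
    rw [integrable_indicator_iff measurableSet_Ioi, IntegrableOn,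
      Measure.restrict_restrict measurableSet_Ioi, hsub]
    exact hI
  have hB : ∫ y in Ioi (0 : ℝ), y ^ 2 * f y ≤ N ^ (3 - 2 * (m : ℝ)) := by
    rw [integral_congr_ae hf, integral_indicator measurableSet_Ioi,
      Measure.restrict_restrict measurableSet_Ioi, hsub, integral_Ioi_rpow_of_lt (by linarith) hN]
    have e : 2 - 2 * (m : ℝ) + 1 = 3 - 2 * m := by ring
    rw [e, neg_div, ← div_neg]
    exact div_le_self (by positivity) (by linarith)
  have := radial_bound (f := f) (g := {ξ : R3 | N ≤ ‖ξ‖}.indicator fun ξ => ((wt ξ)⁻¹) ^ (2 * m))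
    hi hB ((contDiff_wt_inv.continuous.pow _).aestronglyMeasurable.indicator hS)
    (fun ξ => indicator_nonneg (fun ξ _ => by have := wt_pos ξ; positivity) ξ) (fun ξ => by
      by_cases h : N ≤ ‖ξ‖
      · have hξ : 0 < ‖ξ‖ := hN.trans_le h
        have h1 : ‖ξ‖ ≤ wt ξ := by
          have := sq_le_wt_sq ξ
          exact le_of_sq_le_sq (by linarith) (wt_pos ξ).le
        simp only [f, indicator, mem_ofPred_eq, h, if_true, mem_Ici]
        rw [Real.rpow_neg hξ.le, inv_pow]
        have : ‖ξ‖ ^ (2 * (m : ℝ)) = ‖ξ‖ ^ (2 * m) := by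
          rw [← Real.rpow_natCast]; push_cast; rfl
        rw [this]
        gcongr
      · simp [f, h])
  rw [integrable_indicator_iff hS, integral_indicator hS] at this
  exact this

/-! ### Kernels of symbols supported in a ball -/

theorem pd_comp_smul (i : Fin 3) {a : R3 → ℂ} (ha : ContDiff ℝ ∞ a) (c : ℝ) :
    pd i (fun ξ => a (c • ξ)) = fun ξ => c * pd i a (c • ξ) := by
  ext ξ
  have h1 : HasFDerivAt (fun ξ : R3 => c • ξ) (c • ContinuousLinearMap.id ℝ R3) ξ :=
    (hasFDerivAt_id ξ).const_smul c
  have h2 : fderiv ℝ (fun ξ => a (c • ξ)) ξ = _ :=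
    (((ha.differentiable (by simp)) (c • ξ)).hasFDerivAt.comp ξ h1).fderiv
  rw [pd, h2]
  simp [pd]

/-- Smooth cutoffs to the ball of radius `N ≥ 1` are symbols of order zero, uniformly in `N`. -/
theorem exists_cutoff : ∃ C : ℝ, 0 ≤ C ∧ ∀ N : ℝ, 1 ≤ N → ∃ χ : Sym, ‖χ‖ ≤ C ∧
    (∀ ξ, ‖ξ‖ < N → χ ξ = 1) ∧ (∀ ξ, 2 * N < ‖ξ‖ → χ ξ = 0) ∧ ∀ ξ, ‖1 - χ ξ‖ ≤ 1 := by
  let φ : ContDiffBump (0 : R3) := ⟨1, 2, one_pos, one_lt_two⟩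
  let a : R3 → ℂ := fun ξ => ((φ ξ : ℝ) : ℂ)
  have ha : ContDiff ℝ ∞ a := Complex.ofRealCLM.contDiff.comp φ.contDiff
  have hsupp : tsupport a ⊆ Metric.closedBall 0 2 := by
    refine (tsupport_comp_subset (g := fun x : ℝ => (x : ℂ)) (by simp) _).trans ?_
    exact φ.tsupport_eq.le
  have hpd : ∀ i {b : R3 → ℂ}, tsupport b ⊆ Metric.closedBall 0 2 →
      tsupport (pd i b) ⊆ Metric.closedBall 0 2 := fun i b hb =>
    (tsupport_comp_subset (g := fun L : R3 →L[ℝ] ℂ => L (EuclideanSpace.single i 1)) (by simp)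
      _).trans ((tsupport_fderiv_subset ℝ).trans hb)
  have hbd : ∀ b : R3 → ℂ, Continuous b → tsupport b ⊆ Metric.closedBall 0 2 →
      ∃ B, ∀ ξ, ‖b ξ‖ ≤ B := fun b hb hs =>
    hb.bounded_above_of_compact_support
      ((isCompact_closedBall (0 : R3) 2).of_isClosed_subset (isClosed_tsupport b) hs)
  have hz : ∀ {b : R3 → ℂ}, tsupport b ⊆ Metric.closedBall 0 2 → ∀ ξ, 2 < ‖ξ‖ → b ξ = 0 := by
    intro b hb ξ hξ
    refine image_eq_zero_of_notMem_tsupport fun h => ?_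
    have := hb h
    rw [mem_closedBall_zero_iff] at this
    linarith
  have h1 := fun i => hpd i hsupp
  have h2 := fun i => hpd i (h1 i)
  choose B1 hB1 using fun i => hbd _ (contDiff_pd i ha).continuous (h1 i)
  choose B2 hB2 using fun i => hbd _ (contDiff_pd i (contDiff_pd i ha)).continuous (h2 i)
  let S1 := ∑ i, |B1 i|
  let S2 := ∑ i, |B2 i|
  have hS1 : ∀ i ξ, ‖pd i a ξ‖ ≤ S1 := fun i ξ => ((hB1 i ξ).trans (le_abs_self _)).trans
    (Finset.single_le_sum (f := fun i => |B1 i|) (fun _ _ => abs_nonneg _) (Finset.mem_univ i))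
  have hS2 : ∀ i ξ, ‖pd i (pd i a) ξ‖ ≤ S2 := fun i ξ => ((hB2 i ξ).trans (le_abs_self _)).trans
    (Finset.single_le_sum (f := fun i => |B2 i|) (fun _ _ => abs_nonneg _) (Finset.mem_univ i))
  have hS10 : 0 ≤ S1 := Finset.sum_nonneg fun _ _ => abs_nonneg _
  have hS20 : 0 ≤ S2 := Finset.sum_nonneg fun _ _ => abs_nonneg _
  refine ⟨1 + 15 * S1 + 225 * S2 / 2, by positivity, fun N hN => ?_⟩
  have hN0 : 0 < N := one_pos.trans_le hN
  have hjet : ∀ p, jet (fun ξ => a (N⁻¹ • ξ)) p ≤ 1 + 15 * S1 + 225 * S2 / 2 := by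
    rintro ⟨ξ, i⟩
    have hw := wt_pos ξ
    have e2 : pd i (pd i fun ξ => a (N⁻¹ • ξ)) = fun ξ => ((N⁻¹ : ℝ) : ℂ) *
        (((N⁻¹ : ℝ) : ℂ) * pd i (pd i a) (N⁻¹ • ξ)) := by
      rw [pd_comp_smul i ha]
      have : (fun ξ => ((N⁻¹ : ℝ) : ℂ) * pd i a (N⁻¹ • ξ)) =
          (fun _ => ((N⁻¹ : ℝ) : ℂ)) * fun ξ => pd i a (N⁻¹ • ξ) := rfl
      have hc : ContDiff ℝ ∞ fun ξ : R3 => pd i a (N⁻¹ • ξ) :=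
        (contDiff_pd i ha).comp (contDiff_id.const_smul N⁻¹)
      rw [this, pd_mul i contDiff_const hc, pd_const, pd_comp_smul i (contDiff_pd i ha)]
      ext ξ
      simp
    unfold jet
    simp only
    rw [e2, pd_comp_smul i ha]
    simp only [norm_mul, Complex.norm_real, norm_inv, Real.norm_of_nonneg hN0.le]
    have h0 : ‖a (N⁻¹ • ξ)‖ ≤ 1 := by
      rw [Complex.norm_real, Real.norm_of_nonneg φ.nonneg]; exact φ.le_one
    by_cases hξ : 2 < ‖N⁻¹ • ξ‖
    · rw [hz (h1 i) _ hξ, hz (h2 i) _ hξ]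
      simp only [norm_zero, mul_zero]
      linarith
    · rw [norm_smul, norm_inv, Real.norm_of_nonneg hN0.le, not_lt, inv_mul_le_iff₀ hN0] at hξ
      have hwN : wt ξ * N⁻¹ ≤ 15 := by
        rw [← div_eq_mul_inv, div_le_iff₀ hN0]
        linarith [wt_le ξ]
      have h3 : wt ξ * (N⁻¹ * ‖pd i a (N⁻¹ • ξ)‖) ≤ 15 * S1 := by
        rw [← mul_assoc]
        exact mul_le_mul hwN (hS1 _ _) (norm_nonneg _) (by norm_num)
      have h4 : wt ξ ^ 2 * (N⁻¹ * (N⁻¹ * ‖pd i (pd i a) (N⁻¹ • ξ)‖)) ≤ 225 * S2 := by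
        have e : wt ξ ^ 2 * (N⁻¹ * (N⁻¹ * ‖pd i (pd i a) (N⁻¹ • ξ)‖)) =
          (wt ξ * N⁻¹) ^ 2 * ‖pd i (pd i a) (N⁻¹ • ξ)‖ := by ring
        rw [e]
        refine mul_le_mul ?_ (hS2 _ _) (norm_nonneg _) (by norm_num)
        calc (wt ξ * N⁻¹) ^ 2 ≤ 15 ^ 2 := by gcongr
          _ = 225 := by norm_num
      linarith
  refine ⟨⟨fun ξ => a (N⁻¹ • ξ), ha.comp (contDiff_id.const_smul N⁻¹), _, hjet⟩,
    Sym.norm_le_of_jet_le hjet, fun ξ hξ => ?_, fun ξ hξ => ?_, fun ξ => ?_⟩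
  · change ((φ (N⁻¹ • ξ) : ℝ) : ℂ) = 1
    rw [φ.one_of_mem_closedBall, Complex.ofReal_one]
    rw [mem_closedBall_zero_iff, norm_smul, norm_inv, Real.norm_of_nonneg hN0.le,
      inv_mul_le_iff₀ hN0]
    simpa [φ] using hξ.le
  · refine hz hsupp _ ?_
    rw [norm_smul, norm_inv, Real.norm_of_nonneg hN0.le, lt_inv_mul_iff₀ hN0]
    linarith
  · change ‖(1 : ℂ) - ((φ (N⁻¹ • ξ) : ℝ) : ℂ)‖ ≤ 1
    rw [← Complex.ofReal_one, ← Complex.ofReal_sub, Complex.norm_real, Real.norm_eq_abs, abs_le]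
    have := φ.nonneg (x := N⁻¹ • ξ)
    have := φ.le_one (x := N⁻¹ • ξ)
    constructor <;> linarith

theorem Sym.norm_pd_le (a : Sym) (i : Fin 3) (ξ : R3) : ‖pd i a ξ‖ ≤ ‖a‖ * (wt ξ)⁻¹ := by
  have hw := wt_pos ξ
  have h := a.jet_le_norm (ξ, i)
  unfold jet at h
  simp only at h
  rw [← div_eq_mul_inv, le_div_iff₀ hw]
  have h2 : 0 ≤ wt ξ ^ 2 * ‖pd i (pd i a) ξ‖ / 2 := by positivity
  linarith [norm_nonneg (a ξ)]

theorem Sym.norm_pd_pd_le (a : Sym) (i : Fin 3) (ξ : R3) :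
    ‖pd i (pd i a) ξ‖ ≤ 2 * ‖a‖ * (wt ξ)⁻¹ ^ 2 := by
  have hw := wt_pos ξ
  have h := a.jet_le_norm (ξ, i)
  unfold jet at h
  simp only at h
  rw [inv_pow, ← div_eq_mul_inv, le_div_iff₀ (by positivity)]
  have h2 : 0 ≤ wt ξ * ‖pd i a ξ‖ := by positivity
  linarith [norm_nonneg (a ξ)]

/-- Plancherel's theorem for the inverse Fourier transform. -/
theorem integral_norm_sq_fourierInv (f : SchwartzMap R3 ℂ) :
    ∫ x, ‖(𝓕⁻ f : SchwartzMap R3 ℂ) x‖ ^ 2 = ∫ ξ, ‖f ξ‖ ^ 2 := by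
  have := SchwartzMap.integral_norm_sq_fourier (𝓕⁻ f : SchwartzMap R3 ℂ)
  rw [FourierTransform.fourier_fourierInv_eq] at this
  exact this.symm

/-- A derivative of `f` is a multiplication by a coordinate on the inverse Fourier transform. -/
theorem fourierInv_pd (f g : SchwartzMap R3 ℂ) (i : Fin 3) (h : ∀ ξ, g ξ = pd i f ξ) (x : R3) :
    (𝓕⁻ g : SchwartzMap R3 ℂ) x =
      -(2 * Real.pi * Complex.I) * (x i * (𝓕⁻ f : SchwartzMap R3 ℂ) x) := by
  have hg : g = LineDeriv.lineDerivOp (EuclideanSpace.single i (1 : ℝ) : R3) f := by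
    ext ξ
    rw [h, SchwartzMap.lineDerivOp_apply_eq_fderiv]
    rfl
  rw [hg, SchwartzMap.fourierInv_lineDerivOp_eq]
  rw [smul_apply, SchwartzMap.smulLeftCLM_apply_apply (by fun_prop)]
  simp [EuclideanSpace.inner_single_right]

theorem integrable_norm_sq_schwartz (f : SchwartzMap R3 ℂ) : Integrable fun x => ‖f x‖ ^ 2 :=
  (memLp_two_iff_integrable_sq_norm f.continuous.aestronglyMeasurable).1 (f.memLp 2)

/-- The kernel of a symbol of order zero supported in the ball of radius `2N` has an `L¹` norm
of order at most `N^{1/4}`; here `N = μ⁴`. -/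
theorem exists_kernel_bound : ∃ C : ℝ, 0 ≤ C ∧ ∀ (g : Sym) (μ : ℝ), 1 ≤ μ →
    (∀ ξ, 2 * μ ^ 4 < ‖ξ‖ → g ξ = 0) →
    ∃ H : SchwartzMap R3 ℂ, (∀ ξ, 𝓕 (H : R3 → ℂ) ξ = g ξ) ∧ ∫ x, ‖H x‖ ≤ C * ‖g‖ * μ := by
  have hA := sphereArea_nonneg
  have hpi := Real.pi_pos
  refine ⟨sphereArea * (6 + 37 * Real.pi), by positivity, fun g μ hμ hg => ?_⟩
  have hμ0 : 0 < μ := one_pos.trans_le hμ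
  have hcs : HasCompactSupport (g : R3 → ℂ) :=
    HasCompactSupport.of_support_subset_isCompact (isCompact_closedBall (0 : R3) (2 * μ ^ 4))
      fun ξ hξ => by
        rw [mem_closedBall_zero_iff]
        by_contra h
        exact hξ (hg ξ (not_le.1 h))
  let G : SchwartzMap R3 ℂ := hcs.toSchwartzMap g.contDiff
  have hG : (G : R3 → ℂ) = g := rfl
  let D : Fin 3 → SchwartzMap R3 ℂ := fun i =>
    LineDeriv.lineDerivOp (EuclideanSpace.single i (1 : ℝ) : R3) G
  have hD : ∀ i, (D i : R3 → ℂ) = pd i g := fun i => by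
    ext ξ
    rw [SchwartzMap.lineDerivOp_apply_eq_fderiv, hG]; rfl
  let D2 : Fin 3 → SchwartzMap R3 ℂ := fun i =>
    LineDeriv.lineDerivOp (EuclideanSpace.single i (1 : ℝ) : R3) (D i)
  have hD2 : ∀ i, (D2 i : R3 → ℂ) = pd i (pd i g) := fun i => by
    ext ξ
    rw [SchwartzMap.lineDerivOp_apply_eq_fderiv, hD]; rfl
  let H : SchwartzMap R3 ℂ := 𝓕⁻ G
  have hF1 : ∀ i x, ‖(𝓕⁻ (D i) : SchwartzMap R3 ℂ) x‖ ^ 2 = (2 * Real.pi) ^ 2 * (x i ^ 2 * ‖H x‖ ^ 2) :=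
    fun i x => by
      rw [fourierInv_pd G (D i) i (fun ξ => by rw [hD, hG])]
      simp only [norm_mul, norm_neg, Complex.norm_I, Complex.norm_real, Real.norm_of_nonneg hpi.le,
        Complex.norm_ofNat, mul_pow, Real.norm_eq_abs, sq_abs]
      ring
  have hF2 : ∀ i x, ‖(𝓕⁻ (D2 i) : SchwartzMap R3 ℂ) x‖ ^ 2 =
      (2 * Real.pi) ^ 4 * (x i ^ 4 * ‖H x‖ ^ 2) := fun i x => by
    rw [fourierInv_pd (D i) (D2 i) i (fun ξ => by rw [hD2, hD])]
    have := hF1 i x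
    simp only [norm_mul, norm_neg, Complex.norm_I, Complex.norm_real, Real.norm_of_nonneg hpi.le,
      Complex.norm_ofNat, mul_pow, Real.norm_eq_abs, sq_abs] at this ⊢
    rw [this]
    ring
  have i1 : ∀ i, Integrable fun x : R3 => x i ^ 2 * ‖H x‖ ^ 2 := fun i => by
    have := (integrable_norm_sq_schwartz (𝓕⁻ (D i))).const_mul (((2 * Real.pi) ^ 2)⁻¹)
    refine this.congr (Filter.Eventually.of_forall fun x => ?_)
    simp only [hF1]
    field_simp
  have i2 : ∀ i, Integrable fun x : R3 => x i ^ 4 * ‖H x‖ ^ 2 := fun i => by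
    have := (integrable_norm_sq_schwartz (𝓕⁻ (D2 i))).const_mul (((2 * Real.pi) ^ 4)⁻¹)
    refine this.congr (Filter.Eventually.of_forall fun x => ?_)
    simp only [hF2]
    field_simp
  have h2pi : 1 ≤ 2 * Real.pi := by linarith [Real.pi_gt_three]
  have b1 : ∀ i, ∫ x : R3, x i ^ 2 * ‖H x‖ ^ 2 ≤ sphereArea * (‖g‖ ^ 2 * (2 * μ ^ 4)) := fun i => by
    have e : (2 * Real.pi) ^ 2 * ∫ x : R3, x i ^ 2 * ‖H x‖ ^ 2 = ∫ ξ, ‖D i ξ‖ ^ 2 := by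
      rw [← integral_norm_sq_fourierInv (D i), ← integral_const_mul]
      simp only [hF1]
    have hb : ∫ ξ, ‖D i ξ‖ ^ 2 ≤ sphereArea * (‖g‖ ^ 2 * (2 * μ ^ 4)) := by
      refine (integral_le_of_le_wt_inv_two (g := fun ξ => ‖D i ξ‖ ^ 2) (L := ‖g‖ ^ 2)
        (R := 2 * μ ^ 4) (by positivity)
        ((D i).continuous.norm.pow 2).aestronglyMeasurable (fun ξ => by positivity)
        (fun ξ => ?_) fun ξ hξ => ?_).2
      · rw [hD, ← mul_pow]
        gcongr
        exact g.norm_pd_le i ξ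
      · have : (g : R3 → ℂ) =ᶠ[nhds ξ] fun _ => 0 := by
          have ho : IsOpen {ξ : R3 | 2 * μ ^ 4 < ‖ξ‖} := isOpen_lt continuous_const continuous_norm
          filter_upwards [ho.mem_nhds hξ] with η hη using hg η hη
        have h0 : pd i g ξ = 0 := by rw [pd, this.fderiv_eq]; simp
        rw [hD, h0]
        simp
    have h0 : 0 ≤ ∫ x : R3, x i ^ 2 * ‖H x‖ ^ 2 := integral_nonneg fun x => by positivity
    have : 1 ≤ (2 * Real.pi) ^ 2 := one_le_pow₀ h2pi
    nlinarith
  have b2 : ∀ i, ∫ x : R3, x i ^ 4 * ‖H x‖ ^ 2 ≤ 4 * ‖g‖ ^ 2 * (sphereArea * Real.pi) := fun i => by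
    have e : (2 * Real.pi) ^ 4 * ∫ x : R3, x i ^ 4 * ‖H x‖ ^ 2 = ∫ ξ, ‖D2 i ξ‖ ^ 2 := by
      rw [← integral_norm_sq_fourierInv (D2 i), ← integral_const_mul]
      simp only [hF2]
    have hb : ∫ ξ, ‖D2 i ξ‖ ^ 2 ≤ 4 * ‖g‖ ^ 2 * (sphereArea * Real.pi) := by
      refine (integral_le_of_le_wt_inv_four (g := fun ξ => ‖D2 i ξ‖ ^ 2) (L := 4 * ‖g‖ ^ 2)
        ((D2 i).continuous.norm.pow 2).aestronglyMeasurable (fun ξ => by positivity)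
        (fun ξ => ?_)).2
      rw [hD2]
      calc ‖pd i (pd i g) ξ‖ ^ 2 ≤ (2 * ‖g‖ * (wt ξ)⁻¹ ^ 2) ^ 2 := by
            gcongr
            exact g.norm_pd_pd_le i ξ
        _ = _ := by ring
    have h0 : 0 ≤ ∫ x : R3, x i ^ 4 * ‖H x‖ ^ 2 := integral_nonneg fun x => by positivity
    have : 1 ≤ (2 * Real.pi) ^ 4 := one_le_pow₀ h2pi
    nlinarith
  have hnorm2 : ∀ x : R3, ‖x‖ ^ 2 = x 0 ^ 2 + x 1 ^ 2 + x 2 ^ 2 := fun x => by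
    rw [EuclideanSpace.norm_sq_eq, Fin.sum_univ_three]; simp
  -- the weight of `integral_kernel_weight`, for the length `1/μ²`
  let w : R3 → ℝ := fun x => (μ ^ 2)⁻¹ * ‖x‖ ^ 2 + μ ^ 2 * ‖x‖ ^ 4
  let S : R3 → ℝ := fun x => ∑ i, ((μ ^ 2)⁻¹ * (x i ^ 2 * ‖H x‖ ^ 2) +
    3 * μ ^ 2 * (x i ^ 4 * ‖H x‖ ^ 2))
  have hwS : ∀ x, w x * ‖H x‖ ^ 2 ≤ S x := fun x => by
    have h4 : ‖x‖ ^ 4 ≤ 3 * (x 0 ^ 4 + x 1 ^ 4 + x 2 ^ 4) := by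
      rw [show ‖x‖ ^ 4 = (‖x‖ ^ 2) ^ 2 by ring, hnorm2]
      nlinarith [sq_nonneg (x 0 ^ 2 - x 1 ^ 2), sq_nonneg (x 0 ^ 2 - x 2 ^ 2),
        sq_nonneg (x 1 ^ 2 - x 2 ^ 2)]
    have h5 : μ ^ 2 * ‖H x‖ ^ 2 * ‖x‖ ^ 4 ≤
        μ ^ 2 * ‖H x‖ ^ 2 * (3 * (x 0 ^ 4 + x 1 ^ 4 + x 2 ^ 4)) := by gcongr
    simp only [w, S, Fin.sum_univ_three]
    rw [hnorm2]
    linarith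
  have iS : Integrable S := integrable_finsetSum _ fun i _ =>
    ((i1 i).const_mul _).add ((i2 i).const_mul _)
  have bS : ∫ x, S x ≤ ‖g‖ ^ 2 * μ ^ 2 * (sphereArea * (6 + 36 * Real.pi)) := by
    have hsum : ∫ x, S x = ∑ i, ∫ x : R3, ((μ ^ 2)⁻¹ * (x i ^ 2 * ‖H x‖ ^ 2) +
        3 * μ ^ 2 * (x i ^ 4 * ‖H x‖ ^ 2)) :=
      integral_finsetSum _ fun i _ => ((i1 i).const_mul _).add ((i2 i).const_mul _)
    rw [hsum]
    have : ∀ i, ∫ x : R3, ((μ ^ 2)⁻¹ * (x i ^ 2 * ‖H x‖ ^ 2) + 3 * μ ^ 2 * (x i ^ 4 * ‖H x‖ ^ 2)) ≤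
        ‖g‖ ^ 2 * μ ^ 2 * (sphereArea * (2 + 12 * Real.pi)) := fun i => by
      rw [integral_add ((i1 i).const_mul _) ((i2 i).const_mul _), integral_const_mul,
        integral_const_mul]
      have h1 := mul_le_mul_of_nonneg_left (b1 i) (inv_nonneg.2 (sq_nonneg μ))
      have h2 := mul_le_mul_of_nonneg_left (b2 i) (by positivity : 0 ≤ 3 * μ ^ 2)
      have e1 : (μ ^ 2)⁻¹ * (sphereArea * (‖g‖ ^ 2 * (2 * μ ^ 4))) =
          2 * sphereArea * ‖g‖ ^ 2 * μ ^ 2 := by field_simp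
      rw [e1] at h1
      linarith
    refine (Finset.sum_le_sum fun i _ => this i).trans (le_of_eq ?_)
    simp
    ring
  obtain ⟨iw, bw⟩ := integral_kernel_weight (M := μ ^ 2) (by positivity)
  refine ⟨H, fun ξ => ?_, ?_⟩
  · have h1 : 𝓕 H = G := FourierTransform.fourier_fourierInv_eq G
    have h2 : (𝓕 H : SchwartzMap R3 ℂ) ξ = g ξ := by rw [h1, hG]
    rw [← h2, SchwartzMap.fourier_coe]
  · rcases (norm_nonneg g).eq_or_lt with hg0 | hg0
    · have : g = 0 := norm_eq_zero.1 hg0.symm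
      have hG0 : G = 0 := by ext ξ; rw [hG, this]; rfl
      have hH0 : H = 0 := by
        change 𝓕⁻ G = 0
        rw [hG0]
        exact map_zero (FourierTransform.fourierCLE ℂ (SchwartzMap R3 ℂ)).symm
      rw [hH0, ← hg0]
      simp
    · have hlam : 0 < ‖g‖ * μ := by positivity
      have hpt : ∀ᵐ x : R3, ‖H x‖ ≤ ‖g‖ * μ / 2 * (w x)⁻¹ + (2 * (‖g‖ * μ))⁻¹ * S x := by
        filter_upwards [Measure.ae_ne volume (0 : R3)] with x hx
        have hx0 : 0 < ‖x‖ := norm_pos_iff.2 hx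
        have hw : 0 < w x := by positivity
        have h1 : ‖H x‖ ≤ ‖g‖ * μ / 2 * (w x)⁻¹ + (2 * (‖g‖ * μ))⁻¹ * (w x * ‖H x‖ ^ 2) := by
          have h2 : 0 ≤ (‖g‖ * μ - w x * ‖H x‖) ^ 2 / (2 * (‖g‖ * μ) * w x) := by positivity
          have e : (‖g‖ * μ - w x * ‖H x‖) ^ 2 / (2 * (‖g‖ * μ) * w x) =
              ‖g‖ * μ / 2 * (w x)⁻¹ + (2 * (‖g‖ * μ))⁻¹ * (w x * ‖H x‖ ^ 2) - ‖H x‖ := by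
            field_simp
            ring
          linarith
        refine h1.trans ?_
        gcongr
        exact hwS x
      have hint := (iw.const_mul (‖g‖ * μ / 2)).add (iS.const_mul (2 * (‖g‖ * μ))⁻¹)
      refine (integral_mono_ae H.integrable.norm hint hpt).trans ?_
      rw [Pi.add_def, integral_add (iw.const_mul _) (iS.const_mul _), integral_const_mul,
        integral_const_mul]
      have h1 := mul_le_mul_of_nonneg_left bw (by positivity : 0 ≤ ‖g‖ * μ / 2)
      have h2 := mul_le_mul_of_nonneg_left bS (by positivity : 0 ≤ (2 * (‖g‖ * μ))⁻¹)
      have e2 : (2 * (‖g‖ * μ))⁻¹ * (‖g‖ ^ 2 * μ ^ 2 * (sphereArea * (6 + 36 * Real.pi))) =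
          ‖g‖ * μ * (sphereArea * (3 + 18 * Real.pi)) := by
        field_simp
        ring
      rw [e2] at h2
      have h3 : 0 ≤ ‖g‖ * μ * sphereArea := by positivity
      have h4 : 0 ≤ ‖g‖ * μ * sphereArea * Real.pi := by positivity
      linarith

/-! ### Fourier multipliers as functionals on the algebra of symbols -/

/-- The character `e^{ik·x}` as a function of the frequency. -/
def chr (x ξ : R3) : ℂ := Complex.exp (((2 * Real.pi * inner ℝ ξ x : ℝ) : ℂ) * Complex.I)

theorem norm_chr (x ξ : R3) : ‖chr x ξ‖ = 1 := Complex.norm_exp_ofReal_mul_I _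

theorem continuous_chr : Continuous fun p : R3 × R3 => chr p.1 p.2 := by
  unfold chr; fun_prop

theorem fourierInv_eq_chr (h : R3 → ℂ) (x : R3) : 𝓕⁻ h x = ∫ ξ, chr x ξ * h ξ := by
  rw [Real.fourierInv_eq']
  rfl

theorem Sym.continuous (a : Sym) : Continuous (a : R3 → ℂ) := a.contDiff.continuous

theorem Sym.integrable_mul (a : Sym) {h : R3 → ℂ} (hh : Integrable h) :
    Integrable fun ξ => a ξ * h ξ :=
  hh.bdd_mul a.continuous.aestronglyMeasurable (Filter.Eventually.of_forall a.norm_apply_le)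

theorem integrable_chr_mul (x : R3) {h : R3 → ℂ} (hh : Integrable h) :
    Integrable fun ξ => chr x ξ * h ξ :=
  hh.bdd_mul (c := 1) (continuous_chr.comp (by fun_prop : Continuous fun ξ : R3 => (x, ξ))).aestronglyMeasurable
    (Filter.Eventually.of_forall fun ξ => (norm_chr x ξ).le)

theorem norm_fourierInv_le {h : R3 → ℂ} (x : R3) : ‖𝓕⁻ h x‖ ≤ ∫ ξ, ‖h ξ‖ := by
  rw [fourierInv_eq_chr]
  refine (norm_integral_le_integral_norm _).trans (le_of_eq ?_)
  simp [norm_chr]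

open Classical in
/-- The value at `x` of the Fourier multiplier `a` applied to the function of Fourier transform
`h`, as a functional of the symbol `a`. It is `0` if `h` is not integrable. -/
def mulOp (h : R3 → ℂ) (x : R3) : Sym →L[ℝ] ℂ :=
  if hh : Integrable h then
    LinearMap.mkContinuous
      { toFun := fun a => 𝓕⁻ (fun ξ => a ξ * h ξ) x
        map_add' := fun a b => by
          simp only [fourierInv_eq_chr, Sym.add_apply, add_mul, mul_add]
          exact integral_add (integrable_chr_mul x (a.integrable_mul hh))
            (integrable_chr_mul x (b.integrable_mul hh))
        map_smul' := fun r a => by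
          simp only [fourierInv_eq_chr, Sym.smul_apply, RingHom.id_apply, Complex.real_smul]
          rw [← integral_const_mul]
          congr 1; ext ξ; ring }
      (∫ ξ, ‖h ξ‖) fun a => by
        refine (norm_fourierInv_le x).trans ?_
        rw [mul_comm, ← integral_const_mul]
        refine integral_mono (a.integrable_mul hh).norm (hh.norm.const_mul _) fun ξ => ?_
        simp only [norm_mul]
        exact mul_le_mul_of_nonneg_right (a.norm_apply_le ξ) (norm_nonneg _)
  else 0

theorem mulOp_apply {h : R3 → ℂ} (hh : Integrable h) (x : R3) (a : Sym) :
    mulOp h x a = 𝓕⁻ (fun ξ => a ξ * h ξ) x := by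
  simp [mulOp, hh]

theorem norm_mulOp_le_integral (h : R3 → ℂ) (x : R3) : ‖mulOp h x‖ ≤ ∫ ξ, ‖h ξ‖ := by
  have h0 : 0 ≤ ∫ ξ, ‖h ξ‖ := integral_nonneg fun ξ => norm_nonneg _
  by_cases hh : Integrable h
  · rw [mulOp, dif_pos hh]
    exact LinearMap.mkContinuous_norm_le _ h0 _
  · simp [mulOp, hh, h0]

/-- The kernel of a multiplier acts by convolution. -/
theorem fourierInv_fourier_mul (H : SchwartzMap R3 ℂ) {h : R3 → ℂ} (hh : Integrable h) (x : R3) :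
    𝓕⁻ (fun ξ => 𝓕 (H : R3 → ℂ) ξ * h ξ) x = ∫ y, H y * 𝓕⁻ h (x - y) := by
  have hflip := VectorFourier.integral_fourierIntegral_smul_eq_flip (e := Real.fourierChar)
    (μ := (volume : Measure R3)) (ν := (volume : Measure R3)) (L := innerₗ R3) (f := (H : R3 → ℂ))
    (g := fun ξ => chr x ξ * h ξ) Real.continuous_fourierChar continuous_inner H.integrable
    (integrable_chr_mul x hh)
  rw [fourierInv_eq_chr]
  have e1 : (∫ ξ, chr x ξ * (𝓕 (H : R3 → ℂ) ξ * h ξ)) = ∫ ξ, 𝓕 (H : R3 → ℂ) ξ • (chr x ξ * h ξ) := by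
    congr 1; ext ξ; simp only [smul_eq_mul]; ring
  rw [e1]
  refine hflip.trans ?_
  congr 1; ext y
  rw [smul_eq_mul, fourierInv_eq_chr]
  congr 1
  change VectorFourier.fourierIntegral _ _ (innerₗ R3).flip _ y = _
  rw [VectorFourier.fourierIntegral]
  congr 1; ext ξ
  rw [Circle.smul_def, Real.fourierChar_apply, smul_eq_mul, ← mul_assoc, chr, chr, ← Complex.exp_add]
  congr 2
  simp [inner_sub_right]
  ring

theorem norm_fourierInv_fourier_mul_le (H : SchwartzMap R3 ℂ) {h : R3 → ℂ} (hh : Integrable h)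
    {A : ℝ} (hA : ∀ x, ‖𝓕⁻ h x‖ ≤ A) (x : R3) :
    ‖𝓕⁻ (fun ξ => 𝓕 (H : R3 → ℂ) ξ * h ξ) x‖ ≤ (∫ y, ‖H y‖) * A := by
  rw [fourierInv_fourier_mul H hh, ← integral_mul_const]
  refine norm_integral_le_of_norm_le (H.integrable.norm.mul_const A)
    (Filter.Eventually.of_forall fun y => ?_)
  rw [norm_mul]
  exact mul_le_mul_of_nonneg_left (hA _) (norm_nonneg _)

/-- The bound `‖⟨k⟩^m h‖_{L²} ≤ B`, with the measurability of `h`. -/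
structure SobBound (m : ℕ) (h : R3 → ℂ) (B : ℝ) : Prop where
  meas : AEStronglyMeasurable h
  nonneg : 0 ≤ B
  bound : eLpNorm (fun ξ => (wt ξ : ℂ) ^ m * h ξ) 2 ≤ ENNReal.ofReal B

theorem continuous_wt : Continuous wt := contDiff_wt.continuous

theorem SobBound.memLp {m : ℕ} {h : R3 → ℂ} {B : ℝ} (H : SobBound m h B) :
    MemLp (fun ξ => (wt ξ : ℂ) ^ m * h ξ) 2 :=
  ⟨((Complex.continuous_ofReal.comp continuous_wt).pow m).aestronglyMeasurable.mul H.meas,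
    H.bound.trans_lt ENNReal.ofReal_lt_top⟩

theorem SobBound.integral_sq_le {m : ℕ} {h : R3 → ℂ} {B : ℝ} (H : SobBound m h B) :
    ∫ ξ, (wt ξ ^ m * ‖h ξ‖) ^ 2 ≤ B ^ 2 := by
  have e : ∀ ξ, (wt ξ ^ m * ‖h ξ‖) ^ 2 = ‖(wt ξ : ℂ) ^ m * h ξ‖ ^ 2 := fun ξ => by
    rw [norm_mul, norm_pow, Complex.norm_real, Real.norm_of_nonneg (wt_pos ξ).le]
  simp_rw [e]
  have h1 := H.bound
  rw [eLpNorm_eq_lintegral_rpow_enorm_toReal (by norm_num) (by norm_num)] at h1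
  rw [integral_eq_lintegral_of_nonneg_ae (Filter.Eventually.of_forall fun ξ => by positivity)
    (by have := H.memLp.1.norm.pow 2; exact this)]
  refine ENNReal.toReal_le_of_le_ofReal (by positivity) ?_
  have h2 := ENNReal.rpow_le_rpow h1 (by norm_num : (0 : ℝ) ≤ 2)
  rw [← ENNReal.rpow_mul] at h2
  simp only [ENNReal.toReal_ofNat, one_div, isUnit_iff_ne_zero, ne_eq, OfNat.ofNat_ne_zero,
    not_false_eq_true, IsUnit.inv_mul_cancel, ENNReal.rpow_one] at h2
  rw [ENNReal.ofReal_rpow_of_nonneg H.nonneg (by norm_num)] at h2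
  refine le_trans (le_of_eq ?_) (h2.trans (le_of_eq ?_))
  · congr 1; ext ξ
    rw [← ofReal_norm, ENNReal.ofReal_rpow_of_nonneg (norm_nonneg _) (by norm_num)]
    norm_num
  · norm_num

/-- Cauchy-Schwarz against a power of the weight. -/
theorem SobBound.integral_le {m : ℕ} {h : R3 → ℂ} {B : ℝ} (H : SobBound m h B) {s : Set R3}
    {φ : R3 → ℝ} {P : ℝ} (hφm : AEStronglyMeasurable φ) (hφ0 : ∀ ξ, 0 ≤ φ ξ)
    (hφ : IntegrableOn (fun ξ => φ ξ ^ 2) s) (hP : ∫ ξ in s, φ ξ ^ 2 ≤ P) :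
    IntegrableOn (fun ξ => φ ξ * (wt ξ ^ m * ‖h ξ‖)) s ∧
      ∫ ξ in s, φ ξ * (wt ξ ^ m * ‖h ξ‖) ≤ Real.sqrt P * B := by
  have m1 : MemLp φ (ENNReal.ofReal 2) (volume.restrict s) := by
    rw [ENNReal.ofReal_ofNat]
    exact (memLp_two_iff_integrable_sq hφm.restrict).2 hφ
  have m2 : MemLp (fun ξ => wt ξ ^ m * ‖h ξ‖) (ENNReal.ofReal 2) (volume.restrict s) := by
    rw [ENNReal.ofReal_ofNat]
    refine (H.memLp.norm.restrict s).ae_eq (Filter.Eventually.of_forall fun ξ => ?_)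
    simp only [norm_mul, norm_pow, Complex.norm_real, Real.norm_of_nonneg (wt_pos ξ).le]
  have h0 : ∀ ξ, 0 ≤ wt ξ ^ m * ‖h ξ‖ := fun ξ => by have := wt_pos ξ; positivity
  refine ⟨?_, ?_⟩
  · rw [ENNReal.ofReal_ofNat] at m1 m2
    exact m1.integrable_mul m2
  · refine (integral_mul_le_Lp_mul_Lq_of_nonneg Real.HolderConjugate.two_two
      (Filter.Eventually.of_forall hφ0) (Filter.Eventually.of_forall h0) m1 m2).trans ?_
    have hs : ∫ ξ in s, (wt ξ ^ m * ‖h ξ‖) ^ 2 ≤ B ^ 2 := by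
      refine (setIntegral_le_integral ?_ (Filter.Eventually.of_forall fun ξ => by positivity)).trans
        H.integral_sq_le
      have := (memLp_two_iff_integrable_sq_norm H.memLp.1).1 H.memLp
      refine this.congr (Filter.Eventually.of_forall fun ξ => ?_)
      simp only [norm_mul, norm_pow, Complex.norm_real, Real.norm_of_nonneg (wt_pos ξ).le]
    simp only [Real.rpow_two]
    rw [← Real.sqrt_eq_rpow, ← Real.sqrt_eq_rpow]
    exact mul_le_mul (Real.sqrt_le_sqrt hP) ((Real.sqrt_le_sqrt hs).trans
      (Real.sqrt_sq H.nonneg).le) (Real.sqrt_nonneg _) (Real.sqrt_nonneg _)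

theorem SobBound.integrable_weight {m j : ℕ} (hj : j + 2 ≤ m) {h : R3 → ℂ} {B : ℝ}
    (H : SobBound m h B) :
    (Integrable fun ξ => (wt ξ : ℂ) ^ j * h ξ) ∧
      ∫ ξ, ‖(wt ξ : ℂ) ^ j * h ξ‖ ≤ Real.sqrt (sphereArea * Real.pi) * B := by
  have hc := contDiff_wt_inv.continuous
  have h4 := integrable_wt_inv_four
  have key := H.integral_le (s := univ) (φ := fun ξ => ((wt ξ)⁻¹) ^ 2) (P := sphereArea * Real.pi)
    (hc.pow 2).aestronglyMeasurable (fun ξ => by positivity)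
    (by simpa [← pow_mul] using h4.1) (by simpa [← pow_mul] using h4.2)
  rw [integrableOn_univ, setIntegral_univ] at key
  have hle : ∀ ξ, ‖(wt ξ : ℂ) ^ j * h ξ‖ ≤ ((wt ξ)⁻¹) ^ 2 * (wt ξ ^ m * ‖h ξ‖) := fun ξ => by
    have hw := wt_pos ξ
    rw [norm_mul, norm_pow, Complex.norm_real, Real.norm_of_nonneg hw.le, ← mul_assoc]
    gcongr
    rw [inv_pow, inv_mul_eq_div, le_div_iff₀ (by positivity), ← pow_add]
    exact pow_le_pow_right₀ (one_le_wt ξ) hj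
  have hi : Integrable fun ξ => (wt ξ : ℂ) ^ j * h ξ :=
    key.1.mono' (((Complex.continuous_ofReal.comp continuous_wt).pow j).aestronglyMeasurable.mul
      H.meas) (Filter.Eventually.of_forall hle)
  exact ⟨hi, (integral_mono hi.norm key.1 hle).trans key.2⟩

theorem SobBound.integrable {m : ℕ} (hm : 2 ≤ m) {h : R3 → ℂ} {B : ℝ} (H : SobBound m h B) :
    Integrable h := by
  simpa using (H.integrable_weight (j := 0) (by omega)).1

/-- Multipliers of order zero are bounded on `L^∞` up to a loss of a quarter of a derivative: for
every `N = μ⁴ ≥ 1`, the frequencies below `N` are controlled by the sup norm with the loss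
`N^{1/4}`, and those above `N` by the `H^m` norm. -/
theorem exists_norm_mulOp_le : ∃ C : ℝ, 0 ≤ C ∧ ∀ (m : ℕ), 2 ≤ m → ∀ (h : R3 → ℂ) (A B : ℝ),
    SobBound m h B → (∀ x, ‖𝓕⁻ h x‖ ≤ A) → ∀ μ : ℝ, 1 ≤ μ → ∀ x,
      ‖mulOp h x‖ ≤ C * (μ * A + μ ^ (6 - 4 * (m : ℝ)) * B) := by
  obtain ⟨C1, hC1, hχ⟩ := exists_cutoff
  obtain ⟨C2, hC2, hK⟩ := exists_kernel_bound
  have hs := Real.sqrt_nonneg sphereArea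
  refine ⟨C2 * C1 + Real.sqrt sphereArea, by positivity, fun m hm h A B H hA μ hμ x => ?_⟩
  have hμ0 : 0 < μ := one_pos.trans_le hμ
  have hA0 : 0 ≤ A := (norm_nonneg _).trans (hA 0)
  have hB0 := H.nonneg
  have hh := H.integrable hm
  obtain ⟨χ, hχn, hχ1, hχ0, hχb⟩ := hχ (μ ^ 4) (one_le_pow₀ hμ)
  have hp : 0 ≤ μ ^ (6 - 4 * (m : ℝ)) := by positivity
  refine ContinuousLinearMap.opNorm_le_bound _ (by positivity) fun a => ?_
  have hsplit : mulOp h x a = mulOp h x (a * χ) + mulOp h x (a * (1 - χ)) := by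
    rw [← map_add]; congr 1; ring
  have hlow : ‖mulOp h x (a * χ)‖ ≤ C2 * (‖a‖ * C1) * μ * A := by
    obtain ⟨G, hG, hGb⟩ := hK (a * χ) μ hμ (fun ξ hξ => by simp [hχ0 ξ hξ])
    rw [mulOp_apply hh]
    simp only [← hG]
    refine (norm_fourierInv_fourier_mul_le G hh hA x).trans (mul_le_mul_of_nonneg_right ?_ hA0)
    refine hGb.trans ?_
    gcongr
    exact (norm_mul_le a χ).trans (mul_le_mul_of_nonneg_left hχn (norm_nonneg _))
  have hhigh : ‖mulOp h x (a * (1 - χ))‖ ≤ ‖a‖ * (Real.sqrt sphereArea * μ ^ (6 - 4 * (m : ℝ)) * B) := by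
    rw [mulOp_apply hh]
    refine (norm_fourierInv_le x).trans ?_
    have hc := contDiff_wt_inv.continuous
    have ht := integral_wt_inv_tail hm (N := μ ^ 4) (by positivity)
    have key := H.integral_le (s := {ξ | μ ^ 4 ≤ ‖ξ‖}) (φ := fun ξ => ((wt ξ)⁻¹) ^ m)
      (P := sphereArea * (μ ^ 4) ^ (3 - 2 * (m : ℝ)))
      (hc.pow m).aestronglyMeasurable (fun ξ => by have := wt_pos ξ; positivity)
      (by simpa [← pow_mul, mul_comm] using ht.1) (by simpa [← pow_mul, mul_comm] using ht.2)
    have hS : MeasurableSet {ξ : R3 | μ ^ 4 ≤ ‖ξ‖} := measurableSet_le measurable_const measurable_norm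
    have e1 : ∀ ξ, ((wt ξ)⁻¹) ^ m * (wt ξ ^ m * ‖h ξ‖) = ‖h ξ‖ := fun ξ => by
      have := (wt_pos ξ).ne'
      rw [← mul_assoc, ← mul_pow, inv_mul_cancel₀ this, one_pow, one_mul]
    simp only [e1] at key
    have e2 : Real.sqrt (sphereArea * (μ ^ 4) ^ (3 - 2 * (m : ℝ))) =
        Real.sqrt sphereArea * μ ^ (6 - 4 * (m : ℝ)) := by
      rw [Real.sqrt_mul sphereArea_nonneg, ← Real.rpow_natCast μ 4, ← Real.rpow_mul hμ0.le,
        Real.sqrt_eq_rpow (μ ^ _), ← Real.rpow_mul hμ0.le]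
      congr 2
      push_cast; ring
    rw [e2] at key
    calc ∫ ξ, ‖(a * (1 - χ)) ξ * h ξ‖ ≤ ∫ ξ, {ξ | μ ^ 4 ≤ ‖ξ‖}.indicator (fun ξ => ‖a‖ * ‖h ξ‖) ξ := by
          refine integral_mono ((a * (1 - χ)).integrable_mul hh).norm
            ((integrable_indicator_iff hS).2 (key.1.const_mul _)) fun ξ => ?_
          by_cases hξ : μ ^ 4 ≤ ‖ξ‖
          · simp only [indicator, mem_ofPred_eq, hξ, if_true, Sym.mul_apply, norm_mul, Sym.sub_apply,
              Sym.one_apply]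
            have := mul_le_mul (a.norm_apply_le ξ) (hχb ξ) (norm_nonneg _) (norm_nonneg _)
            rw [mul_one] at this
            exact mul_le_mul_of_nonneg_right this (norm_nonneg _)
          · simp [hξ, hχ1 ξ (not_le.1 hξ)]
      _ = ‖a‖ * ∫ ξ in {ξ | μ ^ 4 ≤ ‖ξ‖}, ‖h ξ‖ := by
          rw [integral_indicator hS, integral_const_mul]
      _ ≤ _ := mul_le_mul_of_nonneg_left key.2 (norm_nonneg _)
  rw [hsplit]
  refine (norm_add_le _ _).trans ((add_le_add hlow hhigh).trans ?_)
  have h1 : 0 ≤ C2 * C1 * (μ ^ (6 - 4 * (m : ℝ)) * B) * ‖a‖ := by positivity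
  have h2 : 0 ≤ Real.sqrt sphereArea * (μ * A) * ‖a‖ := by positivity
  linarith

/-! ### Dependence of the multipliers on the point and on time -/

/-- Multiplication of Fourier data by `⟨k⟩^j`. -/
def wmul (j : ℕ) (h : R3 → ℂ) (ξ : R3) : ℂ := (wt ξ : ℂ) ^ j * h ξ

theorem wmul_zero (h : R3 → ℂ) : wmul 0 h = h := by ext ξ; simp [wmul]

theorem wmul_wmul (i j : ℕ) (h : R3 → ℂ) : wmul i (wmul j h) = wmul (i + j) h := by
  ext ξ; simp only [wmul]; ring

theorem norm_wmul (j : ℕ) (h : R3 → ℂ) (ξ : R3) : ‖wmul j h ξ‖ = wt ξ ^ j * ‖h ξ‖ := by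
  rw [wmul, norm_mul, norm_pow, Complex.norm_real, Real.norm_of_nonneg (wt_pos ξ).le]

theorem aestronglyMeasurable_wmul (j : ℕ) {h : R3 → ℂ} (hm : AEStronglyMeasurable h) :
    AEStronglyMeasurable (wmul j h) :=
  ((Complex.continuous_ofReal.comp continuous_wt).pow j).aestronglyMeasurable.mul hm

theorem integrable_wmul_of_le {i j : ℕ} (hij : i ≤ j) {h : R3 → ℂ} (hm : AEStronglyMeasurable h)
    (hj : Integrable (wmul j h)) : Integrable (wmul i h) :=
  hj.mono (aestronglyMeasurable_wmul i hm) (Filter.Eventually.of_forall fun ξ => by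
    rw [norm_wmul, norm_wmul]
    exact mul_le_mul_of_nonneg_right (pow_le_pow_right₀ (one_le_wt ξ) hij) (norm_nonneg _))

/-- The symbol of `⟨D⟩⁻¹ ∂_e`. -/
def dsym : R3 →L[ℝ] Sym := (ContinuousLinearMap.mul ℝ Sym (Sym.const Complex.I)).comp Sym.kdir

theorem dsym_apply (e : R3) : dsym e = Sym.const Complex.I * Sym.kdir e := rfl

theorem dsym_mul_wt (e ξ : R3) :
    dsym e ξ * wt ξ = Complex.I * ((inner ℝ (waveVec ξ) e : ℝ) : ℂ) := by
  have hw : (wt ξ : ℂ) ≠ 0 := by exact_mod_cast (wt_pos ξ).ne'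
  rw [dsym_apply, Sym.mul_apply, Sym.const_apply, Sym.kdir_apply]
  push_cast
  field_simp

/-- The derivative of `mulOp` in the point. -/
def gradOp (h : R3 → ℂ) (x : R3) : R3 →L[ℝ] Sym →L[ℝ] ℂ :=
  ((ContinuousLinearMap.compL ℝ Sym Sym ℂ (mulOp (wmul 1 h) x)).comp
    (ContinuousLinearMap.mul ℝ Sym)).comp dsym

theorem gradOp_apply (h : R3 → ℂ) (x e : R3) (a : Sym) :
    gradOp h x e a = mulOp (wmul 1 h) x (dsym e * a) := rfl

theorem norm_cexp_sub_one_le (θ : ℝ) : ‖Complex.exp (θ * Complex.I) - 1‖ ≤ |θ| := by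
  rw [mul_comm]; exact Real.norm_exp_I_mul_ofReal_sub_one_le

theorem norm_cexp_sub_one_sub_le (θ : ℝ) :
    ‖Complex.exp (θ * Complex.I) - 1 - θ * Complex.I‖ ≤ 2 * θ ^ 2 := by
  have hn : ‖(θ : ℂ) * Complex.I‖ = |θ| := by simp
  rcases le_or_gt |θ| 1 with h | h
  · refine (Complex.norm_exp_sub_one_sub_id_le (by rw [hn]; exact h)).trans ?_
    rw [hn, sq_abs]
    nlinarith [sq_nonneg θ]
  · refine (norm_sub_le _ _).trans ?_
    rw [hn, ← sq_abs]
    have := norm_cexp_sub_one_le θ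
    nlinarith

theorem chr_add (x y ξ : R3) : chr (x + y) ξ = chr x ξ * chr y ξ := by
  rw [chr, chr, chr, ← Complex.exp_add, inner_add_right]
  congr 1; push_cast; ring

theorem chr_eq (y ξ : R3) :
    chr y ξ = Complex.exp (((inner ℝ (waveVec ξ) y : ℝ) : ℂ) * Complex.I) := by
  rw [chr, waveVec, inner_smul_left]; simp

theorem abs_inner_waveVec_le (ξ y : R3) : |inner ℝ (waveVec ξ) y| ≤ wt ξ * ‖y‖ :=
  (abs_real_inner_le_norm _ _).trans
    (mul_le_mul_of_nonneg_right (norm_le_bracket _) (norm_nonneg _))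

theorem mulOp_eq_integral {h : R3 → ℂ} (hh : Integrable h) (x : R3) (a : Sym) :
    mulOp h x a = ∫ ξ, chr x ξ * (a ξ * h ξ) := by
  rw [mulOp_apply hh, fourierInv_eq_chr]

theorem norm_mulOp_add_sub_le {h : R3 → ℂ} (hm : AEStronglyMeasurable h)
    (h1 : Integrable (wmul 1 h)) (x y : R3) :
    ‖mulOp h (x + y) - mulOp h x‖ ≤ (∫ ξ, ‖wmul 1 h ξ‖) * ‖y‖ := by
  have h0 : Integrable h := by
    simpa [wmul_zero] using integrable_wmul_of_le (Nat.zero_le 1) hm h1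
  refine ContinuousLinearMap.opNorm_le_bound _ (by positivity) fun a => ?_
  rw [sub_apply, mulOp_eq_integral h0, mulOp_eq_integral h0,
    ← integral_sub (integrable_chr_mul _ (a.integrable_mul h0))
      (integrable_chr_mul _ (a.integrable_mul h0))]
  have e : (∫ ξ, ‖wmul 1 h ξ‖) * ‖y‖ * ‖a‖ = ∫ ξ, ‖wmul 1 h ξ‖ * (‖y‖ * ‖a‖) := by
    rw [integral_mul_const]; ring
  rw [e]
  refine norm_integral_le_of_norm_le (h1.norm.mul_const _) (Filter.Eventually.of_forall fun ξ => ?_)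
  rw [chr_add, ← sub_mul]
  have e2 : chr x ξ * chr y ξ - chr x ξ = chr x ξ * (chr y ξ - 1) := by ring
  rw [e2, norm_mul, norm_mul, norm_mul, norm_chr, one_mul, norm_wmul, pow_one, chr_eq]
  calc _ ≤ (wt ξ * ‖y‖) * (‖a‖ * ‖h ξ‖) := by
        gcongr
        · have := wt_pos ξ; positivity
        · exact (norm_cexp_sub_one_le _).trans (abs_inner_waveVec_le ξ y)
        · exact a.norm_apply_le ξ
    _ = _ := by ring

theorem norm_mulOp_taylor_le {h : R3 → ℂ} (hm : AEStronglyMeasurable h)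
    (h2 : Integrable (wmul 2 h)) (x y : R3) :
    ‖mulOp h (x + y) - mulOp h x - gradOp h x y‖ ≤ 2 * (∫ ξ, ‖wmul 2 h ξ‖) * ‖y‖ ^ 2 := by
  have h0 : Integrable h := by
    simpa [wmul_zero] using integrable_wmul_of_le (Nat.zero_le 2) hm h2
  have h1 : Integrable (wmul 1 h) := integrable_wmul_of_le (Nat.le_succ 1) hm h2
  refine ContinuousLinearMap.opNorm_le_bound _ (by positivity) fun a => ?_
  have i1 : Integrable (fun ξ => chr (x + y) ξ * (a ξ * h ξ) - chr x ξ * (a ξ * h ξ)) :=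
    (integrable_chr_mul _ (a.integrable_mul h0)).sub (integrable_chr_mul _ (a.integrable_mul h0))
  rw [sub_apply, sub_apply, gradOp_apply, mulOp_eq_integral h0, mulOp_eq_integral h0,
    mulOp_eq_integral h1,
    ← integral_sub (integrable_chr_mul _ (a.integrable_mul h0))
      (integrable_chr_mul _ (a.integrable_mul h0)), ← integral_sub i1
      (integrable_chr_mul _ (Sym.integrable_mul _ h1))]
  have e : 2 * (∫ ξ, ‖wmul 2 h ξ‖) * ‖y‖ ^ 2 * ‖a‖ =
      ∫ ξ, ‖wmul 2 h ξ‖ * (2 * ‖y‖ ^ 2 * ‖a‖) := by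
    rw [integral_mul_const]; ring
  rw [e]
  refine norm_integral_le_of_norm_le (h2.norm.mul_const _) (Filter.Eventually.of_forall fun ξ => ?_)
  have e2 : chr (x + y) ξ * (a ξ * h ξ) - chr x ξ * (a ξ * h ξ) -
      chr x ξ * ((dsym y * a) ξ * wmul 1 h ξ) = chr x ξ * ((chr y ξ - 1 -
        (dsym y ξ * wt ξ)) * (a ξ * h ξ)) := by
    rw [chr_add, wmul, Sym.mul_apply]; ring
  rw [e2, dsym_mul_wt, norm_mul, norm_mul, norm_mul, norm_chr, one_mul, norm_wmul, chr_eq]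
  have h3 := norm_cexp_sub_one_sub_le (inner ℝ (waveVec ξ) y)
  rw [mul_comm _ Complex.I] at h3 ⊢
  have h4 : (inner ℝ (waveVec ξ) y) ^ 2 ≤ (wt ξ * ‖y‖) ^ 2 := by
    rw [← sq_abs]
    exact pow_le_pow_left₀ (abs_nonneg _) (abs_inner_waveVec_le ξ y) 2
  calc _ ≤ 2 * (wt ξ * ‖y‖) ^ 2 * (‖a‖ * ‖h ξ‖) := by
        gcongr
        · linarith
        · exact a.norm_apply_le ξ
    _ = _ := by ring

/-- A function with a quadratic Taylor remainder is differentiable. -/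
theorem hasFDerivAt_of_taylor {E F : Type*} [NormedAddCommGroup E] [NormedSpace ℝ E]
    [NormedAddCommGroup F] [NormedSpace ℝ F] {f : E → F} {L : E →L[ℝ] F} {x : E} {C : ℝ}
    (h : ∀ y, ‖f (x + y) - f x - L y‖ ≤ C * ‖y‖ ^ 2) : HasFDerivAt f L x := by
  rw [hasFDerivAt_iff_isLittleO_nhds_zero]
  refine Asymptotics.IsBigO.trans_isLittleO (g := fun y : E => ‖y‖ ^ 2)
    (Asymptotics.IsBigO.of_bound C (Filter.Eventually.of_forall fun y => ?_)) ?_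
  · rw [Real.norm_of_nonneg (by positivity)]
    exact h y
  · simpa using (Asymptotics.isLittleO_norm_pow_id (E' := E) one_lt_two)

theorem hasFDerivAt_mulOp {h : R3 → ℂ} (hm : AEStronglyMeasurable h)
    (h2 : Integrable (wmul 2 h)) (x : R3) : HasFDerivAt (mulOp h) (gradOp h x) x :=
  hasFDerivAt_of_taylor (norm_mulOp_taylor_le hm h2 x)

/-- Frequencies above `N` contribute little to data with one more integrable moment. -/
theorem norm_mulOp_high_le {h : R3 → ℂ} (hm : AEStronglyMeasurable h)
    (h1 : Integrable (wmul 1 h)) {N : ℝ} (hN : 1 ≤ N) {b : Sym} (hb : ∀ ξ, ‖ξ‖ < N → b ξ = 0)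
    {K : ℝ} (hK : ∀ ξ, ‖b ξ‖ ≤ K) (x : R3) :
    ‖mulOp h x b‖ ≤ K * N⁻¹ * ∫ ξ, ‖wmul 1 h ξ‖ := by
  have hN0 : 0 < N := one_pos.trans_le hN
  have h0 : Integrable h := by
    simpa [wmul_zero] using integrable_wmul_of_le (Nat.zero_le 1) hm h1
  have hK0 : 0 ≤ K := (norm_nonneg _).trans (hK 0)
  rw [mulOp_apply h0]
  refine (norm_fourierInv_le x).trans ?_
  rw [← integral_const_mul]
  refine integral_mono (b.integrable_mul h0).norm (h1.norm.const_mul _) fun ξ => ?_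
  simp only
  rw [norm_mul, norm_wmul, pow_one]
  by_cases hξ : ‖ξ‖ < N
  · rw [hb ξ hξ]
    have := wt_pos ξ
    simp only [norm_zero, zero_mul]
    positivity
  · have hw : N ≤ wt ξ := by
      have := sq_le_wt_sq ξ
      exact (not_lt.1 hξ).trans (le_of_sq_le_sq (by linarith) (wt_pos ξ).le)
    have : 1 ≤ N⁻¹ * wt ξ := by rw [inv_mul_eq_div, le_div_iff₀ hN0]; linarith
    calc ‖b ξ‖ * ‖h ξ‖ ≤ K * ‖h ξ‖ * 1 := by
          rw [mul_one]; exact mul_le_mul_of_nonneg_right (hK ξ) (norm_nonneg _)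
      _ ≤ K * ‖h ξ‖ * (N⁻¹ * wt ξ) := by gcongr
      _ = _ := by ring

open Filter Topology in
/-- If `f τ` is jointly continuous and bounded and `f̂ τ` has uniformly bounded moments, then
multipliers of `f τ` are jointly continuous. No continuity of `f̂ τ` in `τ` is available: the low
frequencies are handled through the kernel of the multiplier. -/
theorem continuousOn_mulOp_fourier {f : ℝ → R3 → ℂ} {s : Set ℝ} {A B : ℝ} {j : ℕ}
    (hf : ContinuousOn (fun z : ℝ × R3 => f z.1 z.2) (s ×ˢ univ))
    (hfi : ∀ τ ∈ s, Integrable (f τ)) (hA : ∀ τ ∈ s, ∀ x, ‖f τ x‖ ≤ A)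
    (hint : ∀ τ ∈ s, Integrable (wmul (j + 1) (𝓕 (f τ))))
    (hB : ∀ τ ∈ s, ∫ ξ, ‖wmul (j + 1) (𝓕 (f τ)) ξ‖ ≤ B) (a : Sym) :
    ContinuousOn (fun z : ℝ × R3 => mulOp (wmul j (𝓕 (f z.1))) z.2 a) (s ×ˢ univ) := by
  obtain ⟨C, -, hχ⟩ := exists_cutoff
  choose! χ hχn hχ1 hχ0 hχb using hχ
  have hmeas : ∀ τ ∈ s, AEStronglyMeasurable (𝓕 (f τ)) := fun τ hτ =>
    (VectorFourier.fourierIntegral_continuous Real.continuous_fourierChar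
      (by exact continuous_inner) (hfi τ hτ)).aestronglyMeasurable
  have hfc : ∀ τ ∈ s, Continuous (f τ) := fun τ hτ =>
    continuousOn_univ.1 (hf.comp (f := fun x : R3 => (τ, x)) (by fun_prop) fun x _ => ⟨hτ, mem_univ _⟩)
  have hj : ∀ τ ∈ s, Integrable (wmul j (𝓕 (f τ))) := fun τ hτ =>
    integrable_wmul_of_le (Nat.le_succ j) (hmeas τ hτ) (hint τ hτ)
  have h0 : ∀ τ ∈ s, Integrable (𝓕 (f τ)) := fun τ hτ => by
    simpa [wmul_zero] using integrable_wmul_of_le (Nat.zero_le _) (hmeas τ hτ) (hint τ hτ)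
  have hunif : TendstoUniformlyOn (fun (n : ℕ) (z : ℝ × R3) =>
      mulOp (wmul j (𝓕 (f z.1))) z.2 (a * χ (n + 1)))
      (fun z => mulOp (wmul j (𝓕 (f z.1))) z.2 a) atTop (s ×ˢ univ) := by
    have hlim : Tendsto (fun n : ℕ => ‖a‖ * ((n : ℝ) + 1)⁻¹ * B) atTop (𝓝 0) := by
      have := (tendsto_one_div_add_atTop_nhds_zero_nat (𝕜 := ℝ)).const_mul ‖a‖ |>.mul_const B
      simpa using this
    rw [Metric.tendstoUniformlyOn_iff]
    intro ε hε
    filter_upwards [hlim.eventually (gt_mem_nhds hε)] with n hn z hz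
    have hn1 : (1 : ℝ) ≤ n + 1 := by simp
    refine lt_of_le_of_lt ?_ hn
    rw [dist_eq_norm, ← map_sub]
    have := norm_mulOp_high_le (aestronglyMeasurable_wmul j (hmeas z.1 hz.1))
      (by rw [wmul_wmul, add_comm]; exact hint z.1 hz.1) hn1 (b := a - a * χ (n + 1))
      (fun ξ hξ => by simp [hχ1 _ hn1 ξ hξ]) (K := ‖a‖) (fun ξ => by
        have e : (a - a * χ (n + 1)) ξ = a ξ * (1 - χ (n + 1) ξ) := by
          simp only [Sym.sub_apply, Sym.mul_apply]; ring
        rw [e, norm_mul]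
        have := mul_le_mul (a.norm_apply_le ξ) (hχb _ hn1 ξ) (norm_nonneg _) (norm_nonneg _)
        rwa [mul_one] at this) z.2
    refine this.trans ?_
    rw [wmul_wmul, add_comm 1 j]
    exact mul_le_mul_of_nonneg_left (hB z.1 hz.1) (by positivity)
  refine hunif.continuousOn (Frequently.of_forall fun n => ?_)
  have hn1 : (1 : ℝ) ≤ n + 1 := by simp
  -- the cut off symbol is the Fourier transform of a Schwartz function
  have hcs : HasCompactSupport (fun ξ => (a * χ (n + 1)) ξ * (wt ξ : ℂ) ^ j) :=
    HasCompactSupport.of_support_subset_isCompact (isCompact_closedBall (0 : R3) (2 * (n + 1)))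
      fun ξ hξ => by
        rw [mem_closedBall_zero_iff]
        by_contra h
        exact hξ (by simp [hχ0 _ hn1 ξ (not_le.1 h)])
  have hcd : ContDiff ℝ ∞ (fun ξ => (a * χ (n + 1)) ξ * (wt ξ : ℂ) ^ j) :=
    (Sym.contDiff _).mul ((Complex.ofRealCLM.contDiff.comp contDiff_wt).pow j)
  let G : SchwartzMap R3 ℂ := 𝓕⁻ (hcs.toSchwartzMap hcd)
  have hG : ∀ ξ, 𝓕 (G : R3 → ℂ) ξ = (a * χ (n + 1)) ξ * (wt ξ : ℂ) ^ j := fun ξ => by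
    have h1 : 𝓕 G = hcs.toSchwartzMap hcd := FourierTransform.fourier_fourierInv_eq _
    have h2 : (𝓕 G : SchwartzMap R3 ℂ) ξ = (a * χ (n + 1)) ξ * (wt ξ : ℂ) ^ j := by rw [h1]; rfl
    rw [← h2, SchwartzMap.fourier_coe]
  have hrep : ∀ z ∈ s ×ˢ (univ : Set R3), mulOp (wmul j (𝓕 (f z.1))) z.2 (a * χ (n + 1)) =
      ∫ y, G y * f z.1 (z.2 - y) := fun z hz => by
    rw [mulOp_apply (hj z.1 hz.1)]
    have e : (fun ξ => (a * χ (n + 1)) ξ * wmul j (𝓕 (f z.1)) ξ) =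
        fun ξ => 𝓕 (G : R3 → ℂ) ξ * 𝓕 (f z.1) ξ := by
      ext ξ; rw [hG, wmul]; ring
    rw [e, fourierInv_fourier_mul G (h0 z.1 hz.1),
      (hfc z.1 hz.1).fourierInv_fourier_eq (hfi z.1 hz.1) (h0 z.1 hz.1)]
  refine ContinuousOn.congr ?_ hrep
  intro z hz
  have hA0 : 0 ≤ A := (norm_nonneg _).trans (hA z.1 hz.1 0)
  refine tendsto_integral_filter_of_dominated_convergence (fun y => ‖G y‖ * A) ?_ ?_
    (G.integrable.norm.mul_const A) ?_
  · filter_upwards [self_mem_nhdsWithin] with w hw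
    have := hfc w.1 hw.1
    exact (G.continuous.mul (by fun_prop)).aestronglyMeasurable
  · filter_upwards [self_mem_nhdsWithin] with w hw
    refine Eventually.of_forall fun y => ?_
    rw [norm_mul]
    exact mul_le_mul_of_nonneg_left (hA w.1 hw.1 _) (norm_nonneg _)
  · refine Eventually.of_forall fun y => ?_
    have h1 : ContinuousOn (fun w : ℝ × R3 => f w.1 (w.2 - y)) (s ×ˢ univ) :=
      hf.comp (f := fun w : ℝ × R3 => (w.1, w.2 - y)) (by fun_prop) fun w hw => ⟨hw.1, mem_univ _⟩
    exact (h1 z hz).const_mul (G y)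

/-! ### Duhamel's formula for bounded measurable sources -/

theorem intervalIntegrable_of_norm_le {φ : ℝ → ℂ} {M : ℝ} (hφ : StronglyMeasurable φ)
    (hM : ∀ s, ‖φ s‖ ≤ M) (a b : ℝ) : IntervalIntegrable φ volume a b :=
  (intervalIntegrable_const (c := M)).mono_fun hφ.aestronglyMeasurable
    (Filter.Eventually.of_forall fun s => (hM s).trans (le_abs_self M))

theorem lipschitzWith_primitive {φ : ℝ → ℂ} {M : ℝ} (hφ : StronglyMeasurable φ)
    (hM : ∀ s, ‖φ s‖ ≤ M) : LipschitzWith M.toNNReal fun t => ∫ s in (0 : ℝ)..t, φ s := by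
  have hM0 : 0 ≤ M := (norm_nonneg _).trans (hM 0)
  refine LipschitzWith.of_dist_le_mul fun t s => ?_
  rw [dist_eq_norm, intervalIntegral.integral_interval_sub_left
    (intervalIntegrable_of_norm_le hφ hM _ _) (intervalIntegrable_of_norm_le hφ hM _ _),
    Real.coe_toNNReal _ hM0, Real.dist_eq]
  exact intervalIntegral.norm_integral_le_of_norm_le_const fun x _ => hM x

theorem ae_hasDerivAt_primitive {φ : ℝ → ℂ} {M : ℝ} (hφ : StronglyMeasurable φ)
    (hM : ∀ s, ‖φ s‖ ≤ M) :
    ∀ᵐ t, HasDerivAt (fun t => ∫ s in (0 : ℝ)..t, φ s) (φ t) t := by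
  have h : LocallyIntegrable φ volume :=
    (locallyIntegrable_const M).mono hφ.aestronglyMeasurable
      (Filter.Eventually.of_forall fun s => (hM s).trans (le_abs_self M))
  filter_upwards [LocallyIntegrable.ae_hasDerivAt_integral h] with t ht using ht 0

/-- The solution `e^{iwt} A + ∫_0^t e^{iw(t-s)} G(s) ds` of `y' = iwy + G`, where `G` is only
bounded and measurable, satisfies the equation in integrated form. -/
theorem duhamel_sub_eq {w : ℝ} {A : ℂ} {G y : ℝ → ℂ} {M : ℝ} (hG : StronglyMeasurable G)
    (hM : ∀ s, ‖G s‖ ≤ M)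
    (hy : ∀ t, y t = Complex.exp (t * (w * Complex.I)) *
      (A + ∫ s in (0 : ℝ)..t, Complex.exp (-(s * (w * Complex.I))) * G s)) (a b : ℝ) :
    y b - y a = ∫ τ in a..b, (w * Complex.I * y τ + G τ) := by
  have hexp : ∀ s : ℝ, ‖Complex.exp (-(s * (w * Complex.I)))‖ = 1 := fun s => by
    have : (-(s * (w * Complex.I)) : ℂ) = ((-(s * w) : ℝ) : ℂ) * Complex.I := by push_cast; ring
    rw [this, Complex.norm_exp_ofReal_mul_I]
  have hφ : StronglyMeasurable fun s : ℝ => Complex.exp (-(s * (w * Complex.I))) * G s :=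
    (Continuous.stronglyMeasurable (by fun_prop)).mul hG
  have hφM : ∀ s : ℝ, ‖Complex.exp (-(s * (w * Complex.I))) * G s‖ ≤ M := fun s => by
    rw [norm_mul, hexp, one_mul]; exact hM s
  set Φ : ℝ → ℂ := fun t => ∫ s in (0 : ℝ)..t, Complex.exp (-(s * (w * Complex.I))) * G s with hΦ
  have hΦl := lipschitzWith_primitive hφ hφM
  have hyc : Continuous y := by
    rw [funext hy]
    exact Continuous.mul (by fun_prop) (continuous_const.add hΦl.continuous)
  let Y : ℝ → ℂ := fun t => ∫ s in (0 : ℝ)..t, w * Complex.I * y s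
  let Ψ : ℝ → ℂ := fun t => ∫ s in (0 : ℝ)..t, G s
  have hyi : ∀ c d, IntervalIntegrable (fun s => w * Complex.I * y s) volume c d := fun c d =>
    Continuous.intervalIntegrable (by fun_prop) c d
  have hY : ∀ t, HasDerivAt Y (w * Complex.I * y t) t := fun t =>
    intervalIntegral.integral_hasDerivAt_right (hyi _ _)
      (Continuous.stronglyMeasurableAtFilter (by fun_prop) _ _) (by fun_prop)
  have hac : AbsolutelyContinuousOnInterval (fun t => y t - (Y t + Ψ t)) a b := by
    have h1 : AbsolutelyContinuousOnInterval y a b := by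
      rw [funext hy]
      have e1 : AbsolutelyContinuousOnInterval (fun t : ℝ => Complex.exp (t * (w * Complex.I)))
          a b := by
        have : ContDiff ℝ 1 fun t : ℝ => Complex.exp (t * (w * Complex.I)) :=
          (Complex.ofRealCLM.contDiff.mul contDiff_const).cexp
        exact this.contDiffOn.absolutelyContinuousOnInterval
      have e2 : AbsolutelyContinuousOnInterval (fun t : ℝ => A + Φ t) a b :=
        LipschitzOnWith.absolutelyContinuousOnInterval (K := M.toNNReal)
          ((LipschitzWith.of_dist_le_mul fun t s => by
            simpa using hΦl.dist_le_mul t s).lipschitzOnWith)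
      exact e1.smul e2
    have h2 : AbsolutelyContinuousOnInterval Y a b := by
      have : ContDiff ℝ 1 Y := by
        rw [contDiff_one_iff_deriv]
        refine ⟨fun t => (hY t).differentiableAt, ?_⟩
        rw [funext fun t => (hY t).deriv]
        fun_prop
      exact this.contDiffOn.absolutelyContinuousOnInterval
    have h3 : AbsolutelyContinuousOnInterval Ψ a b :=
      (lipschitzWith_primitive hG hM).lipschitzOnWith.absolutelyContinuousOnInterval
    exact h1.sub (h2.add h3)
  have hconst := hac.const_of_ae_hasDerivAt_zero (by
    filter_upwards [ae_hasDerivAt_primitive hφ hφM,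
      ae_hasDerivAt_primitive hG hM] with t h1 h2 _
    have e1 : HasDerivAt y (w * Complex.I * y t + G t) t := by
      have e0 : HasDerivAt (fun t : ℝ => Complex.exp (t * (w * Complex.I)))
          (Complex.exp (t * (w * Complex.I)) * (1 * (w * Complex.I))) t :=
        ((Complex.ofRealCLM.hasDerivAt (x := t)).mul_const _).cexp
      have := e0.mul (h1.const_add A)
      rw [funext hy]
      refine this.congr_deriv ?_
      simp only
      have : Complex.exp (t * (w * Complex.I)) * Complex.exp (-(t * (w * Complex.I))) = 1 := by
        rw [← Complex.exp_add]; simp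
      linear_combination G t * this
    exact (e1.sub ((hY t).add h2)).congr_deriv (sub_self _))
  obtain ⟨C, hC⟩ := hconst
  have ha := hC a left_mem_uIcc
  have hb := hC b right_mem_uIcc
  have e1 := intervalIntegral.integral_interval_sub_left (hyi 0 b) (hyi 0 a)
  have e2 := intervalIntegral.integral_interval_sub_left
    (intervalIntegrable_of_norm_le hG hM 0 b) (intervalIntegrable_of_norm_le hG hM 0 a)
  rw [intervalIntegral.integral_add (hyi a b) (intervalIntegrable_of_norm_le hG hM a b), ← e1, ← e2]
  simp only [Y, Ψ] at ha hb
  linear_combination hb - ha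

/-! ### Evolution of the multipliers in time -/

/-- `h τ` solves `∂_τ h = iσ⟨k⟩ h + c f̂` in integrated form, with two integrable moments on the
time interval `[0,t₁]`. The source `f` is continuous in space-time, but its Fourier transform is
only measurable in time. -/
structure Evolves (σ : ℤˣ) (c : Sym) (f h : ℝ → R3 → ℂ) (t₁ A B : ℝ) : Prop where
  duhamel : ∀ s t : ℝ, ∀ ξ, h t ξ - h s ξ =
    ∫ τ in s..t, ((wt ξ * ((σ : ℤ) : ℝ) : ℝ) * Complex.I * h τ ξ + c ξ * 𝓕 (f τ) ξ)
  meas_h : StronglyMeasurable fun z : ℝ × R3 => h z.1 z.2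
  meas_f : StronglyMeasurable fun z : ℝ × R3 => 𝓕 (f z.1) z.2
  int_h : ∀ τ ∈ Icc 0 t₁, Integrable (wmul 2 (h τ)) ∧ ∫ ξ, ‖wmul 2 (h τ) ξ‖ ≤ B
  int_f : ∀ τ ∈ Icc 0 t₁, Integrable (wmul 2 (𝓕 (f τ))) ∧ ∫ ξ, ‖wmul 2 (𝓕 (f τ)) ξ‖ ≤ B
  cont_f : ContinuousOn (fun z : ℝ × R3 => f z.1 z.2) (Icc 0 t₁ ×ˢ univ)
  integrable_f : ∀ τ ∈ Icc 0 t₁, Integrable (f τ)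
  bound_f : ∀ τ ∈ Icc 0 t₁, ∀ x, ‖f τ x‖ ≤ A

/-- The symbol of `⟨D⟩⁻¹` times the generator `iσ⟨D⟩`. -/
def rot (σ : ℤˣ) : Sym := Sym.const (((σ : ℤ) : ℂ) * Complex.I)

theorem integral_wmul_le {i j : ℕ} (hij : i ≤ j) {h : R3 → ℂ} (hm : AEStronglyMeasurable h)
    (hj : Integrable (wmul j h)) : ∫ ξ, ‖wmul i h ξ‖ ≤ ∫ ξ, ‖wmul j h ξ‖ :=
  integral_mono (integrable_wmul_of_le hij hm hj).norm hj.norm fun ξ => by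
    simp only [norm_wmul]
    exact mul_le_mul_of_nonneg_right (pow_le_pow_right₀ (one_le_wt ξ) hij) (norm_nonneg _)

namespace Evolves

variable {σ : ℤˣ} {c : Sym} {f h : ℝ → R3 → ℂ} {t₁ A B : ℝ}

theorem meas_h_right (H : Evolves σ c f h t₁ A B) (τ : ℝ) : AEStronglyMeasurable (h τ) :=
  (H.meas_h.comp_measurable (measurable_prodMk_left (x := τ))).aestronglyMeasurable

theorem meas_f_right (H : Evolves σ c f h t₁ A B) (τ : ℝ) : AEStronglyMeasurable (𝓕 (f τ)) :=
  (H.meas_f.comp_measurable (measurable_prodMk_left (x := τ))).aestronglyMeasurable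

theorem moment_h (H : Evolves σ c f h t₁ A B) {τ : ℝ} (hτ : τ ∈ Icc 0 t₁) {j : ℕ} (hj : j ≤ 2) :
    Integrable (wmul j (h τ)) ∧ ∫ ξ, ‖wmul j (h τ) ξ‖ ≤ B :=
  ⟨integrable_wmul_of_le hj (H.meas_h_right τ) (H.int_h τ hτ).1,
    (integral_wmul_le hj (H.meas_h_right τ) (H.int_h τ hτ).1).trans (H.int_h τ hτ).2⟩

theorem moment_f (H : Evolves σ c f h t₁ A B) {τ : ℝ} (hτ : τ ∈ Icc 0 t₁) {j : ℕ} (hj : j ≤ 2) :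
    Integrable (wmul j (𝓕 (f τ))) ∧ ∫ ξ, ‖wmul j (𝓕 (f τ)) ξ‖ ≤ B :=
  ⟨integrable_wmul_of_le hj (H.meas_f_right τ) (H.int_f τ hτ).1,
    (integral_wmul_le hj (H.meas_f_right τ) (H.int_f τ hτ).1).trans (H.int_f τ hτ).2⟩

theorem mulOp_sub_eq (H : Evolves σ c f h t₁ A B) {j : ℕ} (hj : j ≤ 1) {s t : ℝ}
    (hs : s ∈ Icc 0 t₁) (ht : t ∈ Icc 0 t₁) (x : R3) (a : Sym) :
    mulOp (wmul j (h t)) x a - mulOp (wmul j (h s)) x a =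
      ∫ τ in s..t, (mulOp (wmul (j + 1) (h τ)) x (rot σ * a) +
        mulOp (wmul j (𝓕 (f τ))) x (c * a)) := by
  have hsub : uIoc s t ⊆ Icc 0 t₁ := uIoc_subset_uIcc.trans (ordConnected_Icc.uIcc_subset hs ht)
  have : IsFiniteMeasure (volume.restrict (uIoc s t)) := by rw [uIoc]; infer_instance
  let F : ℝ → R3 → ℂ := fun τ ξ => chr x ξ * ((rot σ * a) ξ * wmul (j + 1) (h τ) ξ) +
    chr x ξ * ((c * a) ξ * wmul j (𝓕 (f τ)) ξ)
  have hFi : ∀ τ ∈ Icc 0 t₁, Integrable (F τ) := fun τ hτ =>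
    (integrable_chr_mul x (Sym.integrable_mul _ (H.moment_h hτ (by omega)).1)).add
      (integrable_chr_mul x (Sym.integrable_mul _ (H.moment_f hτ (by omega)).1))
  have hFm : StronglyMeasurable (Function.uncurry F) := by
    have m1 : ∀ (i : ℕ) (b : Sym), StronglyMeasurable fun z : ℝ × R3 =>
        chr x z.2 * (b z.2 * (wt z.2 : ℂ) ^ i) := fun i b => by
      have := continuous_chr.comp ((continuous_const (y := x)).prodMk (continuous_snd (X := ℝ)))
      have h2 := b.continuous.comp (continuous_snd (X := ℝ))
      have h3 := (Complex.continuous_ofReal.comp continuous_wt).comp (continuous_snd (X := ℝ))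
      exact (this.mul (h2.mul (h3.pow i))).stronglyMeasurable
    convert ((m1 (j + 1) (rot σ * a)).mul H.meas_h).add ((m1 j (c * a)).mul H.meas_f) using 1
    ext z
    simp only [Function.uncurry, F, wmul, Pi.add_apply, Pi.mul_apply]
    ring
  have hFprod : Integrable (Function.uncurry F) ((volume.restrict (uIoc s t)).prod volume) := by
    rw [integrable_prod_iff hFm.aestronglyMeasurable]
    refine ⟨(ae_restrict_iff' measurableSet_uIoc).2 (Filter.Eventually.of_forall fun τ hτ =>
      hFi τ (hsub hτ)), ?_⟩
    refine Integrable.of_bound (C := ‖rot σ * a‖ * B + ‖c * a‖ * B)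
      hFm.norm.integral_prod_right'.aestronglyMeasurable
      ((ae_restrict_iff' measurableSet_uIoc).2 (Filter.Eventually.of_forall fun τ hτ => ?_))
    have hτ' := hsub hτ
    rw [Real.norm_of_nonneg (by positivity)]
    have b1 := (H.moment_h hτ' (j := j + 1) (by omega))
    have b2 := (H.moment_f hτ' (j := j) (by omega))
    calc ∫ ξ, ‖F τ ξ‖ ≤ ∫ ξ, (‖rot σ * a‖ * ‖wmul (j + 1) (h τ) ξ‖ +
          ‖c * a‖ * ‖wmul j (𝓕 (f τ)) ξ‖) := by
          refine integral_mono (hFi τ hτ').norm ((b1.1.norm.const_mul _).add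
            (b2.1.norm.const_mul _)) fun ξ => ?_
          refine (norm_add_le _ _).trans ?_
          rw [norm_mul, norm_mul, norm_mul, norm_mul, norm_chr, one_mul, one_mul]
          gcongr
          · exact Sym.norm_apply_le _ ξ
          · exact Sym.norm_apply_le _ ξ
      _ = ‖rot σ * a‖ * (∫ ξ, ‖wmul (j + 1) (h τ) ξ‖) + ‖c * a‖ * ∫ ξ, ‖wmul j (𝓕 (f τ)) ξ‖ := by
          rw [integral_add (b1.1.norm.const_mul _) (b2.1.norm.const_mul _),
            integral_const_mul, integral_const_mul]
      _ ≤ _ := by gcongr; exacts [b1.2, b2.2]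
  have hrhs : ∀ τ ∈ uIoc s t, mulOp (wmul (j + 1) (h τ)) x (rot σ * a) +
      mulOp (wmul j (𝓕 (f τ))) x (c * a) = ∫ ξ, F τ ξ := fun τ hτ => by
    have b1 := (H.moment_h (hsub hτ) (j := j + 1) (by omega)).1
    have b2 := (H.moment_f (hsub hτ) (j := j) (by omega)).1
    rw [mulOp_eq_integral b1, mulOp_eq_integral b2, ← integral_add
      (integrable_chr_mul x (Sym.integrable_mul _ b1))
      (integrable_chr_mul x (Sym.integrable_mul _ b2))]
  have e1 : ∫ τ in s..t, (mulOp (wmul (j + 1) (h τ)) x (rot σ * a) +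
      mulOp (wmul j (𝓕 (f τ))) x (c * a)) = ∫ τ in s..t, ∫ ξ, F τ ξ := by
    refine intervalIntegral.integral_congr_ae (Filter.Eventually.of_forall fun τ hτ => hrhs τ hτ)
  rw [e1, intervalIntegral_integral_swap hFprod,
    mulOp_eq_integral (H.moment_h ht (by omega)).1, mulOp_eq_integral (H.moment_h hs (by omega)).1,
    ← integral_sub (integrable_chr_mul x (Sym.integrable_mul _ (H.moment_h ht (by omega)).1))
      (integrable_chr_mul x (Sym.integrable_mul _ (H.moment_h hs (by omega)).1))]
  congr 1
  ext ξ
  have e2 : ∀ τ, F τ ξ = chr x ξ * (a ξ * (wt ξ : ℂ) ^ j) *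
      ((wt ξ * ((σ : ℤ) : ℝ) : ℝ) * Complex.I * h τ ξ + c ξ * 𝓕 (f τ) ξ) := fun τ => by
    simp only [F, rot, wmul, Sym.mul_apply, Sym.const_apply]
    push_cast
    ring
  rw [funext e2, intervalIntegral.integral_const_mul, ← H.duhamel]
  simp only [wmul]
  ring

end Evolves

/-- The derivative of an application `L τ (a τ)` for `L` continuous in operator norm and
differentiable pointwise. -/
theorem hasDerivWithinAt_clm_apply_of_pointwise {E F : Type*} [NormedAddCommGroup E]
    [NormedSpace ℝ E] [NormedAddCommGroup F] [NormedSpace ℝ F] {L : ℝ → E →L[ℝ] F} {a : ℝ → E}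
    {s : Set ℝ} {τ : ℝ} {a' : E} {d : F} (hL : ContinuousWithinAt L s τ)
    (hLa : HasDerivWithinAt (fun r => L r (a τ)) d s τ) (ha : HasDerivWithinAt a a' s τ) :
    HasDerivWithinAt (fun r => L r (a r)) (d + L τ a') s τ := by
  rw [hasDerivWithinAt_iff_tendsto_slope] at *
  have h1 : Filter.Tendsto L (nhdsWithin τ (s \ {τ})) (nhds (L τ)) :=
    hL.mono_left (nhdsWithin_mono _ sdiff_subset)
  refine (hLa.add ((isBoundedBilinearMap_apply (𝕜 := ℝ) (E := E) (F := F)).continuous.tendsto (L τ, a')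
    |>.comp (h1.prodMk_nhds ha))).congr fun r => ?_
  change slope (fun r => L r (a τ)) τ r + L r (slope a τ r) = _
  simp only [slope, vsub_eq_sub, map_smul, map_sub]
  rw [← smul_add]
  congr 1
  abel

theorem Sym.norm_rot_le (σ : ℤˣ) : ‖rot σ‖ ≤ 1 := by
  rw [rot, Sym.norm_const]
  rcases Int.units_eq_one_or σ with h | h <;> simp [h]

namespace Evolves

variable {σ : ℤˣ} {c : Sym} {f h : ℝ → R3 → ℂ} {t₁ A B : ℝ}

theorem norm_mulOp_sub_le (H : Evolves σ c f h t₁ A B) {j : ℕ} (hj : j ≤ 1) {s t : ℝ}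
    (hs : s ∈ Icc 0 t₁) (ht : t ∈ Icc 0 t₁) (x : R3) :
    ‖mulOp (wmul j (h t)) x - mulOp (wmul j (h s)) x‖ ≤ (1 + ‖c‖) * B * |t - s| := by
  have hsub : uIoc s t ⊆ Icc 0 t₁ := uIoc_subset_uIcc.trans (ordConnected_Icc.uIcc_subset hs ht)
  have hB : 0 ≤ B := (integral_nonneg fun _ => norm_nonneg _).trans (H.int_h s hs).2
  refine ContinuousLinearMap.opNorm_le_bound _ (by positivity) fun a => ?_
  rw [sub_apply, H.mulOp_sub_eq hj hs ht]
  have : ∀ τ ∈ uIoc s t, ‖mulOp (wmul (j + 1) (h τ)) x (rot σ * a) +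
      mulOp (wmul j (𝓕 (f τ))) x (c * a)‖ ≤ (1 + ‖c‖) * B * ‖a‖ := fun τ hτ => by
    have b1 := H.moment_h (hsub hτ) (j := j + 1) (by omega)
    have b2 := H.moment_f (hsub hτ) (j := j) (by omega)
    have e1 := (mulOp (wmul (j + 1) (h τ)) x).le_of_opNorm_le
      ((norm_mulOp_le_integral _ x).trans b1.2) (rot σ * a)
    have e2 := (mulOp (wmul j (𝓕 (f τ))) x).le_of_opNorm_le
      ((norm_mulOp_le_integral _ x).trans b2.2) (c * a)
    have e3 : ‖rot σ * a‖ ≤ ‖a‖ := (norm_mul_le _ _).trans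
      (mul_le_of_le_one_left (norm_nonneg _) (Sym.norm_rot_le σ))
    calc _ ≤ B * ‖a‖ + B * (‖c‖ * ‖a‖) := (norm_add_le _ _).trans (add_le_add
          (e1.trans (mul_le_mul_of_nonneg_left e3 hB))
          (e2.trans (mul_le_mul_of_nonneg_left (norm_mul_le _ _) hB)))
      _ = _ := by ring
  refine (intervalIntegral.norm_integral_le_of_norm_le_const this).trans (le_of_eq (by ring))

theorem norm_mulOp_sub_mulOp_le (H : Evolves σ c f h t₁ A B) {j : ℕ} (hj : j ≤ 1) {s t : ℝ}
    (hs : s ∈ Icc 0 t₁) (ht : t ∈ Icc 0 t₁) (x y : R3) :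
    ‖mulOp (wmul j (h t)) y - mulOp (wmul j (h s)) x‖ ≤
      (1 + ‖c‖) * B * |t - s| + B * ‖y - x‖ := by
  have h1 := H.norm_mulOp_sub_le hj hs ht y
  have b := H.moment_h hs (j := 1 + j) (by omega)
  have h2 := norm_mulOp_add_sub_le (aestronglyMeasurable_wmul j (H.meas_h_right s))
    (by rw [wmul_wmul]; exact b.1) x (y - x)
  rw [wmul_wmul, add_sub_cancel] at h2
  calc _ ≤ _ := norm_sub_le_norm_sub_add_norm_sub _ (mulOp (wmul j (h s)) y) _
    _ ≤ _ := add_le_add h1 (h2.trans (mul_le_mul_of_nonneg_right b.2 (norm_nonneg _)))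

open Filter Topology

theorem continuousOn_mulOp (H : Evolves σ c f h t₁ A B) {j : ℕ} (hj : j ≤ 1) :
    ContinuousOn (fun z : ℝ × R3 => mulOp (wmul j (h z.1)) z.2) (Icc 0 t₁ ×ˢ univ) := by
  intro z hz
  rw [ContinuousWithinAt, tendsto_iff_norm_sub_tendsto_zero]
  refine squeeze_zero' (Eventually.of_forall fun _ => norm_nonneg _)
    (g := fun w : ℝ × R3 => (1 + ‖c‖) * B * |w.1 - z.1| + B * ‖w.2 - z.2‖) ?_ ?_
  · filter_upwards [self_mem_nhdsWithin] with w hw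
    exact H.norm_mulOp_sub_mulOp_le hj hz.1 hw.1 _ _
  · have : Continuous fun w : ℝ × R3 => (1 + ‖c‖) * B * |w.1 - z.1| + B * ‖w.2 - z.2‖ := by
      fun_prop
    have := this.tendsto z
    simp only [sub_self, abs_zero, norm_zero, mul_zero, add_zero] at this
    exact this.mono_left nhdsWithin_le_nhds

theorem continuousOn_rate (H : Evolves σ c f h t₁ A B) (a : Sym) :
    ContinuousOn (fun z : ℝ × R3 => mulOp (wmul 1 (h z.1)) z.2 (rot σ * a) +
      mulOp (𝓕 (f z.1)) z.2 (c * a)) (Icc 0 t₁ ×ˢ univ) := by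
  refine ((H.continuousOn_mulOp le_rfl).clm_apply continuousOn_const).add ?_
  have := continuousOn_mulOp_fourier (j := 0) H.cont_f H.integrable_f H.bound_f
    (fun τ hτ => (H.moment_f hτ (by omega)).1) (fun τ hτ => (H.moment_f hτ (by omega)).2) (c * a)
  simpa only [wmul_zero] using this

/-- The derivative of a multiplier of `h τ` along a curve. -/
theorem hasDerivWithinAt_mulOp_curve (H : Evolves σ c f h t₁ A B) {γ : ℝ → R3} {γ' : R3} {τ : ℝ}
    (hτ : τ ∈ Icc 0 t₁) (hγ : HasDerivWithinAt γ γ' (Icc 0 t₁) τ) (a : Sym) :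
    HasDerivWithinAt (fun r => mulOp (h r) (γ r) a)
      (mulOp (wmul 1 (h τ)) (γ τ) (rot σ * a) + mulOp (𝓕 (f τ)) (γ τ) (c * a) +
        gradOp (h τ) (γ τ) γ' a) (Icc 0 t₁) τ := by
  set g : ℝ × R3 → ℂ := fun z => mulOp (wmul 1 (h z.1)) z.2 (rot σ * a) +
      mulOp (𝓕 (f z.1)) z.2 (c * a) with hg
  have hgc := H.continuousOn_rate a
  have hspace : HasDerivWithinAt (fun r => mulOp (h τ) (γ r) a) (gradOp (h τ) (γ τ) γ' a)
      (Icc 0 t₁) τ := by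
    have h1 := (hasFDerivAt_mulOp (H.meas_h_right τ) (H.int_h τ hτ).1 (γ τ)).comp_hasDerivWithinAt τ hγ
    exact ((ContinuousLinearMap.apply ℝ ℂ a).hasFDerivAt.comp_hasDerivWithinAt τ h1)
  have hdiff : ∀ r ∈ Icc 0 t₁, mulOp (h r) (γ r) a - mulOp (h τ) (γ r) a =
      ∫ u in τ..r, g (u, γ r) := fun r hr => by
    have := H.mulOp_sub_eq (Nat.zero_le 1) hτ hr (γ r) a
    simpa only [wmul_zero, zero_add] using this
  have htime : HasDerivWithinAt (fun r => mulOp (h r) (γ r) a - mulOp (h τ) (γ r) a)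
      (g (τ, γ τ)) (Icc 0 t₁) τ := by
    rw [hasDerivWithinAt_iff_isLittleO, Asymptotics.isLittleO_iff]
    intro η hη
    have hc := hgc (τ, γ τ) ⟨hτ, mem_univ _⟩
    rw [Metric.continuousWithinAt_iff] at hc
    obtain ⟨δ, hδ, hc⟩ := hc η hη
    have e1 := Metric.continuousWithinAt_iff.1 hγ.continuousWithinAt δ hδ
    obtain ⟨δ', hδ', e1⟩ := e1
    filter_upwards [self_mem_nhdsWithin, mem_nhdsWithin_of_mem_nhds (Metric.ball_mem_nhds τ hδ),
      mem_nhdsWithin_of_mem_nhds (Metric.ball_mem_nhds τ hδ')] with r hr hr1 hr2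
    have hsub : uIcc τ r ⊆ Icc 0 t₁ := ordConnected_Icc.uIcc_subset hτ hr
    have hint : IntervalIntegrable (fun u => g (u, γ r)) volume τ r :=
      ContinuousOn.intervalIntegrable (hgc.comp (f := fun u => (u, γ r)) (by fun_prop)
        fun u hu => ⟨hsub hu, mem_univ _⟩)
    have e3 : (r - τ) • g (τ, γ τ) = ∫ _ in τ..r, g (τ, γ τ) := by simp
    rw [sub_self, sub_zero, hdiff r hr, e3,
      ← intervalIntegral.integral_sub hint intervalIntegrable_const, Real.norm_eq_abs]
    refine intervalIntegral.norm_integral_le_of_norm_le_const fun u hu => ?_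
    rw [← dist_eq_norm]
    refine (hc (x := (u, γ r)) ⟨hsub (uIoc_subset_uIcc hu), mem_univ _⟩ ?_).le
    rw [Prod.dist_eq, max_lt_iff]
    refine ⟨?_, e1 hr hr2⟩
    have : |u - τ| ≤ |r - τ| := abs_sub_left_of_mem_uIcc (uIoc_subset_uIcc hu)
    exact lt_of_le_of_lt this hr1
  exact (htime.add hspace).congr_of_eventuallyEq (Eventually.of_forall fun r => by simp) (by simp)

/-- The derivative of a multiplier of `h τ`, with a symbol that depends on time, along a
curve. -/
theorem hasDerivWithinAt_mulOp (H : Evolves σ c f h t₁ A B) {γ : ℝ → R3} {γ' : R3} {τ : ℝ}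
    (hτ : τ ∈ Icc 0 t₁) (hγ : HasDerivWithinAt γ γ' (Icc 0 t₁) τ) {a : ℝ → Sym} {a' : Sym}
    (ha : HasDerivWithinAt a a' (Icc 0 t₁) τ) :
    HasDerivWithinAt (fun r => mulOp (h r) (γ r) (a r))
      (mulOp (wmul 1 (h τ)) (γ τ) ((rot σ + dsym γ') * a τ) + mulOp (𝓕 (f τ)) (γ τ) (c * a τ) +
        mulOp (h τ) (γ τ) a') (Icc 0 t₁) τ := by
  have hc : ContinuousWithinAt (fun r => mulOp (h r) (γ r)) (Icc 0 t₁) τ := by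
    have := (H.continuousOn_mulOp (Nat.zero_le 1)) (τ, γ τ) ⟨hτ, mem_univ _⟩
    simp only [wmul_zero] at this
    exact this.comp (f := fun r => (r, γ r)) (continuousWithinAt_id.prodMk hγ.continuousWithinAt)
      fun r hr => ⟨hr, mem_univ _⟩
  refine (hasDerivWithinAt_clm_apply_of_pointwise hc
    (H.hasDerivWithinAt_mulOp_curve hτ hγ (a τ)) ha).congr_deriv ?_
  rw [gradOp_apply, add_mul, map_add]
  ring

end Evolves

/-! ### Pointwise and Sobolev bounds from the bootstrap assumptions -/

theorem norm_le_of_eLpNorm_top_le {F : Type*} [NormedAddCommGroup F] {f : R3 → F}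
    (hf : Continuous f) {B : ℝ} (hB : 0 ≤ B) (h : eLpNorm f ∞ volume ≤ ENNReal.ofReal B) (x : R3) :
    ‖f x‖ ≤ B := by
  by_contra hx
  have ho : IsOpen {x | B < ‖f x‖} := isOpen_lt continuous_const hf.norm
  have h0 : volume {x | B < ‖f x‖} = 0 := by
    have : ∀ᵐ x, ‖f x‖ ≤ B := by
      filter_upwards [ae_le_eLpNormEssSup (f := f) (μ := volume)] with x hx
      rw [eLpNorm_exponent_top] at h
      have := hx.trans h
      rwa [← ofReal_norm, ENNReal.ofReal_le_ofReal_iff hB] at this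
    rw [ae_iff] at this
    simpa using this
  have := ho.eq_empty_of_measure_zero h0
  exact (this ▸ (show x ∈ {x | B < ‖f x‖} from not_le.1 hx) : x ∈ (∅ : Set R3))

/-- The Fourier data of a component of `E^osc`. -/
def osc (S0 : ℤˣ → Lp ℂ 2 (volume : Measure R3)) (S : ℤˣ → ℝ → R3 → ℂ) (σ : ℤˣ) (j : Fin 3)
    (t : ℝ) (ξ : R3) : ℂ := oscHat S0 S σ t ξ j

/-- The symbol `a_±(k) i k_j`. -/
def srcSym (σ : ℤˣ) (j : Fin 3) : Sym := Sym.const (((σ : ℤ) : ℂ) / 2) * Sym.kap j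

theorem srcSym_apply (σ : ℤˣ) (j : Fin 3) (ξ : R3) :
    srcSym σ j ξ = amp σ (waveVec ξ) * (Complex.I * (waveVec ξ j : ℂ)) := by
  rw [srcSym, Sym.mul_apply, Sym.const_apply, Sym.kap_apply, kapR, amp]
  have : (bracket (waveVec ξ) : ℝ) = wt ξ := rfl
  rw [this]
  push_cast
  linear_combination (((σ : ℤ) : ℂ) / 2 * (waveVec ξ j : ℂ) * (wt ξ : ℂ)⁻¹) * Complex.I_sq

theorem osc_eq (S0 : ℤˣ → Lp ℂ 2 (volume : Measure R3)) (S : ℤˣ → ℝ → R3 → ℂ) (σ : ℤˣ) (j : Fin 3)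
    (t : ℝ) (ξ : R3) : osc S0 S σ j t ξ =
      Complex.exp (t * ((wt ξ * ((σ : ℤ) : ℝ) : ℝ) * Complex.I)) *
        (srcSym σ j ξ * (𝓕 (S0 σ) : Lp ℂ 2 (volume : Measure R3)) ξ +
          ∫ s in (0 : ℝ)..t, Complex.exp (-(s * ((wt ξ * ((σ : ℤ) : ℝ) : ℝ) * Complex.I))) *
            (srcSym σ j ξ * 𝓕 (S σ s) ξ)) := by
  have e1 : lam σ (waveVec ξ) = (wt ξ * ((σ : ℤ) : ℝ) : ℝ) * Complex.I := by
    rw [lam, wt]; push_cast; ring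
  have e2 : ∀ s : ℝ, Complex.exp (lam σ (waveVec ξ) * ((t - s : ℝ) : ℂ)) * 𝓕 (S σ s) ξ =
      Complex.exp (t * ((wt ξ * ((σ : ℤ) : ℝ) : ℝ) * Complex.I)) *
      (Complex.exp (-(s * ((wt ξ * ((σ : ℤ) : ℝ) : ℝ) * Complex.I))) * 𝓕 (S σ s) ξ) := fun s => by
    rw [e1, ← mul_assoc, ← Complex.exp_add]
    congr 2; push_cast; ring
  have e3 : ∀ s : ℝ, Complex.exp (-(s * ((wt ξ * ((σ : ℤ) : ℝ) : ℝ) * Complex.I))) *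
      (srcSym σ j ξ * 𝓕 (S σ s) ξ) = srcSym σ j ξ *
      (Complex.exp (-(s * ((wt ξ * ((σ : ℤ) : ℝ) : ℝ) * Complex.I))) * 𝓕 (S σ s) ξ) :=
    fun s => by ring
  rw [osc, oscHat, funext e2, funext e3, intervalIntegral.integral_const_mul,
    intervalIntegral.integral_const_mul, srcSym_apply, e1,
    mul_comm ((wt ξ * ((σ : ℤ) : ℝ) : ℝ) * Complex.I) (t : ℂ)]
  simp only [PiLp.smul_apply, smul_eq_mul, cvec]
  ring

theorem stronglyMeasurable_fourier {f : ℝ → R3 → ℂ} (hf : Continuous fun z : ℝ × R3 => f z.1 z.2) :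
    StronglyMeasurable fun z : ℝ × R3 => 𝓕 (f z.1) z.2 := by
  have : Continuous fun w : (ℝ × R3) × R3 => Real.fourierChar (-(inner ℝ w.2 w.1.2)) • f w.1.1 w.2 := by
    have h1 : Continuous fun w : (ℝ × R3) × R3 => f w.1.1 w.2 :=
      hf.comp (f := fun w : (ℝ × R3) × R3 => (w.1.1, w.2)) (by fun_prop)
    have h2 : Continuous fun w : (ℝ × R3) × R3 => Real.fourierChar (-(inner ℝ w.2 w.1.2)) :=
      Real.continuous_fourierChar.comp (by fun_prop)
    exact h2.smul h1
  convert this.stronglyMeasurable.integral_prod_right' (ν := (volume : Measure R3)) using 1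
  ext z
  exact Real.fourier_eq _ _

/-- A source frozen outside of the time interval `[0,t₁]`. -/
def clampTime {t₁ : ℝ} (h : 0 ≤ t₁) (f : ℝ → R3 → ℂ) (τ : ℝ) : R3 → ℂ := f (projIcc 0 t₁ h τ)

theorem clampTime_of_mem {t₁ : ℝ} (h : 0 ≤ t₁) (f : ℝ → R3 → ℂ) {τ : ℝ} (hτ : τ ∈ Icc 0 t₁) :
    clampTime h f τ = f τ := by rw [clampTime, projIcc_of_mem h hτ]

theorem osc_clampTime (S0 : ℤˣ → Lp ℂ 2 (volume : Measure R3)) (S : ℤˣ → ℝ → R3 → ℂ) (σ : ℤˣ)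
    (j : Fin 3) {t₁ : ℝ} (h : 0 ≤ t₁) {τ : ℝ} (hτ : τ ∈ Icc 0 t₁) :
    osc S0 (fun σ => clampTime h (S σ)) σ j τ = osc S0 S σ j τ := by
  ext ξ
  rw [osc_eq, osc_eq]
  congr 2
  refine intervalIntegral.integral_congr fun s hs => ?_
  rw [uIcc_of_le hτ.1] at hs
  simp only [clampTime_of_mem h (S σ) ⟨hs.1, hs.2.trans hτ.2⟩]

theorem norm_cexp_neg_mul_I (s w : ℝ) : ‖Complex.exp (-(s * (w * Complex.I)))‖ = 1 := by
  have : (-(s * (w * Complex.I)) : ℂ) = ((-(s * w) : ℝ) : ℂ) * Complex.I := by push_cast; ring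
  rw [this, Complex.norm_exp_ofReal_mul_I]

theorem norm_srcSym_mul_fourier_le {f : ℝ → R3 → ℂ} {M : ℝ} (hM : ∀ τ, ∫ x, ‖f τ x‖ ≤ M)
    (σ : ℤˣ) (j : Fin 3) (ξ : R3) (s : ℝ) : ‖srcSym σ j ξ * 𝓕 (f s) ξ‖ ≤ ‖srcSym σ j‖ * M := by
  rw [norm_mul]
  have h1 : ‖𝓕 (f s) ξ‖ ≤ M :=
    (VectorFourier.norm_fourierIntegral_le_integral_norm _ _ _ _ _).trans (hM s)
  exact mul_le_mul (Sym.norm_apply_le _ ξ) h1 (norm_nonneg _) (norm_nonneg _)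

theorem stronglyMeasurable_osc {S0 : ℤˣ → Lp ℂ 2 (volume : Measure R3)} {S : ℤˣ → ℝ → R3 → ℂ}
    {σ : ℤˣ} {j : Fin 3} {M : ℝ} (hc : Continuous fun z : ℝ × R3 => S σ z.1 z.2)
    (hM : ∀ τ, ∫ x, ‖S σ τ x‖ ≤ M) :
    StronglyMeasurable fun z : ℝ × R3 => osc S0 S σ j z.1 z.2 := by
  have meas_f := stronglyMeasurable_fourier hc
  have hGm : ∀ ξ, StronglyMeasurable fun s => srcSym σ j ξ * 𝓕 (S σ s) ξ := fun ξ =>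
    (meas_f.comp_measurable (measurable_prodMk_right (y := ξ))).const_mul _
  have hwc : Continuous fun z : ℝ × R3 => wt z.2 := continuous_wt.comp continuous_snd
  have hφm : StronglyMeasurable fun z : ℝ × R3 =>
      Complex.exp (-(z.1 * ((wt z.2 * ((σ : ℤ) : ℝ) : ℝ) * Complex.I))) *
        (srcSym σ j z.2 * 𝓕 (S σ z.1) z.2) := by
    refine StronglyMeasurable.mul (Continuous.stronglyMeasurable ?_) (StronglyMeasurable.mul
      (Continuous.stronglyMeasurable ?_) meas_f)
    · fun_prop
    · exact (srcSym σ j).continuous.comp continuous_snd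
  simp_rw [osc_eq]
  refine StronglyMeasurable.mul (Continuous.stronglyMeasurable ?_) (StronglyMeasurable.add ?_ ?_)
  · fun_prop
  · have h1 : StronglyMeasurable fun z : ℝ × R3 => srcSym σ j z.2 :=
      ((srcSym σ j).continuous.comp continuous_snd).stronglyMeasurable
    exact h1.mul ((Lp.stronglyMeasurable (𝓕 (S0 σ) : Lp ℂ 2 (volume : Measure R3))).comp_measurable
      measurable_snd)
  · refine stronglyMeasurable_uncurry_of_continuous_of_stronglyMeasurable
      (u := fun t ξ => ∫ s in (0 : ℝ)..t,
        Complex.exp (-(s * ((wt ξ * ((σ : ℤ) : ℝ) : ℝ) * Complex.I))) *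
          (srcSym σ j ξ * 𝓕 (S σ s) ξ)) (fun ξ => ?_) (fun t => ?_)
    · exact (lipschitzWith_primitive (M := ‖srcSym σ j‖ * M)
        ((Continuous.stronglyMeasurable (by fun_prop)).mul (hGm ξ)) fun s => by
          rw [Pi.mul_apply, norm_mul, norm_cexp_neg_mul_I, one_mul]; exact norm_srcSym_mul_fourier_le hM σ j ξ s).continuous
    · simp only [intervalIntegral]
      exact (hφm.integral_prod_left' (μ := volume.restrict (Ioc 0 t))).sub
        (hφm.integral_prod_left' (μ := volume.restrict (Ioc t 0)))

/-- `E^osc` solves the oscillator equation with source `S`. -/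
theorem evolves_osc {S0 : ℤˣ → Lp ℂ 2 (volume : Measure R3)} {S : ℤˣ → ℝ → R3 → ℂ} {σ : ℤˣ}
    {j : Fin 3} {t₁ A B M : ℝ} (hc : Continuous fun z : ℝ × R3 => S σ z.1 z.2)
    (hi : ∀ τ, Integrable (S σ τ)) (hM : ∀ τ, ∫ x, ‖S σ τ x‖ ≤ M)
    (int_h : ∀ τ ∈ Icc 0 t₁, Integrable (wmul 2 (osc S0 S σ j τ)) ∧
      ∫ ξ, ‖wmul 2 (osc S0 S σ j τ) ξ‖ ≤ B)
    (int_f : ∀ τ ∈ Icc 0 t₁, Integrable (wmul 2 (𝓕 (S σ τ))) ∧ ∫ ξ, ‖wmul 2 (𝓕 (S σ τ)) ξ‖ ≤ B)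
    (bound_f : ∀ τ ∈ Icc 0 t₁, ∀ x, ‖S σ τ x‖ ≤ A) :
    Evolves σ (srcSym σ j) (S σ) (osc S0 S σ j) t₁ A B := by
  have meas_f := stronglyMeasurable_fourier hc
  have hGm : ∀ ξ, StronglyMeasurable fun s => srcSym σ j ξ * 𝓕 (S σ s) ξ := fun ξ =>
    (meas_f.comp_measurable (measurable_prodMk_right (y := ξ))).const_mul _
  exact ⟨fun s t ξ => duhamel_sub_eq (hGm ξ) (norm_srcSym_mul_fourier_le hM σ j ξ)
    (fun t => osc_eq S0 S σ j t ξ) s t, stronglyMeasurable_osc hc hM, meas_f, int_h, int_f,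
    hc.continuousOn, fun τ _ => hi τ, bound_f⟩

/-- The decay rate `⟨τ⟩^{-3/2+δ/2}` of multipliers of `E^osc`. -/
def rate (δ τ : ℝ) : ℝ := bracket τ ^ (-(3 / 2 : ℝ) + δ / 2)

theorem rate_pos (δ τ : ℝ) : 0 < rate δ τ := Real.rpow_pos_of_pos (bracket_pos τ) _

theorem rate_sq (δ τ : ℝ) : rate δ τ ^ 2 = bracket τ ^ (-3 + δ) := by
  rw [rate, ← Real.rpow_natCast, ← Real.rpow_mul (bracket_pos τ).le]
  congr 1; push_cast; ring

theorem delta_one_pos {α₀ : ℕ} (h : 8 ≤ α₀) : 0 < delta α₀ 1 := by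
  have : (8 : ℝ) ≤ α₀ := by exact_mod_cast h
  rw [delta]; apply div_pos <;> norm_num; linarith

theorem delta_one_le {α₀ : ℕ} (h : 8 ≤ α₀) : delta α₀ 1 ≤ 1 / 7 := by
  have : (8 : ℝ) ≤ α₀ := by exact_mod_cast h
  rw [delta, Nat.cast_one, div_le_div_iff₀ (by linarith) (by norm_num)]
  linarith

theorem delta_one_mul {α₀ : ℕ} (h : 8 ≤ α₀) : delta α₀ 1 * α₀ = 1 + delta α₀ 1 := by
  have : (8 : ℝ) ≤ α₀ := by exact_mod_cast h
  have : (α₀ : ℝ) - 1 ≠ 0 := by linarith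
  rw [delta]; field_simp; push_cast; ring

theorem bracket_mono {s t : ℝ} (hs : 0 ≤ s) (h : s ≤ t) : bracket s ≤ bracket t := by
  rw [bracket, bracket]
  apply Real.sqrt_le_sqrt
  rw [Real.norm_of_nonneg hs, Real.norm_of_nonneg (hs.trans h)]
  nlinarith

theorem SobBound.wmul_le {m j : ℕ} (hj : j + 2 ≤ m) {h : R3 → ℂ} {B : ℝ} (H : SobBound m h B) :
    Integrable (wmul j h) ∧ ∫ ξ, ‖wmul j h ξ‖ ≤ √(sphereArea * Real.pi) * B :=
  H.integrable_weight hj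

theorem sobBound_of_sobolevNorm_le {m : ℕ} {h : R3 → ℂ} {B : ℝ} (hm : AEStronglyMeasurable h)
    (hB : 0 ≤ B) (H : sobolevNorm m h ≤ ENNReal.ofReal B) : SobBound m h B := by
  refine ⟨hm, hB, le_trans (le_of_eq ?_) H⟩
  rw [sobolevNorm]
  congr 1
  ext ξ
  rw [← Complex.ofReal_pow, ← Complex.real_smul]
  rfl

theorem sobolevNorm_comp_le (m : ℕ) (h : R3 → C3) (j : Fin 3) :
    sobolevNorm m (fun ξ => h ξ j) ≤ sobolevNorm m h := by
  refine eLpNorm_mono fun ξ => ?_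
  rw [norm_smul, norm_smul]
  exact mul_le_mul_of_nonneg_left (PiLp.norm_apply_le _ _) (norm_nonneg _)

theorem fourierInv_apply_comp {h : R3 → C3} (hi : Integrable h) (x : R3) (j : Fin 3) :
    𝓕⁻ h x j = 𝓕⁻ (fun ξ => h ξ j) x := by
  rw [Real.fourierInv_eq, Real.fourierInv_eq]
  have hi' : Integrable fun ξ => Real.fourierChar (inner ℝ ξ x) • h ξ := by
    have := (Real.fourierIntegral_convergent_iff (f := h) (μ := volume) (-x)).2 hi
    simpa using this
  exact ((EuclideanSpace.proj (𝕜 := ℂ) j).integral_comp_comm hi').symm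

theorem integrable_of_comp {h : R3 → C3} (hi : ∀ j, Integrable fun ξ => h ξ j) : Integrable h := by
  have e : h = fun ξ => ∑ j, h ξ j • EuclideanSpace.single j (1 : ℂ) := by
    ext ξ i
    simp [Finset.sum_apply, Pi.single_apply]
  rw [e]
  exact integrable_finsetSum _ fun j _ => (hi j).smul_const _

/-- The weak first derivatives of a `C¹` function are the classical ones. -/
theorem norm_fderiv_le_of_weakPartialBound {F : Type*} [NormedAddCommGroup F] [NormedSpace ℝ F]
    [CompleteSpace F] {f : R3 → F} (hf : ContDiff ℝ 1 f) {i : Fin 3} {B : ℝ} (hB : 0 ≤ B)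
    (h : WeakPartialBound (fun _ : Fin 1 => i) f ∞ B) (x : R3) :
    ‖fderiv ℝ f x (EuclideanSpace.single i 1)‖ ≤ B := by
  obtain ⟨g, ⟨-, hg, hw⟩, hb⟩ := h
  have hcont : Continuous fun x => fderiv ℝ f x (EuclideanSpace.single i 1) :=
    (hf.continuous_fderiv one_ne_zero).clm_apply continuous_const
  have hae : ∀ᵐ x, fderiv ℝ f x (EuclideanSpace.single i 1) = g x := by
    refine ae_eq_of_integral_contDiff_smul_eq hcont.locallyIntegrable hg fun ψ hψ hc => ?_
    have h1 := hw ψ hψ hc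
    simp only [iteratedFDeriv_one_apply, pow_one, neg_smul, one_smul] at h1
    have hψd : Continuous fun x => fderiv ℝ ψ x (EuclideanSpace.single i 1) :=
      (hψ.continuous_fderiv (by simp)).clm_apply continuous_const
    have hcd : HasCompactSupport fun x => fderiv ℝ ψ x (EuclideanSpace.single i 1) :=
      hc.fderiv_apply ℝ _
    rw [integral_smul_fderiv_eq_neg_fderiv_smul_of_integrable
      ((hψd.smul hf.continuous).integrable_of_hasCompactSupport hcd.smul_right)
      ((hψ.continuous.smul hcont).integrable_of_hasCompactSupport hc.smul_right)
      ((hψ.continuous.smul hf.continuous).integrable_of_hasCompactSupport hc.smul_right)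
      (fun x _ => (hψ.differentiable (by simp)) x) (fun x _ => (hf.differentiable one_ne_zero) x),
      h1, neg_neg]
  refine norm_le_of_eLpNorm_top_le hcont hB ?_ x
  rwa [eLpNorm_congr_ae hae]

theorem norm_clm_le_of_basis {F : Type*} [NormedAddCommGroup F] [NormedSpace ℝ F]
    (L : R3 →L[ℝ] F) {B : ℝ} (hB : 0 ≤ B) (h : ∀ i, ‖L (EuclideanSpace.single i 1)‖ ≤ B) :
    ‖L‖ ≤ 3 * B := by
  refine L.opNorm_le_bound (by positivity) fun y => ?_
  have e : y = ∑ i, y i • EuclideanSpace.single i (1 : ℝ) := by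
    ext i
    simp [Finset.sum_apply, Pi.single_apply]
  calc ‖L y‖ = ‖∑ i, y i • L (EuclideanSpace.single i 1)‖ := by
        conv_lhs => rw [e]
        rw [map_sum]; simp only [map_smul]
    _ ≤ ∑ _i : Fin 3, ‖y‖ * B := by
        refine norm_sum_le_of_le _ fun i _ => ?_
        rw [norm_smul]
        exact mul_le_mul (PiLp.norm_apply_le _ _) (h i) (norm_nonneg _) (norm_nonneg _)
    _ = 3 * B * ‖y‖ := by simp; ring

theorem integrable_and_integral_norm_le {F : Type*} [NormedAddCommGroup F] {f : R3 → F} {B : ℝ}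
    (hB : 0 ≤ B) (hf : AEStronglyMeasurable f) (h : eLpNorm f 1 volume ≤ ENNReal.ofReal B) :
    Integrable f ∧ ∫ x, ‖f x‖ ≤ B := by
  refine ⟨memLp_one_iff_integrable.1 ⟨hf, h.trans_lt ENNReal.ofReal_lt_top⟩, ?_⟩
  rw [integral_norm_eq_lintegral_enorm hf, ← eLpNorm_one_eq_lintegral_enorm]
  exact ENNReal.toReal_le_of_le_ofReal hB h

theorem continuous_fourier {F : Type*} [NormedAddCommGroup F] [NormedSpace ℂ F] {f : R3 → F}
    (hf : Integrable f) : Continuous (𝓕 f) :=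
  VectorFourier.fourierIntegral_continuous Real.continuous_fourierChar
    (by exact continuous_inner) hf

theorem continuous_fourierInv {F : Type*} [NormedAddCommGroup F] [NormedSpace ℂ F] {f : R3 → F}
    (hf : Integrable f) : Continuous (𝓕⁻ f) := by
  have : (𝓕⁻ f : R3 → F) = fun x => 𝓕 f (-x) := by
    ext1 x; exact Real.fourierInv_eq_fourier_neg f x
  rw [this]
  exact (continuous_fourier hf).comp continuous_neg

theorem continuous_slice {F : Type*} [TopologicalSpace F] {f : ℝ → R3 → F} {s : Set ℝ}
    (hf : ContinuousOn (fun z : ℝ × R3 => f z.1 z.2) (s ×ˢ univ)) {τ : ℝ} (hτ : τ ∈ s) :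
    Continuous (f τ) :=
  continuousOn_univ.1 (hf.comp (f := fun x : R3 => (τ, x)) (by fun_prop) fun _ _ => ⟨hτ, mem_univ _⟩)

/-- The components of `E^r`, as complex-valued functions. -/
def erComp (Er : ℝ → R3 → R3) (j : Fin 3) (t : ℝ) (x : R3) : ℂ := (Er t x j : ℂ)

namespace Bootstrap

variable {α₀ : ℕ} {ε T : ℝ} {S0 : ℤˣ → Lp ℂ 2 (volume : Measure R3)}
    {S : ℤˣ → ℝ → R3 → ℂ} {Er : ℝ → R3 → R3}

theorem integrable_S (hb : Bootstrap α₀ ε T S0 S Er) (hε : 0 < ε) (σ : ℤˣ) {t : ℝ}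
    (ht : t ∈ Ico 0 T) : Integrable (S σ t) ∧ ∫ x, ‖S σ t x‖ ≤ ε := by
  have h := hb.decay_S σ t ht 1 le_rfl
  simp only [invExp, inv_one, ENNReal.toReal_one, sub_self, mul_zero, Real.rpow_zero, mul_one] at h
  exact integrable_and_integral_norm_le hε.le
    (continuous_slice (hb.cont_S σ) ht).aestronglyMeasurable h

theorem norm_S_le (hb : Bootstrap α₀ ε T S0 S Er) (hε : 0 < ε) (σ : ℤˣ) {t : ℝ}
    (ht : t ∈ Ico 0 T) (x : R3) : ‖S σ t x‖ ≤ ε * bracket t ^ (-3 : ℝ) := by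
  have h := hb.decay_S σ t ht ∞ le_top
  simp only [invExp, ENNReal.inv_top, ENNReal.toReal_zero, sub_zero, mul_one] at h
  exact norm_le_of_eLpNorm_top_le (continuous_slice (hb.cont_S σ) ht)
    (mul_nonneg hε.le (Real.rpow_nonneg (bracket_pos t).le _)) h x

theorem sobBound_S (hb : Bootstrap α₀ ε T S0 S Er) (hε : 0 < ε) (σ : ℤˣ) {t : ℝ}
    (ht : t ∈ Ico 0 T) : SobBound α₀ (𝓕 (S σ t)) (ε * bracket t ^ delta α₀ 1) :=
  sobBound_of_sobolevNorm_le (continuous_fourier (hb.integrable_S hε σ ht).1).aestronglyMeasurable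
    (mul_nonneg hε.le (Real.rpow_nonneg (bracket_pos t).le _)) (hb.bdd_S_top σ t ht)

theorem fourierInv_S (hb : Bootstrap α₀ ε T S0 S Er) (hα : 8 ≤ α₀) (hε : 0 < ε) (σ : ℤˣ) {t : ℝ}
    (ht : t ∈ Ico 0 T) : 𝓕⁻ (𝓕 (S σ t)) = S σ t :=
  (continuous_slice (hb.cont_S σ) ht).fourierInv_fourier_eq (hb.integrable_S hε σ ht).1
    ((hb.sobBound_S hε σ ht).integrable (by omega))

theorem integrable_Er (hb : Bootstrap α₀ ε T S0 S Er) (hε : 0 < ε) {t : ℝ}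
    (ht : t ∈ Ico 0 T) : Integrable (Er t) := by
  have h := hb.decay_Er t ht 1 le_rfl
  simp only [invExp, inv_one, ENNReal.toReal_one, sub_self, mul_zero, Real.rpow_zero, mul_one] at h
  exact (integrable_and_integral_norm_le hε.le
    (continuous_slice hb.cont_Er ht).aestronglyMeasurable h).1

theorem norm_Er_le (hb : Bootstrap α₀ ε T S0 S Er) (hε : 0 < ε) {t : ℝ}
    (ht : t ∈ Ico 0 T) (x : R3) : ‖Er t x‖ ≤ ε * bracket t ^ (-3 : ℝ) := by
  have h := hb.decay_Er t ht ∞ le_top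
  simp only [invExp, ENNReal.inv_top, ENNReal.toReal_zero, sub_zero, mul_one] at h
  exact norm_le_of_eLpNorm_top_le (continuous_slice hb.cont_Er ht)
    (mul_nonneg hε.le (Real.rpow_nonneg (bracket_pos t).le _)) h x

theorem integrable_erComp (hb : Bootstrap α₀ ε T S0 S Er) (hε : 0 < ε) (j : Fin 3) {t : ℝ}
    (ht : t ∈ Ico 0 T) : Integrable (erComp Er j t) :=
  (Complex.ofRealCLM.comp (EuclideanSpace.proj (𝕜 := ℝ) j)).integrable_comp
    (hb.integrable_Er hε ht)

theorem continuousOn_erComp (hb : Bootstrap α₀ ε T S0 S Er) (j : Fin 3) :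
    ContinuousOn (fun z : ℝ × R3 => erComp Er j z.1 z.2) (Ico 0 T ×ˢ univ) :=
  (Complex.ofRealCLM.comp (EuclideanSpace.proj (𝕜 := ℝ) j)).continuous.comp_continuousOn hb.cont_Er

theorem norm_erComp_le (hb : Bootstrap α₀ ε T S0 S Er) (hε : 0 < ε) (j : Fin 3) {t : ℝ}
    (ht : t ∈ Ico 0 T) (x : R3) : ‖erComp Er j t x‖ ≤ ε := by
  rw [erComp, Complex.norm_real]
  refine (PiLp.norm_apply_le _ _).trans ((hb.norm_Er_le hε ht x).trans ?_)
  exact mul_le_of_le_one_right hε.le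
    (Real.rpow_le_one_of_one_le_of_nonpos (one_le_bracket t) (by norm_num))

theorem sobBound_erComp (hb : Bootstrap α₀ ε T S0 S Er) (hε : 0 < ε) (j : Fin 3) {t : ℝ}
    (ht : t ∈ Ico 0 T) :
    SobBound (α₀ + 1) (𝓕 (erComp Er j t)) (ε * bracket t ^ delta α₀ 1) := by
  refine sobBound_of_sobolevNorm_le (continuous_fourier
    (hb.integrable_erComp hε j ht)).aestronglyMeasurable
    (mul_nonneg hε.le (Real.rpow_nonneg (bracket_pos t).le _))
    (le_trans (le_of_eq ?_) ((sobolevNorm_comp_le _ _ j).trans (hb.bdd_Er_top t ht)))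
  congr 1
  ext ξ
  have hi : Integrable fun x => cvec (Er t x) := integrable_of_comp fun j =>
    hb.integrable_erComp hε j ht
  have := fourierInv_apply_comp hi (-ξ) j
  rw [Real.fourierInv_eq_fourier_neg, Real.fourierInv_eq_fourier_neg, neg_neg] at this
  exact this.symm

theorem fourierInv_erComp (hb : Bootstrap α₀ ε T S0 S Er) (hα : 8 ≤ α₀) (hε : 0 < ε) (j : Fin 3)
    {t : ℝ} (ht : t ∈ Ico 0 T) : 𝓕⁻ (𝓕 (erComp Er j t)) = erComp Er j t :=
  (continuous_slice (hb.continuousOn_erComp j) ht).fourierInv_fourier_eq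
    (hb.integrable_erComp hε j ht) ((hb.sobBound_erComp hε j ht).integrable (by omega))

/-! ### Decay of the multipliers of the oscillating field -/

theorem clampTime_S (hb : Bootstrap α₀ ε T S0 S Er) (hε : 0 < ε) (σ : ℤˣ) {t₁ : ℝ}
    (h0 : 0 ≤ t₁) (ht : t₁ < T) :
    (Continuous fun z : ℝ × R3 => clampTime h0 (S σ) z.1 z.2) ∧
      (∀ τ, Integrable (clampTime h0 (S σ) τ)) ∧ ∀ τ, ∫ x, ‖clampTime h0 (S σ) τ x‖ ≤ ε := by
  have hm : ∀ τ : ℝ, ((projIcc 0 t₁ h0 τ : Icc 0 t₁) : ℝ) ∈ Ico 0 T := fun τ =>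
    ⟨(projIcc 0 t₁ h0 τ).2.1, (projIcc 0 t₁ h0 τ).2.2.trans_lt ht⟩
  refine ⟨?_, fun τ => (hb.integrable_S hε σ (hm τ)).1, fun τ => (hb.integrable_S hε σ (hm τ)).2⟩
  refine (hb.cont_S σ).comp_continuous (f := fun z : ℝ × R3 =>
    (((projIcc 0 t₁ h0 z.1 : Icc 0 t₁) : ℝ), z.2)) ?_ fun z => ⟨hm _, mem_univ _⟩
  exact (continuous_subtype_val.comp (continuous_projIcc.comp continuous_fst)).prodMk continuous_snd

theorem sobBound_osc (hb : Bootstrap α₀ ε T S0 S Er) (hε : 0 < ε) (σ : ℤˣ) (j : Fin 3) {t : ℝ}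
    (ht : t ∈ Ico 0 T) : SobBound α₀ (osc S0 S σ j t) ε ∧
      SobBound (α₀ + 1) (osc S0 S σ j t) (ε * bracket t ^ delta α₀ 1) := by
  have hm : AEStronglyMeasurable (osc S0 S σ j t) := by
    obtain ⟨h1, -, h3⟩ := hb.clampTime_S hε σ ht.1 ht.2
    rw [← osc_clampTime S0 S σ j ht.1 ⟨ht.1, le_rfl⟩]
    exact (stronglyMeasurable_osc (S := fun σ => clampTime ht.1 (S σ)) h1 h3).comp_measurable
      (measurable_prodMk_left (x := t)) |>.aestronglyMeasurable
  exact ⟨sobBound_of_sobolevNorm_le hm hε.le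
      ((sobolevNorm_comp_le _ (oscHat S0 S σ t) j).trans (hb.bdd_Eosc σ t ht)),
    sobBound_of_sobolevNorm_le hm (mul_nonneg hε.le (Real.rpow_nonneg (bracket_pos t).le _))
      ((sobolevNorm_comp_le _ (oscHat S0 S σ t) j).trans (hb.bdd_Eosc_top σ t ht))⟩

theorem integrable_osc (hb : Bootstrap α₀ ε T S0 S Er) (hα : 8 ≤ α₀) (hε : 0 < ε) (σ : ℤˣ)
    (j : Fin 3) {t : ℝ} (ht : t ∈ Ico 0 T) : Integrable (osc S0 S σ j t) :=
  (hb.sobBound_osc hε σ j ht).1.integrable (by omega)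

theorem Eosc_apply (hb : Bootstrap α₀ ε T S0 S Er) (hα : 8 ≤ α₀) (hε : 0 < ε) (σ : ℤˣ)
    (j : Fin 3) {t : ℝ} (ht : t ∈ Ico 0 T) (x : R3) :
    Eosc S0 S σ t x j = 𝓕⁻ (osc S0 S σ j t) x :=
  fourierInv_apply_comp (integrable_of_comp fun j => hb.integrable_osc hα hε σ j ht) x j

theorem norm_fourierInv_osc_le (hb : Bootstrap α₀ ε T S0 S Er) (hα : 8 ≤ α₀) (hε : 0 < ε)
    (σ : ℤˣ) (j : Fin 3) {t : ℝ} (ht : t ∈ Ico 0 T) (x : R3) :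
    ‖𝓕⁻ (osc S0 S σ j t) x‖ ≤ ε * bracket t ^ (-(3 / 2 : ℝ)) := by
  have h := hb.decay_Eosc σ t ht ∞ le_top
  simp only [invExp, ENNReal.inv_top, ENNReal.toReal_zero, sub_zero] at h
  rw [show (-3 * (1 / 2) : ℝ) = -(3 / 2) by norm_num] at h
  rw [← hb.Eosc_apply hα hε σ j ht]
  exact (PiLp.norm_apply_le _ _).trans (norm_le_of_eLpNorm_top_le (continuous_fourierInv
    (integrable_of_comp fun j => hb.integrable_osc hα hε σ j ht))
    (mul_nonneg hε.le (Real.rpow_nonneg (bracket_pos t).le _)) h x)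

theorem evolves (hb : Bootstrap α₀ ε T S0 S Er) (hα : 8 ≤ α₀) (hε : 0 < ε) (σ : ℤˣ) (j : Fin 3)
    {t₁ : ℝ} (h0 : 0 ≤ t₁) (ht : t₁ < T) : ∃ A B, 
    Evolves σ (srcSym σ j) (clampTime h0 (S σ)) (osc S0 (fun σ => clampTime h0 (S σ)) σ j) t₁ A B := by
  obtain ⟨h1, h2, h3⟩ := hb.clampTime_S hε σ h0 ht
  have hm : ∀ τ ∈ Icc 0 t₁, τ ∈ Ico 0 T := fun τ hτ => ⟨hτ.1, hτ.2.trans_lt ht⟩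
  have hbr : ∀ τ ∈ Icc 0 t₁, ε ≤ ε * bracket t₁ ^ delta α₀ 1 ∧
      ε * bracket τ ^ delta α₀ 1 ≤ ε * bracket t₁ ^ delta α₀ 1 := fun τ hτ => by
    have hd := (delta_one_pos hα).le
    refine ⟨le_mul_of_one_le_right hε.le (Real.one_le_rpow (one_le_bracket _) hd), ?_⟩
    exact mul_le_mul_of_nonneg_left (Real.rpow_le_rpow (bracket_pos τ).le
      (bracket_mono hτ.1 hτ.2) hd) hε.le
  refine ⟨ε, √(sphereArea * Real.pi) * (ε * bracket t₁ ^ delta α₀ 1), ?_⟩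
  refine evolves_osc (S := fun σ => clampTime h0 (S σ)) h1 h2 h3 (fun τ hτ => ?_) (fun τ hτ => ?_)
    fun τ hτ x => ?_
  · rw [osc_clampTime S0 S σ j h0 hτ]
    have := (hb.sobBound_osc hε σ j (hm τ hτ)).1.wmul_le (j := 2) (by omega)
    exact ⟨this.1, this.2.trans (mul_le_mul_of_nonneg_left (hbr τ hτ).1 (Real.sqrt_nonneg _))⟩
  · rw [clampTime_of_mem h0 (S σ) hτ]
    have := (hb.sobBound_S hε σ (hm τ hτ)).wmul_le (j := 2) (by omega)
    exact ⟨this.1, this.2.trans (mul_le_mul_of_nonneg_left (hbr τ hτ).2 (Real.sqrt_nonneg _))⟩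
  · rw [clampTime_of_mem h0 (S σ) hτ]
    refine (hb.norm_S_le hε σ (hm τ hτ) x).trans ?_
    exact mul_le_of_le_one_right hε.le
      (Real.rpow_le_one_of_one_le_of_nonpos (one_le_bracket _) (by norm_num))

end Bootstrap

open Bootstrap in
/-- Decay of the multipliers of `E^osc` and of the sources `S`, with a loss from the multiplier
that is absorbed by half of `δ` through the choice of the frequency cutoff. -/
theorem exists_mulOp_decay {α₀ : ℕ} (hα : 8 ≤ α₀) : ∃ C, 0 ≤ C ∧ ∀ (ε T : ℝ)
    (S0 : ℤˣ → Lp ℂ 2 (volume : Measure R3)) (S : ℤˣ → ℝ → R3 → ℂ) (Er : ℝ → R3 → R3), 0 < ε →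
    Bootstrap α₀ ε T S0 S Er → ∀ t ∈ Ico 0 T, ∀ (σ : ℤˣ) (x : R3),
      (∀ j, ‖mulOp (osc S0 S σ j t) x‖ ≤ C * ε * rate (delta α₀ 1) t) ∧
      ‖mulOp (𝓕 (S σ t)) x‖ ≤ C * ε * rate (delta α₀ 1) t ^ 2 := by
  obtain ⟨C, hC, H⟩ := exists_norm_mulOp_le
  refine ⟨2 * C, by positivity, fun ε T S0 S Er hε hb t ht σ x => ?_⟩
  have hδ := delta_one_pos hα
  have hδ' := delta_one_le hα
  have hδα := delta_one_mul hα
  have hβ1 := one_le_bracket t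
  have hβ := bracket_pos t
  set δ := delta α₀ 1
  set β := bracket t
  constructor
  · intro j
    have h1 := H α₀ (by omega) (osc S0 S σ j t) _ _ (hb.sobBound_osc hε σ j ht).1
      (hb.norm_fourierInv_osc_le hα hε σ j ht) (β ^ (δ / 2)) (Real.one_le_rpow hβ1 (by linarith)) x
    refine h1.trans ?_
    have e1 : β ^ (δ / 2) * (ε * β ^ (-(3 / 2 : ℝ))) = ε * rate δ t := by
      rw [rate, mul_left_comm, ← Real.rpow_add hβ]; congr 2; ring
    have e2 : (β ^ (δ / 2)) ^ (6 - 4 * (α₀ : ℝ)) * ε ≤ ε * rate δ t := by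
      rw [mul_comm, rate, ← Real.rpow_mul hβ.le]
      refine mul_le_mul_of_nonneg_left (Real.rpow_le_rpow_of_exponent_le hβ1 ?_) hε.le
      nlinarith
    calc _ ≤ C * (ε * rate δ t + ε * rate δ t) := by rw [e1]; gcongr
      _ = _ := by ring
  · have h1 := H α₀ (by omega) (𝓕 (S σ t)) _ _ (hb.sobBound_S hε σ ht)
      (by rw [hb.fourierInv_S hα hε σ ht]; exact hb.norm_S_le hε σ ht) (β ^ δ)
      (Real.one_le_rpow hβ1 hδ.le) x
    refine h1.trans ?_
    rw [rate_sq]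
    have e1 : β ^ δ * (ε * β ^ (-3 : ℝ)) = ε * β ^ (-3 + δ) := by
      rw [mul_left_comm, ← Real.rpow_add hβ]; congr 2; ring
    have e2 : (β ^ δ) ^ (6 - 4 * (α₀ : ℝ)) * (ε * β ^ δ) ≤ ε * β ^ (-3 + δ) := by
      rw [mul_left_comm, ← Real.rpow_mul hβ.le, ← Real.rpow_add hβ]
      refine mul_le_mul_of_nonneg_left (Real.rpow_le_rpow_of_exponent_le hβ1 ?_) hε.le
      nlinarith
    calc _ ≤ C * (ε * β ^ (-3 + δ) + ε * β ^ (-3 + δ)) := by rw [e1]; gcongr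
      _ = _ := by ring

/-! ### Vector fields built from multipliers of the oscillating field -/

/-- `z ↦ (Re z) e_j`. -/
def compVec (j : Fin 3) : ℂ →L[ℝ] R3 := Complex.reCLM.smulRight (EuclideanSpace.single j 1)

theorem norm_compVec_le (j : Fin 3) : ‖compVec j‖ ≤ 1 := by
  refine (ContinuousLinearMap.norm_smulRight_apply _ _).le.trans ?_
  simp [Complex.reCLM_norm]

theorem sum_compVec (z : Fin 3 → ℂ) :
    ∑ j, compVec j (z j) = WithLp.toLp 2 fun j => (z j).re := by
  ext i
  simp [compVec, Finset.sum_apply, Pi.single_apply]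

theorem norm_sum_sum_le {F : Type*} [NormedAddCommGroup F] {f : ℤˣ → Fin 3 → F} {B : ℝ}
    (h : ∀ σ j, ‖f σ j‖ ≤ B) : ‖∑ σ, ∑ j, f σ j‖ ≤ 6 * B := by
  calc ‖∑ σ, ∑ j, f σ j‖ ≤ ∑ _σ : ℤˣ, ∑ _j : Fin 3, B :=
        norm_sum_le_of_le _ fun σ _ => norm_sum_le_of_le _ fun j _ => h σ j
    _ = 6 * B := by simp; ring

theorem mulOp_wmul_winv {h : R3 → ℂ} (h0 : Integrable h) (h1 : Integrable (wmul 1 h)) (x : R3)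
    (a : Sym) : mulOp (wmul 1 h) x (Sym.winv * a) = mulOp h x a := by
  rw [mulOp_apply h1, mulOp_apply h0]
  refine congrArg (fun f : R3 → ℂ => 𝓕⁻ f x) (funext fun ξ => ?_)
  have hw : (wt ξ : ℂ) ≠ 0 := by exact_mod_cast (wt_pos ξ).ne'
  rw [Sym.mul_apply, Sym.winv_apply, wmul]
  push_cast
  field_simp

theorem const_I_mul_const_neg_I : Sym.const Complex.I * Sym.const (-Complex.I) = 1 := by
  ext ξ
  simp [Sym.mul_apply, Sym.const_apply]

/-- Multipliers `(iω)⁻¹ ...` of the form `-i⟨D⟩⁻¹ r`, with `r` of order zero. -/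
def velOp (h : R3 → ℂ) (x : R3) : Sym →L[ℝ] ℂ :=
  (mulOp h x).comp (ContinuousLinearMap.mul ℝ Sym (Sym.const (-Complex.I) * Sym.winv))

/-- The gradient of `velOp` in the point: again a multiplier of order zero. -/
def gradVel (h : R3 → ℂ) (x : R3) : R3 →L[ℝ] Sym →L[ℝ] ℂ :=
  ((ContinuousLinearMap.compL ℝ Sym Sym ℂ (mulOp h x)).comp (ContinuousLinearMap.mul ℝ Sym)).comp
    Sym.kdir

theorem gradVel_apply (h : R3 → ℂ) (x e : R3) (r : Sym) :
    gradVel h x e r = mulOp h x (Sym.kdir e * r) := rfl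

theorem norm_gradVel_le (h : R3 → ℂ) (x : R3) : ‖gradVel h x‖ ≤ ‖mulOp h x‖ * ‖Sym.kdir‖ := by
  refine ContinuousLinearMap.opNorm_le_bound _ (by positivity) fun e => ?_
  refine ContinuousLinearMap.opNorm_le_bound _ (by positivity) fun r => ?_
  rw [gradVel_apply]
  refine ((mulOp h x).le_opNorm _).trans ?_
  have := (norm_mul_le (Sym.kdir e) r).trans
    (mul_le_mul_of_nonneg_right (Sym.kdir.le_opNorm e) (norm_nonneg r))
  calc _ ≤ ‖mulOp h x‖ * (‖Sym.kdir‖ * ‖e‖ * ‖r‖) := by gcongr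
    _ = _ := by ring

theorem hasFDerivAt_velOp {h : R3 → ℂ} (hm : AEStronglyMeasurable h)
    (h2 : Integrable (wmul 2 h)) (x : R3) : HasFDerivAt (velOp h) (gradVel h x) x := by
  have h1 : Integrable (wmul 1 h) := integrable_wmul_of_le (by norm_num) hm h2
  have h0 : Integrable h := by
    simpa [wmul_zero] using integrable_wmul_of_le (Nat.zero_le 2) hm h2
  have := ((ContinuousLinearMap.compL ℝ Sym Sym ℂ).flip (ContinuousLinearMap.mul ℝ Sym
    (Sym.const (-Complex.I) * Sym.winv))).hasFDerivAt.comp x (hasFDerivAt_mulOp hm h2 x)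
  refine this.congr_fderiv ?_
  ext e r
  change mulOp (wmul 1 h) x (dsym e * (Sym.const (-Complex.I) * Sym.winv * r)) =
    mulOp h x (Sym.kdir e * r)
  rw [← mulOp_wmul_winv h0 h1, dsym_apply]
  congr 1
  linear_combination (Sym.winv * Sym.kdir e * r) * const_I_mul_const_neg_I

theorem rot_add_dsym_hat (σ : ℤˣ) (v : R3) :
    rot σ + dsym (hat v) = Sym.const Complex.I * Sym.phase σ v := by
  ext ξ
  simp only [rot, dsym_apply, Sym.add_apply, Sym.mul_apply, Sym.const_apply, Sym.kdir_apply,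
    Sym.phase_apply]
  ring

/-- The symbol of `(λ_± + ik·v̂)⁻¹`. -/
def symA (σ : ℤˣ) (v : R3) : Sym := Sym.const (-Complex.I) * Sym.winv * Sym.resolvent σ v

/-- The symbol of `∂_e (λ_± + ik·v̂)⁻¹`. -/
def symB (σ : ℤˣ) (v : R3) : R3 →L[ℝ] Sym :=
  ((ContinuousLinearMap.mul ℝ Sym).flip (Sym.resolvent σ v)).comp Sym.kdir

/-- The symbol of `∂_e (λ_± + ik·v̂)⁻²`. -/
def symC (σ : ℤˣ) (v : R3) : R3 →L[ℝ] Sym :=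
  ((ContinuousLinearMap.mul ℝ Sym).flip (symA σ v * Sym.resolvent σ v)).comp Sym.kdir

theorem symB_apply (σ : ℤˣ) (v e : R3) : symB σ v e = Sym.kdir e * Sym.resolvent σ v := rfl

theorem symC_apply (σ : ℤˣ) (v e : R3) :
    symC σ v e = Sym.kdir e * (symA σ v * Sym.resolvent σ v) := rfl

theorem contDiff_symA (σ : ℤˣ) : ContDiff ℝ ∞ (symA σ) :=
  contDiff_const.mul (Sym.contDiff_resolvent σ)

theorem contDiff_symB (σ : ℤˣ) : ContDiff ℝ ∞ (symB σ) :=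
  ((ContinuousLinearMap.mul ℝ Sym).flip.contDiff.comp (Sym.contDiff_resolvent σ)).clm_comp
    contDiff_const

theorem contDiff_symC (σ : ℤˣ) : ContDiff ℝ ∞ (symC σ) :=
  ((ContinuousLinearMap.mul ℝ Sym).flip.contDiff.comp
    ((contDiff_symA σ).mul (Sym.contDiff_resolvent σ))).clm_comp contDiff_const

theorem osc_mul_symA (σ : ℤˣ) (v : R3) : (rot σ + dsym (hat v)) * symA σ v = Sym.winv * 1 := by
  rw [rot_add_dsym_hat, symA]
  linear_combination (Sym.phase σ v * Sym.winv * Sym.resolvent σ v) * const_I_mul_const_neg_I +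
    Sym.winv * Sym.phase_mul_resolvent σ v

theorem osc_mul_symB (σ : ℤˣ) (v e : R3) : (rot σ + dsym (hat v)) * symB σ v e = dsym e := by
  rw [rot_add_dsym_hat, symB_apply, dsym_apply]
  linear_combination (Sym.const Complex.I * Sym.kdir e) * Sym.phase_mul_resolvent σ v

theorem osc_mul_symC (σ : ℤˣ) (v e : R3) :
    (rot σ + dsym (hat v)) * symC σ v e = Sym.winv * symB σ v e := by
  rw [symC_apply, symB_apply]
  linear_combination (Sym.kdir e * Sym.resolvent σ v) * osc_mul_symA σ v

section Fields

variable (S0 : ℤˣ → Lp ℂ 2 (volume : Measure R3)) (S : ℤˣ → ℝ → R3 → ℂ) (Er : ℝ → R3 → R3)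

/-- The real vector field obtained by applying the multipliers `m σ` to `E^osc`. -/
def oscVec (t : ℝ) (x : R3) (m : ℤˣ → Sym) : R3 :=
  ∑ σ, ∑ j, compVec j (mulOp (osc S0 S σ j t) x (m σ))

/-- `oscVec` for multipliers that depend linearly on a vector. -/
def oscVecL (t : ℝ) (x : R3) (m : ℤˣ → R3 →L[ℝ] Sym) : R3 →L[ℝ] R3 :=
  ∑ σ, ∑ j, (compVec j).comp ((mulOp (osc S0 S σ j t) x).comp (m σ))

/-- The contribution of the sources `S` to the time derivative of `oscVec`. -/
def srcVec (t : ℝ) (x : R3) (m : ℤˣ → Sym) : R3 :=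
  ∑ σ, ∑ j, compVec j (mulOp (𝓕 (S σ t)) x (srcSym σ j * m σ))

/-- `srcVec` for multipliers that depend linearly on a vector. -/
def srcVecL (t : ℝ) (x : R3) (m : ℤˣ → R3 →L[ℝ] Sym) : R3 →L[ℝ] R3 :=
  ∑ σ, ∑ j, (compVec j).comp ((mulOp (𝓕 (S σ t)) x).comp
    ((ContinuousLinearMap.mul ℝ Sym (srcSym σ j)).comp (m σ)))

/-- The gradient of the oscillating field `∑_± E^osc_±`. -/
def gradOsc (t : ℝ) (x : R3) : R3 →L[ℝ] R3 :=
  ∑ σ, ∑ j, (compVec j).comp ((mulOp (wmul 1 (osc S0 S σ j t)) x).comp dsym)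

/-- The gradient of `E^r`. -/
def gradEr (t : ℝ) (x : R3) : R3 →L[ℝ] R3 :=
  ∑ j, (compVec j).comp ((gradOp (𝓕 (erComp Er j t)) x).flip 1)

theorem oscVecL_apply (t : ℝ) (x : R3) (m : ℤˣ → R3 →L[ℝ] Sym) (e : R3) :
    oscVecL S0 S t x m e = oscVec S0 S t x fun σ => m σ e := by
  simp [oscVecL, oscVec]

theorem srcVecL_apply (t : ℝ) (x : R3) (m : ℤˣ → R3 →L[ℝ] Sym) (e : R3) :
    srcVecL S t x m e = srcVec S t x fun σ => m σ e := by
  simp [srcVecL, srcVec]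

theorem gradOsc_apply (t : ℝ) (x e : R3) : gradOsc S0 S t x e =
    ∑ σ, ∑ j, compVec j (mulOp (wmul 1 (osc S0 S σ j t)) x (dsym e)) := by
  simp [gradOsc]

end Fields

theorem clm_eq_sum_smulRight {F : Type*} [NormedAddCommGroup F] [NormedSpace ℝ F]
    (L : R3 →L[ℝ] F) : L = ∑ i, ContinuousLinearMap.smulRightL ℝ R3 F
      (EuclideanSpace.proj (𝕜 := ℝ) i) (L (EuclideanSpace.single i 1)) := by
  ext y
  have e : y = ∑ i, y i • EuclideanSpace.single i (1 : ℝ) := by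
    ext i
    simp [Finset.sum_apply, Pi.single_apply]
  conv_lhs => rw [e]
  simp

theorem hasDerivWithinAt_clm_of_apply {F : Type*} [NormedAddCommGroup F] [NormedSpace ℝ F]
    {L : ℝ → R3 →L[ℝ] F} {L' : R3 →L[ℝ] F} {s : Set ℝ} {τ : ℝ}
    (h : ∀ e, HasDerivWithinAt (fun r => L r e) (L' e) s τ) : HasDerivWithinAt L L' s τ := by
  rw [clm_eq_sum_smulRight L', funext fun r => clm_eq_sum_smulRight (L r)]
  exact HasDerivWithinAt.fun_sum fun i _ =>
    (ContinuousLinearMap.smulRightL ℝ R3 F _).hasFDerivAt.comp_hasDerivWithinAt τ (h _)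

namespace Bootstrap

variable {α₀ : ℕ} {ε T : ℝ} {S0 : ℤˣ → Lp ℂ 2 (volume : Measure R3)}
    {S : ℤˣ → ℝ → R3 → ℂ} {Er : ℝ → R3 → R3}

/-- The time derivative of a multiplier of `E^osc` along a curve: the oscillator, the
sources, and the variation of the symbol with the velocity. -/
theorem hasDerivWithinAt_oscVec (hb : Bootstrap α₀ ε T S0 S Er) (hα : 8 ≤ α₀) (hε : 0 < ε)
    {t₁ : ℝ} (ht : t₁ < T) {X V : ℝ → R3} {X' V' : R3} {τ : ℝ} (hτ : τ ∈ Icc 0 t₁)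
    (hX : HasDerivWithinAt X X' (Icc 0 t₁) τ) (hV : HasDerivWithinAt V V' (Icc 0 t₁) τ)
    {m : ℤˣ → R3 → Sym} (hm : ∀ σ, ContDiff ℝ ∞ (m σ)) :
    HasDerivWithinAt (fun r => oscVec S0 S r (X r) fun σ => m σ (V r))
      ((∑ σ, ∑ j, compVec j (mulOp (wmul 1 (osc S0 S σ j τ)) (X τ)
        ((rot σ + dsym X') * m σ (V τ)))) + srcVec S τ (X τ) (fun σ => m σ (V τ)) +
        oscVec S0 S τ (X τ) fun σ => fderiv ℝ (m σ) (V τ) V') (Icc 0 t₁) τ := by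
  have h0 : 0 ≤ t₁ := hτ.1.trans hτ.2
  have key : ∀ σ j, HasDerivWithinAt (fun r => compVec j (mulOp (osc S0 S σ j r) (X r) (m σ (V r))))
      (compVec j (mulOp (wmul 1 (osc S0 S σ j τ)) (X τ) ((rot σ + dsym X') * m σ (V τ))) +
        compVec j (mulOp (𝓕 (S σ τ)) (X τ) (srcSym σ j * m σ (V τ))) +
        compVec j (mulOp (osc S0 S σ j τ) (X τ) (fderiv ℝ (m σ) (V τ) V'))) (Icc 0 t₁) τ := by
    intro σ j
    obtain ⟨A, B, H⟩ := hb.evolves hα hε σ j h0 ht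
    have hmV : HasDerivWithinAt (fun r => m σ (V r)) (fderiv ℝ (m σ) (V τ) V') (Icc 0 t₁) τ :=
      ((hm σ).differentiable (by simp) (V τ)).hasFDerivAt.comp_hasDerivWithinAt τ hV
    have h1 := (compVec j).hasFDerivAt.comp_hasDerivWithinAt τ (H.hasDerivWithinAt_mulOp hτ hX hmV)
    rw [clampTime_of_mem h0 (S σ) hτ, osc_clampTime S0 S σ j h0 hτ, map_add, map_add] at h1
    refine h1.congr (fun r hr => ?_) ?_
    · simp only [Function.comp, osc_clampTime S0 S σ j h0 hr]
    · simp only [Function.comp, osc_clampTime S0 S σ j h0 hτ]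
  have := HasDerivWithinAt.fun_sum fun σ (_ : σ ∈ Finset.univ) =>
    HasDerivWithinAt.fun_sum fun j (_ : j ∈ Finset.univ) => key σ j
  refine this.congr_deriv ?_
  simp only [Finset.sum_add_distrib, srcVec, oscVec]

theorem mulOp_osc_wmul_winv (hb : Bootstrap α₀ ε T S0 S Er) (hα : 8 ≤ α₀) (hε : 0 < ε) {t : ℝ}
    (ht : t ∈ Ico 0 T) (σ : ℤˣ) (j : Fin 3) (x : R3) (a : Sym) :
    mulOp (wmul 1 (osc S0 S σ j t)) x (Sym.winv * a) = mulOp (osc S0 S σ j t) x a :=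
  mulOp_wmul_winv (hb.integrable_osc hα hε σ j ht)
    ((hb.sobBound_osc hε σ j ht).1.wmul_le (by omega)).1 x a

theorem hasDerivWithinAt_symA (hb : Bootstrap α₀ ε T S0 S Er) (hα : 8 ≤ α₀) (hε : 0 < ε)
    {t₁ : ℝ} (ht : t₁ < T) {X V : ℝ → R3} {V' : R3} {τ : ℝ} (hτ : τ ∈ Icc 0 t₁)
    (hX : HasDerivWithinAt X (hat (V τ)) (Icc 0 t₁) τ) (hV : HasDerivWithinAt V V' (Icc 0 t₁) τ) :
    HasDerivWithinAt (fun r => oscVec S0 S r (X r) fun σ => symA σ (V r))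
      (oscVec S0 S τ (X τ) (fun _ => 1) + srcVec S τ (X τ) (fun σ => symA σ (V τ)) +
        oscVec S0 S τ (X τ) fun σ => fderiv ℝ (symA σ) (V τ) V') (Icc 0 t₁) τ := by
  refine (hb.hasDerivWithinAt_oscVec hα hε ht hτ hX hV contDiff_symA).congr_deriv ?_
  congr 2
  refine Finset.sum_congr rfl fun σ _ => Finset.sum_congr rfl fun j _ => ?_
  rw [osc_mul_symA, hb.mulOp_osc_wmul_winv hα hε ⟨hτ.1, hτ.2.trans_lt ht⟩]

theorem fderiv_apply_clm {G : Type*} [NormedAddCommGroup G] [NormedSpace ℝ G]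
    {m : R3 → R3 →L[ℝ] G} (hm : ContDiff ℝ ∞ m) (v w e : R3) :
    fderiv ℝ (fun v => m v e) v w = fderiv ℝ m v w e := by
  have := ((hm.differentiable (by simp) v).hasFDerivAt.clm_apply (hasFDerivAt_const e v)).fderiv
  rw [this]
  simp

theorem hasDerivWithinAt_symB (hb : Bootstrap α₀ ε T S0 S Er) (hα : 8 ≤ α₀) (hε : 0 < ε)
    {t₁ : ℝ} (ht : t₁ < T) {X V : ℝ → R3} {V' : R3} {τ : ℝ} (hτ : τ ∈ Icc 0 t₁)
    (hX : HasDerivWithinAt X (hat (V τ)) (Icc 0 t₁) τ) (hV : HasDerivWithinAt V V' (Icc 0 t₁) τ) :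
    HasDerivWithinAt (fun r => oscVecL S0 S r (X r) fun σ => symB σ (V r))
      (gradOsc S0 S τ (X τ) + srcVecL S τ (X τ) (fun σ => symB σ (V τ)) +
        oscVecL S0 S τ (X τ) fun σ => fderiv ℝ (symB σ) (V τ) V') (Icc 0 t₁) τ := by
  refine hasDerivWithinAt_clm_of_apply fun e => ?_
  simp only [add_apply, oscVecL_apply, srcVecL_apply]
  refine (hb.hasDerivWithinAt_oscVec hα hε ht hτ hX hV (m := fun σ v => symB σ v e)
    fun σ => (contDiff_symB σ).clm_apply contDiff_const).congr_deriv ?_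
  congr 2
  · rw [gradOsc_apply]
    refine Finset.sum_congr rfl fun σ _ => Finset.sum_congr rfl fun j _ => ?_
    rw [osc_mul_symB]
  · ext1 σ
    exact fderiv_apply_clm (contDiff_symB σ) _ _ _

theorem hasDerivWithinAt_symC (hb : Bootstrap α₀ ε T S0 S Er) (hα : 8 ≤ α₀) (hε : 0 < ε)
    {t₁ : ℝ} (ht : t₁ < T) {X V : ℝ → R3} {V' : R3} {τ : ℝ} (hτ : τ ∈ Icc 0 t₁)
    (hX : HasDerivWithinAt X (hat (V τ)) (Icc 0 t₁) τ) (hV : HasDerivWithinAt V V' (Icc 0 t₁) τ) :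
    HasDerivWithinAt (fun r => oscVecL S0 S r (X r) fun σ => symC σ (V r))
      (oscVecL S0 S τ (X τ) (fun σ => symB σ (V τ)) + srcVecL S τ (X τ) (fun σ => symC σ (V τ)) +
        oscVecL S0 S τ (X τ) fun σ => fderiv ℝ (symC σ) (V τ) V') (Icc 0 t₁) τ := by
  refine hasDerivWithinAt_clm_of_apply fun e => ?_
  simp only [add_apply, oscVecL_apply, srcVecL_apply]
  refine (hb.hasDerivWithinAt_oscVec hα hε ht hτ hX hV (m := fun σ v => symC σ v e)
    fun σ => (contDiff_symC σ).clm_apply contDiff_const).congr_deriv ?_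
  congr 2
  · refine Finset.sum_congr rfl fun σ _ => Finset.sum_congr rfl fun j _ => ?_
    rw [osc_mul_symC, hb.mulOp_osc_wmul_winv hα hε ⟨hτ.1, hτ.2.trans_lt ht⟩]
  · ext1 σ
    exact fderiv_apply_clm (contDiff_symC σ) _ _ _

end Bootstrap

namespace Bootstrap

variable {α₀ : ℕ} {ε T : ℝ} {S0 : ℤˣ → Lp ℂ 2 (volume : Measure R3)}
    {S : ℤˣ → ℝ → R3 → ℂ} {Er : ℝ → R3 → R3}

theorem field_eq (hb : Bootstrap α₀ ε T S0 S Er) (hα : 8 ≤ α₀) (hε : 0 < ε) {t : ℝ}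
    (ht : t ∈ Ico 0 T) (x : R3) :
    field S0 S Er t x = oscVec S0 S t x (fun _ => 1) + Er t x := by
  rw [field, oscVec, Finset.sum_comm]
  congr 1
  simp_rw [← map_sum]
  rw [sum_compVec]
  ext j
  rw [revec]
  simp only [WithLp.ofLp_sum, Finset.sum_apply]
  congr 1
  refine Finset.sum_congr rfl fun σ _ => ?_
  rw [hb.Eosc_apply hα hε σ j ht, mulOp_apply (hb.integrable_osc hα hε σ j ht)]
  simp

theorem Vosc_eq (hb : Bootstrap α₀ ε T S0 S Er) (hα : 8 ≤ α₀) (hε : 0 < ε) {t : ℝ}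
    (ht : t ∈ Ico 0 T) (x v : R3) :
    Vosc S0 S t x v = oscVec S0 S t x fun σ => symA σ v := by
  rw [Vosc, oscVec, Finset.sum_comm]
  simp_rw [← map_sum]
  rw [sum_compVec]
  ext j
  rw [revec]
  simp only [WithLp.ofLp_sum, Finset.sum_apply]
  congr 1
  refine Finset.sum_congr rfl fun σ _ => ?_
  have e : ∀ ξ i, ((omega σ v (waveVec ξ) ^ 1)⁻¹ • oscHat S0 S σ t ξ) i =
      symA σ v ξ * osc S0 S σ i t ξ := fun ξ i => by
    rw [pow_one, Sym.omega_inv]; rfl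
  have hi : Integrable fun ξ => (omega σ v (waveVec ξ) ^ 1)⁻¹ • oscHat S0 S σ t ξ :=
    integrable_of_comp fun i => by
      simp_rw [e]; exact Sym.integrable_mul _ (hb.integrable_osc hα hε σ i ht)
  rw [mulOp_apply (hb.integrable_osc hα hε σ j ht), oscField, fourierInv_apply_comp hi]
  simp_rw [e]

theorem Er_eq (hb : Bootstrap α₀ ε T S0 S Er) (hα : 8 ≤ α₀) (hε : 0 < ε) {t : ℝ}
    (ht : t ∈ Ico 0 T) (x : R3) :
    Er t x = ∑ j, compVec j (mulOp (𝓕 (erComp Er j t)) x 1) := by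
  rw [sum_compVec]
  ext j
  change Er t x j = (mulOp (𝓕 (erComp Er j t)) x 1).re
  rw [mulOp_apply ((hb.sobBound_erComp hε j ht).integrable (by omega))]
  simp only [Sym.one_apply, one_mul]
  have := hb.fourierInv_erComp hα hε j ht
  exact (congrArg Complex.re (congrFun this x)).symm

/-- Bounds on two moments, uniform on compact time intervals. -/
theorem exists_moment_bound (hb : Bootstrap α₀ ε T S0 S Er) (hα : 8 ≤ α₀) (hε : 0 < ε) {t₁ : ℝ}
    (ht : t₁ < T) : ∃ B, 0 ≤ B ∧ ∀ τ ∈ Icc 0 t₁,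
      (∀ σ j, ∀ i ≤ 2, Integrable (wmul i (osc S0 S σ j τ)) ∧
        ∫ ξ, ‖wmul i (osc S0 S σ j τ) ξ‖ ≤ B) ∧
      ∀ j, ∀ i ≤ 2, Integrable (wmul i (𝓕 (erComp Er j τ))) ∧
        ∫ ξ, ‖wmul i (𝓕 (erComp Er j τ)) ξ‖ ≤ B := by
  refine ⟨√(sphereArea * Real.pi) * (ε * bracket t₁ ^ delta α₀ 1), ?_, fun τ hτ => ?_⟩
  · exact mul_nonneg (Real.sqrt_nonneg _)
      (mul_nonneg hε.le (Real.rpow_nonneg (bracket_pos t₁).le _))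
  have hτ' : τ ∈ Ico 0 T := ⟨hτ.1, hτ.2.trans_lt ht⟩
  have hd := (delta_one_pos hα).le
  constructor
  · intro σ j i hi
    have := (hb.sobBound_osc hε σ j hτ').1.wmul_le (j := i) (by omega)
    exact ⟨this.1, this.2.trans (mul_le_mul_of_nonneg_left (le_mul_of_one_le_right hε.le
      (Real.one_le_rpow (one_le_bracket _) hd)) (Real.sqrt_nonneg _))⟩
  · intro j i hi
    have := (hb.sobBound_erComp hε j hτ').wmul_le (j := i) (by omega)
    exact ⟨this.1, this.2.trans (mul_le_mul_of_nonneg_left (mul_le_mul_of_nonneg_left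
      (Real.rpow_le_rpow (bracket_pos τ).le (bracket_mono hτ.1 hτ.2) hd) hε.le)
      (Real.sqrt_nonneg _))⟩

theorem meas_erComp (hb : Bootstrap α₀ ε T S0 S Er) (hε : 0 < ε) (j : Fin 3) {t : ℝ}
    (ht : t ∈ Ico 0 T) : AEStronglyMeasurable (𝓕 (erComp Er j t)) :=
  (hb.sobBound_erComp hε j ht).meas

/-- Uniform Taylor expansion of the field. -/
theorem field_taylor (hb : Bootstrap α₀ ε T S0 S Er) (hα : 8 ≤ α₀) (hε : 0 < ε) {t₁ : ℝ}
    (ht : t₁ < T) : ∃ C, 0 ≤ C ∧ ∀ τ ∈ Icc 0 t₁, ∀ x y,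
      ‖field S0 S Er τ (x + y) - field S0 S Er τ x - (gradOsc S0 S τ x + gradEr Er τ x) y‖ ≤
        C * ‖y‖ ^ 2 := by
  obtain ⟨B, hB, H⟩ := hb.exists_moment_bound hα hε ht
  have aux : ∀ {h : R3 → ℂ}, AEStronglyMeasurable h →
      Integrable (wmul 2 h) → ∫ ξ, ‖wmul 2 h ξ‖ ≤ B → ∀ (j : Fin 3) (x y : R3),
      ‖compVec j (mulOp h (x + y) 1) - compVec j (mulOp h x 1) - compVec j (gradOp h x y 1)‖ ≤
        2 * B * ‖(1 : Sym)‖ * ‖y‖ ^ 2 := by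
    intro h hm h2 hB2 j x y
    rw [← map_sub, ← map_sub]
    refine ((compVec j).le_of_opNorm_le (norm_compVec_le j) _).trans ?_
    rw [one_mul]
    have h3 := (mulOp h (x + y) - mulOp h x - gradOp h x y).le_of_opNorm_le
      (norm_mulOp_taylor_le hm h2 x y) 1
    calc _ ≤ _ := h3
      _ ≤ 2 * B * ‖y‖ ^ 2 * ‖(1 : Sym)‖ := by gcongr
      _ = _ := by ring
  refine ⟨6 * (2 * B * ‖(1 : Sym)‖) + 3 * (2 * B * ‖(1 : Sym)‖), by positivity,
    fun τ hτ x y => ?_⟩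
  have hτ' : τ ∈ Ico 0 T := ⟨hτ.1, hτ.2.trans_lt ht⟩
  rw [hb.field_eq hα hε hτ', hb.field_eq hα hε hτ', hb.Er_eq hα hε hτ', hb.Er_eq hα hε hτ']
  have e : oscVec S0 S τ (x + y) (fun _ => 1) +
      ∑ j, compVec j (mulOp (𝓕 (erComp Er j τ)) (x + y) 1) -
      (oscVec S0 S τ x (fun _ => 1) + ∑ j, compVec j (mulOp (𝓕 (erComp Er j τ)) x 1)) -
      (gradOsc S0 S τ x + gradEr Er τ x) y =
      (∑ σ, ∑ j, (compVec j (mulOp (osc S0 S σ j τ) (x + y) 1) -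
        compVec j (mulOp (osc S0 S σ j τ) x 1) - compVec j (gradOp (osc S0 S σ j τ) x y 1))) +
      ∑ j, (compVec j (mulOp (𝓕 (erComp Er j τ)) (x + y) 1) -
        compVec j (mulOp (𝓕 (erComp Er j τ)) x 1) -
        compVec j (gradOp (𝓕 (erComp Er j τ)) x y 1)) := by
    rw [add_apply, gradOsc_apply]
    have e2 : gradEr Er τ x y = ∑ j, compVec j (gradOp (𝓕 (erComp Er j τ)) x y 1) := by
      simp [gradEr]
    simp only [e2, oscVec, Finset.sum_sub_distrib, gradOp_apply, mul_one]
    abel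
  rw [e]
  have hτm := H τ hτ
  have hsum := norm_sum_sum_le (f := fun σ j => compVec j (mulOp (osc S0 S σ j τ) (x + y) 1) -
    compVec j (mulOp (osc S0 S σ j τ) x 1) - compVec j (gradOp (osc S0 S σ j τ) x y 1))
    fun σ j => aux (hb.sobBound_osc hε σ j hτ').1.meas (hτm.1 σ j 2 le_rfl).1
      (hτm.1 σ j 2 le_rfl).2 j x y
  have hsum2 : ‖∑ j, (compVec j (mulOp (𝓕 (erComp Er j τ)) (x + y) 1) -
        compVec j (mulOp (𝓕 (erComp Er j τ)) x 1) -
        compVec j (gradOp (𝓕 (erComp Er j τ)) x y 1))‖ ≤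
      ∑ _j : Fin 3, 2 * B * ‖(1 : Sym)‖ * ‖y‖ ^ 2 :=
    norm_sum_le_of_le _ fun j _ => aux (hb.meas_erComp hε j hτ') (hτm.2 j 2 le_rfl).1
      (hτm.2 j 2 le_rfl).2 j x y
  refine (norm_add_le _ _).trans ((add_le_add hsum hsum2).trans (le_of_eq ?_))
  simp
  ring

theorem continuousOn_gradOsc (hb : Bootstrap α₀ ε T S0 S Er) (hα : 8 ≤ α₀) (hε : 0 < ε) {t₁ : ℝ}
    (h0 : 0 ≤ t₁) (ht : t₁ < T) :
    ContinuousOn (fun z : ℝ × R3 => gradOsc S0 S z.1 z.2) (Icc 0 t₁ ×ˢ univ) := by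
  refine continuousOn_clm_apply.2 fun e => ?_
  simp only [gradOsc_apply]
  refine continuousOn_finsetSum _ fun σ _ => continuousOn_finsetSum _ fun j _ => ?_
  obtain ⟨A, B', H'⟩ := hb.evolves hα hε σ j h0 ht
  refine (compVec j).continuous.comp_continuousOn ?_
  refine ((H'.continuousOn_mulOp le_rfl).clm_apply (continuousOn_const (c := dsym e))).congr fun z hz => ?_
  simp only [osc_clampTime S0 S σ j h0 hz.1]

theorem continuousOn_gradEr (hb : Bootstrap α₀ ε T S0 S Er) (hα : 8 ≤ α₀) (hε : 0 < ε) {t₁ : ℝ}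
    (ht : t₁ < T) :
    ContinuousOn (fun z : ℝ × R3 => gradEr Er z.1 z.2) (Icc 0 t₁ ×ˢ univ) := by
  obtain ⟨B, hB, H⟩ := hb.exists_moment_bound hα hε ht
  have hsub : Icc 0 t₁ ⊆ Ico 0 T := fun τ hτ => ⟨hτ.1, hτ.2.trans_lt ht⟩
  refine continuousOn_clm_apply.2 fun e => ?_
  have e2 : ∀ z : ℝ × R3, gradEr Er z.1 z.2 e =
      ∑ j, compVec j (mulOp (wmul 1 (𝓕 (erComp Er j z.1))) z.2 (dsym e * 1)) := fun z => by
    simp [gradEr, gradOp_apply]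
  simp only [e2]
  refine continuousOn_finsetSum _ fun j _ => (compVec j).continuous.comp_continuousOn ?_
  exact continuousOn_mulOp_fourier (j := 1) ((hb.continuousOn_erComp j).mono
    (prod_mono_left hsub)) (fun τ hτ => hb.integrable_erComp hε j (hsub hτ))
    (fun τ hτ => hb.norm_erComp_le hε j (hsub hτ)) (fun τ hτ => ((H τ hτ).2 j 2 le_rfl).1)
    (fun τ hτ => ((H τ hτ).2 j 2 le_rfl).2) _

theorem exists_norm_grad_le (hb : Bootstrap α₀ ε T S0 S Er) (hα : 8 ≤ α₀) (hε : 0 < ε) {t₁ : ℝ}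
    (ht : t₁ < T) : ∃ C, 0 ≤ C ∧ ∀ τ ∈ Icc 0 t₁, ∀ x,
      ‖gradOsc S0 S τ x + gradEr Er τ x‖ ≤ C := by
  obtain ⟨B, hB, H⟩ := hb.exists_moment_bound hα hε ht
  refine ⟨6 * (B * ‖dsym‖) + 3 * (B * ‖dsym‖ * ‖(1 : Sym)‖), by positivity, fun τ hτ x => ?_⟩
  have hm : ∀ {h : R3 → ℂ}, ∫ ξ, ‖h ξ‖ ≤ B → ‖mulOp h x‖ ≤ B := fun h =>
    (norm_mulOp_le_integral _ x).trans h
  refine (norm_add_le _ _).trans (add_le_add ?_ ?_)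
  · refine norm_sum_sum_le fun σ j => ?_
    refine (ContinuousLinearMap.opNorm_comp_le _ _).trans ?_
    refine (mul_le_of_le_one_left (norm_nonneg _) (norm_compVec_le j)).trans ?_
    refine (ContinuousLinearMap.opNorm_comp_le _ _).trans ?_
    exact mul_le_mul_of_nonneg_right (hm ((H τ hτ).1 σ j 1 (by norm_num)).2) (norm_nonneg _)
  · calc _ ≤ ∑ _j : Fin 3, B * ‖dsym‖ * ‖(1 : Sym)‖ := norm_sum_le_of_le _ fun j _ => ?_
      _ = _ := by simp
    refine (ContinuousLinearMap.opNorm_comp_le _ _).trans ?_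
    refine (mul_le_of_le_one_left (norm_nonneg _) (norm_compVec_le j)).trans ?_
    refine ContinuousLinearMap.opNorm_le_bound _ (by positivity) fun y => ?_
    rw [ContinuousLinearMap.flip_apply, gradOp_apply]
    refine ((mulOp _ x).le_of_opNorm_le (hm ((H τ hτ).2 j 1 (by norm_num)).2) _).trans ?_
    calc B * ‖dsym y * 1‖ ≤ B * (‖dsym‖ * ‖y‖ * ‖(1 : Sym)‖) := by
          gcongr
          exact (norm_mul_le _ _).trans (mul_le_mul_of_nonneg_right (dsym.le_opNorm y)
            (norm_nonneg _))
      _ = _ := by ring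

theorem hasFDerivAt_Er (hb : Bootstrap α₀ ε T S0 S Er) (hα : 8 ≤ α₀) (hε : 0 < ε) {t : ℝ}
    (ht : t ∈ Ico 0 T) (x : R3) : HasFDerivAt (Er t) (gradEr Er t x) x := by
  rw [funext (hb.Er_eq hα hε ht)]
  refine (HasFDerivAt.fun_sum fun j _ => (compVec j).hasFDerivAt.comp x
    ((ContinuousLinearMap.apply ℝ ℂ (1 : Sym)).hasFDerivAt.comp x (hasFDerivAt_mulOp
      (hb.meas_erComp hε j ht) ((hb.sobBound_erComp hε j ht).wmul_le (by omega)).1 x)))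

theorem norm_gradEr_le (hb : Bootstrap α₀ ε T S0 S Er) (hα : 8 ≤ α₀) (hε : 0 < ε) {t : ℝ}
    (ht : t ∈ Ico 0 T) (x : R3) : ‖gradEr Er t x‖ ≤ 3 * (ε * rate (delta α₀ 1) t ^ 2) := by
  have hB : 0 ≤ ε * rate (delta α₀ 1) t ^ 2 := by positivity
  have hd := fun x => hb.hasFDerivAt_Er hα hε ht x
  have hc : ContDiff ℝ 1 (Er t) := by
    rw [contDiff_one_iff_fderiv]
    refine ⟨fun x => (hd x).differentiableAt, ?_⟩
    rw [funext fun x => (hd x).fderiv]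
    exact continuous_slice (hb.continuousOn_gradEr hα hε ht.2) ⟨ht.1, le_rfl⟩
  refine norm_clm_le_of_basis _ hB fun i => ?_
  rw [← (hd x).fderiv]
  refine norm_fderiv_le_of_weakPartialBound hc hB ?_ x
  have := hb.decay_high_Er t ht ∞ le_top 1 le_rfl (by omega) (fun _ => i)
  rw [rate_sq]
  simpa only [invExp, ENNReal.inv_top, ENNReal.toReal_zero, sub_zero, mul_one] using this

end Bootstrap

/-! ### Normal form of the characteristic system -/

/-- The analytic input for the study of the characteristics of a field `E` on `[0,t₁]`.
Along the characteristics, `E = dF/dτ + O(η b²)` and `∇E = dG/dτ + O(η b²)`, where `F` and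
`G = ∂_x F` have size `η b`, with `b = rate δ τ`; and `G` is itself, up to `O(η b²)`, the
derivative of a function `H` of size `η b`. The bounds hold as long as the velocity stays in the
ball of radius `ρ`. -/
structure NormalForm (t₁ δ ρ η : ℝ) (E : ℝ → R3 → R3) (DE : ℝ → R3 → R3 →L[ℝ] R3)
    (F : ℝ → R3 → R3 → R3) (G Fv H : ℝ → R3 → R3 → R3 →L[ℝ] R3) : Prop where
  taylor : ∃ C, 0 ≤ C ∧ ∀ τ ∈ Icc 0 t₁, ∀ x y, ‖E τ (x + y) - E τ x - DE τ x y‖ ≤ C * ‖y‖ ^ 2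
  norm_DE : ∃ C, 0 ≤ C ∧ ∀ τ ∈ Icc 0 t₁, ∀ x, ‖DE τ x‖ ≤ C
  cont_DE : ContinuousOn (fun z : ℝ × R3 => DE z.1 z.2) (Icc 0 t₁ ×ˢ univ)
  norm_E : ∀ τ ∈ Icc 0 t₁, ∀ x, ‖E τ x‖ ≤ η * rate δ τ
  norm_F : ∀ τ ∈ Icc 0 t₁, ∀ x v, ‖v‖ ≤ ρ → ‖F τ x v‖ ≤ η * rate δ τ
  norm_G : ∀ τ ∈ Icc 0 t₁, ∀ x v, ‖v‖ ≤ ρ → ‖G τ x v‖ ≤ η * rate δ τ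
  norm_Fv : ∀ τ ∈ Icc 0 t₁, ∀ x v, ‖v‖ ≤ ρ → ‖Fv τ x v‖ ≤ η * rate δ τ
  norm_H : ∀ τ ∈ Icc 0 t₁, ∀ x v, ‖v‖ ≤ ρ → ‖H τ x v‖ ≤ η * rate δ τ
  fderiv_x : ∀ τ ∈ Icc 0 t₁, ∀ x v, HasFDerivAt (fun y => F τ y v) (G τ x v) x
  fderiv_v : ∀ τ ∈ Icc 0 t₁, ∀ x v, HasFDerivAt (fun w => F τ x w) (Fv τ x v) v
  deriv_F : ∀ {X V : ℝ → R3} {τ : ℝ}, τ ∈ Icc 0 t₁ →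
    HasDerivWithinAt X (hat (V τ)) (Icc 0 t₁) τ → HasDerivWithinAt V (E τ (X τ)) (Icc 0 t₁) τ →
    ∃ R : R3, HasDerivWithinAt (fun r => F r (X r) (V r)) (E τ (X τ) - R) (Icc 0 t₁) τ ∧
      (‖V τ‖ ≤ ρ → ‖R‖ ≤ η * rate δ τ ^ 2)
  deriv_G : ∀ {X V : ℝ → R3} {τ : ℝ}, τ ∈ Icc 0 t₁ →
    HasDerivWithinAt X (hat (V τ)) (Icc 0 t₁) τ → HasDerivWithinAt V (E τ (X τ)) (Icc 0 t₁) τ →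
    ∃ R : R3 →L[ℝ] R3, HasDerivWithinAt (fun r => G r (X r) (V r)) (DE τ (X τ) - R) (Icc 0 t₁) τ ∧
      (‖V τ‖ ≤ ρ → ‖R‖ ≤ η * rate δ τ ^ 2)
  deriv_H : ∀ {X V : ℝ → R3} {τ : ℝ}, τ ∈ Icc 0 t₁ →
    HasDerivWithinAt X (hat (V τ)) (Icc 0 t₁) τ → HasDerivWithinAt V (E τ (X τ)) (Icc 0 t₁) τ →
    ∃ R : R3 →L[ℝ] R3, HasDerivWithinAt (fun r => H r (X r) (V r)) (G τ (X τ) (V τ) + R)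
      (Icc 0 t₁) τ ∧ (‖V τ‖ ≤ ρ → ‖R‖ ≤ η * rate δ τ ^ 2)

theorem rate_le_one {δ : ℝ} (hδ : δ ≤ 3) (τ : ℝ) : rate δ τ ≤ 1 :=
  Real.rpow_le_one_of_one_le_of_nonpos (one_le_bracket τ) (by linarith)

section Bounds

variable {S0 : ℤˣ → Lp ℂ 2 (volume : Measure R3)} {S : ℤˣ → ℝ → R3 → ℂ} {t : ℝ} {x : R3} {A μ : ℝ}

theorem norm_compVec_apply_le (j : Fin 3) (z : ℂ) : ‖compVec j z‖ ≤ ‖z‖ := by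
  simpa using (compVec j).le_of_opNorm_le (norm_compVec_le j) z

theorem norm_oscVec_le (hA : ∀ σ j, ‖mulOp (osc S0 S σ j t) x‖ ≤ A) {m : ℤˣ → Sym}
    (hm : ∀ σ, ‖m σ‖ ≤ μ) : ‖oscVec S0 S t x m‖ ≤ 6 * (A * μ) := by
  refine norm_sum_sum_le fun σ j => (norm_compVec_apply_le _ _).trans ?_
  exact (ContinuousLinearMap.le_opNorm _ _).trans
    (mul_le_mul (hA σ j) (hm σ) (norm_nonneg _) ((norm_nonneg _).trans (hA σ j)))

theorem norm_oscVecL_le (hA : ∀ σ j, ‖mulOp (osc S0 S σ j t) x‖ ≤ A)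
    {m : ℤˣ → R3 →L[ℝ] Sym} (hm : ∀ σ, ‖m σ‖ ≤ μ) : ‖oscVecL S0 S t x m‖ ≤ 6 * (A * μ) := by
  have hA0 : 0 ≤ A := (norm_nonneg _).trans (hA 1 0)
  have hμ0 : 0 ≤ μ := (norm_nonneg _).trans (hm 1)
  refine ContinuousLinearMap.opNorm_le_bound _ (by positivity) fun e => ?_
  rw [oscVecL_apply]
  refine (norm_oscVec_le hA fun σ => (m σ).le_of_opNorm_le (hm σ) e).trans (le_of_eq (by ring))

theorem norm_srcVec_le (hA : ∀ σ, ‖mulOp (𝓕 (S σ t)) x‖ ≤ A) {Q : ℝ}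
    (hQ : ∀ σ j, ‖srcSym σ j‖ ≤ Q) {m : ℤˣ → Sym}
    (hm : ∀ σ, ‖m σ‖ ≤ μ) : ‖srcVec S t x m‖ ≤ 6 * (A * (Q * μ)) := by
  refine norm_sum_sum_le fun σ j => (norm_compVec_apply_le _ _).trans ?_
  refine (ContinuousLinearMap.le_opNorm _ _).trans
    (mul_le_mul (hA σ) ?_ (norm_nonneg _) ((norm_nonneg _).trans (hA σ)))
  exact (norm_mul_le _ _).trans (mul_le_mul (hQ σ j) (hm σ) (norm_nonneg _)
    ((norm_nonneg _).trans (hQ σ j)))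

theorem norm_srcVecL_le (hA : ∀ σ, ‖mulOp (𝓕 (S σ t)) x‖ ≤ A) {Q : ℝ}
    (hQ : ∀ σ j, ‖srcSym σ j‖ ≤ Q) {m : ℤˣ → R3 →L[ℝ] Sym}
    (hm : ∀ σ, ‖m σ‖ ≤ μ) : ‖srcVecL S t x m‖ ≤ 6 * (A * (Q * μ)) := by
  have hA0 : 0 ≤ A := (norm_nonneg _).trans (hA 1)
  have hμ0 : 0 ≤ μ := (norm_nonneg _).trans (hm 1)
  have hQ0 : 0 ≤ Q := (norm_nonneg _).trans (hQ 1 0)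
  refine ContinuousLinearMap.opNorm_le_bound _ (by positivity) fun e => ?_
  rw [srcVecL_apply]
  refine (norm_srcVec_le hA hQ fun σ => (m σ).le_of_opNorm_le (hm σ) e).trans (le_of_eq (by ring))

end Bounds

/-- Symbols that depend continuously on the velocity are bounded on balls. -/
theorem exists_bound_closedBall {F : Type*} [NormedAddCommGroup F] {g : ℤˣ → R3 → F}
    (hg : ∀ σ, Continuous (g σ)) (ρ : ℝ) :
    ∃ M, 0 ≤ M ∧ ∀ σ v, ‖v‖ ≤ ρ → ‖g σ v‖ ≤ M := by
  have h := fun σ => (isCompact_closedBall (0 : R3) ρ).exists_bound_of_continuousOn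
    (hg σ).continuousOn
  choose M hM using h
  refine ⟨∑ σ, |M σ|, by positivity, fun σ v hv => ?_⟩
  exact (hM σ v (by simpa using hv)).trans ((le_abs_self _).trans
    (Finset.single_le_sum (f := fun σ => |M σ|) (fun _ _ => abs_nonneg _) (Finset.mem_univ σ)))

theorem exists_symbol_bound (ρ : ℝ) : ∃ M, 0 ≤ M ∧ ∀ σ v, ‖v‖ ≤ ρ →
    (‖symA σ v‖ ≤ M ∧ ‖fderiv ℝ (symA σ) v‖ ≤ M) ∧ (‖symB σ v‖ ≤ M ∧ ‖fderiv ℝ (symB σ) v‖ ≤ M) ∧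
      (‖symC σ v‖ ≤ M ∧ ‖fderiv ℝ (symC σ) v‖ ≤ M) := by
  obtain ⟨M1, h1, H1⟩ := exists_bound_closedBall (fun σ => (contDiff_symA σ).continuous) ρ
  obtain ⟨M2, h2, H2⟩ := exists_bound_closedBall
    (fun σ => (contDiff_symA σ).continuous_fderiv (by simp)) ρ
  obtain ⟨M3, h3, H3⟩ := exists_bound_closedBall (fun σ => (contDiff_symB σ).continuous) ρ
  obtain ⟨M4, h4, H4⟩ := exists_bound_closedBall
    (fun σ => (contDiff_symB σ).continuous_fderiv (by simp)) ρ
  obtain ⟨M5, h5, H5⟩ := exists_bound_closedBall (fun σ => (contDiff_symC σ).continuous) ρ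
  obtain ⟨M6, h6, H6⟩ := exists_bound_closedBall
    (fun σ => (contDiff_symC σ).continuous_fderiv (by simp)) ρ
  refine ⟨M1 + M2 + M3 + M4 + M5 + M6, by positivity, fun σ v hv => ⟨⟨?_, ?_⟩, ⟨?_, ?_⟩, ?_, ?_⟩⟩
  · linarith [H1 σ v hv]
  · linarith [H2 σ v hv]
  · linarith [H3 σ v hv]
  · linarith [H4 σ v hv]
  · linarith [H5 σ v hv]
  · linarith [H6 σ v hv]

theorem exists_normalForm {α₀ : ℕ} (hα : 8 ≤ α₀) (ρ : ℝ) : ∃ K, 0 < K ∧ ∀ (ε T : ℝ)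
    (S0 : ℤˣ → Lp ℂ 2 (volume : Measure R3)) (S : ℤˣ → ℝ → R3 → ℂ) (Er : ℝ → R3 → R3), 0 < ε →
    ε ≤ 1 → Bootstrap α₀ ε T S0 S Er → ∀ t₁ ∈ Ico 0 T,
      NormalForm t₁ (delta α₀ 1) ρ (K * ε) (field S0 S Er)
        (fun τ x => gradOsc S0 S τ x + gradEr Er τ x)
        (Vosc S0 S) (fun τ x v => oscVecL S0 S τ x fun σ => symB σ v)
        (fun τ x v => oscVecL S0 S τ x fun σ => fderiv ℝ (symA σ) v)
        (fun τ x v => oscVecL S0 S τ x fun σ => symC σ v) := by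
  obtain ⟨C, hC, HC⟩ := exists_mulOp_decay hα
  obtain ⟨M, hM, HM⟩ := exists_symbol_bound ρ
  obtain ⟨Q, hQ, HQ⟩ : ∃ Q, 0 ≤ Q ∧ ∀ σ j, ‖srcSym σ j‖ ≤ Q := by
    refine ⟨∑ σ, ∑ j, ‖srcSym σ j‖, by positivity, fun σ j => ?_⟩
    exact (Finset.single_le_sum (f := fun j => ‖srcSym σ j‖) (fun _ _ => norm_nonneg _)
      (Finset.mem_univ j)).trans (Finset.single_le_sum (f := fun σ => ∑ j, ‖srcSym σ j‖)
        (fun _ _ => by positivity) (Finset.mem_univ σ))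
  set N := ‖(1 : Sym)‖ with hN
  have hN0 : 0 ≤ N := norm_nonneg _
  set kE := 6 * (C * N) + 1 with hkE
  have hkE0 : 0 ≤ kE := by positivity
  refine ⟨6 * (C * M) + kE + 3 + 6 * (C * (Q * M)) + 6 * (C * (M * kE)), by positivity, ?_⟩
  intro ε T S0 S Er hε hε1 hb t₁ ht₁
  have hmem : ∀ τ ∈ Icc 0 t₁, τ ∈ Ico 0 T := fun τ hτ => ⟨hτ.1, hτ.2.trans_lt ht₁.2⟩
  set δ := delta α₀ 1 with hδ
  have hδ1 : δ ≤ 1 / 7 := delta_one_le hα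
  have hδ0 : 0 < δ := delta_one_pos hα
  have hosc : ∀ τ ∈ Icc 0 t₁, ∀ x, ∀ σ j, ‖mulOp (osc S0 S σ j τ) x‖ ≤ C * ε * rate δ τ :=
    fun τ hτ x σ j => (HC ε T S0 S Er hε hb τ (hmem τ hτ) σ x).1 j
  have hsrc : ∀ τ ∈ Icc 0 t₁, ∀ x, ∀ σ, ‖mulOp (𝓕 (S σ τ)) x‖ ≤ C * ε * rate δ τ ^ 2 :=
    fun τ hτ x σ => (HC ε T S0 S Er hε hb τ (hmem τ hτ) σ x).2
  have hEr : ∀ τ ∈ Icc 0 t₁, ∀ x, ‖Er τ x‖ ≤ ε * rate δ τ ^ 2 := fun τ hτ x => by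
    refine (hb.norm_Er_le hε (hmem τ hτ) x).trans (mul_le_mul_of_nonneg_left ?_ hε.le)
    rw [rate_sq]
    exact Real.rpow_le_rpow_of_exponent_le (one_le_bracket τ) (by linarith)
  have hb1 : ∀ τ, rate δ τ ^ 2 ≤ rate δ τ := fun τ => by
    have := rate_pos δ τ
    have := rate_le_one (δ := δ) (by linarith) τ
    nlinarith
  have hE : ∀ τ ∈ Icc 0 t₁, ∀ x, ‖field S0 S Er τ x‖ ≤ kE * ε * rate δ τ := fun τ hτ x => by
    rw [hb.field_eq hα hε (hmem τ hτ)]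
    have h1 := norm_oscVec_le (hosc τ hτ x) (m := fun _ => 1) (μ := N) fun _ => le_rfl
    have h2 := (hEr τ hτ x).trans (mul_le_mul_of_nonneg_left (hb1 τ) hε.le)
    calc _ ≤ _ := norm_add_le _ _
      _ ≤ _ := add_le_add h1 h2
      _ = _ := by rw [hkE]; ring
  -- the multiples of `ε b` and of `ε b²` that occur in the bounds
  have hle1 : ∀ τ, 6 * (C * ε * rate δ τ * M) ≤
      (6 * (C * M) + kE + 3 + 6 * (C * (Q * M)) + 6 * (C * (M * kE))) * ε * rate δ τ := fun τ => by
    have : 0 ≤ (kE + 3 + 6 * (C * (Q * M)) + 6 * (C * (M * kE))) * ε * rate δ τ := by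
      have := rate_pos δ τ
      positivity
    linarith
  have hD : ∀ τ ∈ Icc 0 t₁, ∀ x, 6 * (C * ε * rate δ τ * (M * ‖field S0 S Er τ x‖)) ≤
      6 * (C * (M * kE)) * ε * rate δ τ ^ 2 := fun τ hτ x => by
    have hr := rate_pos δ τ
    calc _ ≤ 6 * (C * ε * rate δ τ * (M * (kE * 1 * rate δ τ))) := by
          gcongr
          refine (hE τ hτ x).trans ?_
          gcongr
      _ = _ := by ring
  have hle2 : ∀ τ, ∀ x y z : ℝ, x ≤ 3 * (ε * rate δ τ ^ 2) →
      y ≤ 6 * (C * ε * rate δ τ ^ 2 * (Q * M)) → z ≤ 6 * (C * (M * kE)) * ε * rate δ τ ^ 2 →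
      x + y + z ≤ (6 * (C * M) + kE + 3 + 6 * (C * (Q * M)) + 6 * (C * (M * kE))) * ε *
        rate δ τ ^ 2 := fun τ x y z hx hy hz => by
    have : 0 ≤ (6 * (C * M) + kE) * ε * rate δ τ ^ 2 := by positivity
    linarith
  have hVosc : ∀ τ ∈ Icc 0 t₁, ∀ x v, Vosc S0 S τ x v = oscVec S0 S τ x fun σ => symA σ v :=
    fun τ hτ x v => hb.Vosc_eq hα hε (hmem τ hτ) x v
  refine ⟨hb.field_taylor hα hε ht₁.2, hb.exists_norm_grad_le hα hε ht₁.2,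
    (hb.continuousOn_gradOsc hα hε ht₁.1 ht₁.2).add (hb.continuousOn_gradEr hα hε ht₁.2),
    ?_, ?_, ?_, ?_, ?_, ?_, ?_, ?_, ?_, ?_⟩
  · intro τ hτ x
    refine (hE τ hτ x).trans ?_
    have := rate_pos δ τ
    gcongr
    have : 0 ≤ 6 * (C * M) + 3 + 6 * (C * (Q * M)) + 6 * (C * (M * kE)) := by positivity
    linarith
  · intro τ hτ x v hv
    rw [hVosc τ hτ]
    exact (norm_oscVec_le (hosc τ hτ x) fun σ => (HM σ v hv).1.1).trans (hle1 τ)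
  · intro τ hτ x v hv
    exact (norm_oscVecL_le (hosc τ hτ x) fun σ => (HM σ v hv).2.1.1).trans (hle1 τ)
  · intro τ hτ x v hv
    exact (norm_oscVecL_le (hosc τ hτ x) fun σ => (HM σ v hv).1.2).trans (hle1 τ)
  · intro τ hτ x v hv
    exact (norm_oscVecL_le (hosc τ hτ x) fun σ => (HM σ v hv).2.2.1).trans (hle1 τ)
  · intro τ hτ x v
    have hs := fun σ j => (hb.sobBound_osc hε σ j (hmem τ hτ)).1
    have := HasFDerivAt.fun_sum fun σ (_ : σ ∈ Finset.univ) => HasFDerivAt.fun_sum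
      fun j (_ : j ∈ Finset.univ) => (compVec j).hasFDerivAt.comp x
        ((ContinuousLinearMap.apply ℝ ℂ (Sym.resolvent σ v)).hasFDerivAt.comp x
          (hasFDerivAt_velOp (hs σ j).meas ((hs σ j).wmul_le (by omega)).1 x))
    rw [funext fun y => hVosc τ hτ y v]
    refine this.congr_fderiv ?_
    ext1 e
    rw [oscVecL_apply]
    simp [oscVec, gradVel_apply, symB_apply]
  · intro τ hτ x v
    rw [funext fun w => hVosc τ hτ x w]
    exact HasFDerivAt.fun_sum fun σ _ => HasFDerivAt.fun_sum fun j _ =>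
      (compVec j).hasFDerivAt.comp v ((mulOp _ x).hasFDerivAt.comp v
        ((contDiff_symA σ).differentiable (by simp) v).hasFDerivAt)
  · intro X V τ hτ hX hV
    refine ⟨Er τ (X τ) - srcVec S τ (X τ) (fun σ => symA σ (V τ)) -
      oscVec S0 S τ (X τ) (fun σ => fderiv ℝ (symA σ) (V τ) (field S0 S Er τ (X τ))), ?_, ?_⟩
    · have h1 := hb.hasDerivWithinAt_symA hα hε ht₁.2 hτ hX hV
      refine (h1.congr (fun r hr => hVosc r hr _ _) (hVosc τ hτ _ _)).congr_deriv ?_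
      rw [hb.field_eq hα hε (hmem τ hτ)]
      abel
    · intro hv
      refine (norm_sub_le _ _).trans ((add_le_add_left (norm_sub_le _ _) _).trans
        (hle2 τ _ _ _ ?_ ?_ ?_))
      · have := hEr τ hτ (X τ)
        have h0 : 0 ≤ ε * rate δ τ ^ 2 := by positivity
        linarith
      · exact norm_srcVec_le (hsrc τ hτ _) HQ fun σ => (HM σ _ hv).1.1
      · exact (norm_oscVec_le (hosc τ hτ _) fun σ =>
          ContinuousLinearMap.le_of_opNorm_le _ (HM σ _ hv).1.2 _).trans (hD τ hτ _)
  · intro X V τ hτ hX hV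
    refine ⟨gradEr Er τ (X τ) - srcVecL S τ (X τ) (fun σ => symB σ (V τ)) -
      oscVecL S0 S τ (X τ) (fun σ => fderiv ℝ (symB σ) (V τ) (field S0 S Er τ (X τ))), ?_, ?_⟩
    · refine (hb.hasDerivWithinAt_symB hα hε ht₁.2 hτ hX hV).congr_deriv ?_
      abel
    · intro hv
      refine (norm_sub_le _ _).trans ((add_le_add_left (norm_sub_le _ _) _).trans
        (hle2 τ _ _ _ ?_ ?_ ?_))
      · exact hb.norm_gradEr_le hα hε (hmem τ hτ) _
      · exact norm_srcVecL_le (hsrc τ hτ _) HQ fun σ => (HM σ _ hv).2.1.1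
      · exact (norm_oscVecL_le (hosc τ hτ _) fun σ =>
          ContinuousLinearMap.le_of_opNorm_le _ (HM σ _ hv).2.1.2 _).trans (hD τ hτ _)
  · intro X V τ hτ hX hV
    refine ⟨srcVecL S τ (X τ) (fun σ => symC σ (V τ)) +
      oscVecL S0 S τ (X τ) (fun σ => fderiv ℝ (symC σ) (V τ) (field S0 S Er τ (X τ))), ?_, ?_⟩
    · refine (hb.hasDerivWithinAt_symC hα hε ht₁.2 hτ hX hV).congr_deriv ?_
      abel
    · intro hv
      have := hle2 τ 0 _ _ (by positivity)
        (norm_srcVecL_le (hsrc τ hτ (X τ)) HQ fun σ => (HM σ _ hv).2.2.1)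
        ((norm_oscVecL_le (hosc τ hτ (X τ)) fun σ =>
          ContinuousLinearMap.le_of_opNorm_le _ (HM σ _ hv).2.2.2 _).trans (hD τ hτ (X τ)))
      rw [zero_add] at this
      exact (norm_add_le _ _).trans this

namespace Bootstrap

variable {α₀ : ℕ} {ε T : ℝ} {S0 : ℤˣ → Lp ℂ 2 (volume : Measure R3)}
    {S : ℤˣ → ℝ → R3 → ℂ} {Er : ℝ → R3 → R3}

theorem Vosc_eq_velOp (hb : Bootstrap α₀ ε T S0 S Er) (hα : 8 ≤ α₀) (hε : 0 < ε) {t : ℝ}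
    (ht : t ∈ Ico 0 T) (x : R3) : Vosc S0 S t x = fun v =>
      ∑ σ, ∑ j, ((compVec j).comp (velOp (osc S0 S σ j t) x)) (Sym.resolvent σ v) := by
  ext1 v
  rw [hb.Vosc_eq hα hε ht]
  rfl

theorem contDiff_Vosc (hb : Bootstrap α₀ ε T S0 S Er) (hα : 8 ≤ α₀) (hε : 0 < ε) {t : ℝ}
    (ht : t ∈ Ico 0 T) (x : R3) : ContDiff ℝ ∞ (Vosc S0 S t x) := by
  rw [hb.Vosc_eq_velOp hα hε ht]
  exact ContDiff.sum fun σ _ => ContDiff.sum fun j _ =>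
    (ContinuousLinearMap.contDiff _).comp (Sym.contDiff_resolvent σ)

theorem iteratedFDeriv_Vosc (hb : Bootstrap α₀ ε T S0 S Er) (hα : 8 ≤ α₀) (hε : 0 < ε) {t : ℝ}
    (ht : t ∈ Ico 0 T) (n : ℕ) (x v : R3) : iteratedFDeriv ℝ n (Vosc S0 S t x) v =
      ∑ σ, ∑ j, ((compVec j).comp (velOp (osc S0 S σ j t) x)).compContinuousMultilinearMap
        (iteratedFDeriv ℝ n (Sym.resolvent σ) v) := by
  have hc : ∀ σ j, ContDiff ℝ n fun v =>
      ((compVec j).comp (velOp (osc S0 S σ j t) x)) (Sym.resolvent σ v) := fun σ j =>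
    (ContinuousLinearMap.contDiff _).comp ((Sym.contDiff_resolvent σ).of_le (by exact_mod_cast le_top))
  rw [hb.Vosc_eq_velOp hα hε ht, iteratedFDeriv_fun_sum_apply fun σ _ =>
    (ContDiff.sum fun j _ => hc σ j).contDiffAt]
  refine Finset.sum_congr rfl fun σ _ => ?_
  rw [iteratedFDeriv_fun_sum_apply fun j _ => (hc σ j).contDiffAt]
  refine Finset.sum_congr rfl fun j _ => ?_
  exact ContinuousLinearMap.iteratedFDeriv_comp_left _
    ((Sym.contDiff_resolvent σ).contDiffAt.of_le (m := n) (by exact_mod_cast le_top)) le_rfl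

end Bootstrap

open Bootstrap in
theorem exists_derivBound_Vosc {α₀ : ℕ} (hα : 8 ≤ α₀) (ρ : ℝ) (n : ℕ) : ∃ K, ∀ (ε T : ℝ)
    (S0 : ℤˣ → Lp ℂ 2 (volume : Measure R3)) (S : ℤˣ → ℝ → R3 → ℂ) (Er : ℝ → R3 → R3), 0 < ε →
    Bootstrap α₀ ε T S0 S Er → ∀ t ∈ Ico 0 T, ∀ x v : R3, ‖v‖ ≤ ρ →
      DerivBound (fun y => iteratedFDeriv ℝ n (Vosc S0 S t y) v) x
        (K * ε * bracket t ^ (-(3 / 2 : ℝ) + delta α₀ 1)) := by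
  obtain ⟨C, hC, HC⟩ := exists_mulOp_decay hα
  obtain ⟨M, hM, HM⟩ := exists_bound_closedBall (fun σ => (Sym.contDiff_resolvent σ).continuous_iteratedFDeriv
    (m := n) (by exact_mod_cast le_top)) ρ
  refine ⟨6 * (M * (C * ‖Sym.kdir‖)), fun ε T S0 S Er hε hb t ht x v hv => ?_⟩
  have hs := fun σ j => (hb.sobBound_osc hε σ j ht).1
  -- composition with a fixed multilinear map, as a linear map
  let Φ : ∀ (σ : ℤˣ), Fin 3 → (Sym →L[ℝ] ℂ) →L[ℝ]
      ContinuousMultilinearMap ℝ (fun _ : Fin n => R3) R3 := fun σ j =>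
    ((ContinuousLinearMap.compContinuousMultilinearMapL ℝ (fun _ : Fin n => R3) Sym R3).flip
      (iteratedFDeriv ℝ n (Sym.resolvent σ) v)).comp
      (ContinuousLinearMap.compL ℝ Sym ℂ R3 (compVec j))
  have hΦ : ∀ σ j L, ‖Φ σ j L‖ ≤ M * ‖L‖ := fun σ j L => by
    change ‖((compVec j).comp L).compContinuousMultilinearMap
      (iteratedFDeriv ℝ n (Sym.resolvent σ) v)‖ ≤ _
    refine (ContinuousLinearMap.norm_compContinuousMultilinearMap_le _ _).trans ?_
    have h1 : ‖(compVec j).comp L‖ ≤ ‖L‖ := (ContinuousLinearMap.opNorm_comp_le _ _).trans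
      (mul_le_of_le_one_left (norm_nonneg _) (norm_compVec_le j))
    rw [mul_comm]
    exact mul_le_mul (HM σ v hv) h1 (norm_nonneg _) hM
  have hd : HasFDerivAt (fun y => iteratedFDeriv ℝ n (Vosc S0 S t y) v)
      (∑ σ, ∑ j, (Φ σ j).comp (gradVel (osc S0 S σ j t) x)) x := by
    rw [funext fun y => hb.iteratedFDeriv_Vosc hα hε ht n y v]
    exact HasFDerivAt.fun_sum fun σ _ => HasFDerivAt.fun_sum fun j _ =>
      (Φ σ j).hasFDerivAt.comp x (hasFDerivAt_velOp (hs σ j).meas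
        ((hs σ j).wmul_le (by omega)).1 x)
  refine ⟨hd.differentiableAt, ?_⟩
  rw [hd.fderiv]
  have hrate : rate (delta α₀ 1) t ≤ bracket t ^ (-(3 / 2 : ℝ) + delta α₀ 1) :=
    Real.rpow_le_rpow_of_exponent_le (one_le_bracket t) (by linarith [delta_one_pos hα])
  calc _ ≤ 6 * (M * (C * ε * rate (delta α₀ 1) t * ‖Sym.kdir‖)) :=
        norm_sum_sum_le fun σ j => by
          have h1 := (norm_gradVel_le (osc S0 S σ j t) x).trans (mul_le_mul_of_nonneg_right
            ((HC ε T S0 S Er hε hb t ht σ x).1 j) (norm_nonneg _))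
          refine ContinuousLinearMap.opNorm_le_bound _
            (mul_nonneg hM (le_trans (norm_nonneg (gradVel (osc S0 S σ j t) x)) h1)) fun e => ?_
          refine (hΦ σ j _).trans ?_
          rw [mul_assoc]
          exact mul_le_mul_of_nonneg_left (ContinuousLinearMap.le_of_opNorm_le _ h1 e) hM
    _ ≤ 6 * (M * (C * ε * bracket t ^ (-(3 / 2 : ℝ) + delta α₀ 1) * ‖Sym.kdir‖)) := by gcongr
    _ = _ := by ring

/-! ### Linear equations and differentiability of the flow -/

section LinearODE

variable {W : Type*} [NormedAddCommGroup W] [NormedSpace ℝ W]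

theorem hasDerivWithinAt_Ici_of_Icc {f : ℝ → W} {f' : W} {a b τ : ℝ} (hτ : τ ∈ Ico a b)
    (h : HasDerivWithinAt f f' (Icc a b) τ) : HasDerivWithinAt f f' (Ici τ) τ :=
  h.mono_of_mem_nhdsWithin (Icc_mem_nhdsGE_of_mem hτ)

/-- Mean value inequality with a variable bound `-Γ'` on the derivative. -/
theorem norm_sub_le_of_deriv_le {f f' : ℝ → W} {Γ g : ℝ → ℝ} {a b : ℝ} (hab : a ≤ b)
    (hf : ∀ τ ∈ Icc a b, HasDerivWithinAt f (f' τ) (Icc a b) τ)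
    (hΓ : ∀ τ ∈ Icc a b, HasDerivAt Γ (-g τ) τ) (h : ∀ τ ∈ Icc a b, ‖f' τ‖ ≤ g τ) :
    ‖f a - f b‖ ≤ Γ a - Γ b := by
  have hsub : Ico a b ⊆ Icc a b := Ico_subset_Icc_self
  have := image_norm_le_of_norm_deriv_right_le_deriv_boundary' (f := fun τ => f τ - f a)
    (B := fun τ => Γ a - Γ τ) (B' := g) (a := a) (b := b)
    (fun τ hτ => ((hf τ hτ).continuousWithinAt.sub continuousWithinAt_const))
    (fun τ hτ => (hasDerivWithinAt_Ici_of_Icc hτ (hf τ (hsub hτ))).sub_const _) (by simp)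
    (fun τ hτ => ((hΓ τ hτ).continuousAt.continuousWithinAt).const_sub _)
    (fun τ hτ => by simpa using ((hΓ τ (hsub hτ)).hasDerivWithinAt.const_sub (Γ a)))
    (fun τ hτ => h τ (hsub hτ)) (right_mem_Icc.2 hab)
  rwa [norm_sub_rev] at this

/-- Grönwall's inequality, backwards in time. -/
theorem norm_le_of_backward_gronwall {f f' : ℝ → W} {t K D ε : ℝ} (hK : 1 ≤ K) (hε : 0 ≤ ε)
    (hD : ‖f t‖ ≤ D)
    (hf : ∀ τ ∈ Icc 0 t, HasDerivWithinAt f (f' τ) (Icc 0 t) τ)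
    (h : ∀ τ ∈ Icc 0 t, ‖f' τ‖ ≤ K * ‖f τ‖ + ε) :
    ∀ τ ∈ Icc 0 t, ‖f τ‖ ≤ (D + ε) * Real.exp (K * t) := by
  have hrev : ∀ {τ : ℝ}, τ ∈ Icc 0 t → t - τ ∈ Icc 0 t := fun hτ =>
    ⟨sub_nonneg.2 hτ.2, sub_le_self _ hτ.1⟩
  have hd : ∀ τ ∈ Icc 0 t, HasDerivWithinAt (fun σ => f (t - σ)) (-f' (t - τ)) (Icc 0 t) τ := by
    intro τ hτ
    have h1 : HasDerivWithinAt (fun σ : ℝ => t - σ) (-1) (Icc 0 t) τ :=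
      (hasDerivWithinAt_id τ _).const_sub t
    exact ((hf (t - τ) (hrev hτ)).scomp τ h1 fun σ hσ => hrev hσ).congr_deriv (by simp)
  have hsub : Ico 0 t ⊆ Icc 0 t := Ico_subset_Icc_self
  have key := norm_le_gronwallBound_of_norm_deriv_right_le (f := fun σ => f (t - σ))
    (f' := fun σ => -f' (t - σ)) (δ := D) (K := K) (ε := ε) (a := 0) (b := t)
    (fun τ hτ => (hd τ hτ).continuousWithinAt)
    (fun τ hτ => hasDerivWithinAt_Ici_of_Icc hτ (hd τ (hsub hτ))) (by simpa using hD)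
    (fun τ hτ => by rw [norm_neg]; exact h _ (hrev (hsub hτ)))
  intro τ hτ
  have h1 := key (t - τ) (hrev hτ)
  simp only [sub_sub_cancel, sub_zero] at h1
  refine h1.trans ?_
  rw [gronwallBound_of_K_ne_0 (by linarith)]
  have hD0 : 0 ≤ D := (norm_nonneg _).trans hD
  have e1 : Real.exp (K * (t - τ)) ≤ Real.exp (K * t) :=
    Real.exp_le_exp.2 (mul_le_mul_of_nonneg_left (sub_le_self _ hτ.1) (by linarith))
  have e2 : ε / K ≤ ε := div_le_self hε hK
  have e3 : 0 ≤ ε / K := div_nonneg hε (by linarith)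
  have e4 := Real.exp_pos (K * t)
  nlinarith [Real.exp_pos (K * (t - τ))]

variable [CompleteSpace W]

/-- Linear equations with continuous coefficients have solutions with given final value: Picard
iteration contracts for the norm `sup e^{λτ}|P(τ)|` with `λ` large. -/
theorem exists_linear_solution {A : ℝ → W →L[ℝ] W} {t : ℝ} (ht : 0 ≤ t)
    (hA : ContinuousOn A (Icc 0 t)) (w₀ : W) :
    ∃ P : ℝ → W, P t = w₀ ∧ ∀ τ ∈ Icc 0 t, HasDerivWithinAt P (A τ (P τ)) (Icc 0 t) τ := by
  obtain ⟨C, hC⟩ := isCompact_Icc.exists_bound_of_continuousOn hA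
  set A' : ℝ → W →L[ℝ] W := fun τ => A (projIcc 0 t ht τ) with hA'
  have hA'c : Continuous A' := hA.comp_continuous
    (continuous_subtype_val.comp continuous_projIcc) fun τ => (projIcc 0 t ht τ).2
  have hA'C : ∀ τ, ‖A' τ‖ ≤ C := fun τ => hC _ (projIcc 0 t ht τ).2
  have hC0 : 0 ≤ C := (norm_nonneg _).trans (hA'C 0)
  set l : ℝ := 2 * C + 1 with hl
  have hl0 : 0 < l := by positivity
  let ext : C(Icc 0 t, W) → ℝ → W := fun y τ => y (projIcc 0 t ht τ)
  have hext : ∀ y, Continuous (ext y) := fun y => y.continuous.comp continuous_projIcc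
  let P : C(Icc 0 t, W) → ℝ → W := fun y τ =>
    w₀ + ∫ r in t..τ, A' r (Real.exp (-(l * r)) • ext y r)
  have hint : ∀ y, Continuous fun r => A' r (Real.exp (-(l * r)) • ext y r) := fun y => by
    have := hext y
    fun_prop
  have hP : ∀ y τ, HasDerivAt (P y) (A' τ (Real.exp (-(l * τ)) • ext y τ)) τ := fun y τ =>
    (intervalIntegral.integral_hasDerivAt_right ((hint y).intervalIntegrable _ _)
      ((hint y).stronglyMeasurableAtFilter _ _) (hint y).continuousAt).const_add w₀
  have hPc : ∀ y, Continuous (P y) := fun y =>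
    continuous_iff_continuousAt.2 fun τ => (hP y τ).continuousAt
  let Tm : C(Icc 0 t, W) → C(Icc 0 t, W) := fun y =>
    ⟨fun τ => Real.exp (l * τ) • P y τ, by have := hPc y; fun_prop⟩
  have hcontr : ContractingWith (1 / 2) Tm := by
    refine ⟨by norm_num, LipschitzWith.of_dist_le_mul fun y z => ?_⟩
    rw [ContinuousMap.dist_le (by positivity)]
    intro τ
    have hτ := τ.2
    have e1 : Tm y τ - Tm z τ = Real.exp (l * τ) • ∫ r in t..(τ : ℝ),
        A' r (Real.exp (-(l * r)) • (ext y r - ext z r)) := by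
      change Real.exp (l * τ) • P y τ - Real.exp (l * τ) • P z τ = _
      rw [← smul_sub]
      congr 1
      simp only [P]
      rw [add_sub_add_left_eq_sub, ← intervalIntegral.integral_sub
        ((hint y).intervalIntegrable _ _) ((hint z).intervalIntegrable _ _)]
      simp only [smul_sub, map_sub]
    have e2 : ‖∫ r in t..(τ : ℝ), A' r (Real.exp (-(l * r)) • (ext y r - ext z r))‖ ≤
        (Real.exp (-(l * τ)) - Real.exp (-(l * t))) * (1 / l) * (C * dist y z) := by
      have e3 : (Real.exp (-(l * τ)) - Real.exp (-(l * t))) * (1 / l) * (C * dist y z) =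
          ∫ r in (τ : ℝ)..t, Real.exp (-(l * r)) * (C * dist y z) := by
        rw [intervalIntegral.integral_mul_const]
        congr 1
        rw [intervalIntegral.integral_eq_sub_of_hasDerivAt
          (f := fun r => -(Real.exp (-(l * r)) * (1 / l)))
          (f' := fun r => Real.exp (-(l * r)))]
        · ring
        · intro r _
          have := ((((hasDerivAt_id r).const_mul l).neg.exp).mul_const (1 / l)).neg
          refine this.congr_deriv ?_
          simp only [id]
          field_simp
          rfl
        · exact Continuous.intervalIntegrable (by fun_prop) _ _
      rw [e3, intervalIntegral.integral_symm, norm_neg]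
      refine intervalIntegral.norm_integral_le_of_norm_le hτ.2
        (Filter.Eventually.of_forall fun r _ => ?_)
        (Continuous.intervalIntegrable (by fun_prop) _ _)
      refine ((A' r).le_of_opNorm_le (hA'C r) _).trans ?_
      rw [norm_smul, Real.norm_of_nonneg (Real.exp_pos _).le, ← dist_eq_norm]
      have : dist (ext y r) (ext z r) ≤ dist y z := ContinuousMap.dist_apply_le_dist _
      calc _ ≤ C * (Real.exp (-(l * r)) * dist y z) := by gcongr
        _ = _ := by ring
    rw [dist_eq_norm, e1, norm_smul, Real.norm_of_nonneg (Real.exp_pos _).le]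
    have e4 : Real.exp (l * τ) * Real.exp (-(l * τ)) = 1 := by rw [← Real.exp_add]; simp
    have e5 : C * (1 / l) ≤ 1 / 2 := by
      rw [mul_one_div, div_le_div_iff₀ hl0 two_pos]; linarith
    calc _ ≤ Real.exp (l * τ) * ((Real.exp (-(l * τ)) - Real.exp (-(l * t))) * (1 / l) *
          (C * dist y z)) := by gcongr
      _ ≤ Real.exp (l * τ) * (Real.exp (-(l * τ)) * (1 / l) * (C * dist y z)) := by
          gcongr
          exact sub_le_self _ (Real.exp_pos _).le
      _ = (Real.exp (l * τ) * Real.exp (-(l * τ))) * (C * (1 / l)) * dist y z := by ring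
      _ ≤ 1 * (1 / 2) * dist y z := by rw [e4]; gcongr
      _ = _ := by simp
  have : Nonempty C(Icc 0 t, W) := ⟨0⟩
  set y := ContractingWith.fixedPoint Tm hcontr
  have hy : Tm y = y := hcontr.fixedPoint_isFixedPt
  refine ⟨P y, by simp [P], fun τ hτ => ?_⟩
  refine ((hP y τ).hasDerivWithinAt).congr_deriv ?_
  have e1 : ext y τ = Real.exp (l * τ) • P y τ := by
    have := congrArg (fun z : C(Icc 0 t, W) => z ⟨τ, hτ⟩) hy
    simp only [ext, projIcc_of_mem ht hτ]
    exact this.symm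
  rw [e1, smul_smul, ← Real.exp_add, neg_add_cancel, Real.exp_zero, one_smul, hA']
  simp only [projIcc_of_mem ht hτ]

/-- Differentiability of a flow in a parameter: the derivative solves the linearized equation. -/
theorem exists_hasFDerivAt_flow {Q : Type*} [NormedAddCommGroup Q] [NormedSpace ℝ Q]
    {f : ℝ → W → W} {Φ : ℝ → Q → W} {A : ℝ → W →L[ℝ] W} {t : ℝ} (ht : 0 ≤ t) {p₀ : Q}
    {ι : Q →L[ℝ] W} {L C : ℝ}
    (hΦ : ∀ p, ∀ τ ∈ Icc 0 t, HasDerivWithinAt (fun r => Φ r p) (f τ (Φ τ p)) (Icc 0 t) τ)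
    (hι : ∀ p, Φ t p - Φ t p₀ = ι (p - p₀)) (hA : ContinuousOn A (Icc 0 t))
    (hL : ∀ τ ∈ Icc 0 t, ∀ w, ‖f τ (Φ τ p₀ + w) - f τ (Φ τ p₀)‖ ≤ L * ‖w‖)
    (hC : ∀ τ ∈ Icc 0 t, ∀ w, ‖f τ (Φ τ p₀ + w) - f τ (Φ τ p₀) - A τ w‖ ≤ C * ‖w‖ ^ 2) :
    ∃ J : ℝ → Q →L[ℝ] W, J t = ι ∧
      (∀ τ ∈ Icc 0 t, HasDerivWithinAt J ((A τ).comp (J τ)) (Icc 0 t) τ) ∧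
      ∀ τ ∈ Icc 0 t, HasFDerivAt (Φ τ) (J τ) p₀ := by
  obtain ⟨a, ha⟩ := isCompact_Icc.exists_bound_of_continuousOn hA
  obtain ⟨J, hJt, hJ⟩ := exists_linear_solution (W := Q →L[ℝ] W)
    (A := fun τ => ContinuousLinearMap.compL ℝ Q W W (A τ)) ht
    ((ContinuousLinearMap.compL ℝ Q W W).continuous.comp_continuousOn hA) ι
  refine ⟨J, hJt, hJ, fun τ hτ => ?_⟩
  set L' := max 1 L with hL'
  set a' := max 1 a with ha'
  set k := ‖ι‖ * Real.exp (L' * t) with hk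
  have hw : ∀ p, ∀ σ ∈ Icc 0 t, ‖Φ σ p - Φ σ p₀‖ ≤ k * ‖p - p₀‖ := fun p σ hσ => by
    have := norm_le_of_backward_gronwall (f := fun r => Φ r p - Φ r p₀) (K := L') (ε := 0)
      (D := ‖ι‖ * ‖p - p₀‖) (le_max_left _ _) le_rfl (by rw [hι]; exact ι.le_opNorm _)
      (fun r hr => (hΦ p r hr).sub (hΦ p₀ r hr)) (fun r hr => by
        rw [add_zero]
        have := hL r hr (Φ r p - Φ r p₀)
        rw [add_sub_cancel] at this
        exact this.trans (mul_le_mul_of_nonneg_right (le_max_right _ _) (norm_nonneg _))) σ hσ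
    refine this.trans (le_of_eq ?_)
    rw [hk]; ring
  have hC0 : ∀ σ ∈ Icc 0 t, ∀ w, ‖f σ (Φ σ p₀ + w) - f σ (Φ σ p₀) - A σ w‖ ≤ |C| * ‖w‖ ^ 2 :=
    fun σ hσ w => (hC σ hσ w).trans (mul_le_mul_of_nonneg_right (le_abs_self C) (by positivity))
  refine hasFDerivAt_of_taylor (C := |C| * k ^ 2 * Real.exp (a' * t)) fun q => ?_
  have := norm_le_of_backward_gronwall (f := fun r => Φ r (p₀ + q) - Φ r p₀ - J r q) (K := a')
    (ε := |C| * (k * ‖q‖) ^ 2) (D := 0) (le_max_left _ _) (by positivity)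
    (by rw [hι, hJt]; simp)
    (fun r hr => ((hΦ (p₀ + q) r hr).sub (hΦ p₀ r hr)).sub
      ((ContinuousLinearMap.apply ℝ W q).hasFDerivAt.comp_hasDerivWithinAt r (hJ r hr)))
    (fun r hr => by
      have h1 := hC0 r hr (Φ r (p₀ + q) - Φ r p₀)
      rw [add_sub_cancel] at h1
      have h2 := hw (p₀ + q) r hr
      rw [add_sub_cancel_left] at h2
      have h3 : ‖A r (Φ r (p₀ + q) - Φ r p₀ - J r q)‖ ≤
          a' * ‖Φ r (p₀ + q) - Φ r p₀ - J r q‖ :=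
        (A r).le_of_opNorm_le ((ha r hr).trans (le_max_right _ _)) _
      have e : f r (Φ r (p₀ + q)) - f r (Φ r p₀) -
          (ContinuousLinearMap.apply ℝ W q) ((ContinuousLinearMap.compL ℝ Q W W (A r)) (J r)) =
          A r (Φ r (p₀ + q) - Φ r p₀ - J r q) + (f r (Φ r (p₀ + q)) - f r (Φ r p₀) -
            A r (Φ r (p₀ + q) - Φ r p₀)) := by
        rw [map_sub (A r) _ (J r q)]
        change _ - A r (J r q) = _
        abel
      rw [e]
      refine (norm_add_le _ _).trans (add_le_add h3 (h1.trans ?_))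
      gcongr) τ hτ
  refine this.trans (le_of_eq ?_)
  ring

end LinearODE

/-! ### Decay rates in powers of `1 + τ` -/

/-- The decay rate of the field, comparable to `rate δ`, in the form in which powers integrate
explicitly. -/
def decayB (δ τ : ℝ) : ℝ := (1 + τ) ^ (-(3 / 2 : ℝ) + δ / 2)

/-- The rate of `∫_τ^∞ (decayB δ) ^ 2`. -/
def decayE (δ τ : ℝ) : ℝ := (1 + τ) ^ (-2 + δ)

/-- The rate of `∫_τ^∞ decayE δ`. -/
def decayD (δ τ : ℝ) : ℝ := (1 + τ) ^ (-1 + δ)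

section Decay

variable {δ τ : ℝ}

theorem decayB_pos (hτ : 0 ≤ τ) : 0 < decayB δ τ := Real.rpow_pos_of_pos (by linarith) _

theorem decayE_pos (hτ : 0 ≤ τ) : 0 < decayE δ τ := Real.rpow_pos_of_pos (by linarith) _

theorem decayB_sq (hτ : 0 ≤ τ) : decayB δ τ ^ 2 = (1 + τ) ^ ((-2 + δ) - 1) := by
  rw [decayB, ← Real.rpow_natCast, ← Real.rpow_mul (by linarith)]
  congr 1
  push_cast
  ring

theorem decayE_le (hδ : δ ≤ 1 / 7) (hτ : 0 ≤ τ) : decayE δ τ ≤ decayB δ τ :=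
  Real.rpow_le_rpow_of_exponent_le (by linarith) (by linarith)

theorem decayB_le_decayD (hδ : 0 < δ) (hτ : 0 ≤ τ) : decayB δ τ ≤ decayD δ τ :=
  Real.rpow_le_rpow_of_exponent_le (by linarith) (by linarith)

theorem decayB_le_one (hδ : δ ≤ 1 / 7) (hτ : 0 ≤ τ) : decayB δ τ ≤ 1 :=
  Real.rpow_le_one_of_one_le_of_nonpos (by linarith) (by linarith)

theorem decayB_anti (hδ : δ ≤ 1 / 7) {s : ℝ} (hs : 0 ≤ s) (h : s ≤ τ) :
    decayB δ τ ≤ decayB δ s :=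
  Real.rpow_le_rpow_of_nonpos (by linarith) (by linarith) (by linarith)

theorem continuousOn_decayB {t : ℝ} : ContinuousOn (decayB δ) (Icc 0 t) := by
  refine ContinuousOn.rpow_const (by fun_prop) fun τ hτ => Or.inl ?_
  have := hτ.1
  positivity

theorem rate_le_decayB (hδ : 0 < δ) (hδ' : δ ≤ 1 / 7) (hτ : 0 ≤ τ) :
    rate δ τ ≤ 4 * decayB δ τ := by
  have h1 : (1 + τ) / 2 ≤ bracket τ := by
    have h2 := one_le_bracket τ
    have h3 := (le_abs_self τ).trans (norm_le_bracket τ)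
    linarith
  have h2 : rate δ τ ≤ ((1 + τ) / 2) ^ (-(3 / 2 : ℝ) + δ / 2) :=
    Real.rpow_le_rpow_of_nonpos (by linarith) h1 (by linarith)
  refine h2.trans ?_
  rw [Real.div_rpow (by linarith) (by norm_num), div_eq_mul_inv, mul_comm,
    ← Real.rpow_neg (by norm_num)]
  refine mul_le_mul_of_nonneg_right ?_ (decayB_pos hτ).le
  calc (2 : ℝ) ^ (-(-(3 / 2 : ℝ) + δ / 2)) ≤ 2 ^ (2 : ℝ) :=
        Real.rpow_le_rpow_of_exponent_le (by norm_num) (by linarith)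
    _ = 4 := by norm_num

theorem bracket_le_one_add_self (hτ : 0 ≤ τ) : bracket τ ≤ 1 + τ := by
  rw [bracket, Real.norm_of_nonneg hτ]
  exact Real.sqrt_le_iff.2 ⟨by linarith, by nlinarith⟩

theorem decayB_le_bracket (hδ : 0 < δ) (hδ' : δ ≤ 1 / 7) (hτ : 0 ≤ τ) :
    decayB δ τ ≤ bracket τ ^ (-(3 / 2 : ℝ) + δ) := by
  refine (Real.rpow_le_rpow_of_nonpos (bracket_pos τ) (bracket_le_one_add_self hτ)
    (by linarith)).trans ?_
  exact Real.rpow_le_rpow_of_exponent_le (one_le_bracket τ) (by linarith)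

theorem decayD_le_bracket (hδ' : δ ≤ 1 / 7) (hτ : 0 ≤ τ) :
    decayD δ τ ≤ bracket τ ^ (-1 + δ) :=
  Real.rpow_le_rpow_of_nonpos (bracket_pos τ) (bracket_le_one_add_self hτ) (by linarith)

theorem decayD_le_one (hδ' : δ ≤ 1 / 7) (hτ : 0 ≤ τ) : decayD δ τ ≤ 1 :=
  Real.rpow_le_one_of_one_le_of_nonpos (by linarith) (by linarith)

theorem hasDerivAt_neg_rpow {c : ℝ} (hc : c ≠ 0) (hτ : 0 ≤ τ) :
    HasDerivAt (fun r => (1 + r) ^ c / (-c)) (-((1 + τ) ^ (c - 1))) τ := by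
  have h := (((hasDerivAt_id τ).const_add 1).rpow_const (p := c)
    (Or.inl (by simp only [id]; linarith))).div_const (-c)
  refine h.congr_deriv ?_
  simp only [id]
  field_simp

theorem div_neg_le_three {c x : ℝ} (hc : c ≤ -(1 / 3)) (hx : 0 ≤ x) : x / (-c) ≤ 3 * x := by
  rw [div_le_iff₀ (by linarith)]
  nlinarith

/-- Integration of the decay rates: constants integrate to `t - s`, and each of the other rates
to a multiple of the next one. -/
theorem norm_sub_le_of_decay {W : Type*} [NormedAddCommGroup W] [NormedSpace ℝ W]
    {f f' : ℝ → W} {s t k₀ k₁ k₂ k₃ : ℝ} (hδ' : δ ≤ 1 / 7) (hs : 0 ≤ s) (hst : s ≤ t)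
    (h1 : 0 ≤ k₁) (h2 : 0 ≤ k₂) (h3 : 0 ≤ k₃)
    (hf : ∀ τ ∈ Icc 0 t, HasDerivWithinAt f (f' τ) (Icc 0 t) τ)
    (h : ∀ τ ∈ Icc s t, ‖f' τ‖ ≤ k₀ + k₁ * decayB δ τ + k₂ * decayB δ τ ^ 2 + k₃ * decayE δ τ) :
    ‖f s - f t‖ ≤ k₀ * (t - s) + 3 * k₁ + 3 * k₂ * decayE δ s + 3 * k₃ * decayD δ s := by
  have hsub : Icc s t ⊆ Icc 0 t := Icc_subset_Icc_left hs
  set c₁ : ℝ := -(1 / 2) + δ / 2 with hc₁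
  set c₂ : ℝ := -2 + δ with hc₂
  set c₃ : ℝ := -1 + δ with hc₃
  set Γ : ℝ → ℝ := fun r => k₀ * (-r) + k₁ * ((1 + r) ^ c₁ / (-c₁)) +
    k₂ * ((1 + r) ^ c₂ / (-c₂)) + k₃ * ((1 + r) ^ c₃ / (-c₃)) with hΓ
  have key := norm_sub_le_of_deriv_le (Γ := Γ)
    (g := fun τ => k₀ + k₁ * decayB δ τ + k₂ * decayB δ τ ^ 2 + k₃ * decayE δ τ) hst
    (fun τ hτ => (hf τ (hsub hτ)).mono hsub) (fun τ hτ => by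
      have hτ0 : 0 ≤ τ := hs.trans hτ.1
      have := ((((hasDerivAt_id τ).neg.const_mul k₀).add
        ((hasDerivAt_neg_rpow (c := c₁) (by linarith) hτ0).const_mul k₁)).add
        ((hasDerivAt_neg_rpow (c := c₂) (by linarith) hτ0).const_mul k₂)).add
        ((hasDerivAt_neg_rpow (c := c₃) (by linarith) hτ0).const_mul k₃)
      refine this.congr_deriv ?_
      have e1 : decayB δ τ = (1 + τ) ^ (c₁ - 1) := by
        rw [decayB]; congr 1; rw [hc₁]; ring
      have e2 : decayE δ τ = (1 + τ) ^ (c₃ - 1) := by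
        rw [decayE]; congr 1; rw [hc₃]; ring
      rw [decayB_sq hτ0, e1, e2]
      ring) h
  refine key.trans ?_
  have ht : 0 ≤ t := hs.trans hst
  have p : ∀ c : ℝ, 0 ≤ (1 + s) ^ c ∧ 0 ≤ (1 + t) ^ c := fun c =>
    ⟨Real.rpow_nonneg (by linarith) _, Real.rpow_nonneg (by linarith) _⟩
  have d1 := div_neg_le_three (c := c₁) (by linarith) (p c₁).1
  have d2 := div_neg_le_three (c := c₂) (by linarith) (p c₂).1
  have d3 := div_neg_le_three (c := c₃) (by linarith) (p c₃).1
  have n1 : 0 ≤ k₁ * ((1 + t) ^ c₁ / (-c₁)) := mul_nonneg h1 (div_nonneg (p _).2 (by linarith))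
  have n2 : 0 ≤ k₂ * ((1 + t) ^ c₂ / (-c₂)) := mul_nonneg h2 (div_nonneg (p _).2 (by linarith))
  have n3 : 0 ≤ k₃ * ((1 + t) ^ c₃ / (-c₃)) := mul_nonneg h3 (div_nonneg (p _).2 (by linarith))
  have o1 : (1 + s) ^ c₁ ≤ 1 := Real.rpow_le_one_of_one_le_of_nonpos (by linarith) (by linarith)
  have m1 := mul_le_mul_of_nonneg_left (d1.trans (mul_le_mul_of_nonneg_left o1 zero_le_three)) h1
  have m2 := mul_le_mul_of_nonneg_left d2 h2
  have m3 := mul_le_mul_of_nonneg_left d3 h3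
  simp only [hΓ, decayE, decayD]
  linarith

end Decay

/-! ### Estimates for the linearized characteristic system -/

section Linearized

theorem norm_mul_le_of_le' {𝔸 : Type*} [NormedRing 𝔸] {a b : 𝔸} {x y : ℝ} (ha : ‖a‖ ≤ x) (hb : ‖b‖ ≤ y) :
    ‖a * b‖ ≤ x * y :=
  (norm_mul_le a b).trans (mul_le_mul ha hb (norm_nonneg _) ((norm_nonneg _).trans ha))

variable {𝔸 : Type*} [NormedRing 𝔸] [NormedAlgebra ℝ 𝔸]

/-- The linearized characteristic system `Z' = D Y`, `Y' = A Z` on `[0,t]`, in an algebra of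
operators, together with the normal form of its coefficient `A`: `G' = A - R` and `H' = G + R₃`. -/
structure Linearized (t δ η : ℝ) (D D' A G H R R₃ Z Y : ℝ → 𝔸) : Prop where
  deriv_D : ∀ τ ∈ Icc 0 t, HasDerivWithinAt D (D' τ) (Icc 0 t) τ
  deriv_G : ∀ τ ∈ Icc 0 t, HasDerivWithinAt G (A τ - R τ) (Icc 0 t) τ
  deriv_H : ∀ τ ∈ Icc 0 t, HasDerivWithinAt H (G τ + R₃ τ) (Icc 0 t) τ
  deriv_Z : ∀ τ ∈ Icc 0 t, HasDerivWithinAt Z (D τ * Y τ) (Icc 0 t) τ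
  deriv_Y : ∀ τ ∈ Icc 0 t, HasDerivWithinAt Y (A τ * Z τ) (Icc 0 t) τ
  norm_D : ∀ τ ∈ Icc 0 t, ‖D τ‖ ≤ 2
  norm_D' : ∀ τ ∈ Icc 0 t, ‖D' τ‖ ≤ η * decayB δ τ
  norm_D_sub : ∀ τ ∈ Icc 0 t, ‖D τ - D t‖ ≤ η * decayB δ τ
  norm_G : ∀ τ ∈ Icc 0 t, ‖G τ‖ ≤ η * decayB δ τ
  norm_H : ∀ τ ∈ Icc 0 t, ‖H τ‖ ≤ η * decayB δ τ
  norm_R : ∀ τ ∈ Icc 0 t, ‖R τ‖ ≤ η * decayB δ τ ^ 2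
  norm_R₃ : ∀ τ ∈ Icc 0 t, ‖R₃ τ‖ ≤ η * decayB δ τ ^ 2

variable {t δ η : ℝ} {D D' A G H R R₃ Z Y : ℝ → 𝔸}

namespace Linearized

/-- The corrected unknown `M = Y - G Z` solves an equation from which the coefficient `A` has
disappeared. -/
theorem deriv_M (h : Linearized t δ η D D' A G H R R₃ Z Y) {τ : ℝ} (hτ : τ ∈ Icc 0 t) :
    HasDerivWithinAt (fun r => Y r - G r * Z r) (R τ * Z τ - G τ * (D τ * Y τ)) (Icc 0 t) τ := by
  refine ((h.deriv_Y τ hτ).sub ((h.deriv_G τ hτ).mul (h.deriv_Z τ hτ))).congr_deriv ?_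
  noncomm_ring

theorem deriv_DHZ (h : Linearized t δ η D D' A G H R R₃ Z Y) {τ : ℝ} (hτ : τ ∈ Icc 0 t) :
    HasDerivWithinAt (fun r => D r * H r * Z r)
      (D' τ * H τ * Z τ + D τ * (G τ + R₃ τ) * Z τ + D τ * H τ * (D τ * Y τ)) (Icc 0 t) τ := by
  refine (((h.deriv_D τ hτ).mul (h.deriv_H τ hτ)).mul (h.deriv_Z τ hτ)).congr_deriv ?_
  simp only [Pi.mul_apply]
  noncomm_ring

theorem continuousOn_Z (h : Linearized t δ η D D' A G H R R₃ Z Y) : ContinuousOn Z (Icc 0 t) :=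
  fun τ hτ => (h.deriv_Z τ hτ).continuousWithinAt

theorem continuousOn_Y (h : Linearized t δ η D D' A G H R R₃ Z Y) : ContinuousOn Y (Icc 0 t) :=
  fun τ hτ => (h.deriv_Y τ hτ).continuousWithinAt

end Linearized

end Linearized

section Linearized

variable {𝔸 : Type*} [NormedRing 𝔸] [NormedAlgebra ℝ 𝔸]

theorem exists_max_ratio {W : Type*} [NormedAddCommGroup W] {f : ℝ → W} {w : ℝ → ℝ} {t : ℝ}
    (ht : 0 ≤ t) (hf : ContinuousOn f (Icc 0 t)) (hw : ContinuousOn w (Icc 0 t))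
    (hw0 : ∀ τ ∈ Icc 0 t, 0 < w τ) :
    ∃ m : ℝ, 0 ≤ m ∧ (∀ τ ∈ Icc 0 t, ‖f τ‖ ≤ m * w τ) ∧ ∃ τ ∈ Icc 0 t, ‖f τ‖ = m * w τ := by
  obtain ⟨σ, hσ, hmax⟩ := isCompact_Icc.exists_isMaxOn (nonempty_Icc.2 ht)
    (hf.norm.div hw fun τ hτ => (hw0 τ hτ).ne')
  refine ⟨‖f σ‖ / w σ, div_nonneg (norm_nonneg _) (hw0 σ hσ).le, fun τ hτ => ?_, σ, hσ, ?_⟩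
  · exact (div_le_iff₀ (hw0 τ hτ)).1 (hmax hτ)
  · rw [div_mul_cancel₀ _ (hw0 σ hσ).ne']

variable {t δ η : ℝ} {D D' A G H R R₃ Z Y : ℝ → 𝔸}

namespace Linearized

theorem norm_DHZ_le (h : Linearized t δ η D D' A G H R R₃ Z Y) {τ z : ℝ} (hτ : τ ∈ Icc 0 t)
    (hz : ‖Z τ‖ ≤ z) : ‖D τ * H τ * Z τ‖ ≤ 2 * (η * decayB δ τ) * z :=
  norm_mul_le_of_le' (norm_mul_le_of_le' (h.norm_D τ hτ) (h.norm_H τ hτ)) hz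

/-- The bound for the equation of `M = Y - G Z`. -/
theorem norm_deriv_M_le (h : Linearized t δ η D D' A G H R R₃ Z Y) {τ z y : ℝ}
    (hτ : τ ∈ Icc 0 t) (hz : ‖Z τ‖ ≤ z) (hy : ‖Y τ‖ ≤ y) :
    ‖R τ * Z τ - G τ * (D τ * Y τ)‖ ≤
      η * decayB δ τ ^ 2 * z + η * decayB δ τ * (2 * y) :=
  (norm_sub_le _ _).trans (add_le_add (norm_mul_le_of_le' (h.norm_R τ hτ) hz)
    (norm_mul_le_of_le' (h.norm_G τ hτ) (norm_mul_le_of_le' (h.norm_D τ hτ) hy)))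

variable [NormOneClass 𝔸]

/-- Derivatives with respect to the final position. The maxima of `|M|/b` and of `|Z|` bound each
other through the equations of `M = Y - G Z` and `Z`, and `η` is small enough for these bounds to
close. The numerical constants are not optimized. -/
theorem estimates_x (h : Linearized t δ η D D' A G H R R₃ Z Y) (hδ : 0 < δ) (hδ' : δ ≤ 1 / 7)
    (ht : 0 ≤ t) (hη : 0 < η) (hη' : η ≤ 1 / 1000) (hZ : Z t = 1) (hY : Y t = 0) :
    ∀ s ∈ Icc 0 t, ‖Z s - 1‖ ≤ 1000 * η ∧ ‖Y s + G t‖ ≤ 1000 * η * decayB δ s ∧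
      ‖Z s - 1 - (t - s) • (D t * G t)‖ ≤ 1000 * η * decayD δ s := by
  have htI : t ∈ Icc 0 t := right_mem_Icc.2 ht
  have hcM : ContinuousOn (fun r => Y r - G r * Z r) (Icc 0 t) :=
    fun τ hτ => (h.deriv_M hτ).continuousWithinAt
  have hb0 : ∀ τ ∈ Icc 0 t, 0 < decayB δ τ := fun τ hτ => decayB_pos hτ.1
  obtain ⟨m, hm0, hm, σ, hσ, hmσ⟩ := exists_max_ratio ht hcM continuousOn_decayB hb0
  obtain ⟨z, hz0, hz, ς, hς, hzς⟩ := exists_max_ratio (w := fun _ => 1) ht h.continuousOn_Z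
    continuousOn_const fun _ _ => one_pos
  simp only [mul_one] at hz hzς
  have hYb : ∀ τ ∈ Icc 0 t, ‖Y τ‖ ≤ (m + η * z) * decayB δ τ := fun τ hτ => by
    have e : Y τ = (Y τ - G τ * Z τ) + G τ * Z τ := by abel
    rw [e]
    refine (norm_add_le _ _).trans ((add_le_add (hm τ hτ)
      (norm_mul_le_of_le' (h.norm_G τ hτ) (hz τ hτ))).trans (le_of_eq (by ring)))
  set k : ℝ := η * z + 2 * (η * m) + 2 * (η * (η * z)) with hk
  have hk0 : 0 ≤ k := by positivity
  have hMb : ∀ s ∈ Icc 0 t, ‖(Y s - G s * Z s) + G t‖ ≤ 3 * k * decayE δ s := fun s hs => by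
    have := norm_sub_le_of_decay (k₀ := 0) (k₁ := 0) (k₂ := k) (k₃ := 0) hδ' hs.1 hs.2 le_rfl
      hk0 le_rfl (fun τ hτ => h.deriv_M hτ) fun τ hτ => by
        have hτ' := Icc_subset_Icc_left hs.1 hτ
        refine (h.norm_deriv_M_le hτ' (hz τ hτ') (hYb τ hτ')).trans (le_of_eq ?_)
        rw [hk]; ring
    rw [hY, hZ] at this
    simpa using this
  have hZb : ∀ s ∈ Icc 0 t, ‖Z s - 1‖ ≤ 6 * (m + η * z) := fun s hs => by
    have := norm_sub_le_of_decay (k₀ := 0) (k₁ := 2 * (m + η * z)) (k₂ := 0) (k₃ := 0) hδ' hs.1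
      hs.2 (by positivity) le_rfl le_rfl (fun τ hτ => h.deriv_Z τ hτ) fun τ hτ => by
        have hτ' := Icc_subset_Icc_left hs.1 hτ
        refine (norm_mul_le_of_le' (h.norm_D τ hτ') (hYb τ hτ')).trans (le_of_eq ?_)
        ring
    rw [hZ] at this
    refine this.trans (le_of_eq (by ring))
  have ez : z ≤ 1 + 6 * (m + η * z) := by
    have := norm_le_norm_add_norm_sub' (Z ς) 1
    rw [hzς, norm_one] at this
    exact this.trans (add_le_add le_rfl (hZb ς hς))
  have em : m ≤ η + 3 * k := by
    refine le_of_mul_le_mul_right ?_ (hb0 σ hσ)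
    rw [← hmσ, ← add_sub_cancel_right (Y σ - G σ * Z σ) (G t)]
    have e1 := (h.norm_G t htI).trans
      (mul_le_mul_of_nonneg_left (decayB_anti (δ := δ) hδ' hσ.1 hσ.2) hη.le)
    have e2 := (hMb σ hσ).trans (mul_le_mul_of_nonneg_left (decayE_le hδ' hσ.1) (by positivity))
    refine (norm_sub_le _ _).trans ((add_le_add e2 e1).trans (le_of_eq (by ring)))
  have p1 : η * z ≤ z / 1000 := by nlinarith
  have p2 : η * m ≤ m / 1000 := by nlinarith
  have p3 : η * (η * z) ≤ η * z / 1000 := by nlinarith [mul_nonneg hη.le hz0]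
  have hz2 : z ≤ 2 := by linarith
  have p4 : η * z ≤ 2 * η := by nlinarith
  have hm8 : m ≤ 8 * η := by linarith
  have p5 : η * m ≤ η / 100 := by nlinarith
  have hk3 : k ≤ 3 * η := by linarith
  clear_value k
  have hYb' : ∀ τ ∈ Icc 0 t, ‖Y τ‖ ≤ 10 * η * decayB δ τ := fun τ hτ => by
    refine (hYb τ hτ).trans (mul_le_mul_of_nonneg_right ?_ (hb0 τ hτ).le); linarith
  have hMb' : ∀ s ∈ Icc 0 t, ‖(Y s - G s * Z s) + G t‖ ≤ 9 * η * decayE δ s := fun s hs => by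
    refine (hMb s hs).trans (mul_le_mul_of_nonneg_right ?_ (decayE_pos hs.1).le); linarith
  intro s hs
  have hZs : ‖Z s‖ ≤ 2 := (hz s hs).trans hz2
  have hbs := hb0 s hs
  have hes := decayE_pos (δ := δ) hs.1
  have heb := decayE_le (δ := δ) hδ' hs.1
  have hbd := decayB_le_decayD (δ := δ) hδ hs.1
  refine ⟨(hZb s hs).trans (by linarith), ?_, ?_⟩
  · have e : Y s + G t = ((Y s - G s * Z s) + G t) + G s * Z s := by abel
    rw [e]
    refine (norm_add_le _ _).trans ((add_le_add (hMb' s hs)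
      (norm_mul_le_of_le' (h.norm_G s hs) hZs)).trans ?_)
    nlinarith [mul_pos hη hbs]
  · -- `D H Z` integrates the term `D G Z` of `Z' = D (M + G Z)`, and `M` is close to `-G(t)`
    have hd : ∀ τ ∈ Icc 0 t, HasDerivWithinAt
        (fun r => Z r - (1 + (t - r) • (D t * G t)) - D r * H r * Z r)
        (D τ * ((Y τ - G τ * Z τ) + G t) - (D τ - D t) * G t - D' τ * H τ * Z τ -
          D τ * R₃ τ * Z τ - D τ * H τ * (D τ * Y τ)) (Icc 0 t) τ := fun τ hτ => by
      have h1 : HasDerivWithinAt (fun r : ℝ => (1 : 𝔸) + (t - r) • (D t * G t))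
          ((-1 : ℝ) • (D t * G t)) (Icc 0 t) τ :=
        (((hasDerivWithinAt_id τ _).const_sub t).smul_const _).const_add 1
      refine (((h.deriv_Z τ hτ).sub h1).sub (h.deriv_DHZ hτ)).congr_deriv ?_
      rw [neg_one_smul]
      noncomm_ring
    have key := norm_sub_le_of_decay (k₀ := 0) (k₁ := 0) (k₂ := 5 * η) (k₃ := 18 * η) hδ' hs.1
      hs.2 le_rfl (by positivity) (by positivity) hd fun τ hτ => by
        have hτ' := Icc_subset_Icc_left hs.1 hτ
        have hb := hb0 τ hτ'
        have hZτ : ‖Z τ‖ ≤ 2 := (hz τ hτ').trans hz2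
        have hGt : ‖G t‖ ≤ η * decayB δ τ := (h.norm_G t htI).trans
          (mul_le_mul_of_nonneg_left (decayB_anti (δ := δ) hδ' hτ'.1 hτ'.2) hη.le)
        have b1 := norm_mul_le_of_le' (h.norm_D τ hτ') (hMb' τ hτ')
        have b2 := norm_mul_le_of_le' (h.norm_D_sub τ hτ') hGt
        have b3 := norm_mul_le_of_le' (norm_mul_le_of_le' (h.norm_D' τ hτ') (h.norm_H τ hτ')) hZτ
        have b4 := norm_mul_le_of_le' (norm_mul_le_of_le' (h.norm_D τ hτ') (h.norm_R₃ τ hτ')) hZτ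
        have b5 := norm_mul_le_of_le' (norm_mul_le_of_le' (h.norm_D τ hτ') (h.norm_H τ hτ'))
          (norm_mul_le_of_le' (h.norm_D τ hτ') (hYb' τ hτ'))
        refine (norm_sub_le _ _).trans ((add_le_add ((norm_sub_le _ _).trans
          (add_le_add ((norm_sub_le _ _).trans (add_le_add ((norm_sub_le _ _).trans
            (add_le_add b1 b2)) b3)) b4)) b5).trans ?_)
        have q : η * decayB δ τ ^ 2 * η ≤ η * decayB δ τ ^ 2 / 1000 := by
          have : 0 ≤ η * decayB δ τ ^ 2 := by positivity
          nlinarith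
        nlinarith
    have e : Z s - 1 - (t - s) • (D t * G t) =
        ((Z s - (1 + (t - s) • (D t * G t)) - D s * H s * Z s) -
          (Z t - (1 + (t - t) • (D t * G t)) - D t * H t * Z t)) +
        (D s * H s * Z s - D t * H t * Z t) := by
      rw [hZ, sub_self, zero_smul]
      noncomm_ring
    rw [e]
    have c1 := h.norm_DHZ_le hs hZs
    have c2 := h.norm_DHZ_le htI (hZ ▸ norm_one.le : ‖Z t‖ ≤ 1)
    have c3 := decayB_anti (δ := δ) hδ' hs.1 hs.2
    refine (norm_add_le _ _).trans ((add_le_add key ((norm_sub_le _ _).trans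
      (add_le_add c1 c2))).trans ?_)
    nlinarith [mul_le_mul_of_nonneg_left c3 hη.le, mul_le_mul_of_nonneg_left hbd hη.le,
      mul_le_mul_of_nonneg_left heb hη.le]

/-- Derivatives with respect to the final velocity. Here `Z` grows like `t - τ`, and `M = Y - G Z`
is close to `1`. -/
theorem estimates_v (h : Linearized t δ η D D' A G H R R₃ Z Y) (hδ : 0 < δ) (hδ' : δ ≤ 1 / 7)
    (ht : 0 ≤ t) (hη : 0 < η) (hη' : η ≤ 1 / 1000) (hZ : Z t = 0) (hY : Y t = 1) :
    ∀ s ∈ Icc 0 t, ‖Y s - 1‖ ≤ 1000 * η * decayB δ s * (1 + (t - s)) ∧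
      ‖Z s + (t - s) • D t‖ ≤ 1000 * η * decayD δ s * (t - s) := by
  have htI : t ∈ Icc 0 t := right_mem_Icc.2 ht
  have hb0 : ∀ τ ∈ Icc 0 t, 0 < decayB δ τ := fun τ hτ => decayB_pos hτ.1
  -- a velocity perturbation grows at most like `1 + (t - τ) b(τ)`
  obtain ⟨y, hy0, hy, σ, hσ, hyσ⟩ := exists_max_ratio (w := fun τ => 1 + (t - τ) * decayB δ τ) ht
    h.continuousOn_Y (continuousOn_const.add
      ((continuousOn_const.sub continuousOn_id).mul continuousOn_decayB))
    fun τ hτ => by have := mul_nonneg (sub_nonneg.2 hτ.2) (hb0 τ hτ).le; linarith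
  have hy' : ∀ s ∈ Icc 0 t, ∀ τ ∈ Icc s t, ‖Y τ‖ ≤ y * (1 + (t - s) * decayB δ τ) :=
    fun s hs τ hτ => (hy τ (Icc_subset_Icc_left hs.1 hτ)).trans <|
      mul_le_mul_of_nonneg_left (add_le_add le_rfl (mul_le_mul_of_nonneg_right
        (sub_le_sub_left hτ.1 t) (hb0 τ (Icc_subset_Icc_left hs.1 hτ)).le)) hy0
  have hZb : ∀ s ∈ Icc 0 t, ‖Z s‖ ≤ 8 * y * (t - s) := fun s hs => by
    have hts : 0 ≤ t - s := sub_nonneg.2 hs.2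
    have := norm_sub_le_of_decay (k₀ := 2 * y) (k₁ := 2 * y * (t - s)) (k₂ := 0) (k₃ := 0) hδ' hs.1
      hs.2 (by positivity) le_rfl le_rfl (fun τ hτ => h.deriv_Z τ hτ) fun τ hτ => by
        have hτ' := Icc_subset_Icc_left hs.1 hτ
        refine (norm_mul_le_of_le' (h.norm_D τ hτ') (hy' s hs τ hτ)).trans (le_of_eq ?_)
        ring
    rw [hZ, sub_zero] at this
    refine this.trans (le_of_eq (by ring))
  have hZb' : ∀ s ∈ Icc 0 t, ∀ τ ∈ Icc s t, ‖Z τ‖ ≤ 8 * y * (t - s) := fun s hs τ hτ =>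
    (hZb τ (Icc_subset_Icc_left hs.1 hτ)).trans
      (mul_le_mul_of_nonneg_left (sub_le_sub_left hτ.1 t) (by positivity))
  have hM1 : ∀ s ∈ Icc 0 t, ‖(Y s - G s * Z s) - 1‖ ≤
      6 * (η * y) + 30 * (η * y) * (t - s) * decayE δ s := fun s hs => by
    have hts : 0 ≤ t - s := sub_nonneg.2 hs.2
    have := norm_sub_le_of_decay (k₀ := 0) (k₁ := 2 * (η * y)) (k₂ := 10 * (η * y) * (t - s))
      (k₃ := 0) hδ' hs.1 hs.2 (by positivity) (by positivity) le_rfl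
      (fun τ hτ => h.deriv_M hτ) fun τ hτ => by
        have hτ' := Icc_subset_Icc_left hs.1 hτ
        refine (h.norm_deriv_M_le hτ' (hZb' s hs τ hτ) (hy' s hs τ hτ)).trans (le_of_eq ?_)
        ring
    rw [hY, hZ] at this
    simp only [mul_zero, sub_zero, zero_mul, zero_add, add_zero] at this
    refine this.trans (le_of_eq (by ring))
  have ey : y ≤ 1 + 38 * (η * y) := by
    have hts : 0 ≤ t - σ := sub_nonneg.2 hσ.2
    have hw : 0 < 1 + (t - σ) * decayB δ σ := by
      have := mul_nonneg hts (hb0 σ hσ).le; linarith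
    refine le_of_mul_le_mul_right ?_ hw
    rw [← hyσ]
    have e : Y σ = ((Y σ - G σ * Z σ) - 1) + 1 + G σ * Z σ := by abel
    rw [e]
    refine (norm_add_le _ _).trans ((add_le_add ((norm_add_le _ _).trans (add_le_add (hM1 σ hσ)
      norm_one.le)) (norm_mul_le_of_le' (h.norm_G σ hσ) (hZb σ hσ))).trans ?_)
    have e1 := mul_le_mul_of_nonneg_left (decayE_le (δ := δ) hδ' hσ.1)
      (by positivity : 0 ≤ 30 * (η * y) * (t - σ))
    have e2 : 0 ≤ (t - σ) * decayB δ σ := mul_nonneg hts (hb0 σ hσ).le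
    have e3 : 0 ≤ η * y := by positivity
    nlinarith
  have hy2 : y ≤ 2 := by nlinarith
  have p1 : η * y ≤ 2 * η := by nlinarith
  have hY2 : ∀ s ∈ Icc 0 t, ∀ τ ∈ Icc s t, ‖Y τ‖ ≤ 2 * (1 + (t - s) * decayB δ τ) :=
    fun s hs τ hτ => (hy' s hs τ hτ).trans (mul_le_mul_of_nonneg_right hy2 (by
      have := mul_nonneg (sub_nonneg.2 hs.2) (hb0 τ (Icc_subset_Icc_left hs.1 hτ)).le; linarith))
  have hZ2 : ∀ s ∈ Icc 0 t, ∀ τ ∈ Icc s t, ‖Z τ‖ ≤ 16 * (t - s) := fun s hs τ hτ => by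
    refine (hZb' s hs τ hτ).trans (mul_le_mul_of_nonneg_right ?_ (sub_nonneg.2 hs.2)); linarith
  have hM2 : ∀ s ∈ Icc 0 t, ‖Y s - G s * Z s‖ ≤ 2 * (1 + (t - s) * decayE δ s) := fun s hs => by
    have e := (norm_le_norm_add_norm_sub' (Y s - G s * Z s) 1).trans (add_le_add norm_one.le
      (hM1 s hs))
    have e2 : 0 ≤ (t - s) * decayE δ s := mul_nonneg (sub_nonneg.2 hs.2) (decayE_pos hs.1).le
    nlinarith
  -- the remaining first-order term of the equation of `M` is removed by a second normal form
  have hN : ∀ τ ∈ Icc 0 t, HasDerivWithinAt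
      (fun r => (Y r - G r * Z r) + H r * D r * (Y r - G r * Z r))
      (R τ * Z τ - G τ * (D τ * (G τ * Z τ)) + R₃ τ * D τ * (Y τ - G τ * Z τ) +
        H τ * D' τ * (Y τ - G τ * Z τ) + H τ * D τ * (R τ * Z τ - G τ * (D τ * Y τ)))
      (Icc 0 t) τ := fun τ hτ => by
    refine ((h.deriv_M hτ).add
      (((h.deriv_H τ hτ).mul (h.deriv_D τ hτ)).mul (h.deriv_M hτ))).congr_deriv ?_
    simp only [Pi.mul_apply]
    noncomm_ring
  have hM3 : ∀ s ∈ Icc 0 t, ‖(Y s - G s * Z s) - 1‖ ≤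
      70 * η * (decayB δ s + (t - s) * decayE δ s) := fun s hs => by
    have hts : 0 ≤ t - s := sub_nonneg.2 hs.2
    have key := norm_sub_le_of_decay (k₀ := 0) (k₁ := 0) (k₂ := 21 * η * (1 + (t - s)))
      (k₃ := 0) hδ' hs.1 hs.2 le_rfl (by positivity) le_rfl hN fun τ hτ => by
        have hτ' := Icc_subset_Icc_left hs.1 hτ
        have hb := hb0 τ hτ'
        have hb1 := decayB_le_one (δ := δ) hδ' hτ'.1
        set L := 1 + (t - s) with hL
        have hL0 : 0 < L := by positivity
        have hZL : ‖Z τ‖ ≤ 16 * L := (hZ2 s hs τ hτ).trans (by linarith)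
        have hYL : ‖Y τ‖ ≤ 2 * L := (hY2 s hs τ hτ).trans (by nlinarith)
        have hML : ‖Y τ - G τ * Z τ‖ ≤ 2 * L := (hM2 τ hτ').trans (by
          have h1 := (decayE_le (δ := δ) hδ' hτ'.1).trans hb1
          have h2 := decayE_pos (δ := δ) hτ'.1
          have h3 : t - τ ≤ t - s := sub_le_sub_left hτ.1 t
          nlinarith [hτ.2])
        have hM' : ‖R τ * Z τ - G τ * (D τ * Y τ)‖ ≤ 20 * η * decayB δ τ * L :=
          (h.norm_deriv_M_le hτ' hZL hYL).trans (by
            have := mul_le_mul_of_nonneg_left hb1 (by positivity : 0 ≤ η * decayB δ τ * L)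
            nlinarith)
        have b1 := norm_mul_le_of_le' (h.norm_R τ hτ') hZL
        have b2 := norm_mul_le_of_le' (h.norm_G τ hτ') (norm_mul_le_of_le' (h.norm_D τ hτ')
          (norm_mul_le_of_le' (h.norm_G τ hτ') hZL))
        have b3 := norm_mul_le_of_le' (norm_mul_le_of_le' (h.norm_R₃ τ hτ') (h.norm_D τ hτ')) hML
        have b4 := norm_mul_le_of_le' (norm_mul_le_of_le' (h.norm_H τ hτ') (h.norm_D' τ hτ')) hML
        have b5 := norm_mul_le_of_le' (norm_mul_le_of_le' (h.norm_H τ hτ') (h.norm_D τ hτ')) hM'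
        refine (norm_add_le _ _).trans ((add_le_add ((norm_add_le _ _).trans
          (add_le_add ((norm_add_le _ _).trans (add_le_add ((norm_sub_le _ _).trans
            (add_le_add b1 b2)) b3)) b4)) b5).trans ?_)
        have q : η * decayB δ τ ^ 2 * L * η ≤ η * decayB δ τ ^ 2 * L / 1000 := by
          have : 0 ≤ η * decayB δ τ ^ 2 * L := by positivity
          nlinarith
        nlinarith
    have e : (Y s - G s * Z s) - 1 =
        (((Y s - G s * Z s) + H s * D s * (Y s - G s * Z s)) -
          ((Y t - G t * Z t) + H t * D t * (Y t - G t * Z t))) +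
        (H t * D t - H s * D s * (Y s - G s * Z s)) := by
      rw [hZ, hY]
      noncomm_ring
    rw [e]
    have c1 := norm_mul_le_of_le' (norm_mul_le_of_le' (h.norm_H s hs) (h.norm_D s hs)) (hM2 s hs)
    have c2 := norm_mul_le_of_le' (h.norm_H t htI) (h.norm_D t htI)
    have c3 := mul_le_mul_of_nonneg_left (decayB_anti (δ := δ) hδ' hs.1 hs.2) hη.le
    have c4 := mul_le_mul_of_nonneg_left (decayE_le (δ := δ) hδ' hs.1) hη.le
    have c5 := mul_le_mul_of_nonneg_left (decayB_le_one (δ := δ) hδ' hs.1)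
      (mul_nonneg (mul_nonneg hη.le hts) (decayE_pos (δ := δ) hs.1).le)
    refine (norm_add_le _ _).trans ((add_le_add key ((norm_sub_le _ _).trans
      (add_le_add c2 c1))).trans ?_)
    nlinarith [mul_nonneg hη.le (decayB_pos (δ := δ) hs.1).le,
      mul_nonneg (mul_nonneg hη.le hts) (decayE_pos (δ := δ) hs.1).le]
  intro s hs
  have hts : 0 ≤ t - s := sub_nonneg.2 hs.2
  have hss : s ∈ Icc s t := left_mem_Icc.2 hs.2
  have hbs := hb0 s hs
  have hes := decayE_pos (δ := δ) hs.1
  have heb := decayE_le (δ := δ) hδ' hs.1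
  have hbd := decayB_le_decayD (δ := δ) hδ hs.1
  constructor
  · have e : Y s - 1 = ((Y s - G s * Z s) - 1) + G s * Z s := by abel
    rw [e]
    refine (norm_add_le _ _).trans ((add_le_add (hM3 s hs)
      (norm_mul_le_of_le' (h.norm_G s hs) (hZ2 s hs s hss))).trans ?_)
    have := mul_le_mul_of_nonneg_left heb (mul_nonneg hη.le hts)
    nlinarith [mul_pos hη hbs, mul_nonneg (mul_pos hη hbs).le hts]
  · -- as above, but now `M` is close to `1`
    have hd : ∀ τ ∈ Icc 0 t, HasDerivWithinAt
        (fun r => Z r + (t - r) • D t - D r * H r * Z r)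
        (D τ * ((Y τ - G τ * Z τ) - 1) + (D τ - D t) - D' τ * H τ * Z τ -
          D τ * R₃ τ * Z τ - D τ * H τ * (D τ * Y τ)) (Icc 0 t) τ := fun τ hτ => by
      have h1 : HasDerivWithinAt (fun r : ℝ => (t - r) • D t)
          ((-1 : ℝ) • D t) (Icc 0 t) τ :=
        ((hasDerivWithinAt_id τ _).const_sub t).smul_const _
      refine (((h.deriv_Z τ hτ).add h1).sub (h.deriv_DHZ hτ)).congr_deriv ?_
      rw [neg_one_smul]
      noncomm_ring
    have key := norm_sub_le_of_decay (k₀ := 149 * η * decayB δ s) (k₁ := 0)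
      (k₂ := 42 * η * (t - s)) (k₃ := 140 * η * (t - s)) hδ' hs.1
      hs.2 le_rfl (by positivity) (by positivity) hd fun τ hτ => by
        have hτ' := Icc_subset_Icc_left hs.1 hτ
        have hb := hb0 τ hτ'
        have hbs' := mul_le_mul_of_nonneg_left (decayB_anti (δ := δ) hδ' hs.1 hτ.1) hη.le
        have hZτ := hZ2 s hs τ hτ
        have hMτ : ‖(Y τ - G τ * Z τ) - 1‖ ≤ 70 * η * (decayB δ τ + (t - s) * decayE δ τ) :=
          (hM3 τ hτ').trans (mul_le_mul_of_nonneg_left (add_le_add le_rfl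
            (mul_le_mul_of_nonneg_right (sub_le_sub_left hτ.1 t) (decayE_pos hτ'.1).le))
            (by positivity))
        have b1 := norm_mul_le_of_le' (h.norm_D τ hτ') hMτ
        have b3 := norm_mul_le_of_le' (norm_mul_le_of_le' (h.norm_D' τ hτ') (h.norm_H τ hτ')) hZτ
        have b4 := norm_mul_le_of_le' (norm_mul_le_of_le' (h.norm_D τ hτ') (h.norm_R₃ τ hτ')) hZτ
        have b5 := norm_mul_le_of_le' (norm_mul_le_of_le' (h.norm_D τ hτ') (h.norm_H τ hτ'))
          (norm_mul_le_of_le' (h.norm_D τ hτ') (hY2 s hs τ hτ))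
        refine (norm_sub_le _ _).trans ((add_le_add ((norm_sub_le _ _).trans
          (add_le_add ((norm_sub_le _ _).trans (add_le_add ((norm_add_le _ _).trans
            (add_le_add b1 (h.norm_D_sub τ hτ'))) b3)) b4)) b5).trans ?_)
        have q : η * decayB δ τ ^ 2 * (t - s) * η ≤ η * decayB δ τ ^ 2 * (t - s) / 1000 := by
          have : 0 ≤ η * decayB δ τ ^ 2 * (t - s) := by positivity
          nlinarith
        have q' : 0 ≤ η * decayB δ τ ^ 2 * (t - s) := by positivity
        nlinarith
    have e : Z s + (t - s) • D t =
        ((Z s + (t - s) • D t - D s * H s * Z s) -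
          (Z t + (t - t) • D t - D t * H t * Z t)) + D s * H s * Z s := by
      rw [hZ, sub_self, zero_smul]
      noncomm_ring
    rw [e]
    refine (norm_add_le _ _).trans ((add_le_add key
      (h.norm_DHZ_le hs (hZ2 s hs s hss))).trans ?_)
    have g1 := mul_le_mul_of_nonneg_left hbd (mul_nonneg hη.le hts)
    have g2 := mul_le_mul_of_nonneg_left (heb.trans hbd) (mul_nonneg hη.le hts)
    have g3 := mul_nonneg (mul_nonneg hη.le hts) hbs.le
    nlinarith

end Linearized

end Linearized

/-! ### The relativistic velocity -/

theorem hasFDerivAt_hat (v : R3) : HasFDerivAt hat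
    ((bracket v)⁻¹ • ContinuousLinearMap.id ℝ R3 -
      ((bracket v)⁻¹ ^ 3) • (innerSL ℝ v).smulRight v) v := by
  have hb := (bracket_pos v).ne'
  have h1 := (hasDerivAt_inv hb).comp_hasFDerivAt v (hasFDerivAt_bracket v)
  refine (h1.smul (hasFDerivAt_id v)).congr_fderiv ?_
  ext1 w
  simp [smul_smul, sub_eq_add_neg]
  congr 1
  ring

theorem fderiv_hat_apply (v w : R3) : fderiv ℝ hat v w =
    (bracket v)⁻¹ • w - ((bracket v)⁻¹ ^ 3 * inner ℝ v w) • v := by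
  rw [(hasFDerivAt_hat v).fderiv]
  simp [smul_smul]

theorem norm_fderiv_hat_le (v : R3) : ‖fderiv ℝ hat v‖ ≤ 2 := by
  refine ContinuousLinearMap.opNorm_le_bound _ zero_le_two fun w => ?_
  have hb := bracket_pos v
  have h1 : (bracket v)⁻¹ ≤ 1 := inv_le_one_of_one_le₀ (one_le_bracket v)
  have hv : (bracket v)⁻¹ * ‖v‖ ≤ 1 := by
    rw [inv_mul_le_one₀ hb]; exact norm_le_bracket v
  rw [fderiv_hat_apply]
  refine (norm_sub_le _ _).trans ?_
  rw [norm_smul, norm_smul, norm_mul, Real.norm_of_nonneg (inv_nonneg.2 hb.le),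
    Real.norm_of_nonneg (pow_nonneg (inv_nonneg.2 hb.le) 3)]
  have h2 : ‖(inner ℝ v w : ℝ)‖ ≤ ‖v‖ * ‖w‖ := norm_inner_le_norm v w
  have hi : 0 ≤ (bracket v)⁻¹ := inv_nonneg.2 hb.le
  calc _ ≤ 1 * ‖w‖ + (bracket v)⁻¹ ^ 3 * (‖v‖ * ‖w‖) * ‖v‖ := by gcongr
    _ = ‖w‖ + (bracket v)⁻¹ * (((bracket v)⁻¹ * ‖v‖) * ((bracket v)⁻¹ * ‖v‖)) * ‖w‖ := by ring
    _ ≤ ‖w‖ + 1 * (1 * 1) * ‖w‖ := by gcongr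
    _ = 2 * ‖w‖ := by ring

/-- The differential of `v ↦ v̂` is coercive: the largest compression, along `v`, is by
`⟨v⟩⁻³`. -/
theorem fderiv_hat_injective (v : R3) : Function.Injective (fderiv ℝ hat v) := by
  refine (injective_iff_map_eq_zero _).2 fun w hw => ?_
  have hb := bracket_pos v
  have h1 : inner ℝ (fderiv ℝ hat v w) w = 0 := by rw [hw, inner_zero_left]
  rw [fderiv_hat_apply, inner_sub_left, inner_smul_left, inner_smul_left,
    real_inner_self_eq_norm_sq] at h1
  simp only [conj_trivial] at h1
  have h2 := abs_real_inner_le_norm v w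
  have h3 : (inner ℝ v w : ℝ) ^ 2 ≤ (‖v‖ * ‖w‖) ^ 2 := sq_le_sq' (neg_le_of_abs_le h2)
    ((le_abs_self _).trans h2)
  have h4 : bracket v ^ 2 = 1 + ‖v‖ ^ 2 := bracket_sq v
  have h5 : bracket v ^ 2 * ‖w‖ ^ 2 = (inner ℝ v w : ℝ) ^ 2 := by
    field_simp at h1
    linarith
  have h6 : ‖w‖ ^ 2 ≤ 0 := by
    rw [h4] at h5
    nlinarith
  exact norm_eq_zero.1 (pow_eq_zero_iff two_ne_zero |>.1 (le_antisymm h6 (sq_nonneg _)))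

theorem contDiff_fderiv_hat : ContDiff ℝ ∞ (fderiv ℝ hat) :=
  contDiff_hat.fderiv_right (m := ∞) le_rfl

theorem differentiable_hat : Differentiable ℝ hat := contDiff_hat.differentiable (by simp)

theorem norm_hat_sub_le (v w : R3) : ‖hat w - hat v‖ ≤ 2 * ‖w - v‖ :=
  convex_univ.norm_image_sub_le_of_norm_fderiv_le (fun x _ => differentiable_hat x)
    (fun x _ => norm_fderiv_hat_le x) (mem_univ _) (mem_univ _)

theorem exists_norm_fderiv_fderiv_hat_le (ρ : ℝ) : ∃ C, 0 ≤ C ∧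
    ∀ v : R3, ‖v‖ ≤ ρ → ‖fderiv ℝ (fderiv ℝ hat) v‖ ≤ C := by
  obtain ⟨C, hC⟩ := (isCompact_closedBall (0 : R3) ρ).exists_bound_of_continuousOn
    (contDiff_fderiv_hat.continuous_fderiv (by simp)).continuousOn
  exact ⟨max C 0, le_max_right _ _, fun v hv => (hC v (by simpa using hv)).trans (le_max_left _ _)⟩

theorem norm_fderiv_hat_sub_le {ρ C : ℝ}
    (hC : ∀ v : R3, ‖v‖ ≤ ρ → ‖fderiv ℝ (fderiv ℝ hat) v‖ ≤ C) {v w : R3} (hv : ‖v‖ ≤ ρ)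
    (hw : ‖w‖ ≤ ρ) : ‖fderiv ℝ hat w - fderiv ℝ hat v‖ ≤ C * ‖w - v‖ :=
  (convex_closedBall (0 : R3) ρ).norm_image_sub_le_of_norm_fderiv_le
    (fun x _ => contDiff_fderiv_hat.differentiable (by simp) x)
    (fun x hx => hC x (by simpa using hx)) (by simpa using hv) (by simpa using hw)

theorem exists_norm_hat_taylor_le (ρ : ℝ) : ∃ C, 0 ≤ C ∧ ∀ v w : R3, ‖v‖ ≤ ρ →
    ‖hat (v + w) - hat v - fderiv ℝ hat v w‖ ≤ C * ‖w‖ ^ 2 := by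
  obtain ⟨C, hC0, hC⟩ := exists_norm_fderiv_fderiv_hat_le (ρ + 1)
  refine ⟨max C 4, hC0.trans (le_max_left _ _), fun v w hv => ?_⟩
  rcases le_total ‖w‖ 1 with hw | hw
  · have h := (convex_closedBall v ‖w‖).norm_image_sub_le_of_norm_fderiv_le'
      (f := hat) (φ := fderiv ℝ hat v) (C := C * ‖w‖) (x := v) (y := v + w)
      (fun x _ => differentiable_hat x) (fun x hx => by
        have hx' : ‖x - v‖ ≤ ‖w‖ := by simpa [dist_eq_norm] using hx
        refine (norm_fderiv_hat_sub_le hC (hv.trans (by linarith)) ?_).trans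
          (mul_le_mul_of_nonneg_left hx' hC0)
        have := norm_le_norm_add_norm_sub' x v
        linarith) (by simp) (by simp [dist_eq_norm])
    rw [add_sub_cancel_left] at h
    calc _ ≤ C * ‖w‖ * ‖w‖ := h
      _ = C * ‖w‖ ^ 2 := by ring
      _ ≤ _ := by gcongr; exact le_max_left _ _
  · have h1 := norm_hat_sub_le v (v + w)
    rw [add_sub_cancel_left] at h1
    have h2 := (fderiv ℝ hat v).le_of_opNorm_le (norm_fderiv_hat_le v) w
    calc _ ≤ 2 * ‖w‖ + 2 * ‖w‖ := (norm_sub_le _ _).trans (add_le_add h1 h2)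
      _ = 4 * ‖w‖ * 1 := by ring
      _ ≤ 4 * ‖w‖ * ‖w‖ := by gcongr
      _ = 4 * ‖w‖ ^ 2 := by ring
      _ ≤ _ := by gcongr; exact le_max_right _ _

/-! ### The characteristics and their derivatives -/

section Characteristics

variable {t δ ρ η : ℝ} {E : ℝ → R3 → R3} {DE : ℝ → R3 → R3 →L[ℝ] R3} {F : ℝ → R3 → R3 → R3}
  {G Fv H : ℝ → R3 → R3 → R3 →L[ℝ] R3}

namespace NormalForm

theorem norm_velocity_le (h : NormalForm t δ ρ η E DE F G Fv H) (hδ : 0 < δ) (hδ' : δ ≤ 1 / 7)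
    (hη : 0 < η) (hη' : 12 * η ≤ 1) {X V : ℝ → R3}
    (hV : ∀ τ ∈ Icc 0 t, HasDerivWithinAt V (E τ (X τ)) (Icc 0 t) τ) (hv : ‖V t‖ + 1 ≤ ρ) :
    ∀ τ ∈ Icc 0 t, ‖V τ‖ ≤ ρ := fun s hs => by
  have key := norm_sub_le_of_decay (k₀ := 0) (k₁ := 4 * η) (k₂ := 0) (k₃ := 0) hδ' hs.1 hs.2
    (by positivity) le_rfl le_rfl hV fun τ hτ => by
      have hτ' := Icc_subset_Icc_left hs.1 hτ
      have := mul_le_mul_of_nonneg_left (rate_le_decayB hδ hδ' hτ'.1) hη.le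
      linarith [h.norm_E τ hτ' (X τ)]
  have := norm_le_norm_add_norm_sub' (V s) (V t)
  linarith

/-- The velocity stays within `O(η b)` of its final value: the field is, up to `O(η b²)`, the
derivative of `F`. -/
theorem norm_velocity_sub_le (h : NormalForm t δ ρ η E DE F G Fv H) (hδ : 0 < δ)
    (hδ' : δ ≤ 1 / 7) (hη : 0 < η) (hη' : 12 * η ≤ 1) {X V : ℝ → R3}
    (hX : ∀ τ ∈ Icc 0 t, HasDerivWithinAt X (hat (V τ)) (Icc 0 t) τ)
    (hV : ∀ τ ∈ Icc 0 t, HasDerivWithinAt V (E τ (X τ)) (Icc 0 t) τ) (hv : ‖V t‖ + 1 ≤ ρ) :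
    ∀ τ ∈ Icc 0 t, ‖V τ - V t‖ ≤ 56 * η * decayB δ τ := fun s hs => by
  have htI : t ∈ Icc 0 t := ⟨hs.1.trans hs.2, le_rfl⟩
  have hVρ := h.norm_velocity_le hδ hδ' hη hη' hV hv
  have hex : ∀ τ, ∃ R : R3, τ ∈ Icc 0 t →
      HasDerivWithinAt (fun r => F r (X r) (V r)) (E τ (X τ) - R) (Icc 0 t) τ ∧
      ‖R‖ ≤ η * rate δ τ ^ 2 := fun τ => by
    by_cases hτ : τ ∈ Icc 0 t
    · obtain ⟨R, hR, hR'⟩ := h.deriv_F hτ (hX τ hτ) (hV τ hτ)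
      exact ⟨R, fun _ => ⟨hR, hR' (hVρ τ hτ)⟩⟩
    · exact ⟨0, fun h => absurd h hτ⟩
  choose R hR using hex
  have key := norm_sub_le_of_decay (k₀ := 0) (k₁ := 0) (k₂ := 16 * η) (k₃ := 0) hδ' hs.1 hs.2
    le_rfl (by positivity) le_rfl (fun τ hτ => (hV τ hτ).sub (hR τ hτ).1) fun τ hτ => by
      have hτ' := Icc_subset_Icc_left hs.1 hτ
      rw [sub_sub_cancel]
      have := pow_le_pow_left₀ (rate_pos δ τ).le (rate_le_decayB hδ hδ' hτ'.1) 2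
      have := mul_le_mul_of_nonneg_left this hη.le
      linarith [(hR τ hτ').2]
  have b1 : ∀ τ ∈ Icc 0 t, ‖F τ (X τ) (V τ)‖ ≤ 4 * η * decayB δ τ := fun τ hτ => by
    have := mul_le_mul_of_nonneg_left (rate_le_decayB hδ hδ' hτ.1) hη.le
    linarith [h.norm_F τ hτ (X τ) (V τ) (hVρ τ hτ)]
  have e : V s - V t = ((V s - F s (X s) (V s)) - (V t - F t (X t) (V t))) +
      (F s (X s) (V s) - F t (X t) (V t)) := by abel
  rw [e]
  refine (norm_add_le _ _).trans ((add_le_add key ((norm_sub_le _ _).trans (add_le_add (b1 s hs)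
    (b1 t htI)))).trans ?_)
  have c1 := mul_le_mul_of_nonneg_left (decayB_anti (δ := δ) hδ' hs.1 hs.2) hη.le
  have c2 := mul_le_mul_of_nonneg_left (decayE_le (δ := δ) hδ' hs.1) hη.le
  linarith

/-- Along a characteristic, solutions of the linearized system satisfy the hypotheses of
`Linearized`. -/
theorem exists_linearized (h : NormalForm t δ ρ η E DE F G Fv H) (hδ : 0 < δ)
    (hδ' : δ ≤ 1 / 7) (hη : 0 < η) (hη' : 12 * η ≤ 1) {C : ℝ} (hC0 : 0 ≤ C)
    (hC : ∀ v : R3, ‖v‖ ≤ ρ → ‖fderiv ℝ (fderiv ℝ hat) v‖ ≤ C) {X V : ℝ → R3}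
    (hX : ∀ τ ∈ Icc 0 t, HasDerivWithinAt X (hat (V τ)) (Icc 0 t) τ)
    (hV : ∀ τ ∈ Icc 0 t, HasDerivWithinAt V (E τ (X τ)) (Icc 0 t) τ) (hv : ‖V t‖ + 1 ≤ ρ)
    {Z Y : ℝ → R3 →L[ℝ] R3}
    (hZ : ∀ τ ∈ Icc 0 t, HasDerivWithinAt Z (fderiv ℝ hat (V τ) * Y τ) (Icc 0 t) τ)
    (hY : ∀ τ ∈ Icc 0 t, HasDerivWithinAt Y (DE τ (X τ) * Z τ) (Icc 0 t) τ) :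
    ∃ R R₃ : ℝ → R3 →L[ℝ] R3, Linearized t δ ((56 * C + 16) * η) (fun τ => fderiv ℝ hat (V τ))
      (fun τ => fderiv ℝ (fderiv ℝ hat) (V τ) (E τ (X τ))) (fun τ => DE τ (X τ))
      (fun τ => G τ (X τ) (V τ)) (fun τ => H τ (X τ) (V τ)) R R₃ Z Y := by
  have hVρ := h.norm_velocity_le hδ hδ' hη hη' hV hv
  have hex : ∀ τ, ∃ R R₃ : R3 →L[ℝ] R3, τ ∈ Icc 0 t →
      (HasDerivWithinAt (fun r => G r (X r) (V r)) (DE τ (X τ) - R) (Icc 0 t) τ ∧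
      ‖R‖ ≤ η * rate δ τ ^ 2) ∧
      (HasDerivWithinAt (fun r => H r (X r) (V r)) (G τ (X τ) (V τ) + R₃) (Icc 0 t) τ ∧
      ‖R₃‖ ≤ η * rate δ τ ^ 2) := fun τ => by
    by_cases hτ : τ ∈ Icc 0 t
    · obtain ⟨R, hR, hR'⟩ := h.deriv_G hτ (hX τ hτ) (hV τ hτ)
      obtain ⟨R₃, hR₃, hR₃'⟩ := h.deriv_H hτ (hX τ hτ) (hV τ hτ)
      exact ⟨R, R₃, fun _ => ⟨⟨hR, hR' (hVρ τ hτ)⟩, hR₃, hR₃' (hVρ τ hτ)⟩⟩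
    · exact ⟨0, 0, fun h => absurd h hτ⟩
  choose R R₃ hR using hex
  have h4 : ∀ {x τ : ℝ}, τ ∈ Icc 0 t → x ≤ η * rate δ τ →
      x ≤ (56 * C + 16) * η * decayB δ τ := fun hτ hx => by
    have h1 := mul_le_mul_of_nonneg_left (rate_le_decayB hδ hδ' hτ.1) hη.le
    have h2 := mul_nonneg (mul_nonneg hC0 hη.le) (decayB_pos (δ := δ) hτ.1).le
    have h3 := mul_nonneg hη.le (decayB_pos (δ := δ) hτ.1).le
    linarith
  have h16 : ∀ {x τ : ℝ}, τ ∈ Icc 0 t → x ≤ η * rate δ τ ^ 2 →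
      x ≤ (56 * C + 16) * η * decayB δ τ ^ 2 := fun {x τ} hτ hx => by
    have h1 := mul_le_mul_of_nonneg_left (pow_le_pow_left₀ (rate_pos δ τ).le
      (rate_le_decayB hδ hδ' hτ.1) 2) hη.le
    have h2 := mul_nonneg (mul_nonneg hC0 hη.le) (sq_nonneg (decayB δ τ))
    linarith
  have htI : ∀ {τ}, τ ∈ Icc 0 t → t ∈ Icc 0 t := fun hτ => ⟨hτ.1.trans hτ.2, le_rfl⟩
  refine ⟨R, R₃, ⟨fun τ hτ => ?_, fun τ hτ => (hR τ hτ).1.1, fun τ hτ => (hR τ hτ).2.1, hZ, hY,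
    fun τ _ => norm_fderiv_hat_le _, fun τ hτ => ?_, fun τ hτ => ?_,
    fun τ hτ => h4 hτ (h.norm_G τ hτ _ _ (hVρ τ hτ)),
    fun τ hτ => h4 hτ (h.norm_H τ hτ _ _ (hVρ τ hτ)), fun τ hτ => h16 hτ (hR τ hτ).1.2,
    fun τ hτ => h16 hτ (hR τ hτ).2.2⟩⟩
  · exact (contDiff_fderiv_hat.differentiable (by simp) (V τ)).hasFDerivAt.comp_hasDerivWithinAt τ
      (hV τ hτ)
  · have h1 := (fderiv ℝ (fderiv ℝ hat) (V τ)).le_of_opNorm_le (hC _ (hVρ τ hτ)) (E τ (X τ))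
    have h2 := mul_le_mul_of_nonneg_left ((h.norm_E τ hτ (X τ)).trans
      (mul_le_mul_of_nonneg_left (rate_le_decayB hδ hδ' hτ.1) hη.le)) hC0
    have h3 := mul_nonneg hη.le (decayB_pos (δ := δ) hτ.1).le
    have h4 := mul_nonneg (mul_nonneg hC0 hη.le) (decayB_pos (δ := δ) hτ.1).le
    linarith
  · have h1 := norm_fderiv_hat_sub_le hC (hVρ t (htI hτ)) (hVρ τ hτ)
    have h2 := mul_le_mul_of_nonneg_left
      (h.norm_velocity_sub_le hδ hδ' hη hη' hX hV hv τ hτ) hC0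
    have h3 := mul_nonneg hη.le (decayB_pos (δ := δ) hτ.1).le
    linarith

/-- Differentiability of the characteristics in a parameter `p` on which the final values depend
affinely. -/
theorem exists_hasFDerivAt_characteristics (h : NormalForm t δ ρ η E DE F G Fv H) (hδ : 0 < δ)
    (hδ' : δ ≤ 1 / 7) (ht : 0 ≤ t) (hη : 0 < η) (hη' : 12 * η ≤ 1) {X V : ℝ → R3 → R3}
    (hX : ∀ p, ∀ τ ∈ Icc 0 t, HasDerivWithinAt (fun r => X r p) (hat (V τ p)) (Icc 0 t) τ)
    (hV : ∀ p, ∀ τ ∈ Icc 0 t, HasDerivWithinAt (fun r => V r p) (E τ (X τ p)) (Icc 0 t) τ)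
    {p₀ : R3} (hv : ‖V t p₀‖ + 1 ≤ ρ) {ζ υ : R3 →L[ℝ] R3}
    (hζ : ∀ p, X t p - X t p₀ = ζ (p - p₀)) (hυ : ∀ p, V t p - V t p₀ = υ (p - p₀)) :
    ∃ Z Y : ℝ → R3 →L[ℝ] R3, Z t = ζ ∧ Y t = υ ∧
      (∀ τ ∈ Icc 0 t, HasDerivWithinAt Z (fderiv ℝ hat (V τ p₀) * Y τ) (Icc 0 t) τ) ∧
      (∀ τ ∈ Icc 0 t, HasDerivWithinAt Y (DE τ (X τ p₀) * Z τ) (Icc 0 t) τ) ∧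
      (∀ τ ∈ Icc 0 t, HasFDerivAt (X τ) (Z τ) p₀) ∧
      ∀ τ ∈ Icc 0 t, HasFDerivAt (V τ) (Y τ) p₀ := by
  have hVρ := h.norm_velocity_le hδ hδ' hη hη' (hV p₀) hv
  obtain ⟨C₁, hC₁0, hC₁⟩ := exists_norm_hat_taylor_le ρ
  obtain ⟨C₂, hC₂0, hC₂⟩ := h.taylor
  obtain ⟨C₃, hC₃0, hC₃⟩ := h.norm_DE
  have hEd : ∀ τ ∈ Icc 0 t, ∀ x, HasFDerivAt (E τ) (DE τ x) x := fun τ hτ x =>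
    hasFDerivAt_of_taylor (hC₂ τ hτ x)
  have hEl : ∀ τ ∈ Icc 0 t, ∀ x y, ‖E τ (x + y) - E τ x‖ ≤ C₃ * ‖y‖ := fun τ hτ x y => by
    have := convex_univ.norm_image_sub_le_of_norm_hasFDerivWithin_le (f := E τ) (C := C₃)
      (x := x) (y := x + y) (fun z _ => (hEd τ hτ z).hasFDerivWithinAt) (fun z _ => hC₃ τ hτ z)
      (mem_univ _) (mem_univ _)
    rwa [add_sub_cancel_left] at this
  set A : ℝ → (R3 × R3) →L[ℝ] (R3 × R3) := fun τ =>
    (ContinuousLinearMap.inl ℝ R3 R3).comp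
      ((fderiv ℝ hat (V τ p₀)).comp (ContinuousLinearMap.snd ℝ R3 R3)) +
    (ContinuousLinearMap.inr ℝ R3 R3).comp
      ((DE τ (X τ p₀)).comp (ContinuousLinearMap.fst ℝ R3 R3)) with hA
  have hAapp : ∀ τ w, A τ w = (fderiv ℝ hat (V τ p₀) w.2, DE τ (X τ p₀) w.1) := fun τ w => by
    simp [hA]
  have hXc : ContinuousOn (fun r => X r p₀) (Icc 0 t) := fun τ hτ => (hX p₀ τ hτ).continuousWithinAt
  have hVc : ContinuousOn (fun r => V r p₀) (Icc 0 t) := fun τ hτ => (hV p₀ τ hτ).continuousWithinAt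
  have hAc : ContinuousOn A (Icc 0 t) := by
    refine (continuousOn_const.clm_comp (ContinuousOn.clm_comp
      (contDiff_fderiv_hat.continuous.comp_continuousOn hVc) continuousOn_const)).add
      (continuousOn_const.clm_comp (ContinuousOn.clm_comp ?_ continuousOn_const))
    exact h.cont_DE.comp (continuousOn_id.prodMk hXc) fun τ hτ => ⟨hτ, mem_univ _⟩
  obtain ⟨J, hJt, hJ, hJd⟩ := exists_hasFDerivAt_flow (W := R3 × R3) (Q := R3)
    (f := fun τ w => (hat w.2, E τ w.1)) (Φ := fun τ p => (X τ p, V τ p)) (A := A) (p₀ := p₀)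
    (ι := ζ.prod υ) (L := max 2 C₃) (C := max C₁ C₂) ht
    (fun p τ hτ => (hX p τ hτ).prodMk (hV p τ hτ)) (fun p => by simp [hζ, hυ]) hAc
    (fun τ hτ w => by
      refine max_le ?_ ?_
      · have := norm_hat_sub_le (V τ p₀) (V τ p₀ + w.2)
        rw [add_sub_cancel_left] at this
        exact this.trans (mul_le_mul (le_max_left _ _) (norm_snd_le w) (norm_nonneg _)
          (hC₃0.trans (le_max_right _ _)))
      · exact (hEl τ hτ (X τ p₀) w.1).trans (mul_le_mul (le_max_right _ _) (norm_fst_le w)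
          (norm_nonneg _) (hC₃0.trans (le_max_right _ _))))
    (fun τ hτ w => by
      rw [hAapp]
      refine max_le ?_ ?_
      · exact (hC₁ (V τ p₀) w.2 (hVρ τ hτ)).trans (mul_le_mul (le_max_left _ _)
          (pow_le_pow_left₀ (norm_nonneg _) (norm_snd_le w) 2) (sq_nonneg _)
          (hC₁0.trans (le_max_left _ _)))
      · exact (hC₂ τ hτ (X τ p₀) w.1).trans (mul_le_mul (le_max_right _ _)
          (pow_le_pow_left₀ (norm_nonneg _) (norm_fst_le w) 2) (sq_nonneg _)
          (hC₁0.trans (le_max_left _ _))))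
  have hfst := fun τ (hτ : τ ∈ Icc 0 t) =>
    (ContinuousLinearMap.compL ℝ R3 (R3 × R3) R3
      (ContinuousLinearMap.fst ℝ R3 R3)).hasFDerivAt.comp_hasDerivWithinAt τ (hJ τ hτ)
  have hsnd := fun τ (hτ : τ ∈ Icc 0 t) =>
    (ContinuousLinearMap.compL ℝ R3 (R3 × R3) R3
      (ContinuousLinearMap.snd ℝ R3 R3)).hasFDerivAt.comp_hasDerivWithinAt τ (hJ τ hτ)
  refine ⟨fun τ => (ContinuousLinearMap.fst ℝ R3 R3).comp (J τ),
    fun τ => (ContinuousLinearMap.snd ℝ R3 R3).comp (J τ), ?_, ?_, fun τ hτ => ?_, fun τ hτ => ?_,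
    fun τ hτ => ?_, fun τ hτ => ?_⟩
  · simp only [hJt]; ext1 w; simp
  · simp only [hJt]; ext1 w; simp
  · refine (hfst τ hτ).congr_deriv ?_
    ext1 w
    simp [hAapp]
  · refine (hsnd τ hτ).congr_deriv ?_
    ext1 w
    simp [hAapp]
  · exact (ContinuousLinearMap.fst ℝ R3 R3).hasFDerivAt.comp p₀ (hJd τ hτ)
  · exact (ContinuousLinearMap.snd ℝ R3 R3).hasFDerivAt.comp p₀ (hJd τ hτ)

end NormalForm

end Characteristics

/-! ### Determinants -/

theorem det_clm_eq (L : R3 →L[ℝ] R3) : L.det = Matrix.det (Matrix.of fun i j : Fin 3 =>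
    L (EuclideanSpace.single j 1) i) := by
  rw [ContinuousLinearMap.det, ← LinearMap.det_toMatrix (EuclideanSpace.basisFun (Fin 3) ℝ).toBasis]
  congr 1

theorem contDiff_det : ContDiff ℝ ∞ fun L : R3 →L[ℝ] R3 => L.det := by
  have h : ∀ i j : Fin 3, ContDiff ℝ ∞ fun L : R3 →L[ℝ] R3 =>
      (L (EuclideanSpace.single j 1)) i := fun i j =>
    ((EuclideanSpace.proj (𝕜 := ℝ) i).comp
      (ContinuousLinearMap.apply ℝ R3 (EuclideanSpace.single j (1 : ℝ)))).contDiff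
  simp only [det_clm_eq, Matrix.det_fin_three, Matrix.of_apply]
  fun_prop

theorem exists_abs_det_sub_le (M : ℝ) : ∃ C, 0 ≤ C ∧ ∀ L L' : R3 →L[ℝ] R3, ‖L‖ ≤ M → ‖L'‖ ≤ M →
    |L.det - L'.det| ≤ C * ‖L - L'‖ := by
  obtain ⟨C, hC⟩ := (isCompact_closedBall (0 : R3 →L[ℝ] R3) M).exists_bound_of_continuousOn
    (contDiff_det.continuous_fderiv (by simp)).continuousOn
  refine ⟨max C 0, le_max_right _ _, fun L L' hL hL' => ?_⟩
  exact (convex_closedBall (0 : R3 →L[ℝ] R3) M).norm_image_sub_le_of_norm_fderiv_le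
    (fun x _ => contDiff_det.differentiable (by simp) x)
    (fun x hx => (hC x hx).trans (le_max_left _ _)) (by simpa using hL') (by simpa using hL)

theorem exists_le_abs_det_fderiv_hat (R : ℝ) :
    ∃ c > 0, ∀ v : R3, ‖v‖ ≤ R → c ≤ |(fderiv ℝ hat v).det| := by
  have hne : ∀ v, (fderiv ℝ hat v).det ≠ 0 := fun v h0 => by
    have h1 := LinearMap.bot_lt_ker_of_det_eq_zero (f := (fderiv ℝ hat v : R3 →ₗ[ℝ] R3)) h0
    rw [LinearMap.ker_eq_bot.2 (fderiv_hat_injective v)] at h1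
    exact lt_irrefl _ h1
  have hc : Continuous fun v => |(fderiv ℝ hat v).det| :=
    (contDiff_det.continuous.comp contDiff_fderiv_hat.continuous).abs
  rcases (Metric.closedBall (0 : R3) R).eq_empty_or_nonempty with he | hn
  · exact ⟨1, one_pos, fun v hv => absurd (by simpa using hv : v ∈ Metric.closedBall (0 : R3) R)
      (by simp [he])⟩
  · obtain ⟨w, -, hw⟩ := (isCompact_closedBall (0 : R3) R).exists_isMinOn hn hc.continuousOn
    exact ⟨_, abs_pos.2 (hne w), fun v hv => hw (by simpa using hv)⟩

/-! ### Velocity averages and derivatives in the final position and velocity -/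

/-- The time integral in the velocity average is the displacement. -/
theorem smul_PsiHat {E : ℝ → R3 → R3} {T : ℝ} {X V : ℝ → ℝ → R3 → R3 → R3}
    (hc : IsCharacteristic E T X V) {t : ℝ} (ht : t ∈ Ico 0 T) {s : ℝ} (hs : s ∈ Icc 0 t)
    (x v : R3) : (t - s) • PsiHat V s t x v = x - X s t x v := by
  have hsub : Icc s t ⊆ Icc 0 t := Icc_subset_Icc_left hs.1
  have hV : ContinuousOn (fun τ => hat (V τ t x v)) (Icc s t) :=
    contDiff_hat.continuous.comp_continuousOn fun τ hτ =>
      ((hc.V_deriv t ht τ (hsub hτ) x v).continuousWithinAt).mono hsub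
  have key := intervalIntegral.integral_eq_sub_of_hasDeriv_right_of_le hs.2
    (f := fun τ => X τ t x v) (f' := fun τ => hat (V τ t x v))
    (fun τ hτ => ((hc.X_deriv t ht τ (hsub hτ) x v).continuousWithinAt).mono hsub)
    (fun τ hτ => (hasDerivWithinAt_Ici_of_Icc ⟨hτ.1.le, hτ.2⟩
      ((hc.X_deriv t ht τ (hsub (Ioo_subset_Icc_self hτ)) x v).mono hsub)).mono Ioi_subset_Ici_self)
    (hV.intervalIntegrable_of_Icc hs.2)
  rw [hc.X_init t ht] at key
  rcases hs.2.eq_or_lt with rfl | hlt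
  · simp [hc.X_init s ht]
  · rw [PsiHat, key, smul_smul, mul_inv_cancel₀ (sub_pos.2 hlt).ne', one_smul]

theorem DerivBound.of_hasFDerivAt {W : Type*} [NormedAddCommGroup W] [NormedSpace ℝ W]
    {f : R3 → W} {L : R3 →L[ℝ] W} {a : R3} {B : ℝ} (h : HasFDerivAt f L a) (hB : ‖L‖ ≤ B) :
    DerivBound f a B :=
  ⟨h.differentiableAt, h.fderiv ▸ hB⟩

section Derivatives

variable {t T δ ρ η : ℝ} {E : ℝ → R3 → R3} {DE : ℝ → R3 → R3 →L[ℝ] R3} {F : ℝ → R3 → R3 → R3}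
  {G Fv H : ℝ → R3 → R3 → R3 →L[ℝ] R3} {X V : ℝ → ℝ → R3 → R3 → R3}

namespace NormalForm

/-- Derivatives of the characteristics in the final position. -/
theorem derivBounds_x (h : NormalForm t δ ρ η E DE F G Fv H) (hδ : 0 < δ) (hδ' : δ ≤ 1 / 7)
    (hη : 0 < η) {C : ℝ} (hC0 : 0 ≤ C)
    (hC : ∀ v : R3, ‖v‖ ≤ ρ → ‖fderiv ℝ (fderiv ℝ hat) v‖ ≤ C)
    (hη' : (56 * C + 16) * η ≤ 1 / 1000) (hc : IsCharacteristic E T X V) (ht : t ∈ Ico 0 T)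
    {v : R3} (hv : ‖v‖ + 1 ≤ ρ) (x : R3) : ∀ s ∈ Icc 0 t,
      DerivBound (fun y => V s t y v - v + F t y v) x
        (1000 * ((56 * C + 16) * η) * decayB δ s) ∧
      DerivBound (fun y => (t - s) • (PsiHat V s t y v - hat v + fderiv ℝ hat v (F t y v))) x
        (1000 * ((56 * C + 16) * η) * decayD δ s) ∧
      ∃ Z : R3 →L[ℝ] R3, HasFDerivAt (fun y => X s t y v) Z x ∧
        ‖Z - 1‖ ≤ 1000 * ((56 * C + 16) * η) := by
  have htI : t ∈ Icc 0 t := right_mem_Icc.2 ht.1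
  have h12 : 12 * η ≤ 1 := by nlinarith [mul_nonneg hC0 hη.le]
  obtain ⟨Z, Y, hZt, hYt, hZ, hY, hXd, hVd⟩ := h.exists_hasFDerivAt_characteristics hδ hδ' ht.1
    hη h12 (X := fun r p => X r t p v) (V := fun r p => V r t p v) (p₀ := x)
    (ζ := 1) (υ := 0)
    (fun p τ hτ => hc.X_deriv t ht τ hτ p v) (fun p τ hτ => hc.V_deriv t ht τ hτ p v)
    (by rw [hc.V_init t ht]; exact hv) (fun p => by simp [hc.X_init t ht])
    (fun p => by simp [hc.V_init t ht])
  obtain ⟨R, R₃, hL⟩ := h.exists_linearized hδ hδ' hη h12 hC0 hC (X := fun r => X r t x v)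
    (V := fun r => V r t x v) (fun τ hτ => hc.X_deriv t ht τ hτ x v)
    (fun τ hτ => hc.V_deriv t ht τ hτ x v) (by rw [hc.V_init t ht]; exact hv) hZ hY
  have key := hL.estimates_x hδ hδ' ht.1 (by positivity) hη' hZt hYt
  simp only [hc.X_init t ht, hc.V_init t ht] at key
  intro s hs
  obtain ⟨k1, k2, k3⟩ := key s hs
  refine ⟨.of_hasFDerivAt (((hVd s hs).sub_const v).add (h.fderiv_x t htI x v)) k2, ?_,
    Z s, hXd s hs, k1⟩
  have e : (fun y => (t - s) • (PsiHat V s t y v - hat v + fderiv ℝ hat v (F t y v))) =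
      fun y => y - X s t y v - (t - s) • hat v + (t - s) • fderiv ℝ hat v (F t y v) := by
    funext y
    rw [smul_add, smul_sub, smul_PsiHat hc ht hs]
  rw [e]
  refine .of_hasFDerivAt ((((hasFDerivAt_id x).sub (hXd s hs)).sub_const _).add
    (((fderiv ℝ hat v).hasFDerivAt.comp x (h.fderiv_x t htI x v)).const_smul (t - s))) ?_
  rw [← norm_neg]
  refine le_of_eq_of_le (congrArg norm ?_) k3
  change -(1 - Z s + (t - s) • (fderiv ℝ hat v * G t x v)) = _
  abel

/-- Derivatives of the characteristics in the final velocity. -/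
theorem derivBounds_v (h : NormalForm t δ ρ η E DE F G Fv H) (hδ : 0 < δ) (hδ' : δ ≤ 1 / 7)
    (hη : 0 < η) {C : ℝ} (hC0 : 0 ≤ C)
    (hC : ∀ v : R3, ‖v‖ ≤ ρ → ‖fderiv ℝ (fderiv ℝ hat) v‖ ≤ C)
    (hη' : (56 * C + 16) * η ≤ 1 / 1000) (hc : IsCharacteristic E T X V) (ht : t ∈ Ico 0 T)
    {v : R3} (hv : ‖v‖ + 1 ≤ ρ) (x : R3) : ∀ s ∈ Icc 0 t,
      DerivBound (fun w => V s t x w - w + F t x w) v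
        (1001 * ((56 * C + 16) * η) * decayB δ s * (1 + (t - s))) ∧
      DerivBound (fun w => (t - s) • (PsiHat V s t x w - hat w + fderiv ℝ hat w (F t x w))) v
        (1001 * ((56 * C + 16) * η) * decayD δ s * (t - s)) ∧
      ∃ Z : R3 →L[ℝ] R3, HasFDerivAt (fun w => X s t x w) Z v ∧
        ‖Z + (t - s) • fderiv ℝ hat v‖ ≤ 1000 * ((56 * C + 16) * η) * (t - s) := by
  have htI : t ∈ Icc 0 t := right_mem_Icc.2 ht.1
  have h12 : 12 * η ≤ 1 := by nlinarith [mul_nonneg hC0 hη.le]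
  obtain ⟨Z, Y, hZt, hYt, hZ, hY, hXd, hVd⟩ := h.exists_hasFDerivAt_characteristics hδ hδ' ht.1
    hη h12 (X := fun r p => X r t x p) (V := fun r p => V r t x p) (p₀ := v)
    (ζ := 0) (υ := 1)
    (fun p τ hτ => hc.X_deriv t ht τ hτ x p) (fun p τ hτ => hc.V_deriv t ht τ hτ x p)
    (by rw [hc.V_init t ht]; exact hv) (fun p => by simp [hc.X_init t ht])
    (fun p => by simp [hc.V_init t ht])
  obtain ⟨R, R₃, hL⟩ := h.exists_linearized hδ hδ' hη h12 hC0 hC (X := fun r => X r t x v)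
    (V := fun r => V r t x v) (fun τ hτ => hc.X_deriv t ht τ hτ x v)
    (fun τ hτ => hc.V_deriv t ht τ hτ x v) (by rw [hc.V_init t ht]; exact hv) hZ hY
  have key := hL.estimates_v hδ hδ' ht.1 (by positivity) hη' hZt hYt
  simp only [hc.V_init t ht] at key
  set κ := (56 * C + 16) * η with hκ
  have hvρ : ‖v‖ ≤ ρ := by linarith
  have hrate := mul_le_mul_of_nonneg_left (rate_le_decayB hδ hδ' ht.1) hη.le
  have hb0 := mul_nonneg hη.le (decayB_pos (δ := δ) ht.1).le
  have hCb0 := mul_nonneg hC0 hb0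
  intro s hs
  obtain ⟨k1, k2⟩ := key s hs
  have hts : 0 ≤ t - s := sub_nonneg.2 hs.2
  have hκ0 : 0 ≤ κ := by positivity
  have hbt := mul_le_mul_of_nonneg_left (decayB_anti (δ := δ) hδ' hs.1 hs.2) hκ0
  have hbs := mul_nonneg hκ0 (decayB_pos (δ := δ) hs.1).le
  have hbd := mul_le_mul_of_nonneg_left (decayB_le_decayD (δ := δ) hδ hs.1) hκ0
  refine ⟨.of_hasFDerivAt (((hVd s hs).sub (hasFDerivAt_id v)).add (h.fderiv_v t htI x v)) ?_, ?_,
    Z s, hXd s hs, ?_⟩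
  · refine (norm_add_le _ _).trans ((add_le_add k1 (h.norm_Fv t htI x v hvρ)).trans ?_)
    have : η * rate δ t ≤ κ * decayB δ t := by rw [hκ]; nlinarith
    nlinarith [mul_nonneg hbs hts]
  · have e : (fun w => (t - s) • (PsiHat V s t x w - hat w + fderiv ℝ hat w (F t x w))) =
        fun w => x - X s t x w - (t - s) • hat w + (t - s) • fderiv ℝ hat w (F t x w) := by
      funext y
      rw [smul_add, smul_sub, smul_PsiHat hc ht hs]
    rw [e]
    have hD := ((contDiff_fderiv_hat.differentiable (by simp) v).hasFDerivAt.clm_apply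
      (h.fderiv_v t htI x v)).const_smul (t - s)
    refine .of_hasFDerivAt ((((hXd s hs).const_sub x).sub
      ((differentiable_hat v).hasFDerivAt.const_smul (t - s))).add hD) ?_
    have hW : ‖(fderiv ℝ hat v).comp (Fv t x v) +
        (fderiv ℝ (fderiv ℝ hat) v).flip (F t x v)‖ ≤ κ * decayB δ t := by
      have a1 := (ContinuousLinearMap.opNorm_comp_le (fderiv ℝ hat v) (Fv t x v)).trans
        (mul_le_mul (norm_fderiv_hat_le v) (h.norm_Fv t htI x v hvρ) (norm_nonneg _) zero_le_two)
      have a2 := (ContinuousLinearMap.le_opNorm (fderiv ℝ (fderiv ℝ hat) v).flip (F t x v)).trans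
        (mul_le_mul ((ContinuousLinearMap.opNorm_flip _).le.trans (hC v hvρ))
          (h.norm_F t htI x v hvρ) (norm_nonneg _) hC0)
      refine (norm_add_le _ _).trans ((add_le_add a1 a2).trans ?_)
      have a3 := mul_le_mul_of_nonneg_left hrate hC0
      rw [hκ]
      linarith
    have e2 : -Z s - (t - s) • fderiv ℝ hat v + (t - s) • ((fderiv ℝ hat v).comp (Fv t x v) +
        (fderiv ℝ (fderiv ℝ hat) v).flip (F t x v)) = -(Z s + (t - s) • fderiv ℝ hat v) +
        (t - s) • ((fderiv ℝ hat v).comp (Fv t x v) +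
          (fderiv ℝ (fderiv ℝ hat) v).flip (F t x v)) := by abel
    rw [e2]
    refine (norm_add_le _ _).trans ?_
    rw [norm_neg, norm_smul, Real.norm_of_nonneg hts]
    have := mul_le_mul_of_nonneg_left (hW.trans (hbt.trans hbd)) hts
    linarith
  · refine k2.trans ?_
    have := mul_le_mul_of_nonneg_left (decayD_le_one (δ := δ) hδ' hs.1)
      (mul_nonneg hκ0 hts)
    linarith

end NormalForm

end Derivatives

/-- An operator within `κ r` of `-r L`, with `L` invertible and `κ` small, has a determinant of
order at least `r³`. -/
theorem le_abs_det_of_norm_add_le {L Z : R3 →L[ℝ] R3} {C c κ r : ℝ} (hL : ‖L‖ ≤ 2)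
    (hC : ∀ L L' : R3 →L[ℝ] R3, ‖L‖ ≤ 3 → ‖L'‖ ≤ 3 → |L.det - L'.det| ≤ C * ‖L - L'‖)
    (hC0 : 0 ≤ C) (hc : c ≤ |L.det|) (hr : 0 ≤ r) (hκ : κ ≤ 1) (hκ' : C * κ ≤ c / 2)
    (hZ : ‖Z + r • L‖ ≤ κ * r) : c / 2 * r ^ 3 ≤ |Z.det| := by
  rcases hr.eq_or_lt with rfl | hr
  · simp
  set P := r⁻¹ • (Z + r • L) with hP
  have hPn : ‖P‖ ≤ κ := by
    rw [hP, norm_smul, norm_inv, Real.norm_of_nonneg hr.le, inv_mul_le_iff₀ hr]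
    linarith
  have hZe : Z = (-r) • (L - P) := by
    rw [hP, smul_sub, neg_smul, neg_smul, smul_smul, mul_inv_cancel₀ hr.ne', one_smul]
    abel
  have hdet : Z.det = (-r) ^ 3 * (L - P).det := by
    rw [hZe, ContinuousLinearMap.det, ContinuousLinearMap.toLinearMap_smul, LinearMap.det_smul]
    simp [ContinuousLinearMap.det]
  have h1 := hC L (L - P) (by linarith) ((norm_sub_le _ _).trans (by linarith))
  rw [sub_sub_cancel] at h1
  have h2 : |L.det| - |(L - P).det| ≤ |L.det - (L - P).det| := abs_sub_abs_le_abs_sub _ _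
  have h3 := mul_le_mul_of_nonneg_left hPn hC0
  rw [hdet, abs_mul, abs_pow, abs_neg, abs_of_pos hr, mul_comm]
  exact mul_le_mul_of_nonneg_left (by linarith) (by positivity)

end VKG

end

theorem proposition3p5 (α₀ : ℕ) (hα₀ : 8 ≤ α₀) (K : Set VKG.R3) (hK : IsCompact K) :
    ∃ ε₀ > (0 : ℝ), ∃ C > (0 : ℝ), ∃ c > (0 : ℝ), ∃ Cβ : ℕ → ℝ,
      ∀ ε : ℝ, 0 < ε → ε ≤ ε₀ → ∀ T : ℝ, 0 < T →
      ∀ (S0 : ℤˣ → Lp ℂ 2 (volume : Measure VKG.R3)) (S : ℤˣ → ℝ → VKG.R3 → ℂ)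
        (Er : ℝ → VKG.R3 → VKG.R3) (X V : ℝ → ℝ → VKG.R3 → VKG.R3 → VKG.R3),
        VKG.Bootstrap α₀ ε T S0 S Er →
        VKG.IsCharacteristic (VKG.field S0 S Er) T X V →
        -- derivatives `∂_x ∂_v^β V^osc_{t,t}`, for every order `n = |β|`
        (∀ t ∈ Ico 0 T, ∀ x : VKG.R3, ContDiff ℝ ∞ (VKG.Vosc S0 S t x)) ∧
        (∀ n : ℕ, ∀ t ∈ Ico 0 T, ∀ x : VKG.R3, ∀ v ∈ K,
          VKG.DerivBound (fun y => iteratedFDeriv ℝ n (VKG.Vosc S0 S t y) v) x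
            (Cβ n * ε * VKG.bracket t ^ (-(3 / 2 : ℝ) + VKG.delta α₀ 1))) ∧
        (∀ t ∈ Ico 0 T, ∀ s ∈ Icc 0 t, ∀ x : VKG.R3, ∀ v ∈ K,
          -- velocities
          VKG.DerivBound (fun y => V s t y v - v + VKG.Vosc S0 S t y v) x
            (C * ε * VKG.bracket s ^ (-(3 / 2 : ℝ) + VKG.delta α₀ 1)) ∧
          VKG.DerivBound (fun w => V s t x w - w + VKG.Vosc S0 S t x w) v
            (C * ε * VKG.bracket s ^ (-(3 / 2 : ℝ) + VKG.delta α₀ 1) * (1 + (t - s))) ∧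
          -- velocity averages
          VKG.DerivBound
            (fun y => (t - s) • (VKG.PsiHat V s t y v - VKG.hat v + VKG.VhatOsc S0 S t y v)) x
            (C * ε * VKG.bracket s ^ (-1 + VKG.delta α₀ 1)) ∧
          VKG.DerivBound
            (fun w => (t - s) • (VKG.PsiHat V s t x w - VKG.hat w + VKG.VhatOsc S0 S t x w)) v
            (C * ε * VKG.bracket s ^ (-1 + VKG.delta α₀ 1) * (t - s)) ∧
          -- Jacobian determinants
          DifferentiableAt ℝ (fun y => X s t y v) x ∧
          DifferentiableAt ℝ (fun w => X s t x w) v ∧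
          |(fderiv ℝ (fun y => X s t y v) x).det - 1| ≤ C * ε ∧
          c * VKG.bracket v ^ (-5 : ℝ) * |t - s| ^ 3 ≤
            |(fderiv ℝ (fun w => X s t x w) v).det|) := by
  obtain ⟨R, hR⟩ := hK.isBounded.subset_closedBall (0 : VKG.R3)
  have hR : ∀ v ∈ K, ‖v‖ ≤ R := fun v hv => by simpa using hR hv
  set ρ : ℝ := R + 1 with hρ
  have hδ := VKG.delta_one_pos hα₀
  have hδ' := VKG.delta_one_le hα₀
  obtain ⟨K₁, hK₁, hnf⟩ := VKG.exists_normalForm hα₀ ρ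
  obtain ⟨B, hB0, hB⟩ := VKG.exists_norm_fderiv_fderiv_hat_le ρ
  obtain ⟨Cd, hCd0, hCd⟩ := VKG.exists_abs_det_sub_le 3
  obtain ⟨c, hc0, hc⟩ := VKG.exists_le_abs_det_fderiv_hat R
  choose Cβ hCβ using VKG.exists_derivBound_Vosc hα₀ R
  -- `κ ε` is the size of all the coefficients of the linearized characteristic system
  set κ : ℝ := (56 * B + 16) * K₁ with hκ
  have hκ0 : 0 < κ := by positivity
  have hκ1 : K₁ ≤ κ := by nlinarith [mul_nonneg hB0 hK₁.le]
  refine ⟨min 1 (min (1 / (1000 * κ)) (c / (2 * (1000 * κ * (Cd + 1))))), by positivity,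
    1001 * κ * (Cd + 1), by positivity, c / 2, by positivity, Cβ, ?_⟩
  intro ε hε hε₀ T hT S0 S Er X V hb hch
  have hε1 : ε ≤ 1 := hε₀.trans (min_le_left _ _)
  have hε2 : 1000 * (κ * ε) ≤ 1 := by
    have := hε₀.trans ((min_le_right _ _).trans (min_le_left _ _))
    rw [le_div_iff₀ (by positivity)] at this
    linarith
  have hε3 : (Cd + 1) * (1000 * (κ * ε)) ≤ c / 2 := by
    have := hε₀.trans ((min_le_right _ _).trans (min_le_right _ _))
    rw [le_div_iff₀ (by positivity)] at this
    linarith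
  refine ⟨fun t ht x => hb.contDiff_Vosc hα₀ hε ht x, fun n t ht x v hv =>
    hCβ n ε T S0 S Er hε hb t ht x v (hR v hv), fun t ht s hs x v hv => ?_⟩
  have hv1 := hR v hv
  have hη : 0 < K₁ * ε := mul_pos hK₁ hε
  have eκ : (56 * B + 16) * (K₁ * ε) = κ * ε := by rw [hκ]; ring
  have hη' : (56 * B + 16) * (K₁ * ε) ≤ 1 / 1000 := by rw [eκ]; linarith
  have hN := hnf ε T S0 S Er hε hε1 hb t ht
  obtain ⟨x1, x2, Zx, hZx, x3⟩ := hN.derivBounds_x hδ hδ' hη hB0 hB hη' hch ht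
    (v := v) (by linarith) x s hs
  obtain ⟨v1, v2, Zv, hZv, v3⟩ := hN.derivBounds_v hδ hδ' hη hB0 hB hη' hch ht
    (v := v) (by linarith) x s hs
  rw [eκ] at x1 x2 x3 v1 v2 v3
  have hts : 0 ≤ t - s := sub_nonneg.2 hs.2
  have hbb := VKG.decayB_le_bracket hδ hδ' hs.1
  have hbd := VKG.decayD_le_bracket hδ' hs.1
  have hκε : 0 < κ * ε := mul_pos hκ0 hε
  have hC : 1001 * (κ * ε) ≤ 1001 * κ * (Cd + 1) * ε := by
    nlinarith [mul_nonneg hκε.le hCd0]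
  have hC' : 1000 * (κ * ε) ≤ 1001 * κ * (Cd + 1) * ε := by linarith
  have hp1 := (VKG.decayB_pos (δ := VKG.delta α₀ 1) hs.1).le
  have hp2 := hp1.trans (VKG.decayB_le_decayD hδ hs.1)
  refine ⟨⟨x1.1, x1.2.trans ?_⟩, ⟨v1.1, v1.2.trans ?_⟩, ⟨x2.1, x2.2.trans ?_⟩,
    ⟨v2.1, v2.2.trans ?_⟩, hZx.differentiableAt, hZv.differentiableAt, ?_, ?_⟩
  · exact mul_le_mul hC' hbb hp1 (by positivity)
  · exact mul_le_mul_of_nonneg_right (mul_le_mul hC hbb hp1 (by positivity)) (by linarith)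
  · exact mul_le_mul hC' hbd hp2 (by positivity)
  · exact mul_le_mul_of_nonneg_right (mul_le_mul hC hbd hp2 (by positivity)) hts
  · rw [hZx.fderiv]
    have h1 : ‖(1 : VKG.R3 →L[ℝ] VKG.R3)‖ = 1 := norm_one
    have h2 := norm_le_norm_add_norm_sub' Zx 1
    have h3 := hCd Zx 1 (by linarith) (by linarith)
    have h4 : (1 : VKG.R3 →L[ℝ] VKG.R3).det = 1 := LinearMap.det_id
    rw [h4] at h3
    refine h3.trans ((mul_le_mul_of_nonneg_left x3 hCd0).trans ?_)
    nlinarith [mul_nonneg hκε.le hCd0]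
  · rw [hZv.fderiv, abs_of_nonneg hts]
    have h1 := VKG.le_abs_det_of_norm_add_le (VKG.norm_fderiv_hat_le v) hCd hCd0 (hc v hv1) hts
      hε2 (by linarith) v3
    refine le_trans (mul_le_mul_of_nonneg_right ?_ (by positivity)) h1
    have h2 : VKG.bracket v ^ (-5 : ℝ) ≤ 1 :=
      Real.rpow_le_one_of_one_le_of_nonpos (VKG.one_le_bracket v) (by norm_num)
    exact mul_le_of_le_one_right (by positivity) h2
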